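/- Let $Q$ be a non-degenerate symmetric bilinear form on $V=\mathbb C^N$, let $(G,K)=(SL(V),SO(V,Q))$, let $\mathfrak g_1\subset\mathfrak{sl}(V)$ be the space of traceless endomorphisms that are self-adjoint with respect to $Q$, and let $\mathcal N_1\subset\mathfrak g_1$ be the set of its nilpotent elements. For a partition $\lambda$ of $N$ let $\mathcal O_\lambda\subset\mathcal N_1$ be the set of elements of Jordan type $\lambda$ (a single $K$-orbit, or a union of two $K$-orbits if all parts of $\lambda$ are even). For an integer $1\le m\le N/2$ let $\mathrm{Fl}_m$ be the variety of flags $0\subset V_{m-1}\subset V_m\subset V_m^\perp\subset V_{m-1}^\perp\subset V$ with $\dim V_{m-1}=m-1$, $\dim V_m=m$, and put $$\mathrm{Hess}_m^E=\{(x,V_{m-1}\subset V_m)\in\mathfrak g_1\times \mathrm{Fl}_m \mid xV_m=0,\ xV_m^\perp\subset V_{m-1}\},$$ $$\mathrm{Hess}_m^O=\{(x,V_{m-1}\subset V_m)\in\mathfrak g_1\times \mathrm{Fl}_m \mid xV_m=0,\ xV_{m-1}^\perp\subset V_{m-1}\},$$ with the projections $\tau_m^N:\mathrm{Hess}_m^E\to\mathfrak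 g_1$ and $\sigma_m^N:\mathrm{Hess}_m^O\to\mathfrak g_1$. (If $2m<N$, then $\mathrm{Fl}_m=K/P_m$ is one $K$-orbit; if $2m=N$, it is the union of two $K$-orbits.) Fibres are regarded as reduced complex varieties. (1) The maps $\tau_m^N$ and $\sigma_m^N$ take values in $\mathcal N_1$. For every $x\in\mathcal N_1$ the fibres $(\tau_m^N)^{-1}(x)$ and $(\sigma_m^N)^{-1}(x)$ have a paving by affine spaces, that is, a finite filtration $\emptyset=F_0\subset F_1\subset\dots\subset F_r$ by closed subsets, ending with the whole fibre, such that each $F_{s+1}\setminus F_s$ is isomorphic to an affine space $\mathbb A^{d}$. The same holds for the intersection of each of these fibres with any single $K$-orbit on $\mathrm{Fl}_m$. (2) Let $3i+2j\le N$ and let $x\in\mathcal O_{3^i2^j1^{N-3i-2j}}$. Let $Q_0$ be a non-degenerate symmetric bilinear form on $\mathbb C^{N-3i}$ and let $x_0\in\mathcal O_{2^j1^{N-3i-2j}}$ with respect to $Q_0$. If $x\in\operatorname{Im}\tau_m^N$, then $1\le m-i\le (N-3i)/2$ and $$(\tau_m^N)^{-1}(x)\cong(\tau_{m-i}^{N-3i})^{-1}(x_0).$$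 If $x\in\operatorname{Im}\sigma_m^N$, then $1\le m-i\le (N-3i)/2$ and $$(\sigma_m^N)^{-1}(x)\cong(\sigma_{m-i}^{N-3i})^{-1}(x_0).$$ (3) Let $N=2n+1$, $1\le m\le n$, $0\le i\le m-1$ and $4m\le 2n+3+i$. For every $x\in\mathcal O_{3^i2^{2m-1-2i}1^{2n-4m+3+i}}$, $$(\tau_m^{2n+1})^{-1}(x)\cong\mathrm{OGr}(m-1-i,\,2m-1-2i),$$ the variety of $(m-1-i)$-dimensional isotropic subspaces of $\mathbb C^{2m-1-2i}$ with respect to a non-degenerate symmetric bilinear form. -/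

import Mathlib

namespace HessPaving

/-! Complex algebraic varieties, in the classical sense of spaces with functions. -/

/-- A set with a (Zariski) topology and, for every open set `U`, a class of `ℂ`-valued functions
that are regular on `U`.  Only the values of `f` on `U` are relevant to `Reg U f`. -/
structure FunSpace (X : Type) where
  top : TopologicalSpace X
  Reg : Set X → (X → ℂ) → Prop

/-- Morphisms: continuous maps that pull regular functions back to regular functions. -/
def IsMorphism {X Y : Type} (A : FunSpace X) (B : FunSpace Y) (φ : X → Y) : Prop :=
  (@Continuous X Y A.top B.top φ) ∧
    ∀ (U : Set Y) (f : Y → ℂ), @IsOpen Y B.top U → B.Reg U f → A.Reg (φ ⁻¹' U) (f ∘ φ)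

/-- Isomorphism of varieties. -/
def Isomorphic {X Y : Type} (A : FunSpace X) (B : FunSpace Y) : Prop :=
  ∃ e : X ≃ Y, IsMorphism A B e ∧ IsMorphism B A e.symm

/-- The structure induced on a subset: the subspace topology, and functions that locally extend to
regular functions of the ambient space. -/
def FunSpace.sub {X : Type} (A : FunSpace X) (Z : Set X) : FunSpace Z where
  top := TopologicalSpace.induced Subtype.val A.top
  Reg U f := ∀ z ∈ U, ∃ (W : Set X) (g : X → ℂ), @IsOpen X A.top W ∧ (z : X) ∈ W ∧ A.Reg W g ∧
    ∀ w ∈ U, (w : X) ∈ W → f w = g w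

/-- The quotient structure along a map: the quotient topology, and functions whose pullback is
regular. -/
def FunSpace.quot {X Y : Type} (A : FunSpace X) (π : X → Y) : FunSpace Y where
  top := TopologicalSpace.coinduced π A.top
  Reg U f := A.Reg (π ⁻¹' U) (f ∘ π)

/-- Affine space with coordinates indexed by `ι`: the Zariski topology, generated by the
non-vanishing sets of polynomials, and functions that are locally quotients of polynomials. -/
def affineSpace (ι : Type) : FunSpace (ι → ℂ) where
  top := TopologicalSpace.generateFrom
    {U | ∃ p : MvPolynomial ι ℂ, U = {a | MvPolynomial.eval a p ≠ 0}}
  Reg U f := ∀ a ∈ U, ∃ p q : MvPolynomial ι ℂ, MvPolynomial.eval a q ≠ 0 ∧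
    ∀ b ∈ U, MvPolynomial.eval b q ≠ 0 →
      f b = MvPolynomial.eval b p / MvPolynomial.eval b q

/-- A paving by affine spaces: a finite filtration `∅ = F 0 ⊆ F 1 ⊆ ⋯ ⊆ F r = X` by closed
subsets such that each difference `F (s + 1) \ F s` is isomorphic to an affine space. -/
def HasAffinePaving {X : Type} (A : FunSpace X) : Prop :=
  ∃ (r : ℕ) (F : ℕ → Set X), F 0 = ∅ ∧ F r = Set.univ ∧
    (∀ s ≤ r, @IsClosed X A.top (F s)) ∧
    ∀ s < r, F s ⊆ F (s + 1) ∧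
      ∃ d : ℕ, Isomorphic (A.sub (F (s + 1) \ F s)) (affineSpace (Fin d))

/-! Grassmannians and partial flag varieties. -/

/-- The space `ℂ^N`. -/
abbrev V (N : ℕ) : Type := Fin N → ℂ

/-- The `j`-th column of an `N × k` matrix. -/
def col {N k : ℕ} (A : Fin N × Fin k → ℂ) (j : Fin k) : V N := fun a => A (a, j)

/-- The `N × k` matrices with linearly independent columns. -/
def frames (N k : ℕ) : Set (Fin N × Fin k → ℂ) := {A | LinearIndependent ℂ (col A)}

/-- The `k`-dimensional subspaces of `ℂ^N`. -/
def Gr (k N : ℕ) : Type := {W : Submodule ℂ (V N) // Module.finrank ℂ W = k}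

/-- The column span of a frame. -/
def frameSpan (k N : ℕ) (A : frames N k) : Gr k N :=
  ⟨Submodule.span ℂ (Set.range (col A.1)), by
    simpa using finrank_span_eq_card (R := ℂ) (b := col A.1) A.2⟩

/-- The Grassmannian as a variety: the quotient of the variety of frames. -/
def grassmannian (k N : ℕ) : FunSpace (Gr k N) :=
  ((affineSpace (Fin N × Fin k)).sub (frames N k)).quot (frameSpan k N)

/-- Partial flags `V_{m-1} ⊂ V_m ⊂ ℂ^N` with `dim V_{m-1} = m - 1`, `dim V_m = m` (`m ≥ 1`). -/
structure Flag (m N : ℕ) where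
  small : Submodule ℂ (V N)
  big : Submodule ℂ (V N)
  le : small ≤ big
  finrank_small : Module.finrank ℂ small = m - 1
  finrank_big : Module.finrank ℂ big = m

/-- The flag spanned by the first `m - 1` columns and by all `m` columns of a frame. -/
def frameFlag (m N : ℕ) (A : frames N m) : Flag m N where
  small := Submodule.span ℂ (Set.range fun j : Fin (m - 1) => col A.1 (j.castLE (Nat.sub_le m 1)))
  big := Submodule.span ℂ (Set.range (col A.1))
  le := Submodule.span_mono (by rintro _ ⟨j, rfl⟩; exact ⟨_, rfl⟩)
  finrank_small := by
    have h : LinearIndependent ℂ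
        (fun j : Fin (m - 1) => col A.1 (j.castLE (Nat.sub_le m 1))) :=
      LinearIndependent.comp A.2 _ (Fin.castLE_injective _)
    simpa using finrank_span_eq_card h
  finrank_big := by
    simpa using finrank_span_eq_card (R := ℂ) (b := col A.1) A.2

/-- The partial flag variety: the quotient of the variety of frames. -/
def flagVariety (m N : ℕ) : FunSpace (Flag m N) :=
  ((affineSpace (Fin N × Fin m)).sub (frames N m)).quot (frameFlag m N)

/-! The symmetric pair `(SL(V), SO(V, Q))`; `Q` is a symmetric bilinear form on `V = ℂ^N`. -/

/-- The `(-1)`-eigenspace of the involution `x ↦ -x^*` of `𝔰𝔩(V)`, where `x^*` is the adjoint with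
respect to `Q`: the traceless self-adjoint endomorphisms. -/
def g1 {N : ℕ} (Q : LinearMap.BilinForm ℂ (V N)) : Set (Module.End ℂ (V N)) :=
  {x | (∀ v w, Q (x v) w = Q v (x w)) ∧ LinearMap.trace ℂ (V N) x = 0}

/-- The nilpotent cone of `𝔤₁`. -/
def N1 {N : ℕ} (Q : LinearMap.BilinForm ℂ (V N)) : Set (Module.End ℂ (V N)) :=
  {x | x ∈ g1 Q ∧ IsNilpotent x}

/-- `x` is nilpotent with Jordan blocks of the listed sizes: there is a basis of chains, one for
each block, such that `x` kills the first vector of a chain and maps each other vector of it to the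
preceding one. -/
def HasJordanType {N : ℕ} (x : Module.End ℂ (V N)) (sizes : List ℕ) : Prop :=
  ∃ b : Module.Basis ((s : Fin sizes.length) × Fin (sizes.get s)) ℂ (V N),
    ∀ (s : Fin sizes.length) (r : ℕ) (hr : r < sizes.get s),
      (r = 0 → x (b ⟨s, r, hr⟩) = 0) ∧
      ∀ r' (h' : r = r' + 1), x (b ⟨s, r, hr⟩) = b ⟨s, r', by omega⟩

/-- The partition `3^i 2^j 1^k`. -/
def part321 (i j k : ℕ) : List ℕ :=
  List.replicate i 3 ++ List.replicate j 2 ++ List.replicate k 1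

/-- The nilpotent orbit (for a partition with only even parts, the union of two `SO`-orbits) with a
given Jordan type. -/
def nilOrbit {N : ℕ} (Q : LinearMap.BilinForm ℂ (V N)) (sizes : List ℕ) :
    Set (Module.End ℂ (V N)) :=
  {x | x ∈ N1 Q ∧ HasJordanType x sizes}

/-- The flags `0 ⊂ V_{m-1} ⊂ V_m ⊂ V_m^⊥ ⊂ V_{m-1}^⊥ ⊂ V`. -/
def isotropicFlags {N : ℕ} (Q : LinearMap.BilinForm ℂ (V N)) (m : ℕ) : Set (Flag m N) :=
  {F | F.big ≤ Q.orthogonal F.big}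

/-- The `SO(V, Q)`-orbit of a flag, that is, the variety `SO(V, Q) / Stab(F₀)`. -/
def soOrbit {N : ℕ} (Q : LinearMap.BilinForm ℂ (V N)) {m : ℕ} (F₀ : Flag m N) :
    Set (Flag m N) :=
  {F | ∃ g : V N ≃ₗ[ℂ] V N, (∀ v w, Q (g v) (g w) = Q v w) ∧
    LinearMap.det (g : V N →ₗ[ℂ] V N) = 1 ∧
    F.small = F₀.small.map (g : V N →ₗ[ℂ] V N) ∧ F.big = F₀.big.map (g : V N →ₗ[ℂ] V N)}

/-- The subspace `E_m` of `𝔤₁` attached to a flag: `x V_m = 0` and `x V_m^⊥ ⊆ V_{m-1}`. -/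
def spaceE {N m : ℕ} (Q : LinearMap.BilinForm ℂ (V N)) (F : Flag m N) :
    Set (Module.End ℂ (V N)) :=
  {x | x ∈ g1 Q ∧ (∀ v ∈ F.big, x v = 0) ∧ ∀ v ∈ Q.orthogonal F.big, x v ∈ F.small}

/-- The subspace `O_m` of `𝔤₁` attached to a flag: `x V_m = 0` and `x V_{m-1}^⊥ ⊆ V_{m-1}`. -/
def spaceO {N m : ℕ} (Q : LinearMap.BilinForm ℂ (V N)) (F : Flag m N) :
    Set (Module.End ℂ (V N)) :=
  {x | x ∈ g1 Q ∧ (∀ v ∈ F.big, x v = 0) ∧ ∀ v ∈ Q.orthogonal F.small, x v ∈ F.small}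

/-- The total space of the family `Hess_m^E`; the map `τ_m^N` is the first projection. -/
def hessE {N : ℕ} (Q : LinearMap.BilinForm ℂ (V N)) (m : ℕ) :
    Set (Module.End ℂ (V N) × Flag m N) :=
  {p | p.2 ∈ isotropicFlags Q m ∧ p.1 ∈ spaceE Q p.2}

/-- The total space of the family `Hess_m^O`; the map `σ_m^N` is the first projection. -/
def hessO {N : ℕ} (Q : LinearMap.BilinForm ℂ (V N)) (m : ℕ) :
    Set (Module.End ℂ (V N) × Flag m N) :=
  {p | p.2 ∈ isotropicFlags Q m ∧ p.1 ∈ spaceO Q p.2}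

/-- The image of `τ_m^N`. -/
def imTau {N : ℕ} (Q : LinearMap.BilinForm ℂ (V N)) (m : ℕ) : Set (Module.End ℂ (V N)) :=
  Prod.fst '' hessE Q m

/-- The image of `σ_m^N`. -/
def imSigma {N : ℕ} (Q : LinearMap.BilinForm ℂ (V N)) (m : ℕ) : Set (Module.End ℂ (V N)) :=
  Prod.fst '' hessO Q m

/-- The fibre `(τ_m^N)⁻¹(x)`, as a set of flags. -/
def fiberTau {N : ℕ} (Q : LinearMap.BilinForm ℂ (V N)) (m : ℕ) (x : Module.End ℂ (V N)) :
    Set (Flag m N) :=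
  {F | (x, F) ∈ hessE Q m}

/-- The fibre `(σ_m^N)⁻¹(x)`, as a set of flags. -/
def fiberSigma {N : ℕ} (Q : LinearMap.BilinForm ℂ (V N)) (m : ℕ) (x : Module.End ℂ (V N)) :
    Set (Flag m N) :=
  {F | (x, F) ∈ hessO Q m}

/-- The orthogonal Grassmannian `OGr(k, M)` of `k`-dimensional isotropic subspaces of `ℂ^M`. -/
def OGr {M : ℕ} (k : ℕ) (Q : LinearMap.BilinForm ℂ (V M)) : Set (Gr k M) :=
  {W | W.1 ≤ Q.orthogonal W.1}

end HessPaving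

open HessPaving

/-! Let `x` lie in the image of `τ` or `σ` and let `V_{m-1} ⊂ V_m` be a flag in its fibre. Since `x`
kills `V_m`, the image of `x` lies in `V_m^⊥`, hence `im x² ⊆ V_{m-1} ⊆ V_m ⊆ ker x` and `x³ = 0`.
So the whole fibre lives in `ker x / im x²`. This space contains `R = (im x ∩ ker x) / im x²`, which
carries the form `(x v, w) ↦ Q(v, w)`, and the quotient by it is `S = ker x / (im x ∩ ker x)`, which
carries the form induced by `Q`; both forms are non-degenerate (`exists_adapted`). After a splitting
`R × S`, a subspace `W` has a trace `inner W` on `R` and a projection `outer W` to `S`. Isotropy of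
`V_m` only says that its `outer` part is isotropic in `S` (`Adapted.isotropic_iff`), and `x B^⊥ ⊆ C`
only says that `(inner B)^⊥ ⊆ inner C` in `R` (`Adapted.apply_orthogonal_iff`). The fibres become
the sets of pairs `relE` and `relO` (`fiberTau_eq`, `fiberSigma_eq`).

The reduction from order three to order two follows: the fibre depends only on the quadratic spaces
`R` and `S`. For Jordan type `3^i 2^j 1^k` they have dimensions `j` and `k`, and over `ℂ` the
dimension determines them up to isometry (`exists_isometry`, `isomorphic_flagsOver`). If `dim R = 2p
+ 1` and the reduced pair has dimensions `p` and `p + 1`, a dimension count forces the `S`-part to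
vanish and the pair to be `(B, B^⊥)` with `B` isotropic of dimension `p` (`mem_relE_iff`), which
gives the orthogonal Grassmannian.

For the paving, flags are stratified by the dimensions of their intersections with finitely many
test subspaces. These dimensions are upper semicontinuous, so it is enough that each stratum is an
affine space (`Paved.of_levels`, `paved_of_levels`). In one quadratic space the strata of isotropic
subspaces are Schubert cells, built by induction from `e^⊥ / e` to the whole space, with `e` an
isotropic vector (`exists_isoCells`). Each cell is parametrised by a regular family of isometries
that preserve the tests. These isometries trivialise every further fibration over the cell:
hyperplanes and lines in subquotients (`IsIsoCell.isLiftCell_lines`), and finally the fibration of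
subspaces of `R × S` over their traces and projections, whose fibres are spaces of linear maps
(`isPairCell_of_isLiftCell`). Orthogonality turns isotropic subspaces into coisotropic ones
(`IsLiftCell.dual`).

For a single `K`-orbit, the unipotent isometries of `exists_special_of_opposite` and
`exists_special_of_hyperplanes` show that every orbit of isotropic flags is open, hence also closed,
in the variety of isotropic flags. Affine cells are irreducible, so each cell lies in one orbit and
the paving restricts (`Paved.inter_soOrbit`).

The geometry is reduced to linear algebra by one notion: a family of subspaces is regular if it is
locally the image of a regular family of projections (`RegFam`). Sums, intersections, images,
preimages and orthogonals of constant rank preserve it, and a map of flags or subspaces that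
preserves regular families is a morphism. -/

namespace HessPaving

open MvPolynomial Module Topology

set_option linter.unusedSectionVars false

/-! ### Locally rational functions on subsets of affine space -/

section Reg

variable {ι κ : Type}

/-- `f` is locally a quotient of polynomials on `T`. -/
def RegOn (T : Set (ι → ℂ)) (f : (ι → ℂ) → ℂ) : Prop :=
  ∀ a ∈ T, ∃ p q : MvPolynomial ι ℂ, eval a q ≠ 0 ∧
    ∀ b ∈ T, eval b q ≠ 0 → f b = eval b p / eval b q

/-- The basic open set of a polynomial. -/
def bas (q : MvPolynomial ι ℂ) : Set (ι → ℂ) := {b | eval b q ≠ 0}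

@[simp] lemma mem_bas {q : MvPolynomial ι ℂ} {b : ι → ℂ} : b ∈ bas q ↔ eval b q ≠ 0 := Iff.rfl

lemma bas_mul (p q : MvPolynomial ι ℂ) : bas (p * q) = bas p ∩ bas q := by
  ext b; simp [bas, not_or]

variable {T T' : Set (ι → ℂ)} {f g : (ι → ℂ) → ℂ}

lemma RegOn.poly (p : MvPolynomial ι ℂ) : RegOn T (fun a => eval a p) :=
  fun a _ => ⟨p, 1, by simp, fun b _ _ => by simp⟩

lemma RegOn.const (c : ℂ) : RegOn T (fun _ => c) := by
  simpa using RegOn.poly (T := T) (C c)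

lemma RegOn.coord (i : ι) : RegOn T (fun a => a i) := by
  simpa using RegOn.poly (T := T) (X i)

lemma RegOn.mono (h : RegOn T f) (hT : T' ⊆ T) : RegOn T' f := fun a ha => by
  obtain ⟨p, q, hq, H⟩ := h a (hT ha)
  exact ⟨p, q, hq, fun b hb => H b (hT hb)⟩

lemma RegOn.congr (h : RegOn T f) (hfg : ∀ a ∈ T, g a = f a) : RegOn T g := fun a ha => by
  obtain ⟨p, q, hq, H⟩ := h a ha
  exact ⟨p, q, hq, fun b hb hb' => by rw [hfg b hb, H b hb hb']⟩

lemma RegOn.of_local (h : ∀ a ∈ T, ∃ q : MvPolynomial ι ℂ, eval a q ≠ 0 ∧ RegOn (T ∩ bas q) f) :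
    RegOn T f := fun a ha => by
  obtain ⟨q, hq, H⟩ := h a ha
  obtain ⟨p', q', hq', H'⟩ := H a ⟨ha, hq⟩
  -- The extra factor `q` in the new denominator confines the formula to the open set where the
  -- local expression is valid.
  refine ⟨p' * q, q * q', by simp [hq, hq'], fun b hb hb' => ?_⟩
  simp only [map_mul, ne_eq, mul_eq_zero, not_or] at hb' ⊢
  rw [H' b ⟨hb, hb'.1⟩ hb'.2]
  field_simp [hb'.1, hb'.2]

lemma RegOn.add (hf : RegOn T f) (hg : RegOn T g) : RegOn T (fun a => f a + g a) := fun a ha => by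
  obtain ⟨p, q, hq, H⟩ := hf a ha
  obtain ⟨p', q', hq', H'⟩ := hg a ha
  refine ⟨p * q' + p' * q, q * q', by simp [hq, hq'], fun b hb hb' => ?_⟩
  simp only [map_mul, map_add, ne_eq, mul_eq_zero, not_or] at hb' ⊢
  rw [H b hb hb'.1, H' b hb hb'.2, div_add_div _ _ hb'.1 hb'.2]
  ring

lemma RegOn.mul (hf : RegOn T f) (hg : RegOn T g) : RegOn T (fun a => f a * g a) := fun a ha => by
  obtain ⟨p, q, hq, H⟩ := hf a ha
  obtain ⟨p', q', hq', H'⟩ := hg a ha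
  refine ⟨p * p', q * q', by simp [hq, hq'], fun b hb hb' => ?_⟩
  simp only [map_mul, ne_eq, mul_eq_zero, not_or] at hb' ⊢
  rw [H b hb hb'.1, H' b hb hb'.2, div_mul_div_comm]

lemma RegOn.neg (hf : RegOn T f) : RegOn T (fun a => -f a) := by
  simpa using (RegOn.const (-1)).mul hf

lemma RegOn.sub (hf : RegOn T f) (hg : RegOn T g) : RegOn T (fun a => f a - g a) := by
  simpa [sub_eq_add_neg] using hf.add hg.neg

lemma RegOn.exists_ne (hf : RegOn T f) {a : ι → ℂ} (ha : a ∈ T) (h : f a ≠ 0) :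
    ∃ q : MvPolynomial ι ℂ, eval a q ≠ 0 ∧ ∀ b ∈ T, eval b q ≠ 0 → f b ≠ 0 := by
  obtain ⟨p, q, hq, H⟩ := hf a ha
  refine ⟨p * q, ?_, fun b hb hb' => ?_⟩
  · rw [H a ha hq] at h
    simpa [hq] using h
  · simp only [map_mul, ne_eq, mul_eq_zero, not_or] at hb'
    rw [H b hb hb'.2]
    exact div_ne_zero hb'.1 hb'.2

lemma RegOn.inv (hf : RegOn T f) (h : ∀ a ∈ T, f a ≠ 0) : RegOn T (fun a => (f a)⁻¹) :=
  fun a ha => by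
  obtain ⟨p, q, hq, H⟩ := hf a ha
  have hp : eval a p ≠ 0 := fun h0 => h a ha (by rw [H a ha hq, h0, zero_div])
  -- The inverse is written as `q² / (p q)` rather than `q / p`, so that non-vanishing of the
  -- denominator also guarantees that `p / q` was valid.
  refine ⟨q * q, p * q, by simp [hp, hq], fun b hb hb' => ?_⟩
  simp only [map_mul, ne_eq, mul_eq_zero, not_or] at hb' ⊢
  rw [H b hb hb'.2, inv_div, mul_div_mul_right _ _ hb'.2]

lemma RegOn.sum {α : Type*} (s : Finset α) {F : α → (ι → ℂ) → ℂ} (h : ∀ i ∈ s, RegOn T (F i)) :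
    RegOn T (fun a => ∑ i ∈ s, F i a) := by
  classical
  induction s using Finset.induction_on with
  | empty => simpa using RegOn.const 0
  | insert i s hi ih =>
    simp only [Finset.sum_insert hi]
    exact (h i (by simp)).add (ih fun j hj => h j (by simp [hj]))

lemma RegOn.prod {α : Type*} (s : Finset α) {F : α → (ι → ℂ) → ℂ} (h : ∀ i ∈ s, RegOn T (F i)) :
    RegOn T (fun a => ∏ i ∈ s, F i a) := by
  classical
  induction s using Finset.induction_on with
  | empty => simpa using RegOn.const 1
  | insert i s hi ih =>
    simp only [Finset.prod_insert hi]
    exact (h i (by simp)).mul (ih fun j hj => h j (by simp [hj]))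

lemma RegOn.eval_comp {c : (ι → ℂ) → κ → ℂ} (hc : ∀ k, RegOn T fun a => c a k)
    (p : MvPolynomial κ ℂ) : RegOn T (fun a => eval (c a) p) := by
  induction p using MvPolynomial.induction_on with
  | C r => simpa using RegOn.const r
  | add p q hp hq => simpa using hp.add hq
  | mul_X p i hp => simpa using hp.mul (hc i)

lemma RegOn.det {n : Type*} [Fintype n] [DecidableEq n] {M : (ι → ℂ) → Matrix n n ℂ}
    (hM : ∀ i j, RegOn T fun a => M a i j) : RegOn T (fun a => (M a).det) := by
  simp only [Matrix.det_apply']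
  exact RegOn.sum _ fun s _ => (RegOn.const _).mul (RegOn.prod _ fun i _ => hM _ _)

lemma RegOn.matrix_inv {n : Type*} [Fintype n] [DecidableEq n] {M : (ι → ℂ) → Matrix n n ℂ}
    (hM : ∀ i j, RegOn T fun a => M a i j) (h : ∀ a ∈ T, (M a).det ≠ 0) (i j : n) :
    RegOn T (fun a => (M a)⁻¹ i j) := by
  simp only [Matrix.inv_def, Matrix.smul_apply, smul_eq_mul, Ring.inverse_eq_inv',
    Matrix.adjugate_apply]
  refine ((RegOn.det hM).inv h).mul (RegOn.det fun k l => ?_)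
  by_cases hk : k = j
  · simp only [hk, Matrix.updateRow_self]; exact RegOn.const _
  · simp only [ne_eq, hk, not_false_eq_true, Matrix.updateRow_ne]; exact hM k l

end Reg

/-! ### Regular vector-valued functions -/

section RegVec

variable {ι κ : Type} {T T' : Set (ι → ℂ)}
variable {E F G : Type*} [AddCommGroup E] [Module ℂ E] [FiniteDimensional ℂ E]
  [AddCommGroup F] [Module ℂ F] [FiniteDimensional ℂ F]
  [AddCommGroup G] [Module ℂ G] [FiniteDimensional ℂ G]

/-- A vector-valued function all of whose coordinates are regular on `T`. -/
def RegVec {E : Type*} [AddCommGroup E] [Module ℂ E] (T : Set (ι → ℂ)) (f : (ι → ℂ) → E) : Prop :=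
  ∀ l : Module.Dual ℂ E, RegOn T (fun a => l (f a))

lemma RegVec.mono {f : (ι → ℂ) → E} (h : RegVec T f) (hT : T' ⊆ T) : RegVec T' f :=
  fun l => (h l).mono hT

lemma RegVec.congr {f g : (ι → ℂ) → E} (h : RegVec T f) (hfg : ∀ a ∈ T, g a = f a) :
    RegVec T g := fun l => (h l).congr fun a ha => by rw [hfg a ha]

lemma RegVec.of_local {f : (ι → ℂ) → E}
    (h : ∀ a ∈ T, ∃ q : MvPolynomial ι ℂ, eval a q ≠ 0 ∧ RegVec (T ∩ bas q) f) : RegVec T f :=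
  fun l => RegOn.of_local fun a ha => (h a ha).imp fun _ hq => ⟨hq.1, hq.2 l⟩

lemma RegVec.const (v : E) : RegVec T (fun _ => v) := fun l => RegOn.const (l v)

lemma RegVec.add {f g : (ι → ℂ) → E} (hf : RegVec T f) (hg : RegVec T g) :
    RegVec T (fun a => f a + g a) := fun l => by simpa using (hf l).add (hg l)

lemma RegVec.sub {f g : (ι → ℂ) → E} (hf : RegVec T f) (hg : RegVec T g) :
    RegVec T (fun a => f a - g a) := fun l => by simpa using (hf l).sub (hg l)

lemma RegVec.smul {c : (ι → ℂ) → ℂ} {f : (ι → ℂ) → E} (hc : RegOn T c) (hf : RegVec T f) :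
    RegVec T (fun a => c a • f a) := fun l => by simpa using hc.mul (hf l)

lemma RegVec.sum {α : Type*} (s : Finset α) {f : α → (ι → ℂ) → E}
    (h : ∀ i ∈ s, RegVec T (f i)) : RegVec T (fun a => ∑ i ∈ s, f i a) := fun l => by
  simpa using RegOn.sum s fun i hi => h i hi l

lemma regVec_scalar {f : (ι → ℂ) → ℂ} : RegVec T f ↔ RegOn T f := by
  refine ⟨fun h => h LinearMap.id, fun h l => ?_⟩
  refine ((RegOn.const (l 1)).mul h).congr fun a _ => ?_
  conv_lhs => rw [← mul_one (f a), ← smul_eq_mul, map_smul]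
  rw [smul_eq_mul, mul_comm]

lemma RegVec.linear (L : E →ₗ[ℂ] F) {f : (ι → ℂ) → E} (hf : RegVec T f) :
    RegVec T (fun a => L (f a)) := fun l => hf (l ∘ₗ L)

lemma RegVec.apply {φ : (ι → ℂ) → E →ₗ[ℂ] F} {f : (ι → ℂ) → E} (hφ : RegVec T φ)
    (hf : RegVec T f) : RegVec T (fun a => φ a (f a)) := by
  let b := finBasis ℂ E
  have : RegVec T (fun a => ∑ i, b.repr (f a) i • φ a (b i)) :=
    RegVec.sum _ fun i _ => RegVec.smul (hf (b.coord i)) (hφ.linear (LinearMap.applyₗ (b i)))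
  refine this.congr fun a _ => ?_
  conv_lhs => rw [← b.sum_repr (f a), map_sum]
  simp only [map_smul]

lemma regVec_hom_iff {φ : (ι → ℂ) → E →ₗ[ℂ] F} :
    RegVec T φ ↔ ∀ v, RegVec T (fun a => φ a v) := by
  refine ⟨fun h v => h.apply (RegVec.const v), fun h => ?_⟩
  let b := finBasis ℂ E
  let c := finBasis ℂ F
  have : RegVec T (fun a => ∑ i, (LinearMap.smulRightₗ (b.coord i)) (φ a (b i))) :=
    RegVec.sum _ fun i _ => (h (b i)).linear _
  refine this.congr fun a _ => b.ext fun j => ?_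
  simp [Finsupp.single_apply]

lemma RegVec.comp {φ : (ι → ℂ) → E →ₗ[ℂ] F} {ψ : (ι → ℂ) → F →ₗ[ℂ] G} (hψ : RegVec T ψ)
    (hφ : RegVec T φ) : RegVec T (fun a => ψ a ∘ₗ φ a) :=
  regVec_hom_iff.2 fun v => hψ.apply (regVec_hom_iff.1 hφ v)

lemma RegVec.bilin (B : E →ₗ[ℂ] F →ₗ[ℂ] G) {f : (ι → ℂ) → E} {g : (ι → ℂ) → F}
    (hf : RegVec T f) (hg : RegVec T g) : RegVec T (fun a => B (f a) (g a)) :=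
  (hf.linear B).apply hg

lemma RegVec.pair {f : (ι → ℂ) → E} {g : (ι → ℂ) → F} (hf : RegVec T f) (hg : RegVec T g) :
    RegVec T (fun a => (f a, g a)) := by
  refine ((hf.linear (LinearMap.inl ℂ E F)).add (hg.linear (LinearMap.inr ℂ E F))).congr
    fun a _ => by simp

lemma RegVec.pi {α : Type*} [Fintype α] {f : (ι → ℂ) → α → E} (hf : ∀ i, RegVec T fun a => f a i) :
    RegVec T f := by
  classical
  have : RegVec T (fun a => ∑ i, LinearMap.single ℂ (fun _ => E) i (f a i)) :=
    RegVec.sum _ fun i _ => (hf i).linear _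
  refine this.congr fun a _ => ?_
  simpa using (LinearMap.sum_single_apply (fun _ => E) (f a)).symm

/-- A regular family of linear maps has, near a point where its rank is at least `r`, a regular
family `ψ` with `ψ φ ψ = ψ` of rank `r`. -/
lemma exists_local_inverse {φ : (ι → ℂ) → E →ₗ[ℂ] F} (hφ : RegVec T φ) {a : ι → ℂ} (ha : a ∈ T) :
    ∃ q : MvPolynomial ι ℂ, eval a q ≠ 0 ∧ ∃ ψ : (ι → ℂ) → F →ₗ[ℂ] E, RegVec (T ∩ bas q) ψ ∧
      ∀ t ∈ T ∩ bas q,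
        finrank ℂ (LinearMap.range (φ a)) ≤ finrank ℂ (LinearMap.range (φ t)) ∧
        (finrank ℂ (LinearMap.range (φ t)) = finrank ℂ (LinearMap.range (φ a)) →
          φ t ∘ₗ ψ t ∘ₗ φ t = φ t) := by
  set r := finrank ℂ (LinearMap.range (φ a)) with hr
  let b : Basis (Fin r) ℂ (LinearMap.range (φ a)) := finBasis ℂ _
  have hsurj := (φ a).surjective_rangeRestrict
  choose e he using fun i => hsurj (b i)
  have he' : ∀ i, φ a (e i) = (b i : F) := fun i => by
    rw [← he i]; rfl
  obtain ⟨π, hπ'⟩ := (LinearMap.range (φ a)).subtype.exists_leftInverse_of_injective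
    (Submodule.ker_subtype _)
  have hπ : ∀ x : LinearMap.range (φ a), π x = x := fun x => LinearMap.congr_fun hπ' x
  -- `lam` and `inc` single out an `r × r` minor `N t` of `φ t` that is the identity at `a`. Where
  -- its determinant does not vanish, `inc ∘ N⁻¹ ∘ lam` is the required family.
  let lam : F →ₗ[ℂ] (Fin r → ℂ) := b.equivFun.toLinearMap ∘ₗ π
  let inc : (Fin r → ℂ) →ₗ[ℂ] E := Fintype.linearCombination ℂ e
  let N : (ι → ℂ) → (Fin r → ℂ) →ₗ[ℂ] (Fin r → ℂ) := fun t => lam ∘ₗ φ t ∘ₗ inc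
  have hN : RegVec T N := (RegVec.const lam).comp (hφ.comp (RegVec.const inc))
  let M : (ι → ℂ) → Matrix (Fin r) (Fin r) ℂ := fun t => LinearMap.toMatrix' (N t)
  have hM : ∀ i j, RegOn T fun t => M t i j := fun i j =>
    regVec_hom_iff.1 hN (Pi.single j 1) (LinearMap.proj i) |>.congr fun t _ => by
      simp [M, LinearMap.toMatrix'_apply]
  have hMa : (M a).det ≠ 0 := by
    have : N a = LinearMap.id := by
      refine (Pi.basisFun ℂ (Fin r)).ext fun j => ?_
      simp [N, inc, lam, he', hπ, Fintype.linearCombination_apply_single]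
      ext k
      simp [Finsupp.single_apply, Pi.single_apply, eq_comm]
    simp [M, this]
  obtain ⟨q, hq, Hq⟩ := (RegOn.det hM).exists_ne ha hMa
  refine ⟨q, hq, fun t => inc ∘ₗ Matrix.toLin' (M t)⁻¹ ∘ₗ lam, ?_, ?_⟩
  · refine (RegVec.const inc).comp (RegVec.comp ?_ (RegVec.const lam))
    refine regVec_hom_iff.2 fun v => RegVec.pi fun i => regVec_scalar.2 ?_
    simp only [Matrix.toLin'_apply, Matrix.mulVec, dotProduct]
    exact RegOn.sum _ fun j _ => (RegOn.matrix_inv (fun i j => (hM i j).mono Set.inter_subset_left)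
      (fun b hb => Hq b hb.1 hb.2) i j).mul (RegOn.const _)
  · intro t ht
    have hdet : IsUnit (M t).det := (Hq t ht.1 ht.2).isUnit
    have h1 : Matrix.toLin' (M t)⁻¹ ∘ₗ N t = LinearMap.id := by
      have : N t = Matrix.toLin' (M t) := by simp [M]
      rw [this, ← Matrix.toLin'_mul, Matrix.nonsing_inv_mul _ hdet, Matrix.toLin'_one]
    have hinj : Function.Injective (φ t ∘ₗ inc) := by
      intro x y hxy
      have := congrArg (fun z => Matrix.toLin' (M t)⁻¹ (lam z)) hxy
      have h2 : ∀ x, Matrix.toLin' (M t)⁻¹ (lam ((φ t ∘ₗ inc) x)) = x :=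
        fun x => LinearMap.congr_fun h1 x
      simpa only [h2] using this
    have hle : LinearMap.range (φ t ∘ₗ inc) ≤ LinearMap.range (φ t) :=
      LinearMap.range_comp_le_range _ _
    have hfr : finrank ℂ (LinearMap.range (φ t ∘ₗ inc)) = r := by
      rw [LinearMap.finrank_range_of_inj hinj]; simp
    refine ⟨hfr ▸ Submodule.finrank_mono hle, fun hrk => ?_⟩
    have heq : LinearMap.range (φ t ∘ₗ inc) = LinearMap.range (φ t) :=
      Submodule.eq_of_le_of_finrank_eq hle (by rw [hfr, hrk])
    ext v
    obtain ⟨w, hw⟩ : φ t v ∈ LinearMap.range (φ t ∘ₗ inc) := heq ▸ LinearMap.mem_range_self _ _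
    have h2 : Matrix.toLin' (M t)⁻¹ (lam ((φ t ∘ₗ inc) w)) = w := LinearMap.congr_fun h1 w
    simp only [LinearMap.comp_apply] at hw h2 ⊢
    rw [← hw, h2]

/-- A regular family of linear maps of constant rank has locally a regular generalized inverse. -/
lemma exists_gen_inverse {φ : (ι → ℂ) → E →ₗ[ℂ] F} (hφ : RegVec T φ) {r : ℕ}
    (hr : ∀ t ∈ T, finrank ℂ (LinearMap.range (φ t)) = r) {a : ι → ℂ} (ha : a ∈ T) :
    ∃ q : MvPolynomial ι ℂ, eval a q ≠ 0 ∧ ∃ ψ : (ι → ℂ) → F →ₗ[ℂ] E, RegVec (T ∩ bas q) ψ ∧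
      ∀ t ∈ T ∩ bas q, φ t ∘ₗ ψ t ∘ₗ φ t = φ t := by
  obtain ⟨q, hq, ψ, hψ, H⟩ := exists_local_inverse hφ ha
  exact ⟨q, hq, ψ, hψ, fun t ht => (H t ht).2 (by rw [hr t ht.1, hr a ha])⟩

/-- The unique solution of a regular family of linear systems is regular. -/
lemma RegVec.solve {φ : (ι → ℂ) → E →ₗ[ℂ] F} (hφ : RegVec T φ) {f : (ι → ℂ) → F}
    (hf : RegVec T f) {c : (ι → ℂ) → E} (hinj : ∀ t ∈ T, Function.Injective (φ t))
    (hc : ∀ t ∈ T, φ t (c t) = f t) : RegVec T c := by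
  refine RegVec.of_local fun a ha => ?_
  obtain ⟨q, hq, ψ, hψ, H⟩ := exists_gen_inverse hφ
    (fun t ht => LinearMap.finrank_range_of_inj (hinj t ht)) ha
  refine ⟨q, hq, (hψ.apply (hf.mono Set.inter_subset_left)).congr fun t ht => ?_⟩
  refine hinj t ht.1 ?_
  have := LinearMap.congr_fun (H t ht) (c t)
  simpa [hc t ht.1] using this.symm

end RegVec

/-! ### Regular families of subspaces -/

section RegFam

variable {ι κ : Type} {T T' : Set (ι → ℂ)}
variable {E F G : Type*} [AddCommGroup E] [Module ℂ E] [FiniteDimensional ℂ E]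
  [AddCommGroup F] [Module ℂ F] [FiniteDimensional ℂ F]
  [AddCommGroup G] [Module ℂ G] [FiniteDimensional ℂ G]

/-- A family of subspaces that is locally the image of a regular family of projections. -/
def RegFam {E : Type*} [AddCommGroup E] [Module ℂ E] (T : Set (ι → ℂ))
    (W : (ι → ℂ) → Submodule ℂ E) : Prop :=
  ∀ a ∈ T, ∃ q : MvPolynomial ι ℂ, eval a q ≠ 0 ∧ ∃ P : (ι → ℂ) → E →ₗ[ℂ] E,
    RegVec (T ∩ bas q) P ∧ ∀ t ∈ T ∩ bas q, (∀ v, P t v ∈ W t) ∧ ∀ v ∈ W t, P t v = v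

variable {W W' : (ι → ℂ) → Submodule ℂ E}

lemma RegFam.congr (h : RegFam T W) (hW : ∀ t ∈ T, W' t = W t) : RegFam T W' := fun a ha => by
  obtain ⟨q, hq, P, hP, H⟩ := h a ha
  exact ⟨q, hq, P, hP, fun t ht => by rw [hW t ht.1]; exact H t ht⟩

lemma RegFam.of_local (h : ∀ a ∈ T, ∃ q : MvPolynomial ι ℂ, eval a q ≠ 0 ∧ RegFam (T ∩ bas q) W) :
    RegFam T W := fun a ha => by
  obtain ⟨q, hq, h⟩ := h a ha
  obtain ⟨q', hq', P, hP, H⟩ := h a ⟨ha, hq⟩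
  have hs : T ∩ bas (q * q') = T ∩ bas q ∩ bas q' := by rw [bas_mul, Set.inter_assoc]
  exact ⟨q * q', by simp [hq, hq'], P, hs ▸ hP, hs ▸ H⟩

lemma RegFam.const (W : Submodule ℂ E) : RegFam T (fun _ => W) := fun a _ => by
  obtain ⟨P, hP⟩ := W.subtype.exists_leftInverse_of_injective (Submodule.ker_subtype _)
  exact ⟨1, by simp, fun _ => W.subtype ∘ₗ P, RegVec.const _, fun t _ => ⟨fun v => (P v).2,
    fun v hv => congrArg Subtype.val (LinearMap.congr_fun hP ⟨v, hv⟩)⟩⟩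

/-- With `ψ` a generalized inverse of `φ`, the composite `φ ψ` projects onto the range of `φ`. -/
lemma RegFam.range {φ : (ι → ℂ) → E →ₗ[ℂ] F} (hφ : RegVec T φ) {r : ℕ}
    (hr : ∀ t ∈ T, finrank ℂ (LinearMap.range (φ t)) = r) :
    RegFam T (fun t => LinearMap.range (φ t)) := fun a ha => by
  obtain ⟨q, hq, ψ, hψ, H⟩ := exists_gen_inverse hφ hr ha
  refine ⟨q, hq, fun t => φ t ∘ₗ ψ t, (hφ.mono Set.inter_subset_left).comp hψ, fun t ht =>
    ⟨fun v => ⟨_, rfl⟩, ?_⟩⟩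
  rintro _ ⟨v, rfl⟩
  exact LinearMap.congr_fun (H t ht) v

/-- With `ψ` a generalized inverse of `φ`, the map `1 - ψ φ` projects onto the kernel of `φ`. -/
lemma RegFam.ker {φ : (ι → ℂ) → E →ₗ[ℂ] F} (hφ : RegVec T φ) {r : ℕ}
    (hr : ∀ t ∈ T, finrank ℂ (LinearMap.ker (φ t)) = r) :
    RegFam T (fun t => LinearMap.ker (φ t)) := fun a ha => by
  have hr' : ∀ t ∈ T, finrank ℂ (LinearMap.range (φ t)) = finrank ℂ E - r := fun t ht => by
    have := LinearMap.finrank_range_add_finrank_ker (φ t)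
    rw [hr t ht] at this; omega
  obtain ⟨q, hq, ψ, hψ, H⟩ := exists_gen_inverse hφ hr' ha
  refine ⟨q, hq, fun t => LinearMap.id - ψ t ∘ₗ φ t,
    (RegVec.const _).sub (hψ.comp (hφ.mono Set.inter_subset_left)), fun t ht => ⟨fun v => ?_, ?_⟩⟩
  · have := LinearMap.congr_fun (H t ht) v
    simp only [LinearMap.comp_apply] at this
    simp [this]
  · intro v hv
    rw [LinearMap.mem_ker] at hv
    simp [hv]

lemma range_of_proj {P : E →ₗ[ℂ] E} {W : Submodule ℂ E} (h1 : ∀ v, P v ∈ W)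
    (h2 : ∀ v ∈ W, P v = v) : LinearMap.range P = W :=
  le_antisymm (by rintro _ ⟨v, rfl⟩; exact h1 v) fun v hv => ⟨v, h2 v hv⟩

lemma ker_of_proj {P : E →ₗ[ℂ] E} {W : Submodule ℂ E} (h1 : ∀ v, P v ∈ W)
    (h2 : ∀ v ∈ W, P v = v) {v : E} : v - P v = 0 ↔ v ∈ W :=
  ⟨fun h => by rw [sub_eq_zero.1 h]; exact h1 v, fun h => by rw [h2 v h, sub_self]⟩

lemma RegFam.map {φ : (ι → ℂ) → E →ₗ[ℂ] F} (hφ : RegVec T φ) (hW : RegFam T W) {r : ℕ}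
    (hr : ∀ t ∈ T, finrank ℂ ((W t).map (φ t)) = r) : RegFam T (fun t => (W t).map (φ t)) := by
  refine RegFam.of_local fun a ha => ?_
  obtain ⟨q, hq, P, hP, H⟩ := hW a ha
  have key : ∀ t ∈ T ∩ bas q, (W t).map (φ t) = LinearMap.range (φ t ∘ₗ P t) := fun t ht => by
    rw [LinearMap.range_comp, range_of_proj (H t ht).1 (H t ht).2]
  exact ⟨q, hq, (RegFam.range ((hφ.mono Set.inter_subset_left).comp hP)
    fun t ht => by rw [← key t ht, hr t ht.1]).congr key⟩

lemma RegFam.comap {φ : (ι → ℂ) → F →ₗ[ℂ] E} (hφ : RegVec T φ) (hW : RegFam T W) {r : ℕ}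
    (hr : ∀ t ∈ T, finrank ℂ ((W t).comap (φ t)) = r) :
    RegFam T (fun t => (W t).comap (φ t)) := by
  refine RegFam.of_local fun a ha => ?_
  obtain ⟨q, hq, P, hP, H⟩ := hW a ha
  have key : ∀ t ∈ T ∩ bas q,
      (W t).comap (φ t) = LinearMap.ker (φ t - P t ∘ₗ φ t) := fun t ht => by
    ext v
    simp only [Submodule.mem_comap, LinearMap.mem_ker, LinearMap.sub_apply, LinearMap.comp_apply]
    exact (ker_of_proj (H t ht).1 (H t ht).2).symm
  have hφ' := hφ.mono (Set.inter_subset_left (s := T) (t := bas q))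
  exact ⟨q, hq, (RegFam.ker (hφ'.sub (hP.comp hφ'))
    fun t ht => by rw [← key t ht, hr t ht.1]).congr key⟩

lemma RegFam.prod {W₂ : (ι → ℂ) → Submodule ℂ F} (hW : RegFam T W) (hW₂ : RegFam T W₂) :
    RegFam T (fun t => (W t).prod (W₂ t)) := fun a ha => by
  obtain ⟨q, hq, P, hP, H⟩ := hW a ha
  obtain ⟨q', hq', P', hP', H'⟩ := hW₂ a ha
  have hs : T ∩ bas (q * q') ⊆ T ∩ bas q := fun b hb => ⟨hb.1, by
    rw [bas_mul] at hb; exact hb.2.1⟩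
  have hs' : T ∩ bas (q * q') ⊆ T ∩ bas q' := fun b hb => ⟨hb.1, by
    rw [bas_mul] at hb; exact hb.2.2⟩
  refine ⟨q * q', by simp [hq, hq'], fun t => (P t).prodMap (P' t), ?_, fun t ht => ⟨fun v =>
    ⟨(H t (hs ht)).1 _, (H' t (hs' ht)).1 _⟩, fun v hv =>
    Prod.ext ((H t (hs ht)).2 _ hv.1) ((H' t (hs' ht)).2 _ hv.2)⟩⟩
  exact regVec_hom_iff.2 fun v => RegVec.pair (regVec_hom_iff.1 (hP.mono hs) v.1)
    (regVec_hom_iff.1 (hP'.mono hs') v.2)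

lemma RegFam.sup (hW : RegFam T W) (hW' : RegFam T W') {r : ℕ}
    (hr : ∀ t ∈ T, finrank ℂ (W t ⊔ W' t : Submodule ℂ E) = r) :
    RegFam T (fun t => W t ⊔ W' t) := by
  have key : ∀ t, W t ⊔ W' t =
      ((W t).prod (W' t)).map (LinearMap.coprod LinearMap.id LinearMap.id) := fun t => by
    ext v
    simp only [Submodule.mem_sup, Submodule.mem_map, Submodule.mem_prod, Prod.exists,
      LinearMap.coprod_apply, LinearMap.id_apply]
    constructor
    · rintro ⟨y, hy, z, hz, h⟩; exact ⟨y, z, ⟨hy, hz⟩, h⟩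
    · rintro ⟨y, z, ⟨hy, hz⟩, h⟩; exact ⟨y, hy, z, hz, h⟩
  exact (RegFam.map (RegVec.const _) (hW.prod hW') fun t ht => by rw [← key t, hr t ht]).congr
    fun t _ => key t

lemma RegFam.inf (hW : RegFam T W) (hW' : RegFam T W') {r : ℕ}
    (hr : ∀ t ∈ T, finrank ℂ (W t ⊓ W' t : Submodule ℂ E) = r) :
    RegFam T (fun t => W t ⊓ W' t) := by
  have key : ∀ t, W t ⊓ W' t =
      ((W t).prod (W' t)).comap (LinearMap.prod LinearMap.id LinearMap.id) := fun t => by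
    ext v; simp
  exact (RegFam.comap (RegVec.const _) (hW.prod hW') fun t ht => by rw [← key t, hr t ht]).congr
    fun t _ => key t

/-- A regular family of subspaces has a regular family of left-orthogonality functionals. -/
lemma RegFam.orthogonal {Q : LinearMap.BilinForm ℂ E} (hW : RegFam T W) {r : ℕ}
    (hr : ∀ t ∈ T, finrank ℂ (Q.orthogonal (W t)) = r) :
    RegFam T (fun t => Q.orthogonal (W t)) := by
  refine RegFam.of_local fun a ha => ?_
  obtain ⟨q, hq, P, hP, H⟩ := hW a ha
  let φ : (ι → ℂ) → E →ₗ[ℂ] Module.Dual ℂ E := fun t => (Q ∘ₗ P t).flip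
  have key : ∀ t ∈ T ∩ bas q, Q.orthogonal (W t) = LinearMap.ker (φ t) := fun t ht => by
    ext v
    rw [LinearMap.BilinForm.mem_orthogonal_iff, LinearMap.mem_ker]
    constructor
    · intro h; ext w; exact h _ ((H t ht).1 w)
    · intro h w hw
      have := LinearMap.congr_fun h w
      simpa [φ, (H t ht).2 w hw] using this
  have hφ : RegVec (T ∩ bas q) φ := regVec_hom_iff.2 fun v => regVec_hom_iff.2 fun w =>
    RegVec.bilin Q (regVec_hom_iff.1 hP w) (RegVec.const v)
  exact ⟨q, hq, (RegFam.ker hφ fun t ht => by rw [← key t ht, hr t ht.1]).congr key⟩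

/-- If membership in a regular family determines `c t` by an affine-linear system, then `c` is
regular. -/
lemma RegFam.solve (hW : RegFam T W) {L : (ι → ℂ) → F →ₗ[ℂ] E} (hL : RegVec T L)
    {f : (ι → ℂ) → E} (hf : RegVec T f) {c : (ι → ℂ) → F}
    (hinj : ∀ t ∈ T, ∀ v, L t v ∈ W t → v = 0) (hc : ∀ t ∈ T, L t (c t) + f t ∈ W t) :
    RegVec T c := by
  refine RegVec.of_local fun a ha => ?_
  obtain ⟨q, hq, P, hP, H⟩ := hW a ha
  have hL' := hL.mono (Set.inter_subset_left (s := T) (t := bas q))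
  have hf' := hf.mono (Set.inter_subset_left (s := T) (t := bas q))
  -- Membership in `W t` is the vanishing of `1 - P t`, which turns the condition into an ordinary
  -- injective linear system for `c t`.
  refine ⟨q, hq, RegVec.solve (φ := fun t => L t - P t ∘ₗ L t) (hL'.sub (hP.comp hL'))
    (f := fun t => P t (f t) - f t) ((hP.apply hf').sub hf') ?_ ?_⟩
  · intro t ht
    rw [← LinearMap.ker_eq_bot, LinearMap.ker_eq_bot']
    exact fun v hv => hinj t ht.1 v ((ker_of_proj (H t ht).1 (H t ht).2).1 hv)
  · intro t ht
    have := (ker_of_proj (H t ht).1 (H t ht).2).2 (hc t ht.1)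
    simp only [map_add, LinearMap.sub_apply, LinearMap.comp_apply] at this ⊢
    rw [sub_eq_zero] at this
    rw [sub_eq_sub_iff_add_eq_add, this]; abel

/-- Simultaneous version: `c t` is determined by the conditions `L t v (c t) + f t v ∈ W t`. -/
lemma RegFam.solve_hom (hW : RegFam T W) {L : (ι → ℂ) → F →ₗ[ℂ] G →ₗ[ℂ] E} (hL : RegVec T L)
    {f : (ι → ℂ) → G →ₗ[ℂ] E} (hf : RegVec T f) {c : (ι → ℂ) → F}
    (hinj : ∀ t ∈ T, ∀ v, (∀ g, L t v g ∈ W t) → v = 0)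
    (hc : ∀ t ∈ T, ∀ g, L t (c t) g + f t g ∈ W t) :
    RegVec T c := by
  refine RegVec.of_local fun a ha => ?_
  obtain ⟨q, hq, P, hP, H⟩ := hW a ha
  have hL' := hL.mono (Set.inter_subset_left (s := T) (t := bas q))
  have hf' := hf.mono (Set.inter_subset_left (s := T) (t := bas q))
  refine ⟨q, hq, RegVec.solve (φ := fun t => L t - (LinearMap.llcomp ℂ G E E (P t)) ∘ₗ L t)
    (hL'.sub ((hP.linear (LinearMap.llcomp ℂ G E E)).comp hL'))
    (f := fun t => P t ∘ₗ f t - f t) ((hP.comp hf').sub hf') ?_ ?_⟩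
  · intro t ht
    rw [← LinearMap.ker_eq_bot, LinearMap.ker_eq_bot']
    exact fun v hv => hinj t ht.1 v fun g => (ker_of_proj (H t ht).1 (H t ht).2).1
      (LinearMap.congr_fun hv g)
  · intro t ht
    ext g
    have := (ker_of_proj (H t ht).1 (H t ht).2).2 (hc t ht.1 g)
    simp only [map_add, LinearMap.sub_apply, LinearMap.comp_apply, LinearMap.llcomp_apply']
      at this ⊢
    rw [sub_eq_zero] at this
    rw [sub_eq_sub_iff_add_eq_add, this]; abel

/-- The set where a regular family of linear maps has rank at least `r` is open. -/
lemma exists_rank_ge {φ : (ι → ℂ) → E →ₗ[ℂ] F} (hφ : RegVec T φ) {a : ι → ℂ} (ha : a ∈ T) :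
    ∃ q : MvPolynomial ι ℂ, eval a q ≠ 0 ∧ ∀ t ∈ T ∩ bas q,
      finrank ℂ (LinearMap.range (φ a)) ≤ finrank ℂ (LinearMap.range (φ t)) := by
  obtain ⟨q, hq, ψ, -, H⟩ := exists_local_inverse hφ ha
  exact ⟨q, hq, fun t ht => (H t ht).1⟩

end RegFam

/-! ### Varieties presented as quotients of quasi-affine varieties -/

section Presentation

variable {X Y : Type} {ι κ : Type}

/-- The non-vanishing sets of polynomials are stable under intersection, so they form a basis of the
topology that they generate. -/
lemma affine_isOpen_iff {U : Set (ι → ℂ)} : IsOpen[(affineSpace ι).top] U ↔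
    ∀ a ∈ U, ∃ q : MvPolynomial ι ℂ, eval a q ≠ 0 ∧ bas q ⊆ U := by
  constructor
  · intro h
    induction h with
    | basic s hs => obtain ⟨p, rfl⟩ := hs; exact fun a ha => ⟨p, ha, subset_rfl⟩
    | univ => exact fun a _ => ⟨1, by simp, Set.subset_univ _⟩
    | inter s t _ _ hs ht =>
      intro a ha
      obtain ⟨p, hp, h⟩ := hs a ha.1
      obtain ⟨q, hq, h'⟩ := ht a ha.2
      exact ⟨p * q, by simp [hp, hq], bas_mul p q ▸ Set.inter_subset_inter h h'⟩
    | sUnion S _ hS =>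
      rintro a ⟨s, hs, ha⟩
      obtain ⟨p, hp, h⟩ := hS s hs a ha
      exact ⟨p, hp, h.trans (Set.subset_sUnion_of_mem hs)⟩
  · intro h
    choose! q hq hU using h
    have : U = ⋃₀ {s | ∃ a ∈ U, s = bas (q a)} := by
      ext b
      simp only [Set.mem_sUnion, Set.mem_ofPred_eq]
      exact ⟨fun hb => ⟨_, ⟨b, hb, rfl⟩, hq b hb⟩,
        by rintro ⟨_, ⟨a, ha, rfl⟩, hb⟩; exact hU a ha hb⟩
    rw [this]
    refine TopologicalSpace.GenerateOpen.sUnion _ ?_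
    rintro _ ⟨a, _, rfl⟩
    exact TopologicalSpace.GenerateOpen.basic _ ⟨q a, rfl⟩

/-- A description of the relatively open subsets and of the regular functions of all subspaces of
`A` in terms of a surjection from a subset of an affine space. -/
structure Presentation (A : FunSpace X) (ι : Type) where
  S : Set (ι → ℂ)
  π : S → X
  surj : Function.Surjective π
  reg_mono : ∀ {U U' : Set X} {f : X → ℂ}, A.Reg U f → U' ⊆ U → A.Reg U' f
  open_iff : ∀ {Z C : Set X}, C ⊆ Z → ((∃ O, IsOpen[A.top] O ∧ O ∩ Z = C) ↔
    ∀ a : S, π a ∈ C → ∃ q : MvPolynomial ι ℂ, eval a.1 q ≠ 0 ∧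
      ∀ b : S, π b ∈ Z → eval b.1 q ≠ 0 → π b ∈ C)
  reg_iff : ∀ {Z : Set X} {U : Set Z} {f : Z → ℂ}, (A.sub Z).Reg U f ↔
    ∀ (a : S) (ha : π a ∈ Z), ⟨π a, ha⟩ ∈ U → ∃ p q : MvPolynomial ι ℂ, eval a.1 q ≠ 0 ∧
      ∀ (b : S) (hb : π b ∈ Z), ⟨π b, hb⟩ ∈ U → eval b.1 q ≠ 0 →
        f ⟨π b, hb⟩ = eval b.1 p / eval b.1 q

/-- The preimage of a subset under the presenting surjection. -/
def Presentation.pull {A : FunSpace X} (P : Presentation A ι) (Z : Set X) : Set (ι → ℂ) :=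
  {a | ∃ h : a ∈ P.S, P.π ⟨a, h⟩ ∈ Z}

/-- Affine space is presented by itself. -/
def affinePresentation (ι : Type) : Presentation (affineSpace ι) ι where
  S := Set.univ
  π := Subtype.val
  surj a := ⟨⟨a, trivial⟩, rfl⟩
  reg_mono h hU := RegOn.mono h hU
  open_iff {Z C} hC := by
    constructor
    · rintro ⟨O, hO, rfl⟩ a ha
      obtain ⟨q, hq, h⟩ := affine_isOpen_iff.1 hO a ha.1
      exact ⟨q, hq, fun b hb hb' => ⟨h hb', hb⟩⟩
    · intro h
      choose! q hq H using h
      refine ⟨{b | ∃ a : (Set.univ : Set (ι → ℂ)), a.1 ∈ C ∧ b ∈ bas (q a)},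
        affine_isOpen_iff.2 fun b hb => ?_, ?_⟩
      · obtain ⟨a, ha, hb⟩ := hb
        exact ⟨q a, hb, fun c hc => ⟨a, ha, hc⟩⟩
      · ext b
        constructor
        · rintro ⟨⟨a, ha, hb⟩, hbZ⟩
          exact H a ha ⟨b, trivial⟩ hbZ hb
        · exact fun hb => ⟨⟨⟨b, trivial⟩, hb, hq ⟨b, trivial⟩ hb⟩, hC hb⟩
  reg_iff {Z U f} := by
    constructor
    · intro h a ha haU
      obtain ⟨W, g, hW, haW, hg, H⟩ := h _ haU
      obtain ⟨r, hr, hrW⟩ := affine_isOpen_iff.1 hW _ haW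
      obtain ⟨p, q, hq, H'⟩ := hg _ haW
      refine ⟨p * r, q * r, by simp only [map_mul]; exact mul_ne_zero hq hr, fun b hb hbU hb' => ?_⟩
      simp only [map_mul, ne_eq, mul_eq_zero, not_or] at hb' ⊢
      rw [H _ hbU (hrW hb'.2), H' _ (hrW hb'.2) hb'.1, mul_div_mul_right _ _ hb'.2]
    · rintro h ⟨a, ha⟩ haU
      obtain ⟨p, q, hq, H⟩ := h ⟨a, trivial⟩ ha haU
      refine ⟨bas q, fun b => eval b p / eval b q, affine_isOpen_iff.2 fun b hb => ⟨q, hb, subset_rfl⟩,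
        hq, fun b hb => ⟨p, q, hb, fun c _ _ => rfl⟩, fun b hb hb' => H ⟨b, trivial⟩ b.2 hb hb'⟩

/-- A quotient of a quasi-affine variety by a map with enough symmetries and local sections. -/
def quotPresentation (S : Set (ι → ℂ)) (π : S → X) (surj : Function.Surjective π)
    (symm : ∀ a b : S, π a = π b → ∃ τ : ι → MvPolynomial ι ℂ, (fun i => eval b.1 (τ i)) = a.1 ∧
      ∀ c : S, ∃ h : (fun i => eval c.1 (τ i)) ∈ S, π ⟨_, h⟩ = π c)
    (sec : ∀ a : S, ∃ (R : Set (ι → ℂ)) (ν : (ι → ℂ) → ι → ℂ), a.1 ∈ R ∧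
      (∀ b ∈ S ∩ R, ∃ q : MvPolynomial ι ℂ, eval b q ≠ 0 ∧ ∀ c ∈ S, eval c q ≠ 0 → c ∈ R) ∧
      (∀ i, RegOn (S ∩ R) fun b => ν b i) ∧
      ∀ b : S, b.1 ∈ R → (∃ h : ν b ∈ S, π ⟨ν b, h⟩ = π b) ∧
        ∀ b' : S, π b' = π b → b'.1 ∈ R ∧ ν b' = ν b) :
    Presentation (((affineSpace ι).sub S).quot π) ι :=
  have op : ∀ {U : Set X}, IsOpen[(((affineSpace ι).sub S).quot π).top] U ↔
      ∀ a : S, π a ∈ U → ∃ q : MvPolynomial ι ℂ, eval a.1 q ≠ 0 ∧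
        ∀ b : S, eval b.1 q ≠ 0 → π b ∈ U := by
    intro U
    rw [show IsOpen[(((affineSpace ι).sub S).quot π).top] U ↔
      IsOpen[((affineSpace ι).sub S).top] (π ⁻¹' U) from Iff.rfl]
    constructor
    · rintro ⟨W, hW, hWU⟩ a ha
      have haW : a ∈ Subtype.val ⁻¹' W := hWU ▸ ha
      obtain ⟨q, hq, h⟩ := affine_isOpen_iff.1 hW a haW
      exact ⟨q, hq, fun b hb => by
        have : b ∈ Subtype.val ⁻¹' W := h hb
        rw [hWU] at this; exact this⟩
    · intro h
      choose! q hq H using h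
      refine ⟨{b | ∃ a : S, π a ∈ U ∧ b ∈ bas (q a)}, affine_isOpen_iff.2 ?_, ?_⟩
      · rintro b ⟨a, ha, hb⟩
        exact ⟨q a, hb, fun c hc => ⟨a, ha, hc⟩⟩
      · ext b
        exact ⟨fun ⟨a, ha, hb⟩ => H a ha b hb, fun hb => ⟨b, hb, hq b hb⟩⟩
  -- The map `π` is open. This is where the symmetries enter: a neighbourhood of one representative
  -- is carried to a neighbourhood of any other.
  have im : ∀ R : Set (ι → ℂ), (∀ a ∈ R, a ∈ S → ∃ q : MvPolynomial ι ℂ, eval a q ≠ 0 ∧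
      ∀ b ∈ S, eval b q ≠ 0 → b ∈ R) →
      IsOpen[(((affineSpace ι).sub S).quot π).top] {x | ∃ b : S, π b = x ∧ b.1 ∈ R} := by
    intro R hR
    refine op.2 ?_
    rintro a ⟨b, hab, hb⟩
    obtain ⟨q, hq, H⟩ := hR b hb b.2
    obtain ⟨τ, hτ, hτS⟩ := symm b a hab
    -- Substituting the symmetry `τ` into `q` gives a polynomial whose value at `c` is the value of
    -- `q` at the translate of `c`, a point of the same fibre.
    refine ⟨bind₁ τ q, ?_, fun c hc => ?_⟩
    · have : eval a.1 (bind₁ τ q) = eval b.1 q := by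
        rw [← hτ]; simp only [eval, eval₂Hom_bind₁]
      rwa [this]
    · obtain ⟨hS, hπ⟩ := hτS c
      refine ⟨⟨_, hS⟩, hπ, H _ hS ?_⟩
      have : eval c.1 (bind₁ τ q) = eval (fun i => eval c.1 (τ i)) q := by
        simp only [eval, eval₂Hom_bind₁]
      rwa [← this]
  { S := S
    π := π
    surj := surj
    reg_mono := fun {U U' f} h hU z hz => by
      obtain ⟨W, g, h1, h2, h3, h4⟩ := h z (hU hz)
      exact ⟨W, g, h1, h2, h3, fun w hw => h4 w (hU hw)⟩
    open_iff := fun {Z C} hC => by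
      constructor
      · rintro ⟨O, hO, rfl⟩ a ha
        obtain ⟨q, hq, h⟩ := op.1 hO a ha.1
        exact ⟨q, hq, fun b hb hb' => ⟨h b hb', hb⟩⟩
      · intro h
        choose! q hq H using h
        refine ⟨_, im {b | ∃ a : S, π a ∈ C ∧ b ∈ bas (q a)} ?_, ?_⟩
        · rintro b ⟨a, ha, hb⟩ _
          exact ⟨q a, hb, fun c _ hc => ⟨a, ha, hc⟩⟩
        · ext x
          constructor
          · rintro ⟨⟨b, rfl, a, ha, hb⟩, hbZ⟩
            exact H a ha b hbZ hb
          · intro hx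
            obtain ⟨b, rfl⟩ := surj x
            exact ⟨⟨b, rfl, b, hx, hq b hx⟩, hC hx⟩
    reg_iff := fun {Z U f} => by
      constructor
      · intro h a ha haU
        obtain ⟨W, g, hW, haW, hg, H⟩ := h _ haU
        obtain ⟨r, hr, hrW⟩ := op.1 hW _ haW
        obtain ⟨W₁, g₁, hW₁, haW₁, hg₁, H₁⟩ := hg a haW
        obtain ⟨r₁, hr₁, hrW₁⟩ := affine_isOpen_iff.1 hW₁ _ haW₁
        obtain ⟨p, q, hq, H'⟩ := hg₁ _ haW₁
        refine ⟨p * (r * r₁), q * (r * r₁), by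
          simp only [map_mul]; exact mul_ne_zero hq (mul_ne_zero hr hr₁), fun b hb hbU hb' => ?_⟩
        simp only [map_mul, ne_eq, mul_eq_zero, not_or] at hb' ⊢
        have hbW : π b ∈ W := hrW b hb'.2.1
        have hbW₁ : b.1 ∈ W₁ := hrW₁ hb'.2.2
        have e1 : f ⟨π b, hb⟩ = g (π b) := H _ hbU hbW
        have e2 : g (π b) = g₁ b := H₁ b hbW hbW₁
        rw [e1, e2, H' _ hbW₁ hb'.1, mul_div_mul_right _ _ (mul_ne_zero hb'.2.1 hb'.2.2)]
      · rintro h ⟨x, hx⟩ hxU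
        obtain ⟨a, rfl⟩ := surj x
        obtain ⟨R, ν, hr, hR, hν, Hν⟩ := sec a
        obtain ⟨⟨haS, hπ⟩, -⟩ := Hν a hr
        obtain ⟨p, q, hq, H⟩ := h ⟨ν a, haS⟩ (hπ ▸ hx) (by
          have : (⟨π ⟨ν a, haS⟩, hπ ▸ hx⟩ : Z) = ⟨π a, hx⟩ := Subtype.ext hπ
          rwa [this])
        have hqν := RegOn.eval_comp hν q
        have hpν := RegOn.eval_comp hν p
        classical
        -- The extension is the quotient `p / q` evaluated at the normalised representative `ν`.
        -- Because `ν` is constant on fibres, the choice made by `surjInv` is immaterial.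
        let g : X → ℂ := fun y => eval (ν (Function.surjInv surj y).1) p /
          eval (ν (Function.surjInv surj y).1) q
        have hg : ∀ b : S, b.1 ∈ R → g (π b) = eval (ν b) p / eval (ν b) q := by
          intro b hb
          have := ((Hν b hb).2 (Function.surjInv surj (π b)) (Function.surjInv_eq surj _)).2
          simp only [g, this]
        refine ⟨_, g, im {b | b ∈ R ∧ eval (ν b) q ≠ 0} ?_, ⟨a, rfl, hr, hq⟩, ?_, ?_⟩
        · rintro b ⟨hb, hb'⟩ hbS
          obtain ⟨s, hs, Hs⟩ := hqν.exists_ne ⟨hbS, hb⟩ hb'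
          obtain ⟨r, hr, Hr⟩ := hR b ⟨hbS, hb⟩
          refine ⟨r * s, by simp only [map_mul]; exact mul_ne_zero hr hs, fun c hcS hc => ?_⟩
          simp only [map_mul, ne_eq, mul_eq_zero, not_or] at hc
          exact ⟨Hr c hcS hc.1, Hs c ⟨hcS, Hr c hcS hc.1⟩ hc.2⟩
        · rintro b ⟨b', hbb', hb', hb''⟩
          obtain ⟨hbr, hνb⟩ := (Hν b' hb').2 b hbb'.symm
          rw [← hνb] at hb''
          have hT : RegOn (S ∩ R ∩ {c | eval (ν c) q ≠ 0})
              fun c => eval (ν c) p * (eval (ν c) q)⁻¹ :=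
            (hpν.mono Set.inter_subset_left).mul
              ((hqν.mono Set.inter_subset_left).inv fun c hc => hc.2)
          obtain ⟨p₁, q₁, hq₁, H₁⟩ := hT b ⟨⟨b.2, hbr⟩, hb''⟩
          refine ⟨bas q₁, fun c => eval c p₁ / eval c q₁,
            affine_isOpen_iff.2 fun c hc => ⟨q₁, hc, subset_rfl⟩, hq₁,
            fun c hc => ⟨p₁, q₁, hc, fun d _ _ => rfl⟩, ?_⟩
          rintro c ⟨c', hcc', hc', hc''⟩ hcq
          obtain ⟨hcr, hνc⟩ := (Hν c' hc').2 c hcc'.symm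
          rw [← hνc] at hc''
          change g (π c) = _
          rw [hg c hcr, div_eq_mul_inv]
          exact H₁ c ⟨⟨c.2, hcr⟩, hc''⟩ hcq
        · rintro ⟨_, hyZ⟩ hyU ⟨b, rfl, hb, hb'⟩
          obtain ⟨⟨hbS, hπb⟩, -⟩ := Hν b hb
          have he : (⟨π ⟨ν b, hbS⟩, hπb ▸ hyZ⟩ : Z) = ⟨π b, hyZ⟩ := Subtype.ext hπb
          have := H ⟨ν b, hbS⟩ (hπb ▸ hyZ) (by rwa [he]) hb'
          rw [he] at this
          rw [this, hg b hb] }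

variable {A : FunSpace X} {B : FunSpace Y}

/-- A map that lifts locally to regular maps of the presenting spaces is a morphism. -/
theorem isMorphism_of_lift (PX : Presentation A ι) (PY : Presentation B κ) {Z : Set X} {Z' : Set Y}
    (φ : Z → Z') (h : ∀ (a : PX.S), PX.π a ∈ Z → ∃ q : MvPolynomial ι ℂ, eval a.1 q ≠ 0 ∧
      ∃ c : (ι → ℂ) → κ → ℂ, (∀ k, RegOn (PX.pull Z ∩ bas q) fun b => c b k) ∧
      ∀ (b : PX.S) (hb : PX.π b ∈ Z), eval b.1 q ≠ 0 →
        ∃ h : c b ∈ PY.S, PY.π ⟨c b, h⟩ = φ ⟨PX.π b, hb⟩) :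
    IsMorphism (A.sub Z) (B.sub Z') φ := by
  constructor
  · refine @continuous_def _ _ (A.sub Z).top (B.sub Z').top _ |>.2 ?_
    rintro _ ⟨O, hO, rfl⟩
    have hC : Subtype.val '' (φ ⁻¹' (Subtype.val ⁻¹' O)) ⊆ Z := by
      rintro _ ⟨x, _, rfl⟩; exact x.2
    obtain ⟨O₁, hO₁, hO₁'⟩ := (PX.open_iff hC).2 (by
      rintro a ⟨⟨x, hx⟩, hxO, hxa⟩
      change x = _ at hxa
      subst hxa
      obtain ⟨q, hq, c, hc, H⟩ := h a hx
      obtain ⟨hcS, hcπ⟩ := H a hx hq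
      obtain ⟨r, hr, Hr⟩ := (PY.open_iff (Set.subset_univ O)).1 ⟨O, hO, by simp⟩ ⟨c a, hcS⟩
        (by rw [hcπ]; exact hxO)
      obtain ⟨s, hs, Hs⟩ := (RegOn.eval_comp hc r).exists_ne ⟨⟨a.2, hx⟩, hq⟩ hr
      refine ⟨q * s, by simp only [map_mul]; exact mul_ne_zero hq hs, fun b hb hb' => ?_⟩
      simp only [map_mul, ne_eq, mul_eq_zero, not_or] at hb'
      obtain ⟨hbS, hbπ⟩ := H b hb hb'.1
      refine ⟨⟨PX.π b, hb⟩, ?_, rfl⟩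
      have := Hr ⟨c b, hbS⟩ trivial (Hs b ⟨⟨b.2, hb⟩, hb'.1⟩ hb'.2)
      rw [hbπ] at this
      exact this)
    refine ⟨O₁, hO₁, ?_⟩
    ext x
    constructor
    · intro hx
      obtain ⟨y, hy, hyx⟩ : (x : X) ∈ Subtype.val '' (φ ⁻¹' (Subtype.val ⁻¹' O)) :=
        hO₁' ▸ ⟨hx, x.2⟩
      rwa [← Subtype.ext hyx]
    · intro hx
      have : (x : X) ∈ O₁ ∩ Z := hO₁' ▸ ⟨x, hx, rfl⟩
      exact this.1
  · intro U f hU hf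
    refine PX.reg_iff.2 fun a ha haU => ?_
    obtain ⟨q, hq, c, hc, H⟩ := h a ha
    obtain ⟨hcS, hcπ⟩ := H a ha hq
    obtain ⟨p, r, hr, Hr⟩ := PY.reg_iff.1 hf ⟨c a, hcS⟩ (by rw [hcπ]; exact (φ _).2)
      (by simp only [hcπ]; exact haU)
    obtain ⟨s, hs, Hs⟩ := (RegOn.eval_comp hc r).exists_ne ⟨⟨a.2, ha⟩, hq⟩ hr
    have hT : RegOn (PX.pull Z ∩ bas q ∩ bas s) fun b => eval (c b) p * (eval (c b) r)⁻¹ :=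
      ((RegOn.eval_comp hc p).mono Set.inter_subset_left).mul
        (((RegOn.eval_comp hc r).mono Set.inter_subset_left).inv fun b hb => Hs b hb.1 hb.2)
    obtain ⟨p₁, q₁, hq₁, H₁⟩ := hT a.1 ⟨⟨⟨a.2, ha⟩, hq⟩, hs⟩
    refine ⟨p₁ * (q * s), q₁ * (q * s), by
      simp only [map_mul]; exact mul_ne_zero hq₁ (mul_ne_zero hq hs), fun b hb hbU hb' => ?_⟩
    simp only [map_mul, ne_eq, mul_eq_zero, not_or] at hb' ⊢
    obtain ⟨hbS, hbπ⟩ := H b hb hb'.2.1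
    rw [mul_div_mul_right _ _ (mul_ne_zero hb'.2.1 hb'.2.2),
      ← H₁ b ⟨⟨⟨b.2, hb⟩, hb'.2.1⟩, hb'.2.2⟩ hb'.1]
    refine Eq.trans ?_ (div_eq_mul_inv _ _)
    have := Hr ⟨c b, hbS⟩ (by rw [hbπ]; exact (φ _).2) (by simp only [hbπ]; exact hbU)
      (Hs b ⟨⟨b.2, hb⟩, hb'.2.1⟩ hb'.2.2)
    rw [← this]
    simp only [Function.comp, hbπ]

lemma IsMorphism.comp {W : Type} {C : FunSpace W} {φ : X → Y} {ψ : Y → W} (hψ : IsMorphism B C ψ)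
    (hφ : IsMorphism A B φ) : IsMorphism A C (ψ ∘ φ) :=
  ⟨@Continuous.comp _ _ _ A.top B.top C.top _ _ hψ.1 hφ.1, fun U f hU hf =>
    hφ.2 _ _ (@IsOpen.preimage _ _ B.top C.top _ hψ.1 _ hU) (hψ.2 U f hU hf)⟩

lemma Isomorphic.trans {W : Type} {C : FunSpace W} (h : Isomorphic A B) (h' : Isomorphic B C) :
    Isomorphic A C := by
  obtain ⟨e, he, he'⟩ := h
  obtain ⟨d, hd, hd'⟩ := h'
  exact ⟨e.trans d, hd.comp he, he'.comp hd'⟩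

lemma isomorphic_sub_sub (hA : ∀ {U U' : Set X} {f : X → ℂ}, A.Reg U f → U' ⊆ U → A.Reg U' f)
    (Z : Set X) (Y : Set Z) :
    Isomorphic ((A.sub Z).sub Y) (A.sub (Subtype.val '' Y)) := by
  let e : Y ≃ (Subtype.val '' Y : Set X) :=
    { toFun := fun y => ⟨y.1.1, y.1, y.2, rfl⟩
      invFun := fun x => ⟨⟨x.1, by obtain ⟨_, y, _, rfl⟩ := x; exact y.2⟩,
        by obtain ⟨_, y, hy, rfl⟩ := x; exact hy⟩
      left_inv := fun y => rfl
      right_inv := fun x => rfl }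
  refine ⟨e, ⟨?_, ?_⟩, ⟨?_, ?_⟩⟩
  · refine @continuous_def _ _ ((A.sub Z).sub Y).top (A.sub (Subtype.val '' Y)).top _ |>.2 ?_
    rintro _ ⟨O, hO, rfl⟩
    exact ⟨_, ⟨O, hO, rfl⟩, rfl⟩
  · intro U f _ hf y hy
    obtain ⟨W, g, hW, hyW, hg, H⟩ := hf (e y) hy
    exact ⟨Subtype.val ⁻¹' W, g ∘ Subtype.val, ⟨W, hW, rfl⟩, hyW,
      fun z hz => ⟨W, g, hW, hz, hg, fun _ _ _ => rfl⟩, fun w hw hw' => H (e w) hw hw'⟩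
  · refine @continuous_def _ _ (A.sub (Subtype.val '' Y)).top ((A.sub Z).sub Y).top _ |>.2 ?_
    rintro _ ⟨_, ⟨O, hO, rfl⟩, rfl⟩
    exact ⟨O, hO, rfl⟩
  · intro U f _ hf x hx
    obtain ⟨W, g, ⟨W₀, hW₀, hWW₀⟩, hxW, hg, H⟩ := hf (e.symm x) hx
    obtain ⟨W₁, g₁, hW₁, hxW₁, hg₁, H₁⟩ := hg _ hxW
    have hxW₀ : (x : X) ∈ W₀ := by
      have : (e.symm x).1 ∈ Subtype.val ⁻¹' W₀ := hWW₀ ▸ hxW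
      exact this
    refine ⟨W₀ ∩ W₁, g₁, @IsOpen.inter _ A.top _ _ hW₀ hW₁, ⟨hxW₀, hxW₁⟩,
      hA hg₁ Set.inter_subset_right, fun w hw hw' => ?_⟩
    have hwW : (e.symm w).1 ∈ W := by rw [← hWW₀]; exact hw'.1
    exact (H (e.symm w) hw hwW).trans (H₁ _ hwW hw'.2)

lemma isomorphic_affine_univ (ι : Type) :
    Isomorphic ((affineSpace ι).sub Set.univ) (affineSpace ι) := by
  refine ⟨Equiv.Set.univ _, ⟨?_, ?_⟩, ⟨?_, ?_⟩⟩
  · exact @continuous_induced_dom _ _ _ (affineSpace ι).top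
  · intro U f hU hf a ha
    exact ⟨U, f, hU, ha, hf, fun _ _ _ => rfl⟩
  · refine @continuous_def _ _ (affineSpace ι).top ((affineSpace ι).sub Set.univ).top _ |>.2 ?_
    rintro _ ⟨O, hO, rfl⟩
    exact hO
  · intro U f _ hf a ha
    obtain ⟨p, q, hq, H⟩ := (affinePresentation ι).reg_iff.1 hf ⟨a, trivial⟩ trivial ha
    exact ⟨p, q, hq, fun b hb hb' => H ⟨b, trivial⟩ trivial hb hb'⟩

end Presentation

/-! ### Frames -/

section Frames

variable {N k : ℕ}

lemma finrank_map_inj {E F : Type*} [AddCommGroup E] [Module ℂ E] [AddCommGroup F] [Module ℂ F]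
    {f : E →ₗ[ℂ] F} (hf : Function.Injective f) (W : Submodule ℂ E) :
    finrank ℂ (W.map f) = finrank ℂ W :=
  (Submodule.equivMapOfInjective f hf W).finrank_eq.symm

/-- The linear map `ℂ^k → ℂ^N` with a given matrix. -/
def lin (A : Fin N × Fin k → ℂ) : (Fin k → ℂ) →ₗ[ℂ] V N := Fintype.linearCombination ℂ (col A)

/-- The matrix of a linear map `ℂ^k → ℂ^N`. -/
def unlin (f : (Fin k → ℂ) →ₗ[ℂ] V N) : Fin N × Fin k → ℂ := fun p => f (Pi.single p.2 1) p.1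

lemma lin_single (A : Fin N × Fin k → ℂ) (j : Fin k) : lin A (Pi.single j 1) = col A j := by
  simp [lin, Fintype.linearCombination_apply_single]

@[simp] lemma lin_unlin (f : (Fin k → ℂ) →ₗ[ℂ] V N) : lin (unlin f) = f :=
  (Pi.basisFun ℂ (Fin k)).ext fun j => by
    rw [Pi.basisFun_apply, lin_single]; rfl

lemma lin_injective_iff {A : Fin N × Fin k → ℂ} : Function.Injective (lin A) ↔ A ∈ frames N k := by
  rw [frames, Set.mem_ofPred_eq, linearIndependent_iff_injective_fintypeLinearCombination]
  rfl

lemma unlin_mem {f : (Fin k → ℂ) →ₗ[ℂ] V N} (hf : Function.Injective f) : unlin f ∈ frames N k :=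
  lin_injective_iff.1 (by rwa [lin_unlin])

lemma range_lin (A : Fin N × Fin k → ℂ) :
    LinearMap.range (lin A) = Submodule.span ℂ (Set.range (col A)) :=
  Fintype.range_linearCombination ℂ (col A)

/-- The span of the first `l` unit vectors. -/
def firsts (k l : ℕ) : Submodule ℂ (Fin k → ℂ) :=
  Submodule.span ℂ (Set.range fun j : {j : Fin k // j.1 < l} => Pi.single j.1 1)

/-- The projection to the first `l` coordinates. -/
def proj (k l : ℕ) : (Fin k → ℂ) →ₗ[ℂ] (Fin k → ℂ) :=
  LinearMap.pi fun j => if j.1 < l then LinearMap.proj j else 0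

lemma proj_apply (k l : ℕ) (x : Fin k → ℂ) (j : Fin k) :
    proj k l x j = if j.1 < l then x j else 0 := by
  simp only [proj, LinearMap.pi_apply]; split_ifs <;> rfl

lemma proj_mem (k l : ℕ) (x : Fin k → ℂ) : proj k l x ∈ firsts k l := by
  have : proj k l x = ∑ j : {j : Fin k // j.1 < l}, x j.1 • (Pi.single j.1 1 : Fin k → ℂ) := by
    ext i
    rw [proj_apply, Finset.sum_apply]
    simp only [Pi.smul_apply, smul_eq_mul, Pi.single_apply, mul_ite, mul_one, mul_zero]
    split_ifs with h
    · rw [Finset.sum_eq_single ⟨i, h⟩]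
      · simp
      · intro b _ hb
        rw [if_neg]; rintro rfl; exact hb rfl
      · simp
    · exact (Finset.sum_eq_zero fun j _ => if_neg (by rintro rfl; exact h j.2)).symm
  rw [this]
  exact Submodule.sum_mem _ fun j _ => Submodule.smul_mem _ _ (Submodule.subset_span ⟨j, rfl⟩)

lemma proj_eq_self {l : ℕ} {x : Fin k → ℂ} (hx : x ∈ firsts k l) : proj k l x = x := by
  have : firsts k l ≤ LinearMap.ker (proj k l - LinearMap.id) := by
    rw [firsts, Submodule.span_le]
    rintro _ ⟨j, rfl⟩
    simp only [SetLike.mem_coe, LinearMap.mem_ker, LinearMap.sub_apply, LinearMap.id_apply,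
      sub_eq_zero]
    ext i
    rw [proj_apply, Pi.single_apply]
    split_ifs with h1 h2 h2
    · rfl
    · rfl
    · subst h2; exact absurd j.2 h1
    · rfl
  simpa [sub_eq_zero] using this hx

lemma finrank_firsts {l : ℕ} (h : l ≤ k) : finrank ℂ (firsts k l) = l := by
  rw [firsts, finrank_span_eq_card]
  · rw [Fintype.card_subtype]
    have : (Finset.univ.filter fun j : Fin k => j.1 < l) =
        Finset.univ.map (Fin.castLEEmb h) := by
      ext j
      simp only [Finset.mem_filter, Finset.mem_univ, true_and, Finset.mem_map]
      exact ⟨fun hj => ⟨⟨j, hj⟩, rfl⟩, by rintro ⟨i, rfl⟩; exact i.2⟩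
    rw [this]; simp
  · have := (Pi.basisFun ℂ (Fin k)).linearIndependent.comp
      (Subtype.val : {j : Fin k // j.1 < l} → Fin k) Subtype.val_injective
    convert this using 1
    ext j; simp

variable {ι : Type} {T : Set (ι → ℂ)}

lemma regVec_lin (T : Set (Fin N × Fin k → ℂ)) : RegVec T (fun A => lin A) := by
  refine regVec_hom_iff.2 fun v => ?_
  simp only [lin, Fintype.linearCombination_apply]
  exact RegVec.sum _ fun j _ => RegVec.smul (RegOn.const _) (RegVec.pi fun i =>
    regVec_scalar.2 (RegOn.coord (i, j)))

lemma RegVec.unlin {f : (ι → ℂ) → (Fin k → ℂ) →ₗ[ℂ] V N} (hf : RegVec T f) (p : Fin N × Fin k) :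
    RegOn T (fun t => unlin (f t) p) :=
  regVec_hom_iff.1 hf (Pi.single p.2 1) (LinearMap.proj p.1)

/-- An injective regular family stays injective nearby. -/
lemma exists_injective {E F : Type*} [AddCommGroup E] [Module ℂ E] [FiniteDimensional ℂ E]
    [AddCommGroup F] [Module ℂ F] [FiniteDimensional ℂ F] {φ : (ι → ℂ) → E →ₗ[ℂ] F}
    (hφ : RegVec T φ) {a : ι → ℂ} (ha : a ∈ T) (hi : Function.Injective (φ a)) :
    ∃ q : MvPolynomial ι ℂ, eval a q ≠ 0 ∧ ∀ t ∈ T ∩ bas q, Function.Injective (φ t) := by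
  obtain ⟨q, hq, H⟩ := exists_rank_ge hφ ha
  refine ⟨q, hq, fun t ht => ?_⟩
  have := H t ht
  rw [LinearMap.finrank_range_of_inj hi] at this
  rw [← LinearMap.ker_eq_bot, ← Submodule.finrank_eq_zero]
  have := LinearMap.finrank_range_add_finrank_ker (φ t)
  omega

section Present

variable {X : Type} (l : ℕ) (π : frames N k → X) (surj : Function.Surjective π)
  (hπ : ∀ a b : frames N k, π a = π b ↔
    (firsts k l).map (lin a.1) = (firsts k l).map (lin b.1) ∧
      LinearMap.range (lin a.1) = LinearMap.range (lin b.1))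

-- Two frames with the same image under `π` differ by an invertible matrix `γ` that preserves the
-- first coordinate subspace. Right multiplication by `γ` is polynomial on all frames and changes no
-- flag.
include hπ in
lemma frames_symm (a b : frames N k) (hab : π a = π b) :
    ∃ τ : Fin N × Fin k → MvPolynomial (Fin N × Fin k) ℂ, (fun i => eval b.1 (τ i)) = a.1 ∧
      ∀ c : frames N k, ∃ h : (fun i => eval c.1 (τ i)) ∈ frames N k, π ⟨_, h⟩ = π c := by
  obtain ⟨h1, h2⟩ := (hπ a b).1 hab
  have ia := lin_injective_iff.2 a.2
  have ib := lin_injective_iff.2 b.2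
  obtain ⟨L, hL⟩ := (lin b.1).exists_leftInverse_of_injective (LinearMap.ker_eq_bot.2 ib)
  let γ := L ∘ₗ lin a.1
  have hγ : lin b.1 ∘ₗ γ = lin a.1 := by
    refine LinearMap.ext fun x => ?_
    obtain ⟨y, hy⟩ : lin a.1 x ∈ LinearMap.range (lin b.1) := h2 ▸ LinearMap.mem_range_self _ x
    have := LinearMap.congr_fun hL y
    simp only [LinearMap.comp_apply, LinearMap.id_apply] at this
    simp only [γ, LinearMap.comp_apply, ← hy, this]
  have iγ : Function.Injective γ := fun x y hxy => ia (by
    rw [← hγ]; simp only [LinearMap.comp_apply, hxy])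
  have rγ : LinearMap.range γ = ⊤ := LinearMap.range_eq_top.2
    (LinearMap.injective_iff_surjective.1 iγ)
  have mγ : (firsts k l).map γ = firsts k l := by
    refine Submodule.map_injective_of_injective ib ?_
    rw [← Submodule.map_comp, hγ, h1]
  have key : ∀ c : Fin N × Fin k → ℂ, (fun i : Fin N × Fin k => eval c
      (∑ j, MvPolynomial.X (i.1, j) * C (γ (Pi.single i.2 1) j))) = unlin (lin c ∘ₗ γ) := by
    intro c
    ext i
    simp only [map_sum, map_mul, eval_X, eval_C, unlin, LinearMap.comp_apply, lin,
      Fintype.linearCombination_apply, Finset.sum_apply, Pi.smul_apply, smul_eq_mul, col]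
    exact Finset.sum_congr rfl fun j _ => mul_comm _ _
  refine ⟨fun i => ∑ j, MvPolynomial.X (i.1, j) * C (γ (Pi.single i.2 1) j), ?_, fun c => ?_⟩
  · rw [key, hγ]
    ext i
    rw [unlin, lin_single]; rfl
  · have hc : unlin (lin c.1 ∘ₗ γ) ∈ frames N k :=
      unlin_mem ((lin_injective_iff.2 c.2).comp iγ)
    refine ⟨by rw [key]; exact hc, ?_⟩
    rw [hπ]
    simp only [key, lin_unlin]
    rw [Submodule.map_comp, mγ, LinearMap.range_comp, rγ, Submodule.map_top]
    exact ⟨rfl, rfl⟩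

lemma exists_inverse (N : (Fin k → ℂ) →ₗ[ℂ] (Fin k → ℂ)) : ∃ N' : (Fin k → ℂ) →ₗ[ℂ] (Fin k → ℂ),
    Function.Injective N → ∀ x, N (N' x) = x := by
  by_cases h : Function.Injective N
  · exact ⟨(LinearEquiv.ofInjectiveEndo N h).symm,
      fun _ x => (LinearEquiv.ofInjectiveEndo N h).apply_symm_apply x⟩
  · exact ⟨0, fun h' => absurd h' h⟩

-- A reduced frame serves as normal form. Fix a left inverse `L` of the frame `a`. Near `a` there is
-- exactly one frame of the given flag whose first `l` vectors lie in the small space and map to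
-- unit vectors under `pr ∘ L`, and whose other vectors map to unit vectors under `L`. It depends on
-- the flag alone and rationally on any frame of it.
include hπ in
lemma frames_sec (a : frames N k) :
    ∃ (R : Set (Fin N × Fin k → ℂ)) (ν : (Fin N × Fin k → ℂ) → Fin N × Fin k → ℂ), a.1 ∈ R ∧
      (∀ b ∈ frames N k ∩ R, ∃ q : MvPolynomial (Fin N × Fin k) ℂ, eval b q ≠ 0 ∧
        ∀ c ∈ frames N k, eval c q ≠ 0 → c ∈ R) ∧
      (∀ i, RegOn (frames N k ∩ R) fun b => ν b i) ∧
      ∀ b : frames N k, b.1 ∈ R → (∃ h : ν b ∈ frames N k, π ⟨ν b, h⟩ = π b) ∧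
        ∀ b' : frames N k, π b' = π b → b'.1 ∈ R ∧ ν b' = ν b := by
  have ia := lin_injective_iff.2 a.2
  obtain ⟨L, hL⟩ := (lin a.1).exists_leftInverse_of_injective (LinearMap.ker_eq_bot.2 ia)
  let pr := proj k l
  let M := fun b : Fin N × Fin k → ℂ => L ∘ₗ lin b
  -- The leading `l × l` block of `L ∘ lin b`, padded by the identity so that its inverse is an
  -- endomorphism of the whole of `ℂ^k`.
  let M₁ := fun b : Fin N × Fin k → ℂ => pr ∘ₗ L ∘ₗ lin b ∘ₗ pr + (LinearMap.id - pr)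
  have pp : ∀ x, pr (pr x) = pr x := fun x => proj_eq_self (proj_mem k l x)
  have hM : ∀ T, RegVec T M := fun T => (RegVec.const L).comp (regVec_lin T)
  have hM₁ : ∀ T, RegVec T M₁ := fun T => ((RegVec.const pr).comp ((RegVec.const L).comp
    ((regVec_lin T).comp (RegVec.const pr)))).add (RegVec.const _)
  choose I hI using fun b => exists_inverse (M b)
  choose I₁ hI₁ using fun b => exists_inverse (M₁ b)
  let R : Set (Fin N × Fin k → ℂ) := {b | Function.Injective (M b) ∧ Function.Injective (M₁ b)}
  let nu := fun b : Fin N × Fin k → ℂ => lin b ∘ₗ (I₁ b ∘ₗ pr + I b ∘ₗ (LinearMap.id - pr))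
  have hI₁mem : ∀ b ∈ R, ∀ x, I₁ b (pr x) ∈ firsts k l := by
    intro b hb x
    have := congrArg (fun y => y - pr y) (hI₁ b hb.2 (pr x))
    simp only [M₁, LinearMap.add_apply, LinearMap.comp_apply, LinearMap.sub_apply,
      LinearMap.id_apply, map_add, map_sub, pp, sub_self, add_zero] at this
    rw [add_sub_cancel_left, sub_eq_zero] at this
    rw [this]; exact proj_mem k l _
  have nu1 : ∀ b ∈ R, ∀ x, nu b (pr x) ∈ (firsts k l).map (lin b) ∧
      pr (L (nu b (pr x))) = pr x := by
    intro b hb x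
    have e : nu b (pr x) = lin b (I₁ b (pr x)) := by
      simp [nu, pp]
    refine ⟨e ▸ ⟨_, hI₁mem b hb x, rfl⟩, ?_⟩
    have := hI₁ b hb.2 (pr x)
    have h2 : pr (I₁ b (pr x)) = I₁ b (pr x) := proj_eq_self (hI₁mem b hb x)
    simp only [M₁, LinearMap.add_apply, LinearMap.comp_apply, LinearMap.sub_apply,
      LinearMap.id_apply, h2, sub_self, add_zero] at this
    rw [e, this]
  have nu2 : ∀ b ∈ R, ∀ x, nu b (x - pr x) ∈ LinearMap.range (lin b) ∧
      L (nu b (x - pr x)) = x - pr x := by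
    intro b hb x
    have e : nu b (x - pr x) = lin b (I b (x - pr x)) := by
      simp [nu, pp]
    exact ⟨e ▸ LinearMap.mem_range_self _ _, by rw [e]; exact hI b hb.1 (x - pr x)⟩
  -- Membership in `R` is transversality of the two spaces of the flag to fixed subspaces. Hence `R`
  -- is saturated, and the same transversality makes the normal form unique.
  have hRiff : ∀ b ∈ frames N k, b ∈ R ↔ (∀ v ∈ LinearMap.range (lin b), L v = 0 → v = 0) ∧
      (∀ v ∈ (firsts k l).map (lin b), pr (L v) = 0 → v = 0) := by
    intro b hb
    have ib := lin_injective_iff.2 hb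
    constructor
    · rintro ⟨h1, h2⟩
      constructor
      · rintro _ ⟨y, rfl⟩ hy
        rw [h1 (a₁ := y) (a₂ := 0) (by rw [map_zero]; exact hy), map_zero]
      · rintro _ ⟨y, hyl, rfl⟩ hy
        have hpy : pr y = y := proj_eq_self hyl
        rw [h2 (a₁ := y) (a₂ := 0) (by simp [M₁, hpy, hy]), map_zero]
    · rintro ⟨h1, h2⟩
      refine ⟨LinearMap.ker_eq_bot.1 (LinearMap.ker_eq_bot'.2 fun y hy => ?_),
        LinearMap.ker_eq_bot.1 (LinearMap.ker_eq_bot'.2 fun y hy => ?_)⟩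
      · exact ib (by rw [h1 _ ⟨y, rfl⟩ hy, map_zero])
      · have h3 := congrArg (fun y => y - pr y) hy
        have h4 := congrArg pr hy
        simp only [M₁, LinearMap.add_apply, LinearMap.comp_apply, LinearMap.sub_apply,
          LinearMap.id_apply, map_add, map_sub, pp, sub_self, add_zero, map_zero] at h3 h4
        rw [add_sub_cancel_left, sub_eq_zero] at h3
        rw [← h3] at h4
        exact ib (by rw [h2 _ ⟨y, h3 ▸ proj_mem k l y, rfl⟩ h4, map_zero])
  refine ⟨R, fun b => unlin (nu b), ?_, ?_, ?_, ?_⟩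
  · have hLa : ∀ x, L (lin a.1 x) = x := fun x => LinearMap.congr_fun hL x
    refine (hRiff a a.2).2 ⟨?_, ?_⟩
    · rintro _ ⟨y, rfl⟩ hy
      rw [← hLa y, hy, map_zero]
    · rintro _ ⟨y, hyl, rfl⟩ hy
      rw [hLa, show pr y = y from proj_eq_self hyl] at hy
      rw [hy, map_zero]
  · rintro b ⟨hb, hbR⟩
    obtain ⟨q, hq, H⟩ := exists_injective (hM (frames N k)) hb hbR.1
    obtain ⟨q', hq', H'⟩ := exists_injective (hM₁ (frames N k)) hb hbR.2
    refine ⟨q * q', by simp [hq, hq'], fun c hc hc' => ?_⟩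
    simp only [map_mul, ne_eq, mul_eq_zero, not_or] at hc'
    exact ⟨H c ⟨hc, hc'.1⟩, H' c ⟨hc, hc'.2⟩⟩
  · intro i
    refine RegVec.unlin ((regVec_lin _).comp (RegVec.add ?_ ?_)) i
    · refine RegVec.comp (regVec_hom_iff.2 fun v => ?_) (RegVec.const _)
      exact RegVec.solve (hM₁ _) (RegVec.const v) (fun t ht => ht.2.2)
        fun t ht => hI₁ t ht.2.2 v
    · refine RegVec.comp (regVec_hom_iff.2 fun v => ?_) (RegVec.const _)
      exact RegVec.solve (hM _) (RegVec.const v) (fun t ht => ht.2.1)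
        fun t ht => hI t ht.2.1 v
  · intro b hb
    obtain ⟨u1, u2⟩ := (hRiff b b.2).1 hb
    have inu : Function.Injective (nu b) := by
      refine LinearMap.ker_eq_bot.1 (LinearMap.ker_eq_bot'.2 fun x hx => ?_)
      have hx' : nu b (pr x) + nu b (x - pr x) = 0 := by rw [← map_add]; simpa using hx
      have h3 : pr (L (nu b (pr x) + nu b (x - pr x))) = pr (L 0) := by rw [hx']
      rw [map_add, map_add, (nu1 b hb x).2, (nu2 b hb x).2, map_sub, pp, sub_self, add_zero,
        map_zero, map_zero] at h3
      rw [h3, map_zero, zero_add, sub_zero] at hx'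
      have := (nu2 b hb x).2
      rw [h3, sub_zero, hx', map_zero] at this
      exact this.symm
    have hnf : unlin (nu b) ∈ frames N k := unlin_mem inu
    have ib := lin_injective_iff.2 b.2
    refine ⟨⟨hnf, ?_⟩, ?_⟩
    · rw [hπ]
      simp only [lin_unlin]
      constructor
      · refine Submodule.eq_of_le_of_finrank_eq ?_ ?_
        · rintro _ ⟨y, hy, rfl⟩
          have : pr y = y := proj_eq_self hy
          rw [← this]; exact (nu1 b hb y).1
        · rw [finrank_map_inj inu, finrank_map_inj ib]
      · refine Submodule.eq_of_le_of_finrank_eq ?_ ?_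
        · rintro _ ⟨y, rfl⟩
          exact LinearMap.mem_range_self _ _
        · rw [LinearMap.finrank_range_of_inj inu, LinearMap.finrank_range_of_inj ib]
    · intro b' hbb'
      obtain ⟨h1, h2⟩ := (hπ b' b).1 hbb'
      have hb' : b'.1 ∈ R := (hRiff b' b'.2).2 (by rw [h1, h2]; exact ⟨u1, u2⟩)
      refine ⟨hb', congrArg unlin (LinearMap.ext fun x => ?_)⟩
      have e1 : nu b' (pr x) = nu b (pr x) := by
        refine sub_eq_zero.1 (u2 _ (Submodule.sub_mem _ (h1 ▸ (nu1 b' hb' x).1) (nu1 b hb x).1) ?_)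
        rw [map_sub, map_sub, (nu1 b' hb' x).2, (nu1 b hb x).2, sub_self]
      have e2 : nu b' (x - pr x) = nu b (x - pr x) := by
        refine sub_eq_zero.1 (u1 _ (Submodule.sub_mem _ (h2 ▸ (nu2 b' hb' x).1) (nu2 b hb x).1) ?_)
        rw [map_sub, (nu2 b' hb' x).2, (nu2 b hb x).2, sub_self]
      have := congrArg₂ (· + ·) e1 e2
      simpa only [← map_add, add_sub_cancel] using this

/-- A quotient of the variety of frames by a parabolic equivalence relation. -/
def framePresentation : Presentation (((affineSpace (Fin N × Fin k)).sub (frames N k)).quot π)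
    (Fin N × Fin k) :=
  quotPresentation (frames N k) π surj (frames_symm l π hπ) (frames_sec l π hπ)

end Present

end Frames

/-! ### Presentations of flag varieties and Grassmannians, and morphisms between them -/

section Flags

variable {m N k l : ℕ} {ι κ : Type} {X Y : Type}

lemma exists_relCompl {E : Type*} [AddCommGroup E] [Module ℂ E] {S B : Submodule ℂ E} (h : S ≤ B) :
    ∃ C ≤ B, S ⊓ C = ⊥ ∧ S ⊔ C = B := by
  obtain ⟨D, hD⟩ := S.exists_isCompl
  refine ⟨D ⊓ B, inf_le_right, ?_, ?_⟩
  · rw [← inf_assoc, hD.inf_eq_bot, bot_inf_eq]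
  · rw [← sup_inf_assoc_of_le _ h, hD.sup_eq_top, top_inf_eq]

lemma exists_frame {S B : Submodule ℂ (V N)} (h : S ≤ B) (hS : finrank ℂ S = l)
    (hB : finrank ℂ B = k) : ∃ f : (Fin k → ℂ) →ₗ[ℂ] V N, Function.Injective f ∧
      (firsts k l).map f = S ∧ LinearMap.range f = B := by
  have hlk : l ≤ k := hS ▸ hB ▸ Submodule.finrank_mono h
  obtain ⟨C, -, h1, h2⟩ := exists_relCompl h
  obtain ⟨P, hP⟩ := (firsts k l).exists_isCompl
  have hC : finrank ℂ C = k - l := by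
    have := Submodule.finrank_sup_add_finrank_inf_eq S C
    rw [h1, h2, finrank_bot] at this; omega
  have hP' : finrank ℂ P = k - l := by
    have := Submodule.finrank_add_eq_of_isCompl hP
    rw [finrank_firsts hlk, finrank_fin_fun] at this; omega
  let e₁ : firsts k l ≃ₗ[ℂ] S := LinearEquiv.ofFinrankEq _ _ (by rw [finrank_firsts hlk, hS])
  let e₂ : P ≃ₗ[ℂ] C := LinearEquiv.ofFinrankEq _ _ (by rw [hP', hC])
  let f := LinearMap.ofIsCompl hP (S.subtype ∘ₗ e₁.toLinearMap) (C.subtype ∘ₗ e₂.toLinearMap)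
  have hf1 : (firsts k l).map f = S := by
    ext v
    constructor
    · rintro ⟨x, hx, rfl⟩
      have := LinearMap.ofIsCompl_apply_left (h := hP) (φ := S.subtype ∘ₗ e₁.toLinearMap)
        (ψ := C.subtype ∘ₗ e₂.toLinearMap) ⟨x, hx⟩
      change f x = _ at this
      rw [this]; exact (e₁ ⟨x, hx⟩).2
    · intro hv
      refine ⟨(e₁.symm ⟨v, hv⟩ : Fin k → ℂ), (e₁.symm ⟨v, hv⟩).2, ?_⟩
      have := LinearMap.ofIsCompl_apply_left (h := hP) (φ := S.subtype ∘ₗ e₁.toLinearMap)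
        (ψ := C.subtype ∘ₗ e₂.toLinearMap) (e₁.symm ⟨v, hv⟩)
      rw [this]; simp
  have hf2 : P.map f = C := by
    ext v
    constructor
    · rintro ⟨x, hx, rfl⟩
      have := LinearMap.ofIsCompl_apply_right (h := hP) (φ := S.subtype ∘ₗ e₁.toLinearMap)
        (ψ := C.subtype ∘ₗ e₂.toLinearMap) ⟨x, hx⟩
      change f x = _ at this
      rw [this]; exact (e₂ ⟨x, hx⟩).2
    · intro hv
      refine ⟨(e₂.symm ⟨v, hv⟩ : Fin k → ℂ), (e₂.symm ⟨v, hv⟩).2, ?_⟩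
      have := LinearMap.ofIsCompl_apply_right (h := hP) (φ := S.subtype ∘ₗ e₁.toLinearMap)
        (ψ := C.subtype ∘ₗ e₂.toLinearMap) (e₂.symm ⟨v, hv⟩)
      rw [this]; simp
  have hr : LinearMap.range f = B := by
    rw [← Submodule.map_top, ← hP.sup_eq_top, Submodule.map_sup, hf1, hf2, h2]
  refine ⟨f, ?_, hf1, hr⟩
  rw [← LinearMap.ker_eq_bot, ← Submodule.finrank_eq_zero]
  have := LinearMap.finrank_range_add_finrank_ker f
  rw [hr, hB, finrank_fin_fun] at this
  omega

/-- A fixed frame at `a` is pushed into the nearby subspaces by the regular projections. At `a` it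
is unchanged, and linear independence is an open condition. -/
lemma exists_local_frame {T : Set (ι → ℂ)} {S B : (ι → ℂ) → Submodule ℂ (V N)} (hS : RegFam T S)
    (hB : RegFam T B) (hle : ∀ t ∈ T, S t ≤ B t) (hl : ∀ t ∈ T, finrank ℂ (S t) = l)
    (hk : ∀ t ∈ T, finrank ℂ (B t) = k) {a : ι → ℂ} (ha : a ∈ T) :
    ∃ q : MvPolynomial ι ℂ, eval a q ≠ 0 ∧ ∃ f : (ι → ℂ) → (Fin k → ℂ) →ₗ[ℂ] V N,
      RegVec (T ∩ bas q) f ∧ ∀ t ∈ T ∩ bas q, Function.Injective (f t) ∧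
        (firsts k l).map (f t) = S t ∧ LinearMap.range (f t) = B t := by
  obtain ⟨g, hg, hg1, hg2⟩ := exists_frame (hle a ha) (hl a ha) (hk a ha)
  have hlk : l ≤ k := hl a ha ▸ hk a ha ▸ Submodule.finrank_mono (hle a ha)
  obtain ⟨q, hq, P, hP, H⟩ := hS a ha
  obtain ⟨q', hq', P', hP', H'⟩ := hB a ha
  have hs : T ∩ bas (q * q') ⊆ T ∩ bas q := fun b hb => ⟨hb.1, by
    rw [bas_mul] at hb; exact hb.2.1⟩
  have hs' : T ∩ bas (q * q') ⊆ T ∩ bas q' := fun b hb => ⟨hb.1, by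
    rw [bas_mul] at hb; exact hb.2.2⟩
  let f := fun t => P t ∘ₗ g ∘ₗ proj k l + P' t ∘ₗ g ∘ₗ (LinearMap.id - proj k l)
  have hf : RegVec (T ∩ bas (q * q')) f :=
    ((hP.mono hs).comp (RegVec.const _)).add ((hP'.mono hs').comp (RegVec.const _))
  have haT : a ∈ T ∩ bas (q * q') := ⟨ha, by simp [hq, hq']⟩
  have hfa : f a = g := by
    refine LinearMap.ext fun x => ?_
    have h1 : P a (g (proj k l x)) = g (proj k l x) :=
      (H a (hs haT)).2 _ (hg1 ▸ ⟨_, proj_mem k l x, rfl⟩)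
    have h2 : P' a (g (x - proj k l x)) = g (x - proj k l x) :=
      (H' a (hs' haT)).2 _ (hg2 ▸ ⟨_, rfl⟩)
    simp only [f, LinearMap.add_apply, LinearMap.comp_apply, LinearMap.sub_apply,
      LinearMap.id_apply, h1, h2]
    rw [← map_add, add_sub_cancel]
  obtain ⟨r, hr, Hr⟩ := exists_injective hf haT (hfa ▸ hg)
  have hT : T ∩ bas (q * q' * r) = T ∩ bas (q * q') ∩ bas r := by rw [bas_mul, Set.inter_assoc]
  refine ⟨q * q' * r, by simp only [map_mul]; exact mul_ne_zero (mul_ne_zero hq hq') hr, f, ?_, ?_⟩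
  · rw [hT]; exact hf.mono Set.inter_subset_left
  · rw [hT]
    intro t ht
    have hi := Hr t ht
    refine ⟨hi, Submodule.eq_of_le_of_finrank_eq ?_ ?_, Submodule.eq_of_le_of_finrank_eq ?_ ?_⟩
    · rintro _ ⟨x, hx, rfl⟩
      have : proj k l x = x := proj_eq_self hx
      simp only [f, LinearMap.add_apply, LinearMap.comp_apply, LinearMap.sub_apply,
        LinearMap.id_apply, this, sub_self, map_zero, add_zero]
      exact (H t (hs ht.1)).1 _
    · rw [finrank_map_inj hi, finrank_firsts hlk, hl t ht.1.1]
    · rintro _ ⟨x, rfl⟩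
      exact Submodule.add_mem _ (hle t ht.1.1 ((H t (hs ht.1)).1 _)) ((H' t (hs' ht.1)).1 _)
    · rw [LinearMap.finrank_range_of_inj hi, hk t ht.1.1, finrank_fin_fun]

lemma Flag.ext' {F F' : Flag m N} (h1 : F.small = F'.small) (h2 : F.big = F'.big) : F = F' := by
  cases F; cases F'; cases h1; cases h2; rfl

lemma frameFlag_small (A : frames N m) :
    (frameFlag m N A).small = (firsts m (m - 1)).map (lin A.1) := by
  rw [firsts, Submodule.map_span, ← Set.range_comp]
  change Submodule.span ℂ _ = _
  congr 1
  ext v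
  simp only [Set.mem_range, Function.comp, lin_single]
  constructor
  · rintro ⟨j, rfl⟩; exact ⟨⟨j.castLE (Nat.sub_le m 1), j.2⟩, rfl⟩
  · rintro ⟨⟨j, hj⟩, rfl⟩; exact ⟨⟨j, hj⟩, rfl⟩

lemma frameFlag_big (A : frames N m) : (frameFlag m N A).big = LinearMap.range (lin A.1) :=
  (range_lin A.1).symm

lemma exists_frameFlag (F : Flag m N) {f : (Fin m → ℂ) →ₗ[ℂ] V N} (hf : Function.Injective f)
    (h1 : (firsts m (m - 1)).map f = F.small) (h2 : LinearMap.range f = F.big) :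
    ∃ h : unlin f ∈ frames N m, frameFlag m N ⟨unlin f, h⟩ = F :=
  ⟨unlin_mem hf, Flag.ext' (by rw [frameFlag_small, ← h1, lin_unlin])
    (by rw [frameFlag_big, ← h2, lin_unlin])⟩

/-- The flag variety is presented by frames. -/
def flagPresentation (m N : ℕ) : Presentation (flagVariety m N) (Fin N × Fin m) :=
  framePresentation (m - 1) (frameFlag m N)
    (fun F => by
      obtain ⟨f, hf, h1, h2⟩ := exists_frame F.le F.finrank_small F.finrank_big
      obtain ⟨h, hF⟩ := exists_frameFlag F hf h1 h2
      exact ⟨_, hF⟩)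
    (fun a b => by
      rw [← frameFlag_small, ← frameFlag_small, ← frameFlag_big, ← frameFlag_big]
      exact ⟨fun h => by rw [h]; exact ⟨rfl, rfl⟩, fun h => Flag.ext' h.1 h.2⟩)

lemma exists_frameSpan (W : Gr k N) {f : (Fin k → ℂ) →ₗ[ℂ] V N} (hf : Function.Injective f)
    (h : LinearMap.range f = W.1) :
    ∃ h : unlin f ∈ frames N k, frameSpan k N ⟨unlin f, h⟩ = W :=
  ⟨unlin_mem hf, Subtype.ext (by
    change Submodule.span ℂ _ = _
    rw [← range_lin, lin_unlin, h])⟩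

lemma firsts_zero (k : ℕ) : firsts k 0 = ⊥ := by
  rw [← Submodule.finrank_eq_zero (R := ℂ), finrank_firsts (Nat.zero_le _)]

/-- The Grassmannian is presented by frames. -/
def grPresentation (k N : ℕ) : Presentation (grassmannian k N) (Fin N × Fin k) :=
  framePresentation 0 (frameSpan k N)
    (fun W => by
      obtain ⟨f, hf, -, h2⟩ := exists_frame (bot_le (a := W.1)) finrank_bot' W.2
      obtain ⟨h, hF⟩ := exists_frameSpan W hf h2
      exact ⟨_, hF⟩)
    (fun a b => by
      rw [firsts_zero, Submodule.map_bot, Submodule.map_bot, range_lin, range_lin]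
      exact ⟨fun h => ⟨rfl, congrArg Subtype.val h⟩, fun h => Subtype.ext h.2⟩)
where
  finrank_bot' : finrank ℂ (⊥ : Submodule ℂ (V N)) = 0 := finrank_bot _ _

variable {A : FunSpace X}

theorem isMorphism_to_flag (PX : Presentation A ι) {Z : Set X} {Z' : Set (Flag m N)} (φ : Z → Z')
    (s b : (ι → ℂ) → Submodule ℂ (V N)) (hs : RegFam (PX.pull Z) s) (hb : RegFam (PX.pull Z) b)
    (h : ∀ (a : PX.S) (ha : PX.π a ∈ Z), (φ ⟨PX.π a, ha⟩).1.small = s a ∧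
      (φ ⟨PX.π a, ha⟩).1.big = b a) :
    IsMorphism (A.sub Z) ((flagVariety m N).sub Z') φ := by
  refine isMorphism_of_lift PX (flagPresentation m N) φ fun a ha => ?_
  obtain ⟨q, hq, f, hf, H⟩ := exists_local_frame (l := m - 1) (k := m) hs hb
    (by rintro t ⟨h1, h2⟩; rw [← (h ⟨t, h1⟩ h2).1, ← (h ⟨t, h1⟩ h2).2]; exact Flag.le _)
    (by rintro t ⟨h1, h2⟩; rw [← (h ⟨t, h1⟩ h2).1]; exact Flag.finrank_small _)
    (by rintro t ⟨h1, h2⟩; rw [← (h ⟨t, h1⟩ h2).2]; exact Flag.finrank_big _) ⟨a.2, ha⟩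
  refine ⟨q, hq, fun t => unlin (f t), fun k => hf.unlin k, fun c hc hcq => ?_⟩
  obtain ⟨h1, h2, h3⟩ := H c ⟨⟨c.2, hc⟩, hcq⟩
  exact exists_frameFlag _ h1 (h2.trans (h c hc).1.symm) (h3.trans (h c hc).2.symm)

theorem isMorphism_to_gr (PX : Presentation A ι) {Z : Set X} {Z' : Set (Gr k N)} (φ : Z → Z')
    (b : (ι → ℂ) → Submodule ℂ (V N)) (hb : RegFam (PX.pull Z) b)
    (h : ∀ (a : PX.S) (ha : PX.π a ∈ Z), (φ ⟨PX.π a, ha⟩).1.1 = b a) :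
    IsMorphism (A.sub Z) ((grassmannian k N).sub Z') φ := by
  refine isMorphism_of_lift PX (grPresentation k N) φ fun a ha => ?_
  obtain ⟨q, hq, f, hf, H⟩ := exists_local_frame (l := 0) (k := k) (RegFam.const ⊥) hb
    (fun _ _ => bot_le) (fun _ _ => finrank_bot _ _)
    (by rintro t ⟨h1, h2⟩; rw [← h ⟨t, h1⟩ h2]; exact (φ ⟨PX.π ⟨t, h1⟩, h2⟩).1.2) ⟨a.2, ha⟩
  refine ⟨q, hq, fun t => unlin (f t), fun k => hf.unlin k, fun c hc hcq => ?_⟩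
  obtain ⟨h1, -, h3⟩ := H c ⟨⟨c.2, hc⟩, hcq⟩
  exact exists_frameSpan _ h1 (h3.trans (h c hc).symm)

lemma regFam_frame_big {T : Set (Fin N × Fin k → ℂ)} (hT : T ⊆ frames N k) :
    RegFam T (fun A => LinearMap.range (lin A)) :=
  RegFam.range (regVec_lin T) (r := k) fun t ht => by
    rw [LinearMap.finrank_range_of_inj (lin_injective_iff.2 (hT ht)), finrank_fin_fun]

lemma regFam_frame_small {T : Set (Fin N × Fin k → ℂ)} (hT : T ⊆ frames N k) :
    RegFam T (fun A => (firsts k l).map (lin A)) :=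
  RegFam.map (regVec_lin T) (RegFam.const _) (r := finrank ℂ (firsts k l)) fun t ht => by
    rw [finrank_map_inj (lin_injective_iff.2 (hT ht))]

lemma pull_subset {A : FunSpace X} (P : Presentation A ι) (Z : Set X) : P.pull Z ⊆ P.S :=
  fun _ h => h.1

/-- A map between sets of flags that preserves regular families is a morphism. -/
theorem isMorphism_flag_flag {m' N' : ℕ} {Z : Set (Flag m N)} {Z' : Set (Flag m' N')} (φ : Z → Z')
    (s b : Submodule ℂ (V N) → Submodule ℂ (V N) → Submodule ℂ (V N'))
    (h : ∀ F : Z, (φ F).1.small = s F.1.small F.1.big ∧ (φ F).1.big = b F.1.small F.1.big)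
    (hr : ∀ (T : Set (Fin N × Fin m → ℂ)) (S B : (Fin N × Fin m → ℂ) → Submodule ℂ (V N)),
      RegFam T S → RegFam T B → (∀ t ∈ T, ∃ F ∈ Z, F.small = S t ∧ F.big = B t) →
      RegFam T (fun t => s (S t) (B t)) ∧ RegFam T (fun t => b (S t) (B t))) :
    IsMorphism ((flagVariety m N).sub Z) ((flagVariety m' N').sub Z') φ := by
  have key := hr ((flagPresentation m N).pull Z) _ _
    (regFam_frame_small (pull_subset _ _)) (regFam_frame_big (pull_subset _ _)) (by
      rintro t ⟨h1, h2⟩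
      exact ⟨_, h2, frameFlag_small ⟨t, h1⟩, frameFlag_big ⟨t, h1⟩⟩)
  refine isMorphism_to_flag (flagPresentation m N) φ _ _ key.1 key.2 fun a ha => ?_
  have e1 : ((flagPresentation m N).π a).small = _ := frameFlag_small a
  have e2 : ((flagPresentation m N).π a).big = _ := frameFlag_big a
  rw [(h _).1, (h _).2, e1, e2]
  exact ⟨rfl, rfl⟩

theorem isMorphism_flag_gr {k' N' : ℕ} {Z : Set (Flag m N)} {Z' : Set (Gr k' N')} (φ : Z → Z')
    (b : Submodule ℂ (V N) → Submodule ℂ (V N) → Submodule ℂ (V N'))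
    (h : ∀ F : Z, (φ F).1.1 = b F.1.small F.1.big)
    (hr : ∀ (T : Set (Fin N × Fin m → ℂ)) (S B : (Fin N × Fin m → ℂ) → Submodule ℂ (V N)),
      RegFam T S → RegFam T B → (∀ t ∈ T, ∃ F ∈ Z, F.small = S t ∧ F.big = B t) →
      RegFam T (fun t => b (S t) (B t))) :
    IsMorphism ((flagVariety m N).sub Z) ((grassmannian k' N').sub Z') φ := by
  have key := hr ((flagPresentation m N).pull Z) _ _
    (regFam_frame_small (pull_subset _ _)) (regFam_frame_big (pull_subset _ _)) (by
      rintro t ⟨h1, h2⟩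
      exact ⟨_, h2, frameFlag_small ⟨t, h1⟩, frameFlag_big ⟨t, h1⟩⟩)
  refine isMorphism_to_gr (flagPresentation m N) φ _ key fun a ha => ?_
  have e1 : ((flagPresentation m N).π a).small = _ := frameFlag_small a
  have e2 : ((flagPresentation m N).π a).big = _ := frameFlag_big a
  rw [h _, e1, e2]

theorem isMorphism_gr_flag {m' N' : ℕ} {Z : Set (Gr k N)} {Z' : Set (Flag m' N')} (φ : Z → Z')
    (s b : Submodule ℂ (V N) → Submodule ℂ (V N'))
    (h : ∀ W : Z, (φ W).1.small = s W.1.1 ∧ (φ W).1.big = b W.1.1)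
    (hr : ∀ (T : Set (Fin N × Fin k → ℂ)) (B : (Fin N × Fin k → ℂ) → Submodule ℂ (V N)),
      RegFam T B → (∀ t ∈ T, ∃ W ∈ Z, W.1 = B t) →
      RegFam T (fun t => s (B t)) ∧ RegFam T (fun t => b (B t))) :
    IsMorphism ((grassmannian k N).sub Z) ((flagVariety m' N').sub Z') φ := by
  have key := hr ((grPresentation k N).pull Z) _ (regFam_frame_big (pull_subset _ _)) (by
      rintro t ⟨h1, h2⟩
      exact ⟨_, h2, (range_lin t).symm⟩)
  refine isMorphism_to_flag (grPresentation k N) φ _ _ key.1 key.2 fun a ha => ?_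
  have e : ((grPresentation k N).π a).1 = _ := (range_lin a.1).symm
  rw [(h _).1, (h _).2, e]
  exact ⟨rfl, rfl⟩

/-! ### Cells -/

/-- A set of pairs of subspaces that is regularly parametrised by a vector space. -/
def IsPairCell {E : Type*} [AddCommGroup E] [Module ℂ E] [FiniteDimensional ℂ E]
    (C : Set (Submodule ℂ E × Submodule ℂ E)) : Prop :=
  ∃ (D : Type) (_ : AddCommGroup D) (_ : Module ℂ D) (_ : FiniteDimensional ℂ D)
    (p : D → Submodule ℂ E × Submodule ℂ E) (c : Submodule ℂ E × Submodule ℂ E → D),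
    (∀ d, p d ∈ C) ∧ (∀ x ∈ C, p (c x) = x) ∧ (∀ d, c (p d) = d) ∧
    (∀ (ι : Type) (T : Set (ι → ℂ)) (f : (ι → ℂ) → D), RegVec T f →
      RegFam T (fun t => (p (f t)).1) ∧ RegFam T (fun t => (p (f t)).2)) ∧
    ∀ (ι : Type) (T : Set (ι → ℂ)) (S B : (ι → ℂ) → Submodule ℂ E), RegFam T S → RegFam T B →
      (∀ t ∈ T, (S t, B t) ∈ C) → RegVec T (fun t => c (S t, B t))

/-- The pair of subspaces underlying a flag. -/
def Flag.pair (F : Flag m N) : Submodule ℂ (V N) × Submodule ℂ (V N) := (F.small, F.big)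

lemma Flag.pair_injective : Function.Injective (Flag.pair : Flag m N → _) := fun _ _ h =>
  Flag.ext' (congrArg Prod.fst h) (congrArg Prod.snd h)

/-- Regularity of `p` on vectors and of `c` on families of subspaces is exactly what makes the two
directions of the bijection morphisms. -/
theorem isomorphic_of_isPairCell {Z : Set (Flag m N)} (h : IsPairCell (Flag.pair '' Z)) :
    ∃ d : ℕ, Isomorphic ((flagVariety m N).sub Z) (affineSpace (Fin d)) := by
  obtain ⟨D, _, _, _, p, c, h1, h2, h3, h4, h5⟩ := h
  refine ⟨finrank ℂ D, Isomorphic.trans ?_ (isomorphic_affine_univ _)⟩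
  let β : D ≃ₗ[ℂ] (Fin (finrank ℂ D) → ℂ) := (finBasis ℂ D).equivFun
  choose F hF hFp using h1
  let e : Z ≃ (Set.univ : Set (Fin (finrank ℂ D) → ℂ)) :=
    { toFun := fun x => ⟨β (c x.1.pair), trivial⟩
      invFun := fun y => ⟨F (β.symm y.1), hF _⟩
      left_inv := fun x => Subtype.ext (Flag.pair_injective (by
        simp only [LinearEquiv.symm_apply_apply]
        rw [hFp, h2 _ ⟨x.1, x.2, rfl⟩]))
      right_inv := fun y => Subtype.ext (by
        simp only [hFp, h3, LinearEquiv.apply_symm_apply]) }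
  refine ⟨e, ?_, ?_⟩
  · refine isMorphism_of_lift (flagPresentation m N) (affinePresentation _) e fun a ha =>
      ⟨1, by simp, fun A => β (c ((firsts m (m - 1)).map (lin A), LinearMap.range (lin A))),
        fun j => ?_, fun b hb _ => ⟨trivial, ?_⟩⟩
    · have := h5 _ ((flagPresentation m N).pull Z) _ _
        (regFam_frame_small (l := m - 1) (pull_subset _ _)) (regFam_frame_big (pull_subset _ _))
        (by
          rintro t ⟨ht, ht'⟩
          exact ⟨_, ht', Prod.ext (frameFlag_small ⟨t, ht⟩) (frameFlag_big ⟨t, ht⟩)⟩)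
      exact ((this.linear β.toLinearMap).mono Set.inter_subset_left) (LinearMap.proj j)
    · have hp : Flag.pair (frameFlag m N b) =
          ((firsts m (m - 1)).map (lin b.1), LinearMap.range (lin b.1)) :=
        Prod.ext (frameFlag_small b) (frameFlag_big b)
      exact congrArg (fun z => β (c z)) hp.symm
  · have hβ : RegVec ((affinePresentation _).pull Set.univ) fun y => β.symm y :=
      (RegVec.pi fun i => regVec_scalar.2 (RegOn.coord i)).linear β.symm.toLinearMap
    obtain ⟨r1, r2⟩ := h4 _ _ _ hβ
    refine isMorphism_to_flag (affinePresentation _) e.symm _ _ r1 r2 fun a ha => ?_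
    exact ⟨congrArg Prod.fst (hFp _), congrArg Prod.snd (hFp _)⟩

end Flags

/-! ### Pavings -/

section Paving

variable {X : Type} {A : FunSpace X} {Z Z' C Y : Set X}

/-- `C` is a relatively open subset of `Z`. -/
def RelOpen (A : FunSpace X) (Z C : Set X) : Prop := ∃ O, IsOpen[A.top] O ∧ O ∩ Z = C

lemma RelOpen.restrict (h : RelOpen A Z C) (hZ : Z' ⊆ Z) : RelOpen A Z' (Z' ∩ C) := by
  obtain ⟨O, hO, rfl⟩ := h
  exact ⟨O, hO, by ext x; exact ⟨fun h => ⟨h.2, h.1, hZ h.2⟩, fun h => ⟨h.2.1, h.1⟩⟩⟩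

/-- A subset isomorphic to an affine space. -/
def IsCell (A : FunSpace X) (C : Set X) : Prop :=
  ∃ d : ℕ, Isomorphic (A.sub C) (affineSpace (Fin d))

/-- Sets obtained by successively adding relatively open cells. -/
inductive Paved (A : FunSpace X) : Set X → Prop
  | empty : Paved A ∅
  | union {Z C : Set X} (hZ : Paved A Z) (hd : Disjoint Z C) (ho : RelOpen A (Z ∪ C) C)
      (hC : IsCell A C) : Paved A (Z ∪ C)

lemma Paved.of_isCell (h : IsCell A C) : Paved A C := by
  have := Paved.union (A := A) Paved.empty (Set.empty_disjoint C)
    ⟨Set.univ, @isOpen_univ _ A.top, by simp⟩ h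
  simpa using this

/-- The cells of the open piece are added one after another. A cell open in `Z'` stays open in the
union because `Z'` is itself open there. -/
lemma Paved.glue (h : Paved A Z) (h' : Paved A Z') (hd : Disjoint Z Z')
    (ho : RelOpen A (Z ∪ Z') Z') : Paved A (Z ∪ Z') := by
  induction h' with
  | empty => simpa using h
  | @union Z₂ C hZ₂ hd₂ ho₂ hC ih =>
    rw [Set.disjoint_union_right] at hd
    have h1 := ho.restrict (Z' := Z ∪ Z₂) (Set.union_subset_union_right _ Set.subset_union_left)
    have e1 : (Z ∪ Z₂) ∩ (Z₂ ∪ C) = Z₂ := by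
      ext x
      constructor
      · rintro ⟨hx | hx, hx' | hx'⟩
        · exact hx'
        · exact absurd hx' (Set.disjoint_left.1 hd.2 hx)
        · exact hx
        · exact hx
      · exact fun hx => ⟨Or.inr hx, Or.inl hx⟩
    rw [e1] at h1
    rw [← Set.union_assoc]
    refine Paved.union (ih hd.1 h1) ?_ ?_ hC
    · rw [Set.disjoint_union_left]; exact ⟨hd.2, hd₂⟩
    · obtain ⟨O, hO, hOZ⟩ := ho
      obtain ⟨O', hO', hOC⟩ := ho₂
      refine ⟨O ∩ O', @IsOpen.inter _ A.top _ _ hO hO', ?_⟩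
      rw [Set.union_assoc, Set.inter_assoc, Set.inter_comm O', ← Set.inter_assoc, hOZ,
        Set.inter_comm, hOC]

/-- Upper semicontinuity makes `{d ≥ n}` closed, so the level sets of `d` are added in decreasing
order of the value of `d`; each level set is then paved by means of the remaining functions. -/
lemma Paved.of_levels (ds : List (X → ℕ)) (ho : ∀ d ∈ ds, ∀ n, IsOpen[A.top] {x | d x < n})
    (hb : ∀ d ∈ ds, ∃ M, ∀ x, d x ≤ M) :
    ∀ Z : Set X, (∀ x ∈ Z, IsCell A {y | y ∈ Z ∧ ∀ d ∈ ds, d y = d x}) → Paved A Z := by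
  induction ds with
  | nil =>
    intro Z h
    obtain rfl | ⟨x, hx⟩ := Z.eq_empty_or_nonempty
    · exact Paved.empty
    · have := h x hx
      simp only [List.not_mem_nil, false_imp_iff, implies_true, and_true] at this
      exact Paved.of_isCell this
  | cons d ds ih =>
    intro Z h
    obtain ⟨M, hM⟩ := hb d (by simp)
    have hlev : ∀ n, Paved A {x | x ∈ Z ∧ d x = n} := fun n => by
      refine ih (fun d hd => ho d (by simp [hd])) (fun d hd => hb d (by simp [hd])) _ ?_
      rintro x ⟨hx, rfl⟩
      convert h x hx using 1
      ext y
      simp only [Set.mem_ofPred_eq, List.mem_cons, forall_eq_or_imp, and_assoc]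
    -- Here `k` counts the levels already included, starting above the bound `M`. The new level `M -
    -- k` is cut out of the union by the open condition `d < M - k + 1`.
    have key : ∀ k, Paved A {x | x ∈ Z ∧ M + 1 ≤ d x + k} := by
      intro k
      induction k with
      | zero =>
        convert Paved.empty (A := A) using 1
        ext x
        have := hM x
        simp only [Set.mem_ofPred_eq, Set.mem_empty_iff_false, iff_false, not_and]
        omega
      | succ k ihk =>
        by_cases hk : k ≤ M
        · have e : {x | x ∈ Z ∧ M + 1 ≤ d x + (k + 1)} =
              {x | x ∈ Z ∧ M + 1 ≤ d x + k} ∪ {x | x ∈ Z ∧ d x = M - k} := by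
            ext x
            simp only [Set.mem_ofPred_eq, Set.mem_union, ← and_or_left]
            refine and_congr_right fun _ => ?_
            omega
          rw [e]
          refine ihk.glue (hlev _) ?_ ⟨{x | d x < M - k + 1}, ho d (by simp) _, ?_⟩
          · rw [Set.disjoint_left]
            rintro x ⟨_, h1⟩ ⟨_, h2⟩
            omega
          · ext x
            simp only [Set.mem_inter_iff, Set.mem_ofPred_eq, Set.mem_union]
            constructor
            · rintro ⟨h1, h2 | h2⟩
              · omega
              · exact h2
            · rintro ⟨h1, h2⟩
              exact ⟨by omega, Or.inr ⟨h1, h2⟩⟩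
        · convert ihk using 1
          ext x
          simp only [Set.mem_ofPred_eq]
          refine and_congr_right fun _ => ?_
          omega
    convert key (M + 1) using 1
    ext x
    simp

lemma Paved.exists_filtration (h : Paved A Z) : ∃ (r : ℕ) (F : ℕ → Set X), F 0 = ∅ ∧ F r = Z ∧
    (∀ s ≤ r, ∃ K, IsClosed[A.top] K ∧ F s = K ∩ Z) ∧
    ∀ s < r, F s ⊆ F (s + 1) ∧ IsCell A (F (s + 1) \ F s) := by
  induction h with
  | empty => exact ⟨0, fun _ => ∅, rfl, rfl, fun s _ => ⟨∅, @isClosed_empty _ A.top, by simp⟩,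
      fun s hs => absurd hs (Nat.not_lt_zero s)⟩
  | @union Z C hZ hd ho hC ih =>
    obtain ⟨r, F, h0, hr, hcl, hs⟩ := ih
    obtain ⟨O, hO, hOC⟩ := ho
    -- The new cell is open in the union, so the part already built is closed in it, and so are all
    -- earlier members of the filtration.
    have hOZ : Oᶜ ∩ (Z ∪ C) = Z := by
      ext x
      have hx := Set.ext_iff.1 hOC x
      have hx' : x ∈ Z → x ∉ C := fun h => Set.disjoint_left.1 hd h
      simp only [Set.mem_inter_iff, Set.mem_union, Set.mem_compl_iff] at hx ⊢
      tauto
    refine ⟨r + 1, fun s => if s ≤ r then F s else Z ∪ C, by simpa using h0, by simp, ?_, ?_⟩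
    · intro s _
      by_cases hsr : s ≤ r
      · obtain ⟨K, hK, hFK⟩ := hcl s hsr
        refine ⟨K ∩ Oᶜ, @IsClosed.inter _ _ _ A.top hK (@IsOpen.isClosed_compl _ A.top _ hO), ?_⟩
        simp only [if_pos hsr]
        rw [Set.inter_assoc, hOZ, hFK]
      · exact ⟨Set.univ, @isClosed_univ _ A.top, by simp [if_neg hsr]⟩
    · intro s hsr
      rcases Nat.lt_succ_iff_lt_or_eq.1 hsr with hlt | rfl
      · simp only [if_pos hlt.le, if_pos (Nat.succ_le_of_lt hlt)]
        exact hs s hlt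
      · simp only [le_refl, if_true, Nat.not_succ_le_self, if_false, hr]
        refine ⟨Set.subset_union_left, ?_⟩
        rwa [Set.union_sdiff_cancel_left (Set.disjoint_iff.1 hd)]

theorem Paved.hasAffinePaving (h : Paved A Z)
    (hA : ∀ {U U' : Set X} {f : X → ℂ}, A.Reg U f → U' ⊆ U → A.Reg U' f) :
    HasAffinePaving (A.sub Z) := by
  obtain ⟨r, F, h0, hr, hcl, hs⟩ := h.exists_filtration
  have hFZ : ∀ s ≤ r, F s ⊆ Z := fun s hsr => by
    obtain ⟨K, -, hK⟩ := hcl s hsr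
    rw [hK]; exact Set.inter_subset_right
  refine ⟨r, fun s => Subtype.val ⁻¹' F s, by simp [h0], by simp [hr], fun s hsr => ?_,
    fun s hsr => ⟨Set.preimage_mono (hs s hsr).1, ?_⟩⟩
  · obtain ⟨K, hK, hFK⟩ := hcl s hsr
    refine @isClosed_induced_iff _ _ A.top _ _ |>.2 ⟨K, hK, ?_⟩
    ext x
    simp [hFK]
  · obtain ⟨d, hd⟩ := (hs s hsr).2
    refine ⟨d, (isomorphic_sub_sub hA Z _).trans ?_⟩
    have : Subtype.val '' (Subtype.val ⁻¹' F (s + 1) \ Subtype.val ⁻¹' F s : Set Z) =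
        F (s + 1) \ F s := by
      rw [← Set.preimage_sdiff, Subtype.image_preimage_coe, Set.inter_eq_right]
      exact Set.sdiff_subset.trans (hFZ _ hsr)
    rw [this]
    exact hd

/-- Two non-zero polynomials have a non-zero product, which does not vanish identically on `ℂ^n`. -/
lemma affine_irreducible {n : ℕ} {U U' : Set (Fin n → ℂ)}
    (hU : IsOpen[(affineSpace (Fin n)).top] U) (hU' : IsOpen[(affineSpace (Fin n)).top] U')
    (h : U.Nonempty) (h' : U'.Nonempty) : (U ∩ U').Nonempty := by
  obtain ⟨a, ha⟩ := h
  obtain ⟨b, hb⟩ := h'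
  obtain ⟨p, hp, hpU⟩ := affine_isOpen_iff.1 hU a ha
  obtain ⟨q, hq, hqU⟩ := affine_isOpen_iff.1 hU' b hb
  have hp0 : p ≠ 0 := by rintro rfl; simp at hp
  have hq0 : q ≠ 0 := by rintro rfl; simp at hq
  have : ∃ c, eval c (p * q) ≠ 0 := by
    by_contra! hc
    exact mul_ne_zero hp0 hq0 (MvPolynomial.funext fun x => by rw [hc x, map_zero])
  obtain ⟨c, hc⟩ := this
  simp only [map_mul, ne_eq, mul_eq_zero, not_or] at hc
  exact ⟨c, hpU hc.1, hqU hc.2⟩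

/-- Otherwise the cell would be covered by two non-empty disjoint open subsets, against
irreducibility of affine space. -/
lemma IsCell.subset_or_disjoint (hC : IsCell A C) (hCY : C ⊆ Y) (h1 : RelOpen A Y Z)
    (h2 : RelOpen A Y (Y \ Z)) : C ⊆ Z ∨ Disjoint C Z := by
  obtain ⟨d, e, he, he'⟩ := hC
  obtain ⟨O, hO, hOZ⟩ := h1
  obtain ⟨O', hO', hOZ'⟩ := h2
  by_contra! hcon
  obtain ⟨hn, hn'⟩ := hcon
  obtain ⟨x, hxC, hxZ⟩ := Set.not_subset.1 hn
  obtain ⟨y, hyC, hyZ⟩ := Set.not_disjoint_iff.1 hn'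
  have op : ∀ {O}, IsOpen[A.top] O →
      IsOpen[(affineSpace (Fin d)).top] (e.symm ⁻¹' (Subtype.val ⁻¹' O)) := fun {O} hO =>
    @IsOpen.preimage _ _ (affineSpace (Fin d)).top (A.sub C).top _ he'.1 _ ⟨O, hO, rfl⟩
  obtain ⟨z, hz, hz'⟩ := affine_irreducible (op hO) (op hO')
    ⟨e ⟨y, hyC⟩, by
      have : y ∈ O ∩ Y := hOZ ▸ hyZ
      simpa using this.1⟩
    ⟨e ⟨x, hxC⟩, by
      have : x ∈ O' ∩ Y := hOZ' ▸ ⟨hCY hxC, hxZ⟩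
      simpa using this.1⟩
  have hzY : (e.symm z : X) ∈ Y := hCY (e.symm z).2
  have h3 : (e.symm z : X) ∈ Z := hOZ ▸ ⟨hz, hzY⟩
  have h4 : (e.symm z : X) ∈ Y \ Z := hOZ' ▸ ⟨hz', hzY⟩
  exact h4.2 h3

/-- Cells are either kept whole or dropped, so intersecting with an open and closed set never cuts a
cell. -/
lemma Paved.inter (h : Paved A Z') (hY : Z' ⊆ Y) (h1 : RelOpen A Y Z)
    (h2 : RelOpen A Y (Y \ Z)) : Paved A (Z' ∩ Z) := by
  induction h with
  | empty => rw [Set.empty_inter]; exact Paved.empty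
  | @union W C hW hd ho hC ih =>
    have ih' := ih (Set.subset_union_left.trans hY)
    rw [Set.union_inter_distrib_right]
    rcases hC.subset_or_disjoint (Set.subset_union_right.trans hY) h1 h2 with hCZ | hCZ
    · rw [Set.inter_eq_left.2 hCZ]
      refine ih'.union (hd.mono_left Set.inter_subset_left) ?_ hC
      have := ho.restrict (Z' := W ∩ Z ∪ C) (Set.union_subset_union_left _ Set.inter_subset_left)
      rwa [Set.inter_eq_right.2 Set.subset_union_right] at this
    · rw [Set.disjoint_iff_inter_eq_empty.1 hCZ, Set.union_empty]
      exact ih'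

end Paving

/-! ### Semicontinuity of intersection dimensions -/

section Semicontinuity

variable {m N : ℕ}

lemma finrank_map_add_inf_ker {E F : Type*} [AddCommGroup E] [Module ℂ E] [FiniteDimensional ℂ E]
    [AddCommGroup F] [Module ℂ F] (f : E →ₗ[ℂ] F) (W : Submodule ℂ E) :
    finrank ℂ (W.map f) + finrank ℂ (W ⊓ LinearMap.ker f : Submodule ℂ E) = finrank ℂ W := by
  have h := LinearMap.finrank_range_add_finrank_ker (f.domRestrict W)
  rw [LinearMap.range_domRestrict] at h
  have e : finrank ℂ (LinearMap.ker (f.domRestrict W)) =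
      finrank ℂ (W ⊓ LinearMap.ker f : Submodule ℂ E) := by
    rw [← finrank_map_inj W.injective_subtype]
    congr 2 <;>
    ext x <;>
    simp only [Submodule.mem_map, LinearMap.mem_ker, LinearMap.domRestrict_apply,
      Submodule.subtype_apply, Subtype.exists, exists_and_left, exists_prop, exists_eq_right_right,
      Submodule.mem_inf] <;>
    exact and_comm
  rw [e] at h
  exact h

/-- The dimension of `f(P) ∩ E` is `dim P` minus the rank of `P → V / E`, and rank can only increase
nearby. -/
lemma exists_finrank_inf_le {ι : Type} {k : ℕ} {T : Set (ι → ℂ)}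
    {f : (ι → ℂ) → (Fin k → ℂ) →ₗ[ℂ] V N} (hf : RegVec T f) (P : Submodule ℂ (Fin k → ℂ))
    (hinj : ∀ t ∈ T, Function.Injective (f t)) (E : Submodule ℂ (V N)) {a : ι → ℂ} (ha : a ∈ T) :
    ∃ q : MvPolynomial ι ℂ, eval a q ≠ 0 ∧ ∀ t ∈ T ∩ bas q,
      finrank ℂ (P.map (f t) ⊓ E : Submodule ℂ (V N)) ≤
        finrank ℂ (P.map (f a) ⊓ E : Submodule ℂ (V N)) := by
  obtain ⟨q, hq, H⟩ := exists_rank_ge (φ := fun t => E.mkQ ∘ₗ f t ∘ₗ P.subtype)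
    ((RegVec.const _).comp (hf.comp (RegVec.const _))) ha
  refine ⟨q, hq, fun t ht => ?_⟩
  have key : ∀ t ∈ T, finrank ℂ (LinearMap.range (E.mkQ ∘ₗ f t ∘ₗ P.subtype)) +
      finrank ℂ (P.map (f t) ⊓ E : Submodule ℂ (V N)) = finrank ℂ P := fun t ht => by
    have := finrank_map_add_inf_ker E.mkQ (P.map (f t))
    rw [Submodule.ker_mkQ, finrank_map_inj (hinj t ht)] at this
    rw [LinearMap.range_comp, LinearMap.range_comp, Submodule.range_subtype]
    exact this
  have h1 := key t ht.1
  have h2 := key a ha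
  have h3 := H t ht
  omega

lemma isOpen_finrank_big (E : Submodule ℂ (V N)) (n : ℕ) : IsOpen[(flagVariety m N).top]
    {F : Flag m N | finrank ℂ (F.big ⊓ E : Submodule ℂ (V N)) < n} := by
  obtain ⟨O, hO, hO'⟩ := ((flagPresentation m N).open_iff (Set.subset_univ
    {F : Flag m N | finrank ℂ (F.big ⊓ E : Submodule ℂ (V N)) < n})).2 (fun a ha => by
      obtain ⟨q, hq, H⟩ := exists_finrank_inf_le (regVec_lin (frames N m)) ⊤
        (fun t ht => lin_injective_iff.2 ht) E a.2
      refine ⟨q, hq, fun b _ hb => ?_⟩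
      rw [Set.mem_ofPred_eq] at ha ⊢
      refine lt_of_le_of_lt ?_ ha
      have e : ∀ c : (flagPresentation m N).S, ((flagPresentation m N).π c).big =
          (⊤ : Submodule ℂ (Fin m → ℂ)).map (lin c.1) := fun c => by
        rw [Submodule.map_top]; exact frameFlag_big c
      rw [e, e]
      exact H b ⟨b.2, hb⟩)
  rw [Set.inter_univ] at hO'
  rwa [← hO']

lemma isOpen_finrank_small (E : Submodule ℂ (V N)) (n : ℕ) : IsOpen[(flagVariety m N).top]
    {F : Flag m N | finrank ℂ (F.small ⊓ E : Submodule ℂ (V N)) < n} := by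
  obtain ⟨O, hO, hO'⟩ := ((flagPresentation m N).open_iff (Set.subset_univ
    {F : Flag m N | finrank ℂ (F.small ⊓ E : Submodule ℂ (V N)) < n})).2 (fun a ha => by
      obtain ⟨q, hq, H⟩ := exists_finrank_inf_le (regVec_lin (frames N m)) (firsts m (m - 1))
        (fun t ht => lin_injective_iff.2 ht) E a.2
      refine ⟨q, hq, fun b _ hb => ?_⟩
      rw [Set.mem_ofPred_eq] at ha ⊢
      refine lt_of_le_of_lt ?_ ha
      have e : ∀ c : (flagPresentation m N).S, ((flagPresentation m N).π c).small = _ := frameFlag_small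
      rw [e, e]
      exact H b ⟨b.2, hb⟩)
  rw [Set.inter_univ] at hO'
  rwa [← hO']

/-- The functions of `Paved.of_levels` are the intersection dimensions of both members of the flag
with the test subspaces, bounded by `N`. -/
theorem paved_of_levels (Es : List (Submodule ℂ (V N))) (Z : Set (Flag m N))
    (h : ∀ F₀ ∈ Z, IsPairCell (Flag.pair '' {F | F ∈ Z ∧ ∀ E ∈ Es,
      finrank ℂ (F.small ⊓ E : Submodule ℂ (V N)) = finrank ℂ (F₀.small ⊓ E : Submodule ℂ (V N)) ∧
      finrank ℂ (F.big ⊓ E : Submodule ℂ (V N)) = finrank ℂ (F₀.big ⊓ E : Submodule ℂ (V N))})) :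
    Paved (flagVariety m N) Z := by
  refine Paved.of_levels (Es.map (fun E (F : Flag m N) => finrank ℂ (F.small ⊓ E : Submodule ℂ _)) ++
    Es.map (fun E (F : Flag m N) => finrank ℂ (F.big ⊓ E : Submodule ℂ _))) ?_ ?_ Z ?_
  · intro d hd n
    simp only [List.mem_append, List.mem_map] at hd
    rcases hd with ⟨E, -, rfl⟩ | ⟨E, -, rfl⟩
    · exact isOpen_finrank_small E n
    · exact isOpen_finrank_big E n
  · intro d hd
    simp only [List.mem_append, List.mem_map] at hd
    rcases hd with ⟨E, -, rfl⟩ | ⟨E, -, rfl⟩ <;>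
    exact ⟨finrank ℂ (V N), fun F => Submodule.finrank_le _⟩
  · intro F₀ hF₀
    refine isomorphic_of_isPairCell ?_
    convert h F₀ hF₀ using 4 with F
    simp only [List.mem_append, List.mem_map]
    refine and_congr_right fun _ => ⟨?_, ?_⟩
    · exact fun H E hE => ⟨H _ (Or.inl ⟨E, hE, rfl⟩), H _ (Or.inr ⟨E, hE, rfl⟩)⟩
    · rintro H _ (⟨E, hE, rfl⟩ | ⟨E, hE, rfl⟩)
      · exact (H E hE).1
      · exact (H E hE).2

end Semicontinuity

/-! ### Isotropic subspaces of a quadratic space: cells with isometric lifts -/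

section Isotropic

variable {U U' : Type} [AddCommGroup U] [Module ℂ U] [FiniteDimensional ℂ U]
  [AddCommGroup U'] [Module ℂ U'] [FiniteDimensional ℂ U']

/-- Subspaces with the same intersection dimensions with all members of a list. -/
def SameDims (Es : List (Submodule ℂ U)) (W W₀ : Submodule ℂ U) : Prop :=
  ∀ E ∈ Es, finrank ℂ (W ⊓ E : Submodule ℂ U) = finrank ℂ (W₀ ⊓ E : Submodule ℂ U)

/-- The isotropic subspaces in a fixed position relative to a list of subspaces. -/
def isoClass (Q : LinearMap.BilinForm ℂ U) (Es : List (Submodule ℂ U)) (W₀ : Submodule ℂ U) :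
    Set (Submodule ℂ U) :=
  {W | W ≤ Q.orthogonal W ∧ SameDims Es W W₀}

/-- A set of subspaces regularly parametrised by a family of isometries that stabilise all members
of a list of subspaces. -/
def IsIsoCell (Q : LinearMap.BilinForm ℂ U) (Es : List (Submodule ℂ U))
    (C : Set (Submodule ℂ U)) : Prop :=
  ∃ (D : Type) (_ : AddCommGroup D) (_ : Module ℂ D) (_ : FiniteDimensional ℂ D)
    (g : D → U →ₗ[ℂ] U) (B : Submodule ℂ U),
    (∀ d v w, Q (g d v) (g d w) = Q v w) ∧ (∀ d, ∀ E ∈ Es, E.map (g d) ≤ E) ∧ B ∈ C ∧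
    (∀ W ∈ C, ∃ d, B.map (g d) = W) ∧ (∀ d d', B.map (g d) = B.map (g d') → d = d') ∧
    (∀ (ι : Type) (T : Set (ι → ℂ)) (f : (ι → ℂ) → D), RegVec T f → RegVec T fun t => g (f t)) ∧
    ∀ (ι : Type) (T : Set (ι → ℂ)) (f : (ι → ℂ) → D) (W : (ι → ℂ) → Submodule ℂ U),
      RegFam T W → (∀ t ∈ T, W t ∈ C) → (∀ t ∈ T, B.map (g (f t)) = W t) → RegVec T f

lemma SameDims.finrank_eq {Es : List (Submodule ℂ U)} {W W₀ : Submodule ℂ U}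
    (h : SameDims Es W W₀) (ht : ⊤ ∈ Es) : finrank ℂ W = finrank ℂ W₀ := by
  have := h ⊤ ht
  rwa [inf_top_eq, inf_top_eq] at this

lemma isometry_injective {Q : LinearMap.BilinForm ℂ U} (hn : ∀ x, (∀ y, Q x y = 0) → x = 0)
    {g : U →ₗ[ℂ] U} (hg : ∀ v w, Q (g v) (g w) = Q v w) : Function.Injective g := by
  refine LinearMap.ker_eq_bot.1 (LinearMap.ker_eq_bot'.2 fun v hv => hn v fun w => ?_)
  rw [← hg, hv, map_zero, LinearMap.zero_apply]

lemma map_eq_of_le {g : U →ₗ[ℂ] U} (hg : Function.Injective g) {E : Submodule ℂ U}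
    (h : E.map g ≤ E) : E.map g = E :=
  Submodule.eq_of_le_of_finrank_eq h (finrank_map_inj hg E)

lemma finrank_map_inf {g : U →ₗ[ℂ] U} (hg : Function.Injective g) {E : Submodule ℂ U}
    (h : E.map g ≤ E) (W : Submodule ℂ U) :
    finrank ℂ (W.map g ⊓ E : Submodule ℂ U) = finrank ℂ (W ⊓ E : Submodule ℂ U) := by
  conv_lhs => rw [← map_eq_of_le hg h, ← Submodule.map_inf _ hg]
  exact finrank_map_inj hg _

lemma map_isotropic {Q : LinearMap.BilinForm ℂ U} {g : U →ₗ[ℂ] U}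
    (hg : ∀ v w, Q (g v) (g w) = Q v w) {W : Submodule ℂ U} (h : W ≤ Q.orthogonal W) :
    W.map g ≤ Q.orthogonal (W.map g) := by
  rintro _ ⟨v, hv, rfl⟩ _ ⟨w, hw, rfl⟩
  change Q (g w) (g v) = 0
  rw [hg]; exact h hv w hw

lemma map_mem_isoClass {Q : LinearMap.BilinForm ℂ U} (hn : ∀ x, (∀ y, Q x y = 0) → x = 0)
    {Es : List (Submodule ℂ U)} {g : U →ₗ[ℂ] U} (hg : ∀ v w, Q (g v) (g w) = Q v w)
    (hE : ∀ E ∈ Es, E.map g ≤ E) {W W₀ : Submodule ℂ U} (h : W ∈ isoClass Q Es W₀) :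
    W.map g ∈ isoClass Q Es W₀ :=
  ⟨map_isotropic hg h.1, fun E hEs => by
    rw [finrank_map_inf (isometry_injective hn hg) (hE E hEs), h.2 E hEs]⟩

lemma exists_represent {Q : LinearMap.BilinForm ℂ U} (hn : ∀ x, (∀ y, Q x y = 0) → x = 0)
    (l : U →ₗ[ℂ] ℂ) : ∃ c, ∀ v, Q c v = l v := by
  have hi : Function.Injective Q :=
    LinearMap.ker_eq_bot.1 (LinearMap.ker_eq_bot'.2 fun x hx => hn x fun y => by
      rw [hx, LinearMap.zero_apply])
  have hs := (LinearMap.injective_iff_surjective_of_finrank_eq_finrank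
    (Subspace.dual_finrank_eq (K := ℂ) (V := U)).symm).1 hi
  obtain ⟨c, hc⟩ := hs l
  exact ⟨c, fun v => LinearMap.congr_fun hc v⟩

/-- The splitting of a quadratic space as a hyperbolic plane plus a quadratic space. -/
structure HypSplit (Q : LinearMap.BilinForm ℂ U) (Q' : LinearMap.BilinForm ℂ U') where
  e : U
  f : U
  j : U' →ₗ[ℂ] U
  π : U →ₗ[ℂ] U'
  symm : ∀ x y, Q x y = Q y x
  ee : Q e e = 0
  ff : Q f f = 0
  ef : Q e f = 1
  πj : ∀ u, π (j u) = u
  πe : π e = 0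
  πf : π f = 0
  ej : ∀ u, Q e (j u) = 0
  fj : ∀ u, Q f (j u) = 0
  jj : ∀ u v, Q (j u) (j v) = Q' u v
  decomp : ∀ v, v = j (π v) + Q f v • e + Q e v • f

/-- On the line `x + t y` the form is a quadratic polynomial in `t`, which has a root over `ℂ`. -/
lemma exists_isotropic {Q : LinearMap.BilinForm ℂ U} (hs : ∀ x y, Q x y = Q y x)
    (h2 : 2 ≤ finrank ℂ U) : ∃ e : U, e ≠ 0 ∧ Q e e = 0 := by
  let b := finBasis ℂ U
  set x := b ⟨0, by omega⟩
  set y := b ⟨1, by omega⟩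
  by_cases hy : Q y y = 0
  · exact ⟨y, b.ne_zero _, hy⟩
  · obtain ⟨s, hs'⟩ := IsAlgClosed.exists_pow_nat_eq (discrim (Q y y) (2 * Q x y) (Q x x))
      (n := 2) (by norm_num)
    obtain ⟨t, ht⟩ := exists_quadratic_eq_zero hy ⟨s, by rw [← hs', sq]⟩
    refine ⟨x + t • y, fun h0 => ?_, ?_⟩
    · have := congrArg (fun v => b.repr v ⟨0, by omega⟩) h0
      simp [x, y] at this
    · simp only [map_add, map_smul, LinearMap.add_apply, LinearMap.smul_apply, smul_eq_mul,
        hs y x]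
      rw [← ht]; ring

lemma exists_hypSplit {Q : LinearMap.BilinForm ℂ U} (hs : ∀ x y, Q x y = Q y x)
    (hn : ∀ x, (∀ y, Q x y = 0) → x = 0) (h2 : 2 ≤ finrank ℂ U) :
    ∃ (U₁ : Submodule ℂ U) (Q' : LinearMap.BilinForm ℂ U₁), finrank ℂ U₁ < finrank ℂ U ∧
      (∀ x y, Q' x y = Q' y x) ∧ (∀ x, (∀ y, Q' x y = 0) → x = 0) ∧ Nonempty (HypSplit Q Q') := by
  obtain ⟨e, he0, hee⟩ := exists_isotropic hs h2
  obtain ⟨x, hx⟩ : ∃ x, Q e x ≠ 0 := by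
    by_contra! h; exact he0 (hn e h)
  obtain ⟨x, hx⟩ : ∃ x, Q e x = 1 := ⟨(Q e x)⁻¹ • x, by simp [hx]⟩
  -- Subtracting this multiple of `e` makes the partner isotropic without changing its pairing with
  -- `e`.
  set f := x - (Q x x / 2) • e with hf
  have hef : Q e f = 1 := by simp [hf, hee, hx]
  have hfe : Q f e = 1 := by rw [hs, hef]
  have hff : Q f f = 0 := by
    simp only [hf, map_sub, map_smul, LinearMap.sub_apply, LinearMap.smul_apply, smul_eq_mul,
      hs x e, hx, hee]
    ring
  let U₁ : Submodule ℂ U := LinearMap.ker (Q e) ⊓ LinearMap.ker (Q f)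
  have hU₁ : ∀ u : U₁, Q e u = 0 ∧ Q f u = 0 := fun u => u.2
  let p : U →ₗ[ℂ] U := LinearMap.id - (Q f).smulRight e - (Q e).smulRight f
  have hp : ∀ v, p v = v - Q f v • e - Q e v • f := fun v => rfl
  let π : U →ₗ[ℂ] U₁ := p.codRestrict U₁ fun v => by
    rw [hp]
    constructor
    · change Q e _ = 0
      simp [hee, hef]
    · change Q f _ = 0
      simp [hff, hfe]
  have hπ : ∀ v, (π v : U) = v - Q f v • e - Q e v • f := fun v => rfl
  have split : HypSplit Q (Q.restrict U₁) :=
    { e := e, f := f, j := U₁.subtype, π := π, symm := hs, ee := hee, ff := hff, ef := hef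
      πj := fun u => Subtype.ext (by simp [hπ, (hU₁ u).1, (hU₁ u).2])
      πe := Subtype.ext (by simp [hπ, hee, hfe])
      πf := Subtype.ext (by simp [hπ, hff, hef])
      ej := fun u => (hU₁ u).1
      fj := fun u => (hU₁ u).2
      jj := fun u v => rfl
      decomp := fun v => by rw [Submodule.subtype_apply, hπ]; abel }
  refine ⟨U₁, Q.restrict U₁, ?_, fun x y => hs _ _, fun u hu => ?_, ⟨split⟩⟩
  · refine Submodule.finrank_lt fun h => ?_
    have : f ∈ U₁ := h ▸ Submodule.mem_top
    have h1 : Q e f = 0 := this.1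
    rw [hef] at h1; exact one_ne_zero h1
  · refine Subtype.ext (hn u fun v => ?_)
    have h1 : Q u (π v) = 0 := hu (π v)
    rw [hπ, map_sub, map_sub, map_smul, map_smul, hs _ e, hs _ f, (hU₁ u).1, (hU₁ u).2] at h1
    simpa using h1

namespace HypSplit

variable {Q : LinearMap.BilinForm ℂ U} {Q' : LinearMap.BilinForm ℂ U'} (H : HypSplit Q Q')

lemma fe : Q H.f H.e = 1 := by rw [H.symm, H.ef]

lemma je (u : U') : Q (H.j u) H.e = 0 := by rw [H.symm, H.ej]

lemma jf (u : U') : Q (H.j u) H.f = 0 := by rw [H.symm, H.fj]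

lemma jv (u : U') (v : U) : Q (H.j u) v = Q' u (H.π v) := by
  conv_lhs => rw [H.decomp v]
  simp [H.jj, H.je, H.jf]

lemma e_ne : H.e ≠ 0 := fun h => by have := H.ef; rw [h] at this; simp at this

/-- The preimage in `e^⊥` of a subspace of `e^⊥ / e`. -/
def up (E : Submodule ℂ U') : Submodule ℂ U := LinearMap.ker (Q H.e) ⊓ E.comap H.π

lemma mem_up {E : Submodule ℂ U'} {v : U} : v ∈ H.up E ↔ Q H.e v = 0 ∧ H.π v ∈ E := Iff.rfl

/-- The image in `e^⊥ / e` of a subspace. -/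
def bar (W : Submodule ℂ U) : Submodule ℂ U' := (W ⊓ H.up ⊤).map H.π

lemma mem_bar {W : Submodule ℂ U} {u : U'} :
    u ∈ H.bar W ↔ ∃ v ∈ W, Q H.e v = 0 ∧ H.π v = u :=
  ⟨fun ⟨v, hv, h⟩ => ⟨v, hv.1, hv.2.1, h⟩, fun ⟨v, h1, h2, h3⟩ => ⟨v, ⟨h1, h2, trivial⟩, h3⟩⟩

lemma map_inf_up (W : Submodule ℂ U) (E : Submodule ℂ U') :
    (W ⊓ H.up E).map H.π = H.bar W ⊓ E := by
  ext u
  constructor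
  · rintro ⟨v, hv, rfl⟩
    exact ⟨H.mem_bar.2 ⟨v, hv.1, hv.2.1, rfl⟩, hv.2.2⟩
  · rintro ⟨h1, h2⟩
    obtain ⟨v, hv, hev, rfl⟩ := H.mem_bar.1 h1
    exact ⟨v, ⟨hv, hev, h2⟩, rfl⟩

lemma eq_smul_e {v : U} (h1 : Q H.e v = 0) (h2 : H.π v = 0) : v = Q H.f v • H.e := by
  have := H.decomp v
  rwa [h1, h2, map_zero, zero_add, zero_smul, add_zero] at this

/-- On `e^⊥` the kernel of `π` is the line of `e`. Rank-nullity compares positions in the large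
space with positions in `e^⊥ / e`, up to a shift that records whether `e` belongs to the subspace.
-/
lemma finrank_inf_up_of_mem {W : Submodule ℂ U} (hW : H.e ∈ W) (E : Submodule ℂ U') :
    finrank ℂ (W ⊓ H.up E : Submodule ℂ U) = finrank ℂ (H.bar W ⊓ E : Submodule ℂ U') + 1 := by
  have h := finrank_map_add_inf_ker H.π (W ⊓ H.up E)
  have e : W ⊓ H.up E ⊓ LinearMap.ker H.π = Submodule.span ℂ {H.e} := by
    ext v
    rw [Submodule.mem_span_singleton]
    constructor
    · rintro ⟨⟨-, h1, -⟩, h2⟩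
      exact ⟨_, (H.eq_smul_e h1 h2).symm⟩
    · rintro ⟨c, rfl⟩
      refine ⟨⟨W.smul_mem _ hW, ?_, ?_⟩, ?_⟩
      · change Q H.e _ = 0
        simp [H.ee]
      · change H.π _ ∈ E
        simp [H.πe]
      · change H.π _ = 0
        simp [H.πe]
  rw [H.map_inf_up, e, finrank_span_singleton H.e_ne] at h
  exact h.symm

lemma finrank_inf_up_of_notMem {W : Submodule ℂ U} (hW : H.e ∉ W) (E : Submodule ℂ U') :
    finrank ℂ (W ⊓ H.up E : Submodule ℂ U) = finrank ℂ (H.bar W ⊓ E : Submodule ℂ U') := by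
  have h := finrank_map_add_inf_ker H.π (W ⊓ H.up E)
  have e : W ⊓ H.up E ⊓ LinearMap.ker H.π = ⊥ := by
    rw [eq_bot_iff]
    rintro v ⟨⟨hv, h1, -⟩, h2⟩
    have := H.eq_smul_e h1 h2
    by_cases hc : Q H.f v = 0
    · rw [hc, zero_smul] at this; exact this
    · refine absurd ?_ hW
      rw [this] at hv
      have h3 := W.smul_mem (Q H.f v)⁻¹ hv
      rwa [smul_smul, inv_mul_cancel₀ hc, one_smul] at h3
  rw [H.map_inf_up, e, finrank_bot, add_zero] at h
  exact h.symm

lemma finrank_up (E : Submodule ℂ U') : finrank ℂ (H.up E) = finrank ℂ E + 1 := by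
  have h := H.finrank_inf_up_of_mem (W := ⊤) trivial E
  have : H.bar ⊤ = ⊤ := by
    rw [eq_top_iff]; intro u _
    exact H.mem_bar.2 ⟨H.j u, trivial, H.ej u, H.πj u⟩
  rwa [top_inf_eq, this, top_inf_eq] at h

lemma orthogonal_up (E : Submodule ℂ U') : Q.orthogonal (H.up E) = H.up (Q'.orthogonal E) := by
  ext v
  rw [LinearMap.BilinForm.mem_orthogonal_iff, mem_up, LinearMap.BilinForm.mem_orthogonal_iff]
  constructor
  · intro h
    refine ⟨h _ ⟨H.ee, by change H.π _ ∈ E; rw [H.πe]; exact E.zero_mem⟩, fun u hu => ?_⟩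
    have := h (H.j u) ⟨H.ej u, by change H.π _ ∈ E; rwa [H.πj]⟩
    rwa [← H.jv]
  · rintro ⟨h1, h2⟩ w ⟨hw1, hw2⟩
    have h3 := h2 _ hw2
    replace hw1 : Q H.e w = 0 := hw1
    rw [H.decomp w, hw1]
    simp [H.jv, h1, h3]

lemma bar_isotropic {W : Submodule ℂ U} (hW : W ≤ Q.orthogonal W) :
    H.bar W ≤ Q'.orthogonal (H.bar W) := by
  intro u hu u' hu'
  obtain ⟨v, hv, h1, rfl⟩ := H.mem_bar.1 hu
  obtain ⟨v', hv', h1', rfl⟩ := H.mem_bar.1 hu'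
  have := hW hv v' hv'
  change Q v' v = 0 at this
  rw [← H.jv, H.symm]
  rw [H.decomp v', h1'] at this
  simpa [h1, H.symm (H.j _) v] using this

/-- The extension of an endomorphism of `U'` that fixes the hyperbolic plane. -/
noncomputable def hat (g : U' →ₗ[ℂ] U') : U →ₗ[ℂ] U :=
  H.j ∘ₗ g ∘ₗ H.π + (Q H.f).smulRight H.e + (Q H.e).smulRight H.f

lemma hat_apply (g : U' →ₗ[ℂ] U') (v : U) :
    H.hat g v = H.j (g (H.π v)) + Q H.f v • H.e + Q H.e v • H.f := rfl

lemma e_hat (g : U' →ₗ[ℂ] U') (v : U) : Q H.e (H.hat g v) = Q H.e v := by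
  simp [hat_apply, H.ej, H.ee, H.ef]

lemma π_hat (g : U' →ₗ[ℂ] U') (v : U) : H.π (H.hat g v) = g (H.π v) := by
  simp [hat_apply, H.πj, H.πe, H.πf]

lemma hat_isometry {g : U' →ₗ[ℂ] U'} (hg : ∀ v w, Q' (g v) (g w) = Q' v w) (v w : U) :
    Q (H.hat g v) (H.hat g w) = Q v w := by
  conv_rhs => rw [H.decomp v, H.decomp w]
  simp [hat_apply, H.jj, H.je, H.jf, H.ej, H.fj, H.ee, H.ff, H.ef, H.fe, hg]

/-- The Eichler transformation attached to the isotropic vector `e` and to `u`. -/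
noncomputable def eich (u : U') : U →ₗ[ℂ] U :=
  LinearMap.id + (Q H.e).smulRight (H.j u) - (Q (H.j u)).smulRight H.e -
    (Q' u u / 2) • (Q H.e).smulRight H.e

lemma eich_apply (u : U') (v : U) : H.eich u v =
    v + Q H.e v • H.j u - Q (H.j u) v • H.e - (Q' u u / 2) • Q H.e v • H.e := rfl

lemma e_eich (u : U') (v : U) : Q H.e (H.eich u v) = Q H.e v := by
  simp [eich_apply, H.ej, H.ee]

lemma π_eich (u : U') (v : U) : H.π (H.eich u v) = H.π v + Q H.e v • u := by
  simp [eich_apply, H.πj, H.πe]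

lemma eich_e (u : U') : H.eich u H.e = H.e := by simp [eich_apply, H.ee, H.je]

lemma eich_j (u w : U') : H.eich u (H.j w) = H.j w - Q' u w • H.e := by
  simp [eich_apply, H.ej, H.jj]

lemma eich_f (u : U') : H.eich u H.f = H.f + H.j u - (Q' u u / 2) • H.e := by
  simp [eich_apply, H.ef, H.jf]

lemma eich_isometry (u : U') (v w : U) : Q (H.eich u v) (H.eich u w) = Q v w := by
  simp only [eich_apply, map_add, map_sub, map_smul, LinearMap.add_apply, LinearMap.sub_apply,
    LinearMap.smul_apply, smul_eq_mul, H.jj, H.je, H.ej, H.ee, H.symm v H.e, H.symm v (H.j u)]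
  ring

/-- The general form of the lifts. -/
noncomputable def lift (g : U' →ₗ[ℂ] U') (u : U') : U →ₗ[ℂ] U := H.hat g ∘ₗ H.eich u

lemma lift_isometry {g : U' →ₗ[ℂ] U'} (hg : ∀ v w, Q' (g v) (g w) = Q' v w) (u : U') (v w : U) :
    Q (H.lift g u v) (H.lift g u w) = Q v w :=
  (H.hat_isometry hg _ _).trans (H.eich_isometry u v w)

lemma e_lift (g : U' →ₗ[ℂ] U') (u : U') (v : U) : Q H.e (H.lift g u v) = Q H.e v :=
  (H.e_hat g _).trans (H.e_eich u v)

lemma π_lift (g : U' →ₗ[ℂ] U') (u : U') (v : U) (hv : Q H.e v = 0) :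
    H.π (H.lift g u v) = g (H.π v) := by
  rw [lift, LinearMap.comp_apply, π_hat, π_eich, hv, zero_smul, add_zero]

lemma map_lift_up {g : U' →ₗ[ℂ] U'} (u : U') {E : Submodule ℂ U'} (h : E.map g ≤ E) :
    (H.up E).map (H.lift g u) ≤ H.up E := by
  rintro _ ⟨v, ⟨hv, hv'⟩, rfl⟩
  exact ⟨(H.e_lift g u v).trans hv, by
    change H.π _ ∈ E
    rw [H.π_lift g u v hv]; exact h ⟨_, hv', rfl⟩⟩

/-- An Eichler transformation acts trivially on `e^⊥` modulo `e`, so only `g` is visible on `e^⊥ /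
e`. -/
lemma bar_map_lift (g : U' →ₗ[ℂ] U') (u : U') (W : Submodule ℂ U) :
    H.bar (W.map (H.lift g u)) = (H.bar W).map g := by
  ext x
  rw [mem_bar]
  constructor
  · rintro ⟨_, ⟨v, hv, rfl⟩, h1, rfl⟩
    rw [e_lift] at h1
    exact ⟨H.π v, H.mem_bar.2 ⟨v, hv, h1, rfl⟩, (H.π_lift g u v h1).symm⟩
  · rintro ⟨y, hy, rfl⟩
    obtain ⟨v, hv, h1, rfl⟩ := H.mem_bar.1 hy
    exact ⟨_, ⟨v, hv, rfl⟩, by rw [e_lift, h1], H.π_lift g u v h1⟩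

/-- The list of subspaces obtained from a list in the smaller quadratic space. -/
def ups (Es : List (Submodule ℂ U')) : List (Submodule ℂ U) := ⊥ :: ⊤ :: Es.map H.up

lemma lift_ups {Es : List (Submodule ℂ U')} {g : U' →ₗ[ℂ] U'} (hg : ∀ E ∈ Es, E.map g ≤ E)
    (u : U') : ∀ E ∈ H.ups Es, E.map (H.lift g u) ≤ E := by
  intro E hE
  simp only [ups, List.mem_cons, List.mem_map] at hE
  rcases hE with rfl | rfl | ⟨E', hE', rfl⟩
  · simp
  · exact le_top
  · exact H.map_lift_up u (hg E' hE')

lemma regVec_lift {ι : Type} {T : Set (ι → ℂ)} {g : (ι → ℂ) → U' →ₗ[ℂ] U'} (hg : RegVec T g)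
    {u : (ι → ℂ) → U'} (hu : RegVec T u) : RegVec T fun t => H.lift (g t) (u t) := by
  refine RegVec.comp ?_ ?_
  · exact (((RegVec.const H.j).comp (hg.comp (RegVec.const H.π))).add (RegVec.const _)).add
      (RegVec.const _)
  · refine regVec_hom_iff.2 fun v => ?_
    simp only [eich_apply]
    refine (((RegVec.const v).add (RegVec.smul (RegOn.const _) (hu.linear H.j))).sub
      (RegVec.smul (regVec_scalar.1 ?_) (RegVec.const _))).sub
      (RegVec.smul ?_ (RegVec.const _))
    · exact RegVec.bilin Q (hu.linear H.j) (RegVec.const v)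
    · simp only [div_eq_mul_inv]
      exact (regVec_scalar.1 (RegVec.bilin Q' hu hu)).mul (RegOn.const _)

end HypSplit

end Isotropic

/-! ### Schubert cells of isotropic subspaces, by induction on hyperbolic planes -/

section Isotropic

variable {U U' : Type} [AddCommGroup U] [Module ℂ U] [FiniteDimensional ℂ U]
  [AddCommGroup U'] [Module ℂ U'] [FiniteDimensional ℂ U']

/-- A list of subspaces that contains a complete chain and consists of its members. -/
def IsFlagSet (Es : List (Submodule ℂ U)) : Prop :=
  ⊥ ∈ Es ∧ ⊤ ∈ Es ∧ ∀ P : Submodule ℂ U → Prop, P ⊥ → ¬ P ⊤ → (∀ E E', E ≤ E' → P E' → P E) →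
    ∃ E₁ ∈ Es, ∃ E₂ ∈ Es, P E₁ ∧ ¬ P E₂ ∧ E₁ ≤ E₂ ∧ finrank ℂ E₂ ≤ finrank ℂ E₁ + 1 ∧
      ∀ E ∈ Es, E ≤ E₁ ∨ E₂ ≤ E

namespace HypSplit

variable {Q : LinearMap.BilinForm ℂ U} {Q' : LinearMap.BilinForm ℂ U'} (H : HypSplit Q Q')
  {Es : List (Submodule ℂ U')} {W W₀ : Submodule ℂ U}

lemma up_mono {E E' : Submodule ℂ U'} (h : E ≤ E') : H.up E ≤ H.up E' :=
  fun _ hv => ⟨hv.1, h hv.2⟩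

/-- The new chain is `⊥`, then `up ⊥` (the line of `e`), the preimages of the old chain, `up ⊤ =
e^⊥`, and `⊤`. The property fails for the first time at the first step, inside the old chain, or at
the last step. -/
lemma isFlagSet_ups (h : IsFlagSet Es) : IsFlagSet (H.ups Es) := by
  obtain ⟨hb, ht, hP⟩ := h
  refine ⟨by simp [ups], by simp [ups], fun P P0 P1 Pm => ?_⟩
  have hmem : ∀ E ∈ Es, H.up E ∈ H.ups Es := fun E hE => by simp [ups]; exact Or.inr (Or.inr ⟨E, hE, rfl⟩)
  have hcases : ∀ E ∈ H.ups Es, E = ⊥ ∨ E = ⊤ ∨ ∃ E' ∈ Es, H.up E' = E := fun E hE => by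
    simpa [ups] using hE
  by_cases h0 : P (H.up ⊥)
  · by_cases h1 : P (H.up ⊤)
    · refine ⟨H.up ⊤, hmem _ ht, ⊤, by simp [ups], h1, P1, le_top, ?_, fun E hE => ?_⟩
      · have h2 := LinearMap.finrank_range_add_finrank_ker (Q H.e)
        have h3 := Submodule.finrank_le (LinearMap.range (Q H.e))
        have h4 : H.up ⊤ = LinearMap.ker (Q H.e) := by
          ext v; exact ⟨fun h => h.1, fun h => ⟨h, trivial⟩⟩
        rw [finrank_top, h4]
        rw [finrank_self] at h3
        omega
      · rcases hcases E hE with rfl | rfl | ⟨E', -, rfl⟩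
        · exact Or.inl bot_le
        · exact Or.inr le_rfl
        · exact Or.inl (H.up_mono le_top)
    · obtain ⟨E₁, hE₁, E₂, hE₂, p1, p2, hle, hf, hc⟩ := hP (fun E => P (H.up E)) h0 h1
        fun E E' h => Pm _ _ (H.up_mono h)
      refine ⟨_, hmem _ hE₁, _, hmem _ hE₂, p1, p2, H.up_mono hle, ?_, fun E hE => ?_⟩
      · rw [H.finrank_up, H.finrank_up]; omega
      · rcases hcases E hE with rfl | rfl | ⟨E', hE', rfl⟩
        · exact Or.inl bot_le
        · exact Or.inr le_top
        · exact (hc E' hE').imp H.up_mono H.up_mono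
  · refine ⟨⊥, by simp [ups], H.up ⊥, hmem _ hb, P0, h0, bot_le, ?_, fun E hE => ?_⟩
    · rw [H.finrank_up, finrank_bot, finrank_bot]
    · rcases hcases E hE with rfl | rfl | ⟨E', -, rfl⟩
      · exact Or.inl le_rfl
      · exact Or.inr le_top
      · exact Or.inr (H.up_mono bot_le)

lemma orthogonal_mem_ups (hn : ∀ x, (∀ y, Q x y = 0) → x = 0)
    (h : ∀ E ∈ Es, Q'.orthogonal E ∈ Es) : ∀ E ∈ H.ups Es, Q.orthogonal E ∈ H.ups Es := by
  intro E hE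
  simp only [ups, List.mem_cons, List.mem_map] at hE ⊢
  rcases hE with rfl | rfl | ⟨E', hE', rfl⟩
  · refine Or.inr (Or.inl (eq_top_iff.2 fun v _ w hw => ?_))
    rw [(Submodule.mem_bot ℂ).1 hw]
    exact LinearMap.map_zero₂ Q v
  · refine Or.inl (eq_bot_iff.2 fun v hv => hn v fun y => ?_)
    rw [H.symm]; exact hv y trivial
  · exact Or.inr (Or.inr ⟨_, h E' hE', (H.orthogonal_up E').symm⟩)

lemma e_mem_iff : H.e ∈ W ↔ finrank ℂ (W ⊓ H.up ⊥ : Submodule ℂ U) = 1 := by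
  constructor
  · intro h
    rw [H.finrank_inf_up_of_mem h, inf_bot_eq, finrank_bot]
  · intro h
    by_contra h'
    rw [H.finrank_inf_up_of_notMem h', inf_bot_eq, finrank_bot] at h
    exact zero_ne_one h

lemma le_up_iff : W ≤ H.up ⊤ ↔ finrank ℂ (W ⊓ H.up ⊤ : Submodule ℂ U) = finrank ℂ W := by
  constructor
  · intro h; rw [inf_eq_left.2 h]
  · intro h
    exact inf_eq_left.1 (Submodule.eq_of_le_of_finrank_eq inf_le_left h)

lemma sameDims_of_bar (he : H.e ∈ W ↔ H.e ∈ W₀) (hb : SameDims Es (H.bar W) (H.bar W₀))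
    (hf : finrank ℂ W = finrank ℂ W₀) : SameDims (H.ups Es) W W₀ := by
  intro E hE
  simp only [ups, List.mem_cons, List.mem_map] at hE
  rcases hE with rfl | rfl | ⟨E', hE', rfl⟩
  · rw [inf_bot_eq, inf_bot_eq]
  · rw [inf_top_eq, inf_top_eq, hf]
  · by_cases h : H.e ∈ W₀
    · rw [H.finrank_inf_up_of_mem h, H.finrank_inf_up_of_mem (he.2 h), hb E' hE']
    · rw [H.finrank_inf_up_of_notMem h, H.finrank_inf_up_of_notMem (mt he.1 h), hb E' hE']

variable (hbt : ⊥ ∈ Es ∧ ⊤ ∈ Es)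

-- The tests `up ⊥` (the line of `e`) and `up ⊤ = e^⊥` detect whether `W` contains `e` and whether
-- it lies in `e^⊥`. Hence all subspaces in one position fall into the same case of the induction.
include hbt in
lemma of_sameDims (h : SameDims (H.ups Es) W W₀) :
    (H.e ∈ W ↔ H.e ∈ W₀) ∧ (W ≤ H.up ⊤ ↔ W₀ ≤ H.up ⊤) ∧ SameDims Es (H.bar W) (H.bar W₀) ∧
      finrank ℂ W = finrank ℂ W₀ := by
  have hmem : ∀ E ∈ Es, H.up E ∈ H.ups Es := fun E hE => by
    simp [ups]; exact Or.inr (Or.inr ⟨E, hE, rfl⟩)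
  have hf : finrank ℂ W = finrank ℂ W₀ := h.finrank_eq (by simp [ups])
  have he : H.e ∈ W ↔ H.e ∈ W₀ := by
    rw [e_mem_iff, e_mem_iff, h _ (hmem _ hbt.1)]
  refine ⟨he, by rw [le_up_iff, le_up_iff, h _ (hmem _ hbt.2), hf], fun E hE => ?_, hf⟩
  have h2 := h _ (hmem _ hE)
  by_cases h1 : H.e ∈ W₀
  · rw [H.finrank_inf_up_of_mem h1, H.finrank_inf_up_of_mem (he.2 h1)] at h2
    omega
  · rwa [H.finrank_inf_up_of_notMem h1, H.finrank_inf_up_of_notMem (mt he.1 h1)] at h2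

lemma regFam_bar {ι : Type} {T : Set (ι → ℂ)} {W : (ι → ℂ) → Submodule ℂ U} (hW : RegFam T W)
    {r s : ℕ} (hr : ∀ t ∈ T, finrank ℂ (W t ⊓ H.up ⊤ : Submodule ℂ U) = r)
    (hs : ∀ t ∈ T, finrank ℂ (H.bar (W t)) = s) : RegFam T fun t => H.bar (W t) :=
  RegFam.map (RegVec.const _) (hW.inf (RegFam.const _) hr) hs

lemma Q_of_perp {v w : U} (hv : Q H.e v = 0) (hw : Q H.e w = 0) : Q v w = Q' (H.π v) (H.π w) := by
  conv_lhs => rw [H.decomp v, hv]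
  simp [H.jv, hw]

lemma mem_of_bar {v : U} (he : H.e ∈ W) (h1 : Q H.e v = 0) (h2 : H.π v ∈ H.bar W) : v ∈ W := by
  obtain ⟨w, hw, hew, hπ⟩ := H.mem_bar.1 h2
  have := H.eq_smul_e (v := v - w) (by simp [h1, hew]) (by simp [hπ])
  rw [sub_eq_iff_eq_add] at this
  rw [this]
  exact W.add_mem (W.smul_mem _ he) hw

include hbt in
lemma regFam_bar_of_mem {ι : Type} {T : Set (ι → ℂ)} {W : (ι → ℂ) → Submodule ℂ U}
    (hW : RegFam T W) (hC : ∀ t ∈ T, W t ∈ isoClass Q (H.ups Es) W₀) :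
    RegFam T fun t => H.bar (W t) := by
  refine H.regFam_bar hW (r := finrank ℂ (W₀ ⊓ H.up ⊤ : Submodule ℂ U))
    (s := finrank ℂ (H.bar W₀)) (fun t ht => ?_) (fun t ht => ?_)
  · exact (hC t ht).2 _ (by simp [ups]; exact Or.inr (Or.inr ⟨⊤, hbt.2, rfl⟩))
  · exact (H.of_sameDims hbt (hC t ht).2).2.2.1.finrank_eq hbt.2

variable (hn : ∀ x, (∀ y, Q x y = 0) → x = 0) (hn' : ∀ x, (∀ y, Q' x y = 0) → x = 0)

-- An isotropic subspace containing `e` lies between `e` and `e^⊥`, so it is the preimage of its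
-- image in `e^⊥ / e` and needs no new parameter.
include hbt hn in
lemma isIsoCell_of_mem (hW₀ : W₀ ≤ Q.orthogonal W₀)
    (ih : IsIsoCell Q' Es (isoClass Q' Es (H.bar W₀))) (he : H.e ∈ W₀) :
    IsIsoCell Q (H.ups Es) (isoClass Q (H.ups Es) W₀) := by
  obtain ⟨D, _, _, _, g, B, g1, g2, g3, g4, g5, g6, g7⟩ := ih
  have hl : ∀ {W : Submodule ℂ U}, W ≤ Q.orthogonal W → H.e ∈ W → W ≤ H.up ⊤ :=
    fun hW he v hv => ⟨hW hv _ he, trivial⟩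
  have hfr : ∀ {W : Submodule ℂ U}, W ≤ Q.orthogonal W → H.e ∈ W →
      finrank ℂ W = finrank ℂ (H.bar W) + 1 := fun hW he => by
    have := H.finrank_inf_up_of_mem he ⊤
    rwa [inf_eq_left.2 (hl hW he), inf_top_eq] at this
  have heB : H.e ∈ H.up B := ⟨H.ee, by
    change H.π _ ∈ B
    rw [H.πe]; exact B.zero_mem⟩
  have hbB : H.bar (H.up B) = B := by
    ext u
    rw [mem_bar]
    constructor
    · rintro ⟨v, hv, -, rfl⟩; exact hv.2
    · intro hu
      exact ⟨H.j u, ⟨H.ej u, by change H.π _ ∈ B; rwa [H.πj]⟩, H.ej u, H.πj u⟩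
  have hBi : H.up B ≤ Q.orthogonal (H.up B) := by
    rintro v ⟨hv, hv'⟩ w ⟨hw, hw'⟩
    change Q w v = 0
    rw [H.Q_of_perp hw hv]
    exact g3.1 hv' _ hw'
  have hli : ∀ d v w, Q (H.lift (g d) 0 v) (H.lift (g d) 0 w) = Q v w :=
    fun d => H.lift_isometry (g1 d) 0
  refine ⟨D, inferInstance, inferInstance, inferInstance, fun d => H.lift (g d) 0, H.up B, hli,
    fun d => H.lift_ups (g2 d) 0, ⟨hBi, ?_⟩, ?_, ?_, ?_, ?_⟩
  · refine H.sameDims_of_bar (iff_of_true heB he) ?_ ?_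
    · rw [hbB]; exact g3.2
    · rw [hfr hBi heB, hfr hW₀ he, hbB, g3.2.finrank_eq hbt.2]
  · rintro W ⟨hWi, hW⟩
    obtain ⟨h1, h2, h3, h4⟩ := H.of_sameDims hbt hW
    obtain ⟨d, hd⟩ := g4 (H.bar W) ⟨H.bar_isotropic hWi, h3⟩
    refine ⟨d, Submodule.eq_of_le_of_finrank_eq ?_ ?_⟩
    · rintro _ ⟨v, ⟨hv, hv'⟩, rfl⟩
      refine H.mem_of_bar (h1.2 he) ((H.e_lift _ _ _).trans hv) ?_
      rw [H.π_lift _ _ _ hv, ← hd]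
      exact ⟨_, hv', rfl⟩
    · rw [finrank_map_inj (isometry_injective hn (hli d)), hfr hBi heB, hbB, h4, hfr hW₀ he,
        g3.2.finrank_eq hbt.2]
  · intro d d' hdd
    refine g5 d d' ?_
    have := congrArg H.bar hdd
    rwa [bar_map_lift, bar_map_lift, hbB] at this
  · exact fun ι T f hf => H.regVec_lift (g6 ι T f hf) (RegVec.const 0)
  · intro ι T f W hW hC hBW
    refine g7 ι T f _ (H.regFam_bar_of_mem hbt hW hC) (fun t ht =>
      ⟨H.bar_isotropic (hC t ht).1, (H.of_sameDims hbt (hC t ht).2).2.2.1⟩) fun t ht => ?_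
    rw [← hBW t ht, bar_map_lift, hbB]

lemma lift_eq (g : U' →ₗ[ℂ] U') (u : U') : H.lift g u = H.lift g 0 ∘ₗ H.eich u := by
  have : H.eich 0 = LinearMap.id := by
    refine LinearMap.ext fun v => ?_
    simp [eich_apply]
  rw [lift, lift, this]; rfl

include hn in
lemma eich_injective (u : U') : Function.Injective (H.eich u) :=
  isometry_injective hn (H.eich_isometry u)

/-- The complement of an orthogonal space separates the functionals on a subspace. -/
lemma exists_perp_compl (B : Submodule ℂ U') : ∃ D₂ : Submodule ℂ U',
    Q'.orthogonal B ⊓ D₂ = ⊥ ∧ Q'.orthogonal B ⊔ D₂ = ⊤ := by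
  obtain ⟨D₂, h⟩ := (Q'.orthogonal B).exists_isCompl
  exact ⟨D₂, h.inf_eq_bot, h.sup_eq_top⟩

-- A subspace of `e^⊥` that avoids `e` is the graph, over its image `B` in `U'`, of a functional
-- with values in the line of `e`. The Eichler transformation of `u` produces the functional `-Q'(u,
-- ·)`, and every functional on `B` arises from a unique `u` in a complement `D₂` of `B^⊥`. The new
-- parameter is this `u`.
include hbt hn hn' in
lemma isIsoCell_of_le
    (ih : IsIsoCell Q' Es (isoClass Q' Es (H.bar W₀))) (he : H.e ∉ W₀) (hle : W₀ ≤ H.up ⊤) :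
    IsIsoCell Q (H.ups Es) (isoClass Q (H.ups Es) W₀) := by
  obtain ⟨D, _, _, _, g, B, g1, g2, g3, g4, g5, g6, g7⟩ := ih
  have hs' : ∀ x y, Q' x y = Q' y x := fun x y => by rw [← H.jj, H.symm, H.jj]
  have hij : Function.Injective H.j := fun x y h => by rw [← H.πj x, h, H.πj]
  have hfr : ∀ {W : Submodule ℂ U}, W ≤ H.up ⊤ → H.e ∉ W →
      finrank ℂ W = finrank ℂ (H.bar W) := fun hW he => by
    have := H.finrank_inf_up_of_notMem he ⊤
    rwa [inf_eq_left.2 hW, inf_top_eq] at this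
  obtain ⟨D₂, hD₂, hD₂'⟩ := exists_perp_compl (Q' := Q') B
  have huniq : ∀ u ∈ D₂, (∀ w ∈ B, Q' u w = 0) → u = 0 := fun u hu h => by
    have : u ∈ Q'.orthogonal B ⊓ D₂ := ⟨fun w hw => by
      change Q' w u = 0
      rw [hs']; exact h w hw, hu⟩
    rwa [hD₂] at this
  let B₀ := B.map H.j
  have heB : H.e ∉ B₀ := by
    rintro ⟨u, hu, h⟩
    have h1 := H.jf u
    rw [h, H.ef] at h1
    exact one_ne_zero h1
  have hBle : B₀ ≤ H.up ⊤ := by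
    rintro _ ⟨u, -, rfl⟩
    exact ⟨H.ej u, trivial⟩
  have hbB : H.bar B₀ = B := by
    ext u
    rw [mem_bar]
    constructor
    · rintro ⟨_, ⟨w, hw, rfl⟩, -, rfl⟩; rwa [H.πj]
    · exact fun hu => ⟨H.j u, ⟨u, hu, rfl⟩, H.ej u, H.πj u⟩
  have hBi : B₀ ≤ Q.orthogonal B₀ := by
    rintro _ ⟨v, hv, rfl⟩ _ ⟨w, hw, rfl⟩
    change Q (H.j w) (H.j v) = 0
    rw [H.jj]
    exact g3.1 hv _ hw
  have hli : ∀ (d : D) (u : U') v w, Q (H.lift (g d) u v) (H.lift (g d) u w) = Q v w :=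
    fun d u => H.lift_isometry (g1 d) u
  have hinj : ∀ d u, Function.Injective (H.lift (g d) u) := fun d u =>
    isometry_injective hn (hli d u)
  have heE : ∀ u, H.e ∉ B₀.map (H.eich u) := by
    rintro u ⟨x, hx, hxe⟩
    have : x = H.e := H.eich_injective hn u (by rw [hxe, H.eich_e])
    exact heB (this ▸ hx)
  -- If the two functionals differed at `w`, the common graph would contain a non-zero multiple of
  -- `e`.
  have hpos : ∀ (u u' : D₂), B₀.map (H.eich u) = B₀.map (H.eich u') → u = u' := by
    intro u u' h
    refine sub_eq_zero.1 (Subtype.ext (huniq _ (u - u').2 fun w hw => ?_))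
    have h1 : H.eich u (H.j w) ∈ B₀.map (H.eich u') := h ▸ ⟨_, ⟨w, hw, rfl⟩, rfl⟩
    have h2 : H.eich u' (H.j w) ∈ B₀.map (H.eich u') := ⟨_, ⟨w, hw, rfl⟩, rfl⟩
    have h3 := Submodule.sub_mem _ h2 h1
    rw [H.eich_j, H.eich_j, sub_sub_sub_cancel_left, ← sub_smul] at h3
    by_contra hne
    refine heE u' ?_
    have h4 := Submodule.smul_mem _ (Q' (u - u' : U') w)⁻¹ h3
    rw [map_sub, LinearMap.sub_apply] at h4
    have hne' : Q' u w - Q' u' w ≠ 0 := by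
      have e : ((u - u' : D₂) : U') = (u : U') - u' := rfl
      rw [e, map_sub, LinearMap.sub_apply] at hne
      exact hne
    rwa [smul_smul, inv_mul_cancel₀ hne', one_smul] at h4
  refine ⟨D × D₂, inferInstance, inferInstance, inferInstance,
    fun d => H.lift (g d.1) d.2, B₀, fun d => hli d.1 d.2,
    fun d => H.lift_ups (g2 d.1) d.2, ⟨hBi, ?_⟩, ?_, ?_, ?_, ?_⟩
  · refine H.sameDims_of_bar (iff_of_false heB he) ?_ ?_
    · rw [hbB]; exact g3.2
    · rw [hfr hBle heB, hfr hle he, hbB, g3.2.finrank_eq hbt.2]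
  · rintro W ⟨hWi, hW⟩
    obtain ⟨h1, h2, h3, h4⟩ := H.of_sameDims hbt hW
    obtain ⟨d, hd⟩ := g4 (H.bar W) ⟨H.bar_isotropic hWi, h3⟩
    let W₁ := W.comap (H.lift (g d) 0)
    have hsurj : LinearMap.range (H.lift (g d) 0) = ⊤ := LinearMap.range_eq_top.2
      (LinearMap.injective_iff_surjective.1 (hinj d 0))
    have hW₁ : W₁.map (H.lift (g d) 0) = W := by
      rw [Submodule.map_comap_eq, hsurj, top_inf_eq]
    have hbW₁ : H.bar W₁ = B := by
      refine Submodule.map_injective_of_injective (isometry_injective hn' (g1 d)) ?_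
      rw [← H.bar_map_lift (g d) 0, hW₁, hd]
    have hW₁e : ∀ v ∈ W₁, Q H.e v = 0 := fun v hv => by
      have : Q H.e (H.lift (g d) 0 v) = 0 := ((h2.2 hle) hv).1
      rwa [e_lift] at this
    have hW₁n : H.e ∉ W₁ := fun h => by
      have h5 : H.lift (g d) 0 H.e ∈ W := h
      have h6 : H.lift (g d) 0 H.e = H.e := by
        rw [lift, LinearMap.comp_apply, eich_e, hat_apply, H.πe, H.ee, H.fe]; simp
      exact he (h1.1 (h6 ▸ h5))
    -- The left inverse `r` lifts vectors of `B` to `W₁`. The coefficient of `e` in the lift,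
    -- extended to all of `U'`, is represented up to sign by a vector `u`; its component in `B^⊥`
    -- does not matter and only the component `u₂` in `D₂` is kept.
    obtain ⟨r, hr⟩ := (H.π ∘ₗ W₁.subtype).exists_leftInverse_of_injective (by
      refine LinearMap.ker_eq_bot'.2 fun v hv => ?_
      have h5 := H.eq_smul_e (hW₁e v v.2) hv
      by_cases hc : Q H.f v = 0
      · rw [hc, zero_smul] at h5; exact Subtype.ext h5
      · refine absurd ?_ hW₁n
        have h6 := W₁.smul_mem (Q H.f v)⁻¹ v.2
        rwa [h5, smul_smul, map_smul, H.fe, smul_eq_mul, mul_one, inv_mul_cancel₀ hc,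
          one_smul] at h6)
    obtain ⟨u, hu⟩ := exists_represent hn' (-(Q H.f ∘ₗ W₁.subtype ∘ₗ r))
    obtain ⟨u₁, hu₁, u₂, hu₂, rfl⟩ := Submodule.mem_sup.1
      (show u ∈ Q'.orthogonal B ⊔ D₂ from hD₂'.symm ▸ Submodule.mem_top)
    refine ⟨(d, ⟨u₂, hu₂⟩), ?_⟩
    change B₀.map (H.lift (g d) u₂) = W
    rw [lift_eq, Submodule.map_comp, ← hW₁]
    congr 1
    symm
    refine Submodule.eq_of_le_of_finrank_eq ?_ ?_
    · intro v hv
      have hvB : H.π v ∈ B := hbW₁ ▸ H.mem_bar.2 ⟨v, hv, hW₁e v hv, rfl⟩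
      refine ⟨H.j (H.π v), ⟨_, hvB, rfl⟩, ?_⟩
      have h5 : Q' u₂ (H.π v) = - Q H.f v := by
        have h6 := hu (H.π v)
        have h7 : r (H.π v) = ⟨v, hv⟩ := LinearMap.congr_fun hr ⟨v, hv⟩
        have h8 : Q' u₁ (H.π v) = 0 := by rw [hs']; exact hu₁ _ hvB
        rw [map_add, LinearMap.add_apply, h8, zero_add] at h6
        rw [h6]
        simp [h7]
      rw [eich_j, h5]
      conv_rhs => rw [H.decomp v, hW₁e v hv]
      simp
    · rw [finrank_map_inj (H.eich_injective hn u₂), ← finrank_map_inj (hinj d 0), hW₁, h4,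
        hfr hle he, hfr hBle heB, hbB, g3.2.finrank_eq hbt.2]
  · rintro ⟨d, u⟩ ⟨d', u'⟩ hdd
    have hd : d = d' := by
      refine g5 d d' ?_
      have := congrArg H.bar hdd
      rwa [bar_map_lift, bar_map_lift, hbB] at this
    subst hd
    refine Prod.ext rfl (hpos u u' ?_)
    simp only at hdd
    rw [H.lift_eq _ u, H.lift_eq _ u', Submodule.map_comp, Submodule.map_comp] at hdd
    exact Submodule.map_injective_of_injective (hinj d 0) hdd
  · exact fun ι T f hf => H.regVec_lift (g6 ι T _ (hf.linear (LinearMap.fst ℂ D D₂)))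
      (hf.linear (D₂.subtype ∘ₗ LinearMap.snd ℂ D D₂))
  · intro ι T f W hW hC hBW
    have hd : RegVec T fun t => (f t).1 := g7 ι T _ _ (H.regFam_bar_of_mem hbt hW hC) (fun t ht =>
      ⟨H.bar_isotropic (hC t ht).1, (H.of_sameDims hbt (hC t ht).2).2.2.1⟩) fun t ht => by
        rw [← hBW t ht, bar_map_lift, hbB]
    have hcomap : ∀ t ∈ T, (W t).comap (H.lift (g (f t).1) 0) = B₀.map (H.eich (f t).2) :=
      fun t ht => by
        have h : W t = (B₀.map (H.eich (f t).2)).map (H.lift (g (f t).1) 0)  :=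
          (hBW t ht).symm.trans ((congrArg (fun g => B₀.map g)
            (H.lift_eq (g (f t).1) ((f t).2 : U'))).trans (Submodule.map_comp _ _ _))
        rw [h, Submodule.comap_map_eq_of_injective (hinj _ 0)]
    have hW₁ : RegFam T fun t => B₀.map (H.eich (f t).2) :=
      (RegFam.comap (H.regVec_lift (g6 ι T _ hd) (RegVec.const 0)) hW (r := finrank ℂ B₀)
        fun t ht => by
          rw [hcomap t ht, finrank_map_inj (H.eich_injective hn _)]).congr
        fun t ht => (hcomap t ht).symm
    have hu : RegVec T fun t => (f t).2 := by
      -- The conditions `j w - Q'(u, w) e ∈ W₁` for `w ∈ B` are affine in `u` and determine it.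
      refine RegFam.solve_hom (F := D₂) (G := B) hW₁
        (L := fun _ => -(((LinearMap.llcomp ℂ U' ℂ U (LinearMap.toSpanSingleton ℂ U H.e)) ∘ₗ
          (Q' ∘ₗ D₂.subtype)).compl₂ B.subtype)) (RegVec.const _)
        (f := fun _ => H.j ∘ₗ B.subtype) (RegVec.const _) ?_ ?_
      · intro t _ v hv
        refine Subtype.ext (huniq _ v.2 fun w hw => ?_)
        have h1 := hv ⟨w, hw⟩
        by_contra hne
        refine heE (f t).2 ?_
        have h2 := Submodule.smul_mem _ (-(Q' v w)⁻¹) h1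
        have h3 : ((-(((LinearMap.llcomp ℂ U' ℂ U (LinearMap.toSpanSingleton ℂ U H.e)) ∘ₗ
          (Q' ∘ₗ D₂.subtype)).compl₂ B.subtype)) v) ⟨w, hw⟩ = -(Q' v w • H.e) := rfl
        rwa [h3, neg_smul, smul_neg, neg_neg, smul_smul, inv_mul_cancel₀ hne, one_smul] at h2
      · intro t _ w
        refine ⟨H.j w, ⟨w, w.2, rfl⟩, ?_⟩
        rw [eich_j, sub_eq_neg_add]
        rfl
    exact hd.pair hu

-- Such a subspace contains a vector `f + j u + s e`, with `u` unique modulo `B`, the image of its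
-- part in `e^⊥`. Isotropy forces `s = -Q'(u, u) / 2` and makes the part in `e^⊥` the graph of
-- `-Q'(u, ·)` over `B`. This is the image of `B ⊕ ℂ f` under the Eichler transformation of `u`, so
-- a complement of `B` is the new parameter space.
include hbt hn hn' in
lemma isIsoCell_of_not_le (hW₀ : W₀ ≤ Q.orthogonal W₀)
    (ih : IsIsoCell Q' Es (isoClass Q' Es (H.bar W₀))) (hle : ¬ W₀ ≤ H.up ⊤) :
    IsIsoCell Q (H.ups Es) (isoClass Q (H.ups Es) W₀) := by
  obtain ⟨D, _, _, _, g, B, g1, g2, g3, g4, g5, g6, g7⟩ := ih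
  have hs' : ∀ x y, Q' x y = Q' y x := fun x y => by rw [← H.jj, H.symm, H.jj]
  have hij : Function.Injective H.j := fun x y h => by rw [← H.πj x, h, H.πj]
  have hex : ∀ {W : Submodule ℂ U}, ¬ W ≤ H.up ⊤ → ∃ v ∈ W, Q H.e v = 1 := fun {W} hW => by
    obtain ⟨v, hv, hv'⟩ := Set.not_subset.1 hW
    have hne : Q H.e v ≠ 0 := fun h => hv' ⟨h, trivial⟩
    exact ⟨(Q H.e v)⁻¹ • v, W.smul_mem _ hv, by simp [hne]⟩
  have hnm : ∀ {W : Submodule ℂ U}, W ≤ Q.orthogonal W → ¬ W ≤ H.up ⊤ → H.e ∉ W :=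
    fun hWi hW he => by
      obtain ⟨v, hv, hv'⟩ := hex hW
      have h1 : Q H.e v = 0 := hWi hv _ he
      rw [h1] at hv'; exact zero_ne_one hv'
  have hfr : ∀ {W : Submodule ℂ U}, W ≤ Q.orthogonal W → ¬ W ≤ H.up ⊤ →
      finrank ℂ W = finrank ℂ (H.bar W) + 1 := fun {W} hWi hW => by
    have h1 := H.finrank_inf_up_of_notMem (hnm hWi hW) ⊤
    rw [inf_top_eq] at h1
    obtain ⟨v, hv, hv'⟩ := hex hW
    have h2 := finrank_map_add_inf_ker (Q H.e) W
    have h3 : W.map (Q H.e) = ⊤ := by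
      rw [eq_top_iff]
      intro c _
      exact ⟨c • v, W.smul_mem _ hv, by simp [hv']⟩
    have h4 : H.up ⊤ = LinearMap.ker (Q H.e) := by
      ext v; exact ⟨fun h => h.1, fun h => ⟨h, trivial⟩⟩
    rw [h3, finrank_top, finrank_self, ← h4] at h2
    omega
  obtain ⟨D₂, hD₂⟩ := B.exists_isCompl
  have huniq : ∀ u ∈ D₂, u ∈ B → u = 0 := fun u hu h => by
    have : u ∈ B ⊓ D₂ := ⟨h, hu⟩
    rwa [hD₂.inf_eq_bot] at this
  let B₀ := B.map H.j ⊔ Submodule.span ℂ {H.f}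
  have hmem : ∀ {v}, v ∈ B₀ ↔ H.π v ∈ B ∧ Q H.f v = 0 := by
    intro v
    rw [Submodule.mem_sup]
    constructor
    · rintro ⟨_, ⟨u, hu, rfl⟩, _, hz, rfl⟩
      obtain ⟨c, rfl⟩ := Submodule.mem_span_singleton.1 hz
      exact ⟨by simpa [H.πj, H.πf] using hu, by simp [H.fj, H.ff]⟩
    · rintro ⟨h1, h2⟩
      refine ⟨_, ⟨_, h1, rfl⟩, _, Submodule.mem_span_singleton.2 ⟨Q H.e v, rfl⟩, ?_⟩
      conv_rhs => rw [H.decomp v, h2]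
      simp
  have hfB : H.f ∈ B₀ := hmem.2 ⟨by rw [H.πf]; exact B.zero_mem, H.ff⟩
  have hjB : ∀ w ∈ B, H.j w ∈ B₀ := fun w hw => hmem.2 ⟨by rwa [H.πj], H.fj w⟩
  have hBle : ¬ B₀ ≤ H.up ⊤ := fun h => by
    have : Q H.e H.f = 0 := (h hfB).1
    rw [H.ef] at this; exact one_ne_zero this
  have hbB : H.bar B₀ = B := by
    ext u
    rw [mem_bar]
    constructor
    · rintro ⟨v, hv, -, rfl⟩; exact (hmem.1 hv).1
    · exact fun hu => ⟨H.j u, hjB u hu, H.ej u, H.πj u⟩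
  have hBi : B₀ ≤ Q.orthogonal B₀ := by
    intro v hv w hw
    obtain ⟨h1, h2⟩ := hmem.1 hv
    obtain ⟨h3, h4⟩ := hmem.1 hw
    change Q w v = 0
    have h5 : Q' (H.π w) (H.π v) = 0 := g3.1 h1 _ h3
    rw [H.decomp w, h4]
    simp [H.jv, h5, h2]
  have heB : H.e ∉ B₀ := hnm hBi hBle
  have hli : ∀ (d : D) (u : U') v w, Q (H.lift (g d) u v) (H.lift (g d) u w) = Q v w :=
    fun d u => H.lift_isometry (g1 d) u
  have hinj : ∀ d u, Function.Injective (H.lift (g d) u) := fun d u =>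
    isometry_injective hn (hli d u)
  have hsolve : ∀ (u u' : U') (s : ℂ), u ∈ D₂ → H.j u + s • H.e ∈ B₀.map (H.eich u') →
      u = 0 ∧ s = 0 := by
    rintro u u' s hu ⟨x, hx, hxe⟩
    have h1 := congrArg (Q H.e) hxe
    rw [e_eich, map_add, map_smul, H.ej, H.ee, smul_zero, add_zero] at h1
    have h2 := congrArg H.π hxe
    rw [π_eich, h1, zero_smul, add_zero, map_add, map_smul, H.πj, H.πe, smul_zero, add_zero] at h2
    have h3 : u = 0 := huniq u hu (h2 ▸ (hmem.1 hx).1)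
    refine ⟨h3, ?_⟩
    have h4 := H.decomp x
    rw [h1, h2, h3, map_zero, (hmem.1 hx).2, zero_smul, zero_smul, add_zero, add_zero] at h4
    rw [h4, map_zero, h3, map_zero, zero_add] at hxe
    exact (smul_eq_zero.1 hxe.symm).resolve_right H.e_ne
  have hform : ∀ u : U', H.eich u H.f = H.j u + (-(Q' u u / 2)) • H.e + H.f := fun u => by
    rw [eich_f, neg_smul]; abel
  have hpos : ∀ (u u' : D₂), B₀.map (H.eich u) = B₀.map (H.eich u') → u = u' := by
    intro u u' h
    have h1 : H.eich u H.f ∈ B₀.map (H.eich u') := h ▸ ⟨_, hfB, rfl⟩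
    have h2 : H.eich u' H.f ∈ B₀.map (H.eich u') := ⟨_, hfB, rfl⟩
    have h3 := Submodule.sub_mem _ h1 h2
    rw [hform, hform, add_sub_add_right_eq_sub, add_sub_add_comm, ← map_sub, ← sub_smul] at h3
    exact sub_eq_zero.1 (Subtype.ext (hsolve _ _ _ (u - u').2 h3).1)
  refine ⟨D × D₂, inferInstance, inferInstance, inferInstance,
    fun d => H.lift (g d.1) d.2, B₀, fun d => hli d.1 d.2,
    fun d => H.lift_ups (g2 d.1) d.2, ⟨hBi, ?_⟩, ?_, ?_, ?_, ?_⟩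
  · refine H.sameDims_of_bar (iff_of_false heB (hnm hW₀ hle)) ?_ ?_
    · rw [hbB]; exact g3.2
    · rw [hfr hBi hBle, hfr hW₀ hle, hbB, g3.2.finrank_eq hbt.2]
  · rintro W ⟨hWi, hW⟩
    obtain ⟨h1, h2, h3, h4⟩ := H.of_sameDims hbt hW
    obtain ⟨d, hd⟩ := g4 (H.bar W) ⟨H.bar_isotropic hWi, h3⟩
    let W₁ := W.comap (H.lift (g d) 0)
    have hsurj : LinearMap.range (H.lift (g d) 0) = ⊤ := LinearMap.range_eq_top.2
      (LinearMap.injective_iff_surjective.1 (hinj d 0))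
    have hW₁ : W₁.map (H.lift (g d) 0) = W := by
      rw [Submodule.map_comap_eq, hsurj, top_inf_eq]
    have hbW₁ : H.bar W₁ = B := by
      refine Submodule.map_injective_of_injective (isometry_injective hn' (g1 d)) ?_
      rw [← H.bar_map_lift (g d) 0, hW₁, hd]
    have hW₁i : ∀ v ∈ W₁, ∀ w ∈ W₁, Q v w = 0 := fun v hv w hw => by
      rw [← hli d 0]; exact hWi (show H.lift (g d) 0 w ∈ W from hw) _ hv
    have hW₁le : ¬ W₁ ≤ H.up ⊤ := by
      intro h
      refine hle (h2.1 ?_)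
      rw [← hW₁]
      rintro _ ⟨v, hv, rfl⟩
      exact ⟨(H.e_lift _ _ _).trans (h hv).1, trivial⟩
    obtain ⟨v, hv, hv1⟩ := hex hW₁le
    obtain ⟨b, hb, u, hu, hbu⟩ := Submodule.mem_sup.1
      (show H.π v ∈ B ⊔ D₂ from hD₂.sup_eq_top.symm ▸ Submodule.mem_top)
    obtain ⟨w, hw, hw1, hw2⟩ := H.mem_bar.1 (hbW₁.symm ▸ hb)
    have hv2 : v - w ∈ W₁ := W₁.sub_mem hv hw
    have hvw : v - w = H.j u + Q H.f (v - w) • H.e + H.f := by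
      have h5 := H.decomp (v - w)
      have h6 : H.π (v - w) = u := by rw [map_sub, hw2, ← hbu, add_sub_cancel_left]
      rw [h6, map_sub (Q H.e), hv1, hw1, sub_zero, one_smul] at h5
      exact h5
    -- The norm of `j u + s e + f` is `Q'(u, u) + 2 s`, and it vanishes because `W₁` is isotropic.
    have hs0 : Q H.f (v - w) = -(Q' u u / 2) := by
      have h5 := hW₁i _ hv2 _ hv2
      rw [hvw] at h5
      simp [H.jj, H.je, H.jf, H.ej, H.fj, H.ee, H.ff, H.ef, H.fe] at h5
      rw [map_sub]
      linear_combination h5 / 2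
    have hvE : H.eich u H.f = v - w := by
      rw [hform, hvw, hs0]
    refine ⟨(d, ⟨u, hu⟩), ?_⟩
    change B₀.map (H.lift (g d) u) = W
    rw [lift_eq, Submodule.map_comp, ← hW₁]
    congr 1
    symm
    refine Submodule.eq_of_le_of_finrank_eq ?_ ?_
    · intro x hx
      set y := x - Q H.e x • (v - w) with hy
      have hyW : y ∈ W₁ := W₁.sub_mem hx (W₁.smul_mem _ hv2)
      have hey : Q H.e y = 0 := by
        simp [hy, hv1, hw1]
      have hyB : H.π y ∈ B := hbW₁ ▸ H.mem_bar.2 ⟨y, hyW, hey, rfl⟩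
      have hyE : H.eich u (H.j (H.π y)) = y := by
        have h5 := hW₁i _ hv2 _ hyW
        have h6 : Q H.f y = - Q' u (H.π y) := by
          rw [hvw] at h5
          simp [H.jv, hey] at h5
          linear_combination h5
        rw [eich_j]
        conv_rhs => rw [H.decomp y, hey, h6]
        simp [sub_eq_add_neg]
      have hxy : x = H.eich u (Q H.e x • H.f + H.j (H.π y)) := by
        rw [map_add, map_smul, hvE, hyE, hy]; abel
      rw [hxy]
      exact ⟨_, B₀.add_mem (B₀.smul_mem _ hfB) (hjB _ hyB), rfl⟩
    · rw [finrank_map_inj (H.eich_injective hn u), ← finrank_map_inj (hinj d 0), hW₁, h4,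
        hfr hW₀ hle, hfr hBi hBle, hbB, g3.2.finrank_eq hbt.2]
  · rintro ⟨d, u⟩ ⟨d', u'⟩ hdd
    have hd : d = d' := by
      refine g5 d d' ?_
      have := congrArg H.bar hdd
      rwa [bar_map_lift, bar_map_lift, hbB] at this
    subst hd
    refine Prod.ext rfl (hpos u u' ?_)
    simp only at hdd
    rw [H.lift_eq _ u, H.lift_eq _ u', Submodule.map_comp, Submodule.map_comp] at hdd
    exact Submodule.map_injective_of_injective (hinj d 0) hdd
  · exact fun ι T f hf => H.regVec_lift (g6 ι T _ (hf.linear (LinearMap.fst ℂ D D₂)))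
      (hf.linear (D₂.subtype ∘ₗ LinearMap.snd ℂ D D₂))
  · intro ι T f W hW hC hBW
    have hd : RegVec T fun t => (f t).1 := g7 ι T _ _ (H.regFam_bar_of_mem hbt hW hC) (fun t ht =>
      ⟨H.bar_isotropic (hC t ht).1, (H.of_sameDims hbt (hC t ht).2).2.2.1⟩) fun t ht => by
        rw [← hBW t ht, bar_map_lift, hbB]
    have hcomap : ∀ t ∈ T, (W t).comap (H.lift (g (f t).1) 0) = B₀.map (H.eich (f t).2) :=
      fun t ht => by
        have h : W t = (B₀.map (H.eich (f t).2)).map (H.lift (g (f t).1) 0)  :=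
          (hBW t ht).symm.trans ((congrArg (fun g => B₀.map g)
            (H.lift_eq (g (f t).1) ((f t).2 : U'))).trans (Submodule.map_comp _ _ _))
        rw [h, Submodule.comap_map_eq_of_injective (hinj _ 0)]
    have hW₁ : RegFam T fun t => B₀.map (H.eich (f t).2) :=
      (RegFam.comap (H.regVec_lift (g6 ι T _ hd) (RegVec.const 0)) hW (r := finrank ℂ B₀)
        fun t ht => by
          rw [hcomap t ht, finrank_map_inj (H.eich_injective hn _)]).congr
        fun t ht => (hcomap t ht).symm
    -- The coefficient of `e` is quadratic in `u`. Treating it as a second independent unknown keeps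
    -- the system linear; the solution is still unique.
    have hu : RegVec T fun t => ((f t).2, -(Q' (f t).2 (f t).2 / 2)) := by
      refine RegFam.solve (F := D₂ × ℂ) hW₁
        (L := fun _ => LinearMap.coprod (H.j ∘ₗ D₂.subtype) (LinearMap.toSpanSingleton ℂ U H.e))
        (RegVec.const _) (f := fun _ => H.f) (RegVec.const _) ?_ ?_
      · rintro t _ ⟨v, s⟩ hv
        obtain ⟨h1, h2⟩ := hsolve v (f t).2 s v.2 hv
        exact Prod.ext (Subtype.ext h1) h2
      · intro t _
        exact ⟨H.f, hfB, hform _⟩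
    exact hd.pair (hu.linear (LinearMap.fst ℂ D₂ ℂ))

end HypSplit

/-- A non-degenerate form in dimension at most one is anisotropic, so the zero subspace is the only
isotropic one and the cell is a point. -/
lemma isIsoCell_of_finrank_le_one {Q : LinearMap.BilinForm ℂ U}
    (hn : ∀ x, (∀ y, Q x y = 0) → x = 0) (h1 : finrank ℂ U ≤ 1) (Es : List (Submodule ℂ U))
    {W₀ : Submodule ℂ U} (hW₀ : W₀ ≤ Q.orthogonal W₀) :
    IsIsoCell Q Es (isoClass Q Es W₀) := by
  have hbot : ∀ {W : Submodule ℂ U}, W ≤ Q.orthogonal W → W = ⊥ := by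
    intro W hW
    rw [eq_bot_iff]
    intro v hv
    by_contra hv0
    have hv0' : v ≠ 0 := hv0
    have hspan := finrank_span_singleton (K := ℂ) hv0'
    have htop : Submodule.span ℂ {v} = ⊤ := Submodule.eq_top_of_finrank_eq (by
      have := Submodule.finrank_le (Submodule.span ℂ {v}); omega)
    refine hv0' (hn v fun y => ?_)
    obtain ⟨c, rfl⟩ := Submodule.mem_span_singleton.1 (show y ∈ Submodule.span ℂ {v} from htop.symm ▸ Submodule.mem_top)
    have h2 : Q v v = 0 := hW hv v hv
    rw [map_smul, h2, smul_zero]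
  refine ⟨Fin 0 → ℂ, inferInstance, inferInstance, inferInstance, fun _ => LinearMap.id, W₀,
    fun _ _ _ => rfl, fun _ E _ => by rw [Submodule.map_id], ⟨hW₀, fun _ _ => rfl⟩, fun W hW =>
    ⟨0, by rw [Submodule.map_id, hbot hW.1, hbot hW₀]⟩, fun d d' _ => Subsingleton.elim _ _,
    fun _ _ _ _ => RegVec.const _, fun ι T f W _ _ _ =>
    (RegVec.const 0).congr fun t _ => Subsingleton.elim _ _⟩

/-- In a quadratic space there is a complete self-dual flag such that the isotropic subspaces in a
fixed position relative to the flag form a cell. -/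
theorem exists_isoCells (n : ℕ) : ∀ (U : Type) [AddCommGroup U] [Module ℂ U]
    [FiniteDimensional ℂ U] (Q : LinearMap.BilinForm ℂ U), (∀ x y, Q x y = Q y x) →
    (∀ x, (∀ y, Q x y = 0) → x = 0) → finrank ℂ U = n →
    ∃ Es : List (Submodule ℂ U), IsFlagSet Es ∧ (∀ E ∈ Es, Q.orthogonal E ∈ Es) ∧
      ∀ W₀ : Submodule ℂ U, W₀ ≤ Q.orthogonal W₀ → IsIsoCell Q Es (isoClass Q Es W₀) := by
  induction n using Nat.strong_induction_on with
  | _ n ih =>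
    intro U _ _ _ Q hs hn hU
    by_cases h2 : 2 ≤ finrank ℂ U
    · obtain ⟨U₁, Q', hlt, hs', hn', ⟨H⟩⟩ := exists_hypSplit hs hn h2
      obtain ⟨Es, hEs, ho, hc⟩ := ih _ (hU ▸ hlt) U₁ Q' hs' hn' rfl
      refine ⟨H.ups Es, H.isFlagSet_ups hEs, H.orthogonal_mem_ups hn ho, fun W₀ hW₀ => ?_⟩
      have hbt : ⊥ ∈ Es ∧ ⊤ ∈ Es := ⟨hEs.1, hEs.2.1⟩
      have hc' := hc _ (H.bar_isotropic hW₀)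
      by_cases hle : W₀ ≤ H.up ⊤
      · by_cases he : H.e ∈ W₀
        · exact H.isIsoCell_of_mem hbt hn hW₀ hc' he
        · exact H.isIsoCell_of_le hbt hn hn' hc' he hle
      · exact H.isIsoCell_of_not_le hbt hn hn' hW₀ hc' hle
    · refine ⟨[⊥, ⊤], ⟨by simp, by simp, fun P P0 P1 _ => ⟨⊥, by simp, ⊤, by simp, P0, P1, bot_le,
        by rw [finrank_top]; omega, fun E hE => ?_⟩⟩, fun E hE => ?_, fun W₀ hW₀ =>
        isIsoCell_of_finrank_le_one hn (by omega) _ hW₀⟩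
      · simp only [List.mem_cons, List.not_mem_nil, or_false] at hE
        rcases hE with rfl | rfl
        · exact Or.inl le_rfl
        · exact Or.inr le_rfl
      · simp only [List.mem_cons, List.not_mem_nil, or_false] at hE ⊢
        rcases hE with rfl | rfl
        · refine Or.inr (eq_top_iff.2 fun v _ w hw => ?_)
          rw [(Submodule.mem_bot ℂ).1 hw]
          exact LinearMap.map_zero₂ Q v
        · refine Or.inl (eq_bot_iff.2 fun v hv => hn v fun y => ?_)
          rw [hs]; exact hv y trivial

end Isotropic

/-! ### Cells of pairs with automorphism lifts, and their duality -/

section LiftCell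

variable {U : Type} [AddCommGroup U] [Module ℂ U] [FiniteDimensional ℂ U]
  {Q : LinearMap.BilinForm ℂ U}

/-- A set of pairs of subspaces of a quadratic space regularly parametrised by a family of
automorphisms that comes with its contragredient family. -/
def IsLiftCell (Q : LinearMap.BilinForm ℂ U) (C : Set (Submodule ℂ U × Submodule ℂ U)) : Prop :=
  ∃ (D : Type) (_ : AddCommGroup D) (_ : Module ℂ D) (_ : FiniteDimensional ℂ D)
    (g g' : D → U →ₗ[ℂ] U) (S₀ B₀ : Submodule ℂ U),
    (∀ d v w, Q (g' d v) (g d w) = Q v w) ∧ (∀ d, (S₀.map (g d), B₀.map (g d)) ∈ C) ∧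
    (∀ x ∈ C, ∃ d, (S₀.map (g d), B₀.map (g d)) = x) ∧
    (∀ d d', S₀.map (g d) = S₀.map (g d') → B₀.map (g d) = B₀.map (g d') → d = d') ∧
    (∀ (ι : Type) (T : Set (ι → ℂ)) (f : (ι → ℂ) → D), RegVec T f →
      RegVec T (fun t => g (f t)) ∧ RegVec T fun t => g' (f t)) ∧
    ∀ (ι : Type) (T : Set (ι → ℂ)) (f : (ι → ℂ) → D) (S B : (ι → ℂ) → Submodule ℂ U),
      RegFam T S → RegFam T B →
      (∀ t ∈ T, S₀.map (g (f t)) = S t ∧ B₀.map (g (f t)) = B t) → RegVec T f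

lemma injective_of_contragredient (hn : ∀ x, (∀ y, Q x y = 0) → x = 0) {g g' : U →ₗ[ℂ] U}
    (h : ∀ v w, Q (g' v) (g w) = Q v w) : Function.Injective g' := by
  refine LinearMap.ker_eq_bot.1 (LinearMap.ker_eq_bot'.2 fun v hv => hn v fun w => ?_)
  rw [← h, hv, map_zero, LinearMap.zero_apply]

lemma injective_of_contragredient' (hs : ∀ x y, Q x y = Q y x)
    (hn : ∀ x, (∀ y, Q x y = 0) → x = 0) {g g' : U →ₗ[ℂ] U}
    (h : ∀ v w, Q (g' v) (g w) = Q v w) : Function.Injective g :=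
  injective_of_contragredient hn fun v w => by rw [hs, h, hs]

/-- Passing to orthogonals replaces `g` by its contragredient `g'`. This is why a cell of pairs
carries both families: the transvections needed for lines are not isometries. -/
lemma orthogonal_map (hs : ∀ x y, Q x y = Q y x)
    (hn : ∀ x, (∀ y, Q x y = 0) → x = 0) {g g' : U →ₗ[ℂ] U}
    (h : ∀ v w, Q (g' v) (g w) = Q v w) (Y : Submodule ℂ U) :
    Q.orthogonal (Y.map g) = (Q.orthogonal Y).map g' := by
  have hsurj := LinearMap.injective_iff_surjective.1 (injective_of_contragredient hn h)
  ext v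
  obtain ⟨u, rfl⟩ := hsurj v
  rw [LinearMap.BilinForm.mem_orthogonal_iff]
  constructor
  · intro H
    refine ⟨u, fun y hy => ?_, rfl⟩
    change Q y u = 0
    rw [hs, ← h, hs]
    exact H _ ⟨y, hy, rfl⟩
  · rintro ⟨u', hu', he⟩ _ ⟨y, hy, rfl⟩
    rw [← he, hs, h, hs]
    exact hu' y hy

lemma orthogonal_orthogonal' (hs : ∀ x y, Q x y = Q y x)
    (hn : ∀ x, (∀ y, Q x y = 0) → x = 0) (Y : Submodule ℂ U) :
    Q.orthogonal (Q.orthogonal Y) = Y :=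
  LinearMap.BilinForm.orthogonal_orthogonal ⟨hn, fun y h => hn y fun x => by rw [hs, h]⟩
    (fun x y h => by rw [hs, h]) Y

lemma finrank_orthogonal' (hs : ∀ x y, Q x y = Q y x)
    (hn : ∀ x, (∀ y, Q x y = 0) → x = 0) (Y : Submodule ℂ U) :
    finrank ℂ Y + finrank ℂ (Q.orthogonal Y) = finrank ℂ U := by
  have hN : Q.Nondegenerate := ⟨hn, fun y h => hn y fun x => by rw [hs, h]⟩
  have h1 := LinearMap.BilinForm.finrank_orthogonal hN Y
  have h2 := Submodule.finrank_le Y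
  omega

lemma orthogonal_le_orthogonal {Y Z : Submodule ℂ U} (h : Y ≤ Z) :
    Q.orthogonal Z ≤ Q.orthogonal Y := fun _ hv w hw => hv w (h hw)

lemma orthogonal_le_iff (hs : ∀ x y, Q x y = Q y x)
    (hn : ∀ x, (∀ y, Q x y = 0) → x = 0) {Y Z : Submodule ℂ U} :
    Q.orthogonal Z ≤ Q.orthogonal Y ↔ Y ≤ Z := by
  refine ⟨fun h => ?_, orthogonal_le_orthogonal⟩
  rw [← orthogonal_orthogonal' hs hn Y, ← orthogonal_orthogonal' hs hn Z]
  exact orthogonal_le_orthogonal h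

lemma orthogonal_sup (Y Z : Submodule ℂ U) :
    Q.orthogonal (Y ⊔ Z) = Q.orthogonal Y ⊓ Q.orthogonal Z := by
  refine le_antisymm (le_inf (orthogonal_le_orthogonal le_sup_left)
    (orthogonal_le_orthogonal le_sup_right)) ?_
  rintro v ⟨h1, h2⟩ w hw
  obtain ⟨y, hy, z, hz, rfl⟩ := Submodule.mem_sup.1 hw
  change Q (y + z) v = 0
  have h3 : Q y v = 0 := h1 y hy
  have h4 : Q z v = 0 := h2 z hz
  rw [map_add, LinearMap.add_apply, h3, h4, add_zero]

/-- The dimension of `A^⊥ ∩ E` is determined by those of `A`, `E^⊥` and `A ∩ E^⊥`, and the list of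
tests is closed under orthogonals. -/
lemma SameDims.orthogonal (hs : ∀ x y, Q x y = Q y x)
    (hn : ∀ x, (∀ y, Q x y = 0) → x = 0) {Es : List (Submodule ℂ U)} (ht : ⊤ ∈ Es)
    (ho : ∀ E ∈ Es, Q.orthogonal E ∈ Es) {A A₀ : Submodule ℂ U} (h : SameDims Es A A₀) :
    SameDims Es (Q.orthogonal A) (Q.orthogonal A₀) := by
  have key : ∀ A E : Submodule ℂ U, finrank ℂ A + finrank ℂ (Q.orthogonal E) +
      finrank ℂ (Q.orthogonal A ⊓ E : Submodule ℂ U) =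
      finrank ℂ U + finrank ℂ (A ⊓ Q.orthogonal E : Submodule ℂ U) := fun A E => by
    have h1 := finrank_orthogonal' hs hn (A ⊔ Q.orthogonal E)
    rw [orthogonal_sup, orthogonal_orthogonal' hs hn] at h1
    have h2 := Submodule.finrank_sup_add_finrank_inf_eq A (Q.orthogonal E)
    omega
  intro E hE
  have h1 := key A E
  have h2 := key A₀ E
  rw [h _ (ho E hE), h.finrank_eq ht] at h1
  omega

/-- The orthogonals of the base pair, in reverse order, are moved by the contragredient family; the
roles of `g` and `g'` are exchanged. -/
lemma IsLiftCell.dual (hs : ∀ x y, Q x y = Q y x) (hn : ∀ x, (∀ y, Q x y = 0) → x = 0)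
    {C C' : Set (Submodule ℂ U × Submodule ℂ U)} (h : IsLiftCell Q C)
    (hC : ∀ x, x ∈ C' ↔ (Q.orthogonal x.2, Q.orthogonal x.1) ∈ C) : IsLiftCell Q C' := by
  obtain ⟨D, _, _, _, g, g', S₀, B₀, h1, h2, h3, h4, h5, h6⟩ := h
  have h1' : ∀ d v w, Q (g d v) (g' d w) = Q v w := fun d v w => by rw [hs, h1, hs]
  have ho := fun d Y => orthogonal_map hs hn (h1 d) Y
  have ho' := fun d Y => orthogonal_map hs hn (h1' d) Y
  refine ⟨D, inferInstance, inferInstance, inferInstance, g', g, Q.orthogonal B₀,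
    Q.orthogonal S₀, h1', fun d => ?_, fun x hx => ?_, fun d d' hd hd' => ?_, fun ι T f hf =>
    (h5 ι T f hf).symm, fun ι T f S B hS hB H => ?_⟩
  · rw [hC, ← ho, ← ho]
    simp only [orthogonal_orthogonal' hs hn]
    exact h2 d
  · obtain ⟨d, hd⟩ := h3 _ ((hC x).1 hx)
    refine ⟨d, ?_⟩
    rw [Prod.mk.injEq] at hd
    rw [← ho, ← ho, hd.1, hd.2, orthogonal_orthogonal' hs hn, orthogonal_orthogonal' hs hn]
  · refine h4 d d' ?_ ?_
    · rw [← orthogonal_orthogonal' hs hn S₀, ← ho', ← ho', hd']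
    · rw [← orthogonal_orthogonal' hs hn B₀, ← ho', ← ho', hd]
  · refine h6 ι T f (fun t => Q.orthogonal (B t)) (fun t => Q.orthogonal (S t))
      (hB.orthogonal (r := finrank ℂ S₀) fun t ht => ?_)
      (hS.orthogonal (r := finrank ℂ B₀) fun t ht => ?_) fun t ht => ?_
    · rw [← (H t ht).2, ho', orthogonal_orthogonal' hs hn,
        finrank_map_inj (injective_of_contragredient' hs hn (h1 _))]
    · rw [← (H t ht).1, ho', orthogonal_orthogonal' hs hn,
        finrank_map_inj (injective_of_contragredient' hs hn (h1 _))]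
    · rw [← (H t ht).1, ← (H t ht).2, ho', ho', orthogonal_orthogonal' hs hn,
        orthogonal_orthogonal' hs hn]
      exact ⟨rfl, rfl⟩

lemma IsIsoCell.isLiftCell (hn : ∀ x, (∀ y, Q x y = 0) → x = 0) {Es : List (Submodule ℂ U)}
    {W₀ : Submodule ℂ U} (h : IsIsoCell Q Es (isoClass Q Es W₀)) :
    IsLiftCell Q {x | x.1 = x.2 ∧ x.2 ∈ isoClass Q Es W₀} := by
  obtain ⟨D, _, _, _, g, B, g1, g2, g3, g4, g5, g6, g7⟩ := h
  refine ⟨D, inferInstance, inferInstance, inferInstance, g, g, B, B, g1, fun d => ⟨rfl,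
    map_mem_isoClass hn (g1 d) (g2 d) g3⟩, ?_, fun d d' h _ => g5 d d' h,
    fun ι T f hf => ⟨g6 ι T f hf, g6 ι T f hf⟩, fun ι T f S B' hS hB H => ?_⟩
  · rintro ⟨x1, x2⟩ ⟨hx', hx⟩
    obtain rfl : x1 = x2 := hx'
    obtain ⟨d, hd⟩ := g4 _ hx
    exact ⟨d, by rw [hd]⟩
  · exact g7 ι T f S hS (fun t ht => by
      rw [← (H t ht).1]; exact map_mem_isoClass hn (g1 _) (g2 _) g3) fun t ht => (H t ht).1

/-- Lines in a subquotient attached to the members of a cell of isotropic subspaces. -/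
lemma IsIsoCell.isLiftCell_lines (hs : ∀ x y, Q x y = Q y x)
    (hn : ∀ x, (∀ y, Q x y = 0) → x = 0) {Es : List (Submodule ℂ U)} (hEs : IsFlagSet Es)
    {W₀ : Submodule ℂ U} (h : IsIsoCell Q Es (isoClass Q Es W₀))
    {z y w : Submodule ℂ U → Submodule ℂ U} 
    (hz : ∀ g : U →ₗ[ℂ] U, (∀ v v', Q (g v) (g v') = Q v v') → ∀ W, z (W.map g) = (z W).map g)
    (hy : ∀ g : U →ₗ[ℂ] U, (∀ v v', Q (g v) (g v') = Q v v') → ∀ W, y (W.map g) = (y W).map g)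
    (hwz : ∀ W, w (z W) = W)
    (hwr : ∀ (ι : Type) (T : Set (ι → ℂ)) (Z : (ι → ℂ) → Submodule ℂ U), RegFam T Z →
      (∀ t ∈ T, finrank ℂ (w (Z t)) = finrank ℂ W₀) → RegFam T fun t => w (Z t))
    {L₀ : Submodule ℂ U} (hW₀ : W₀ ≤ Q.orthogonal W₀) (hzL : z W₀ ≤ L₀) (hLy : L₀ ≤ y W₀)
    (hL₀ : finrank ℂ L₀ = finrank ℂ (z W₀) + 1) :
    IsLiftCell Q {x | ∃ W ∈ isoClass Q Es W₀, x.1 = z W ∧ z W ≤ x.2 ∧ x.2 ≤ y W ∧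
      finrank ℂ x.2 = finrank ℂ (z W) + 1 ∧ SameDims Es x.2 L₀} := by
  obtain ⟨D, _, _, _, g, B, g1, g2, g3, g4, g5, g6, g7⟩ := h
  have hgi := fun d => isometry_injective hn (g1 d)
  have hgs := fun d => LinearMap.injective_iff_surjective.1 (hgi d)
  have hback : ∀ d (Y : Submodule ℂ U), (Y.comap (g d)).map (g d) = Y := fun d Y => by
    rw [Submodule.map_comap_eq, LinearMap.range_eq_top.2 (hgs d), top_inf_eq]
  have hsd : ∀ d Y, SameDims Es (Y.map (g d)) Y := fun d Y E hE =>
    finrank_map_inf (hgi d) (g2 d E hE) Y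
  -- the base line over `B`
  obtain ⟨d₀, hd₀⟩ := g4 W₀ ⟨hW₀, fun _ _ => rfl⟩
  let L := L₀.comap (g d₀)
  have hLL : L.map (g d₀) = L₀ := hback d₀ L₀
  have hLd : SameDims Es L L₀ := fun E hE => by rw [← hLL, hsd d₀ L E hE]
  have hmono : ∀ d {Y Y' : Submodule ℂ U}, Y.map (g d) ≤ Y'.map (g d) → Y ≤ Y' :=
    fun d Y Y' h => (Submodule.map_le_map_iff_of_injective (hgi d) _ _).1 h
  have hzL' : z B ≤ L := hmono d₀ (by rwa [← hz _ (g1 d₀), hd₀, hLL])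
  have hLy' : L ≤ y B := hmono d₀ (by rwa [← hy _ (g1 d₀), hd₀, hLL])
  have hLf : finrank ℂ L = finrank ℂ (z B) + 1 := by
    rw [← finrank_map_inj (hgi d₀) L, hLL, hL₀, ← hd₀, hz _ (g1 d₀), finrank_map_inj (hgi d₀)]
  -- This is the step of the complete flag at which `L` leaves `z B`: modulo `z B`, the line `L` is
  -- spanned by a vector `l` of `E₂` that does not lie in `E₁ + z B`.
  obtain ⟨E₁, hE₁, E₂, hE₂, p1, p2, hle, hf, hc⟩ := hEs.2.2 (fun E => L ⊓ E ≤ z B) (by simp)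
    (fun h => by
      rw [inf_top_eq] at h
      have := Submodule.finrank_mono h
      omega) fun E E' h h' => (inf_le_inf_left L h).trans h'
  obtain ⟨l, ⟨hlL, hlE⟩, hlz⟩ := Set.not_subset.1 p2
  have hl1 : l ∉ E₁ ⊔ z B := by
    intro h
    obtain ⟨e, he, b, hb, rfl⟩ := Submodule.mem_sup.1 h
    have : e ∈ L := by simpa using L.sub_mem hlL (hzL' hb)
    exact hlz ((z B).add_mem (p1 ⟨this, he⟩) hb)
  have hE₂' : ∀ v ∈ E₂, ∃ a : ℂ, v - a • l ∈ E₁ := by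
    have : E₁ ⊔ Submodule.span ℂ {l} = E₂ := by
      refine Submodule.eq_of_le_of_finrank_le (sup_le hle (by simpa using hlE)) ?_
      have : finrank ℂ E₁ < finrank ℂ (E₁ ⊔ Submodule.span ℂ {l} : Submodule ℂ U) :=
        Submodule.finrank_lt_finrank_of_lt (lt_of_le_of_ne le_sup_left fun h =>
          hl1 (Submodule.mem_sup_left (h ▸ Submodule.mem_sup_right (Submodule.mem_span_singleton_self l))))
      omega
    intro v hv
    rw [← this] at hv
    obtain ⟨e, he, _, hb, rfl⟩ := Submodule.mem_sup.1 hv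
    obtain ⟨a, rfl⟩ := Submodule.mem_span_singleton.1 hb
    exact ⟨a, by simpa using he⟩
  have hLspan : ∀ {M : Submodule ℂ U} {m : U}, z B ≤ M → m ∈ M → m ∉ z B →
      finrank ℂ M = finrank ℂ (z B) + 1 → z B ⊔ Submodule.span ℂ {m} = M := by
    intro M m h1 h2 h3 h4
    refine Submodule.eq_of_le_of_finrank_le (sup_le h1 (by simpa using h2)) ?_
    have : finrank ℂ (z B) < finrank ℂ (z B ⊔ Submodule.span ℂ {m} : Submodule ℂ U) :=
      Submodule.finrank_lt_finrank_of_lt (lt_of_le_of_ne le_sup_left fun h =>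
        h3 (h ▸ Submodule.mem_sup_right (Submodule.mem_span_singleton_self m)))
    omega
  -- the functional
  obtain ⟨φ, hφl, hφ⟩ := Submodule.exists_dual_map_eq_bot_of_notMem hl1 inferInstance
  have hφ0 : ∀ v ∈ E₁ ⊔ z B, φ v = 0 := fun v hv => by
    have : φ v ∈ (E₁ ⊔ z B).map φ := ⟨v, hv, rfl⟩
    rwa [hφ] at this
  obtain ⟨q, hq⟩ := exists_represent hn ((φ l)⁻¹ • φ)
  have hql : Q q l = 1 := by rw [hq]; simp [hφl]
  have hq0 : ∀ v ∈ E₁ ⊔ z B, Q q v = 0 := fun v hv => by rw [hq]; simp [hφ0 v hv]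
  -- The other lines in the same position are spanned modulo `z B` by `l + c` with `c` in `y B ∩
  -- E₁`, and `c` matters only modulo `z B`.
  obtain ⟨D₂, hD₂, hD₂'⟩ := exists_relCompl (inf_le_right : z B ⊓ (y B ⊓ E₁) ≤ y B ⊓ E₁)
  -- The transvection along `c` moves `l` to `l + c`, fixes `E₁ + z B` pointwise and stabilises
  -- every test subspace; `h'` below is its contragredient.
  let h : D₂ → U →ₗ[ℂ] U := fun c => LinearMap.id + (Q q).smulRight (c : U)
  let h' : D₂ → U →ₗ[ℂ] U := fun c => LinearMap.id - (Q (c : U)).smulRight q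
  have hcy : ∀ c : D₂, (c : U) ∈ y B := fun c => (hD₂ c.2).1
  have hcE : ∀ c : D₂, (c : U) ∈ E₁ := fun c => (hD₂ c.2).2
  have hh : ∀ c v, h c v = v + Q q v • (c : U) := fun c v => rfl
  have hh' : ∀ c v, h' c v = v - Q (c : U) v • q := fun c v => rfl
  have hhh : ∀ c v v', Q (h' c v) (h c v') = Q v v' := fun c v v' => by
    have h1 : Q q c = 0 := hq0 _ (Submodule.mem_sup_left (hcE c))
    simp only [hh, hh', map_add, map_sub, map_smul, LinearMap.sub_apply, LinearMap.smul_apply,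
      smul_eq_mul, h1, hs v c]
    ring
  have hhi := fun c => injective_of_contragredient' hs hn (hhh c)
  have hhz : ∀ c, (z B).map (h c) = z B := fun c => map_eq_of_le (hhi c) (by
    rintro _ ⟨v, hv, rfl⟩
    rw [hh, hq0 v (Submodule.mem_sup_right hv), zero_smul, add_zero]; exact hv)
  have hhE : ∀ c, ∀ E ∈ Es, E.map (h c) ≤ E := by
    rintro c E hE _ ⟨v, hv, rfl⟩
    rw [hh]
    rcases hc E hE with h1 | h1
    · rw [hq0 v (Submodule.mem_sup_left (h1 hv)), zero_smul, add_zero]; exact hv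
    · exact E.add_mem hv (E.smul_mem _ (h1 (hle (hcE c))))
  have hhl : ∀ c : D₂, l + c ∈ L.map (h c) := fun c => ⟨l, hlL, by rw [hh, hql, one_smul]⟩
  have hlc : ∀ c : D₂, l + c ∉ z B := fun c hl' => hl1 (by
    have := Submodule.sub_mem _ (Submodule.mem_sup_right hl' : l + (c : U) ∈ E₁ ⊔ z B)
      (Submodule.mem_sup_left (hcE c))
    simpa using this)
  -- Equal intersection dimensions with `E₁` leave no room for vectors of `M ∩ E₁` outside `z B`.
  -- This gives uniqueness of the parameter `c`.
  have hpos : ∀ {M : Submodule ℂ U}, z B ≤ M → SameDims Es M L → M ⊓ E₁ ≤ z B := by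
    intro M h1 h2
    have h3 : z B ⊓ E₁ = M ⊓ E₁ := Submodule.eq_of_le_of_finrank_le (inf_le_inf_right _ h1) (by
      rw [h2 _ hE₁]
      exact Submodule.finrank_mono (le_inf p1 inf_le_right))
    rw [← h3]; exact inf_le_left
  have hzero : ∀ {M : Submodule ℂ U}, z B ≤ M → SameDims Es M L → ∀ c : D₂, (c : U) ∈ M → c = 0 := by
    intro M h1 h2 c h3
    have h4 : (c : U) ∈ (z B ⊓ (y B ⊓ E₁)) ⊓ D₂ := ⟨⟨hpos h1 h2 ⟨h3, hcE c⟩, hcy c, hcE c⟩, c.2⟩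
    rw [hD₂'.1] at h4
    exact Subtype.ext h4
  have hLh : ∀ c : D₂, z B ≤ L.map (h c) := fun c => by
    rw [← hhz c]; exact Submodule.map_mono hzL'
  have hLs : ∀ c : D₂, SameDims Es (L.map (h c)) L := fun c E hE =>
    finrank_map_inf (hhi c) (hhE c E hE) L
  have hmemC : ∀ d c, z (B.map (g d)) = (z B).map (g d ∘ₗ h c) := fun d c => by
    rw [Submodule.map_comp, hhz, hz _ (g1 d)]
  have hB0 : finrank ℂ B = finrank ℂ W₀ := by rw [← hd₀, finrank_map_inj (hgi d₀)]
  refine ⟨D × D₂, inferInstance, inferInstance, inferInstance, fun x => g x.1 ∘ₗ h x.2,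
    fun x => g x.1 ∘ₗ h' x.2, z B, L, fun x v v' => (g1 _ _ _).trans (hhh _ _ _), ?_, ?_, ?_,
    ?_, ?_⟩
  · rintro ⟨d, c⟩
    refine ⟨B.map (g d), map_mem_isoClass hn (g1 d) (g2 d) g3, (hmemC d c).symm, ?_, ?_, ?_, ?_⟩
    · rw [hmemC d c]; exact Submodule.map_mono hzL'
    · change L.map (g d ∘ₗ h c) ≤ _
      rw [hy _ (g1 d), Submodule.map_comp]
      refine Submodule.map_mono ?_
      rintro _ ⟨v, hv, rfl⟩
      exact (y B).add_mem (hLy' hv) ((y B).smul_mem _ (hcy c))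
    · change finrank ℂ (L.map (g d ∘ₗ h c)) = _
      rw [hz _ (g1 d), finrank_map_inj (hgi d), Submodule.map_comp, finrank_map_inj (hgi d),
        finrank_map_inj (hhi c), hLf]
    · intro E hE
      change finrank ℂ (L.map (g d ∘ₗ h c) ⊓ E : Submodule ℂ U) = _
      rw [Submodule.map_comp, hsd d _ E hE, hLs c E hE, hLd E hE]
  · rintro ⟨Z, M⟩ ⟨W, hW, h1, h2, h3, h4, h5⟩
    simp only at h1 h2 h3 h4 h5
    obtain ⟨d, rfl⟩ := g4 W hW
    let M₁ := M.comap (g d)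
    have hM : M₁.map (g d) = M := hback d M
    have hM1 : z B ≤ M₁ := hmono d (by rwa [← hz _ (g1 d), hM])
    have hM2 : M₁ ≤ y B := hmono d (by rwa [← hy _ (g1 d), hM])
    have hM3 : finrank ℂ M₁ = finrank ℂ (z B) + 1 := by
      rw [← finrank_map_inj (hgi d), hM, h4, hz _ (g1 d), finrank_map_inj (hgi d)]
    have hM4 : SameDims Es M₁ L := fun E hE => by rw [← hsd d M₁ E hE, hM, h5 E hE, hLd E hE]
    obtain ⟨m, ⟨hm, hmE⟩, hmz⟩ : ∃ m ∈ M₁ ⊓ E₂, m ∉ z B := by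
      by_contra! hcon
      have h6 : M₁ ⊓ E₂ = z B ⊓ E₂ := le_antisymm (le_inf hcon inf_le_right) (inf_le_inf_right _ hM1)
      have h7 : z B ⊓ E₂ = L ⊓ E₂ := Submodule.eq_of_le_of_finrank_eq (inf_le_inf_right _ hzL') (by
        rw [← h6, hM4 _ hE₂])
      exact p2 (h7 ▸ inf_le_left)
    -- Modulo `E₁` the vector `m` is a non-zero multiple of `l`; rescaling puts it in the form `l`
    -- plus an element of `y B ∩ E₁`.
    obtain ⟨a, ha⟩ := hE₂' m hmE
    have ha0 : a ≠ 0 := by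
      rintro rfl
      rw [zero_smul, sub_zero] at ha
      exact hmz (hpos hM1 hM4 ⟨hm, ha⟩)
    have he : a⁻¹ • m - l ∈ y B ⊓ E₁ := by
      refine ⟨(y B).sub_mem ((y B).smul_mem _ (hM2 hm)) (hLy' hlL), ?_⟩
      have := E₁.smul_mem a⁻¹ ha
      rwa [smul_sub, smul_smul, inv_mul_cancel₀ ha0, one_smul] at this
    rw [← hD₂'.2] at he
    obtain ⟨b, hb, c, hcD, hbc⟩ := Submodule.mem_sup.1 he
    have hlM : l + c ∈ M₁ := by
      have h6 : l + c = a⁻¹ • m - b := by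
        rw [eq_sub_iff_add_eq, add_assoc, add_comm c b, hbc]; abel
      rw [h6]
      exact M₁.sub_mem (M₁.smul_mem _ hm) (hM1 hb.1)
    refine ⟨(d, ⟨c, hcD⟩), Prod.ext ?_ ?_⟩
    · exact (hmemC d _).symm.trans h1.symm
    · change L.map (g d ∘ₗ h ⟨c, hcD⟩) = M
      rw [Submodule.map_comp, ← hM]
      congr 1
      rw [← hLspan hM1 hlM (hlc ⟨c, hcD⟩) hM3, ← hLspan (hLh _) (hhl ⟨c, hcD⟩) (hlc ⟨c, hcD⟩)
        (by rw [finrank_map_inj (hhi _), hLf])]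
  · rintro ⟨d, c⟩ ⟨d', c'⟩ h1 h2
    change (z B).map (g d ∘ₗ h c) = (z B).map (g d' ∘ₗ h c') at h1
    change L.map (g d ∘ₗ h c) = L.map (g d' ∘ₗ h c') at h2
    rw [← hmemC, ← hmemC] at h1
    obtain rfl : d = d' := g5 d d' (by rw [← hwz (B.map (g d)), h1, hwz])
    rw [Submodule.map_comp, Submodule.map_comp] at h2
    have h3 := Submodule.map_injective_of_injective (hgi d) h2
    have h4 := Submodule.sub_mem _ (hhl c) (h3 ▸ hhl c')
    rw [add_sub_add_left_eq_sub] at h4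
    rw [sub_eq_zero.1 (hzero (hLh c) (hLs c) (c - c') h4)]
  · intro ι T f hf
    have h1 : RegVec T fun t => g (f t).1 := g6 ι T _ (hf.linear (LinearMap.fst ℂ D D₂))
    have h2 : RegVec T fun t => ((f t).2 : U) := hf.linear (D₂.subtype ∘ₗ LinearMap.snd ℂ D D₂)
    refine ⟨h1.comp ((RegVec.const _).add ?_), h1.comp ((RegVec.const _).sub ?_)⟩
    · exact h2.linear (LinearMap.smulRightₗ (Q q))
    · exact (h2.linear Q).linear (LinearMap.smulRightₗ.flip q)
  · intro ι T f S M hS hM H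
    have hSW : ∀ t ∈ T, w (S t) = B.map (g (f t).1) := fun t ht => by
      rw [← (H t ht).1, ← hmemC, hwz]
    have hd : RegVec T fun t => (f t).1 := by
      refine g7 ι T _ _ (hwr ι T S hS fun t ht => ?_) (fun t ht => ?_) fun t ht => (hSW t ht).symm
      · rw [hSW t ht, finrank_map_inj (hgi _), hB0]
      · rw [hSW t ht]; exact map_mem_isoClass hn (g1 _) (g2 _) g3
    have hM₁ : ∀ t ∈ T, (M t).comap (g (f t).1) = L.map (h (f t).2) := fun t ht => by
      rw [← (H t ht).2, Submodule.map_comp, Submodule.comap_map_eq_of_injective (hgi _)]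
    have hM₁r : RegFam T fun t => L.map (h (f t).2) :=
      (RegFam.comap (g6 ι T _ hd) hM (r := finrank ℂ L) fun t ht => by
        rw [hM₁ t ht, finrank_map_inj (hhi _)]).congr fun t ht => (hM₁ t ht).symm
    refine hd.pair (RegFam.solve hM₁r (L := fun _ => D₂.subtype) (RegVec.const _)
      (f := fun _ => l) (RegVec.const _) (fun t _ v hv => hzero (hLh _) (hLs _) v hv) fun t _ => ?_)
    rw [add_comm]; exact hhl _

end LiftCell

/-! ### The five kinds of cells in one quadratic space -/

section LiftCell

variable {U : Type} [AddCommGroup U] [Module ℂ U] [FiniteDimensional ℂ U]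
  {Q : LinearMap.BilinForm ℂ U}

lemma sameDims_orthogonal_iff (hs : ∀ x y, Q x y = Q y x)
    (hn : ∀ x, (∀ y, Q x y = 0) → x = 0) {Es : List (Submodule ℂ U)} (ht : ⊤ ∈ Es)
    (ho : ∀ E ∈ Es, Q.orthogonal E ∈ Es) {A A₀ : Submodule ℂ U} :
    SameDims Es (Q.orthogonal A) (Q.orthogonal A₀) ↔ SameDims Es A A₀ := by
  refine ⟨fun h => ?_, fun h => h.orthogonal hs hn ht ho⟩
  have := h.orthogonal hs hn ht ho
  rwa [orthogonal_orthogonal' hs hn, orthogonal_orthogonal' hs hn] at this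

lemma orthogonal_self_iff (hs : ∀ x y, Q x y = Q y x) (hn : ∀ x, (∀ y, Q x y = 0) → x = 0)
    {A : Submodule ℂ U} :
    Q.orthogonal A ≤ Q.orthogonal (Q.orthogonal A) ↔ Q.orthogonal A ≤ A := by
  rw [orthogonal_orthogonal' hs hn]

/-- In a quadratic space there is a list of subspaces such that the isotropic and coisotropic
subspaces, and the relevant hyperplanes in them, in a fixed position relative to the list form a
cell. -/
theorem exists_liftCells (hs : ∀ x y, Q x y = Q y x) (hn : ∀ x, (∀ y, Q x y = 0) → x = 0) :
    ∃ Es : List (Submodule ℂ U), ⊤ ∈ Es ∧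
      (∀ A₀, Q.orthogonal A₀ ≤ A₀ → IsLiftCell Q {x | x.1 = x.2 ∧ Q.orthogonal x.2 ≤ x.2 ∧
        SameDims Es x.1 A₀ ∧ SameDims Es x.2 A₀}) ∧
      (∀ A₁ A₀, Q.orthogonal A₀ ≤ A₁ → A₁ ≤ A₀ → finrank ℂ A₀ = finrank ℂ A₁ + 1 →
        IsLiftCell Q {x | x.1 ≤ x.2 ∧ Q.orthogonal x.2 ≤ x.1 ∧ SameDims Es x.1 A₁ ∧
          SameDims Es x.2 A₀}) ∧
      (∀ A₁ A₀, Q.orthogonal A₁ ≤ A₁ → A₁ ≤ A₀ → finrank ℂ A₀ = finrank ℂ A₁ + 1 →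
        IsLiftCell Q {x | x.1 ≤ x.2 ∧ Q.orthogonal x.1 ≤ x.1 ∧ SameDims Es x.1 A₁ ∧
          SameDims Es x.2 A₀}) ∧
      (∀ W₀, W₀ ≤ Q.orthogonal W₀ → IsLiftCell Q {x | x.1 = x.2 ∧ x.2 ≤ Q.orthogonal x.2 ∧
        SameDims Es x.1 W₀ ∧ SameDims Es x.2 W₀}) ∧
      ∀ W₁ W₀, W₀ ≤ Q.orthogonal W₀ → W₁ ≤ W₀ → finrank ℂ W₀ = finrank ℂ W₁ + 1 →
        IsLiftCell Q {x | x.1 ≤ x.2 ∧ x.2 ≤ Q.orthogonal x.2 ∧ SameDims Es x.1 W₁ ∧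
          SameDims Es x.2 W₀} := by
  obtain ⟨Es, hEs, ho, hc⟩ := exists_isoCells _ U Q hs hn rfl
  have ht : ⊤ ∈ Es := hEs.2.1
  have hoo := orthogonal_orthogonal' hs hn
  have hfo := finrank_orthogonal' hs hn
  have hsd := fun {A A₀ : Submodule ℂ U} => sameDims_orthogonal_iff (A := A) (A₀ := A₀) hs hn ht ho
  have heq : ∀ g : U →ₗ[ℂ] U, (∀ v v', Q (g v) (g v') = Q v v') → ∀ W,
      Q.orthogonal (W.map g) = (Q.orthogonal W).map g := fun g hg W => orthogonal_map hs hn hg W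
  have htop : ∀ g : U →ₗ[ℂ] U, (∀ v v', Q (g v) (g v') = Q v v') → ∀ W : Submodule ℂ U,
      (⊤ : Submodule ℂ U) = (⊤ : Submodule ℂ U).map g := fun g hg W => by
    rw [Submodule.map_top, LinearMap.range_eq_top.2
      (LinearMap.injective_iff_surjective.1 (isometry_injective hn hg))]
  have hreg : ∀ (W₀ : Submodule ℂ U) (ι : Type) (T : Set (ι → ℂ)) (Z : (ι → ℂ) → Submodule ℂ U),
      RegFam T Z → (∀ t ∈ T, finrank ℂ (Q.orthogonal (Z t)) = finrank ℂ W₀) →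
      RegFam T fun t => Q.orthogonal (Z t) := fun W₀ ι T Z hZ h => hZ.orthogonal h
  have hlines : ∀ W₀ L₀ : Submodule ℂ U, W₀ ≤ Q.orthogonal W₀ → Q.orthogonal W₀ ≤ L₀ →
      finrank ℂ L₀ = finrank ℂ (Q.orthogonal W₀) + 1 →
      IsLiftCell Q {x | ∃ W ∈ isoClass Q Es W₀, x.1 = Q.orthogonal W ∧ Q.orthogonal W ≤ x.2 ∧
        x.2 ≤ ⊤ ∧ finrank ℂ x.2 = finrank ℂ (Q.orthogonal W) + 1 ∧ SameDims Es x.2 L₀} :=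
    fun W₀ L₀ h1 h2 h3 => (hc W₀ h1).isLiftCell_lines hs hn hEs (z := fun W => Q.orthogonal W)
      (y := fun _ => ⊤) (w := fun W => Q.orthogonal W) heq htop hoo (hreg W₀) h1 h2 le_top h3
  refine ⟨Es, ht, fun A₀ h1 => ?_, fun A₁ A₀ h1 h2 h3 => ?_, fun A₁ A₀ h1 h2 h3 => ?_,
    fun W₀ h1 => ?_, fun W₁ W₀ h1 h2 h3 => ?_⟩
  -- Coisotropic subspaces are the orthogonals of isotropic ones.
  · refine ((hc (Q.orthogonal A₀) ((orthogonal_self_iff hs hn).2 h1)).isLiftCell hn).dual hs hn ?_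
    rintro ⟨A, A'⟩
    constructor
    · rintro ⟨h2, h3, -, h4⟩
      obtain rfl : A = A' := h2
      exact ⟨rfl, (orthogonal_self_iff hs hn).2 h3, hsd.2 h4⟩
    · rintro ⟨h2, h3, h4⟩
      obtain rfl : A' = A := by rw [← hoo A, ← hoo A']; exact congrArg _ h2
      exact ⟨rfl, (orthogonal_self_iff hs hn).1 h3, hsd.1 h4, hsd.1 h4⟩
  -- Dually, `W = A₀^⊥` is isotropic and `A₁^⊥` is given by a line in `W^⊥ / W`.
  · have hiso : Q.orthogonal A₀ ≤ Q.orthogonal (Q.orthogonal A₀) := by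
      rw [hoo]; exact h1.trans h2
    refine ((hc (Q.orthogonal A₀) hiso).isLiftCell_lines hs hn hEs (z := fun W => W)
      (y := fun W => Q.orthogonal W) (w := fun W => W) (fun _ _ _ => rfl) heq (fun _ => rfl)
      (fun _ _ _ h _ => h) hiso (L₀ := Q.orthogonal A₁) (orthogonal_le_orthogonal h2)
      (orthogonal_le_orthogonal h1) (by
        have := hfo A₀; have := hfo A₁; omega)).dual hs hn ?_
    rintro ⟨A', A⟩
    constructor
    · rintro ⟨h4, h5, h6, h7⟩
      refine ⟨Q.orthogonal A, ⟨?_, hsd.2 h7⟩, rfl, orthogonal_le_orthogonal h4,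
        orthogonal_le_orthogonal h5, ?_, hsd.2 h6⟩
      · rw [hoo]; exact h5.trans h4
      · have := hfo A; have := hfo A'; have := h6.finrank_eq ht; have := h7.finrank_eq ht
        simp only at *
        omega
    · rintro ⟨W, ⟨h4, h5⟩, h6, h7, h8, h9, h10⟩
      simp only at h6 h7 h8 h9 h10
      subst h6
      exact ⟨(orthogonal_le_iff hs hn).1 h7, (orthogonal_le_iff hs hn).1 h8, hsd.1 h10, hsd.1 h5⟩
  -- Here `W = A₁^⊥` is isotropic and `A₀` is given by a line in `U / W^⊥`; no dualisation is
  -- needed.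
  · have e : A₁ = Q.orthogonal (Q.orthogonal A₁) := (hoo A₁).symm
    convert hlines (Q.orthogonal A₁) A₀ ((orthogonal_self_iff hs hn).2 h1) (by rwa [hoo])
      (by rwa [hoo]) using 1
    ext ⟨A', A⟩
    constructor
    · rintro ⟨h4, h5, h6, h7⟩
      refine ⟨Q.orthogonal A', ⟨(orthogonal_self_iff hs hn).2 h5, hsd.2 h6⟩, (hoo _).symm,
        by rwa [hoo], le_top, ?_, h7⟩
      rw [hoo, h6.finrank_eq ht, ← h3]
      exact h7.finrank_eq ht
    · rintro ⟨W, ⟨h4, h5⟩, h6, h7, h8, h9, h10⟩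
      simp only at h6 h7 h8 h9 h10
      subst h6
      exact ⟨h7, by rwa [hoo], by rw [e]; exact hsd.2 h5, h10⟩
  · convert (hc W₀ h1).isLiftCell hn using 1
    ext ⟨W', W⟩
    constructor
    · rintro ⟨h2, h3, -, h4⟩
      exact ⟨h2, h3, h4⟩
    · rintro ⟨h2, h3, h4⟩
      obtain rfl : W' = W := h2
      exact ⟨rfl, h3, h4, h4⟩
  -- A hyperplane `W₁` of the isotropic `W₀` is dual to a line in `U / W₀^⊥`.
  · refine (hlines W₀ (Q.orthogonal W₁) h1 (orthogonal_le_orthogonal h2) (by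
      have := hfo W₀; have := hfo W₁; omega)).dual hs hn ?_
    rintro ⟨W', W⟩
    constructor
    · rintro ⟨h4, h5, h6, h7⟩
      refine ⟨W, ⟨h5, h7⟩, rfl, orthogonal_le_orthogonal h4, le_top, ?_, hsd.2 h6⟩
      have := hfo W; have := hfo W'; have := h6.finrank_eq ht; have := h7.finrank_eq ht
      simp only at *
      omega
    · rintro ⟨X, ⟨h4, h5⟩, h6, h7, h8, h9, h10⟩
      simp only at h6 h7 h8 h9 h10
      obtain rfl : W = X := by rw [← hoo W, h6, hoo]
      exact ⟨(orthogonal_le_iff hs hn).1 h7, h4, hsd.1 h10, h5⟩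

end LiftCell

/-! ### Subspaces of a product with prescribed trace and projection -/

section Product

variable {R S : Type} [AddCommGroup R] [Module ℂ R] [FiniteDimensional ℂ R]
  [AddCommGroup S] [Module ℂ S] [FiniteDimensional ℂ S]

/-- The part of a subspace of `R × S` inside `R`. -/
def inner (W : Submodule ℂ (R × S)) : Submodule ℂ R := W.comap (LinearMap.inl ℂ R S)

/-- The projection of a subspace of `R × S` to `S`. -/
def outer (W : Submodule ℂ (R × S)) : Submodule ℂ S := W.map (LinearMap.snd ℂ R S)

lemma mem_inner {W : Submodule ℂ (R × S)} {r : R} : r ∈ inner W ↔ (r, (0 : S)) ∈ W := Iff.rfl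

lemma mem_outer {W : Submodule ℂ (R × S)} {s : S} : s ∈ outer W ↔ ∃ r, (r, s) ∈ W :=
  ⟨fun ⟨⟨r, _⟩, h, e⟩ => ⟨r, by subst e; exact h⟩, fun ⟨r, h⟩ => ⟨(r, s), h, rfl⟩⟩

lemma finrank_inner_inf (W : Submodule ℂ (R × S)) (E : Submodule ℂ R) :
    finrank ℂ (inner W ⊓ E : Submodule ℂ R) =
      finrank ℂ (W ⊓ E.prod ⊥ : Submodule ℂ (R × S)) := by
  rw [← finrank_map_inj (f := LinearMap.inl ℂ R S) LinearMap.inl_injective]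
  suffices h : (inner W ⊓ E).map (LinearMap.inl ℂ R S) = W ⊓ E.prod ⊥ by rw [h]
  ext ⟨r, s⟩
  constructor
  · rintro ⟨r', ⟨h1, h2⟩, h3⟩
    rw [LinearMap.inl_apply, Prod.mk.injEq] at h3
    obtain ⟨rfl, rfl⟩ := h3
    exact ⟨h1, h2, rfl⟩
  · rintro ⟨h1, h2, h3⟩
    obtain rfl : s = 0 := h3
    exact ⟨r, ⟨h1, h2⟩, rfl⟩

lemma finrank_outer_inf (W : Submodule ℂ (R × S)) (E : Submodule ℂ S) :
    finrank ℂ (outer W ⊓ E : Submodule ℂ S) + finrank ℂ (inner W) =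
      finrank ℂ (W ⊓ (⊤ : Submodule ℂ R).prod E : Submodule ℂ (R × S)) := by
  have h1 := finrank_map_add_inf_ker (LinearMap.snd ℂ R S) (W ⊓ (⊤ : Submodule ℂ R).prod E)
  have h2 : (W ⊓ (⊤ : Submodule ℂ R).prod E).map (LinearMap.snd ℂ R S) = outer W ⊓ E := by
    ext s
    constructor
    · rintro ⟨⟨r, s⟩, ⟨h1, h2⟩, rfl⟩
      exact ⟨mem_outer.2 ⟨r, h1⟩, h2.2⟩
    · rintro ⟨h1, h2⟩
      obtain ⟨r, hr⟩ := mem_outer.1 h1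
      exact ⟨(r, s), ⟨hr, trivial, h2⟩, rfl⟩
  have h3 : (W ⊓ (⊤ : Submodule ℂ R).prod E) ⊓ LinearMap.ker (LinearMap.snd ℂ R S) =
      W ⊓ (⊤ : Submodule ℂ R).prod ⊥ := by
    ext ⟨r, s⟩
    constructor
    · rintro ⟨⟨h1, h2⟩, h3⟩
      obtain rfl : s = 0 := h3
      exact ⟨h1, trivial, rfl⟩
    · rintro ⟨h1, h2, h3⟩
      obtain rfl : s = 0 := h3
      exact ⟨⟨h1, trivial, E.zero_mem⟩, rfl⟩
  rw [h2, h3, ← finrank_inner_inf, inf_top_eq] at h1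
  exact h1

lemma finrank_outer (W : Submodule ℂ (R × S)) :
    finrank ℂ (outer W) + finrank ℂ (inner W) = finrank ℂ W := by
  have := finrank_outer_inf W ⊤
  rwa [inf_top_eq, Submodule.prod_top, inf_top_eq] at this

lemma finrank_prod' (Y : Submodule ℂ R) (Z : Submodule ℂ S) :
    finrank ℂ (Y.prod Z) = finrank ℂ Y + finrank ℂ Z := by
  have h1 : inner (Y.prod Z) = Y := by
    ext r
    exact ⟨fun h => h.1, fun h => ⟨h, Z.zero_mem⟩⟩
  have h2 : outer (Y.prod Z) = Z := by
    ext s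
    rw [mem_outer]
    exact ⟨fun ⟨_, h⟩ => h.2, fun h => ⟨0, Y.zero_mem, h⟩⟩
  rw [← finrank_outer, h1, h2, add_comm]

lemma RegFam.inner {ι : Type} {T : Set (ι → ℂ)} {W : (ι → ℂ) → Submodule ℂ (R × S)}
    (hW : RegFam T W) {r : ℕ} (h : ∀ t ∈ T, finrank ℂ (inner (W t)) = r) :
    RegFam T fun t => HessPaving.inner (W t) := RegFam.comap (RegVec.const _) hW h

lemma RegFam.outer {ι : Type} {T : Set (ι → ℂ)} {W : (ι → ℂ) → Submodule ℂ (R × S)}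
    (hW : RegFam T W) {r : ℕ} (h : ∀ t ∈ T, finrank ℂ (outer (W t)) = r) :
    RegFam T fun t => HessPaving.outer (W t) := RegFam.map (RegVec.const _) hW h

/-- Pairs of subspaces of `R × S` whose traces on `R` and projections to `S` are in given cells, at
least one of which consists of pairs of equal subspaces, form a cell. -/
theorem isPairCell_of_isLiftCell {QR : LinearMap.BilinForm ℂ R} {QS : LinearMap.BilinForm ℂ S}
    (hsR : ∀ x y, QR x y = QR y x) (hnR : ∀ x, (∀ y, QR x y = 0) → x = 0)
    (hsS : ∀ x y, QS x y = QS y x) (hnS : ∀ x, (∀ y, QS x y = 0) → x = 0)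
    {CR : Set (Submodule ℂ R × Submodule ℂ R)} {CS : Set (Submodule ℂ S × Submodule ℂ S)}
    (hR : IsLiftCell QR CR) (hS : IsLiftCell QS CS) (hle : ∀ x ∈ CR, x.1 ≤ x.2)
    (hle' : ∀ x ∈ CS, x.1 ≤ x.2) (heq : (∀ x ∈ CR, x.1 = x.2) ∨ ∀ x ∈ CS, x.1 = x.2) :
    IsPairCell {x : Submodule ℂ (R × S) × Submodule ℂ (R × S) |
      x.1 ≤ x.2 ∧ (inner x.1, inner x.2) ∈ CR ∧ (outer x.1, outer x.2) ∈ CS} := by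
  obtain ⟨D, _, _, _, g, g', A₁, A, a1, a2, a3, a4, a5, a6⟩ := hR
  obtain ⟨D', _, _, _, k, k', B₁, B, b1, b2, b3, b4, b5, b6⟩ := hS
  have hgi := fun d => injective_of_contragredient' hsR hnR (a1 d)
  have hki := fun d => injective_of_contragredient' hsS hnS (b1 d)
  have hA : A₁ ≤ A := (Submodule.map_le_map_iff_of_injective (hgi 0) _ _).1 (hle _ (a2 0))
  have hB : B₁ ≤ B := (Submodule.map_le_map_iff_of_injective (hki 0) _ _).1 (hle' _ (b2 0))
  have hAB : A₁ = A ∨ B₁ = B := by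
    rcases heq with h | h
    · exact Or.inl (Submodule.map_injective_of_injective (hgi 0) (h _ (a2 0)))
    · exact Or.inr (Submodule.map_injective_of_injective (hki 0) (h _ (b2 0)))
  -- A subspace with trace `A₁` and projection `B` is `A₁` plus the graph of a map `B → R`,
  -- determined modulo `A₁`; taking values in the complement `Rc` makes it unique. The shears `u h`
  -- realise these graphs.
  obtain ⟨Rc, hRc⟩ := A₁.exists_isCompl
  obtain ⟨p₀, hp₀⟩ := B.subtype.exists_leftInverse_of_injective (Submodule.ker_subtype _)
  have hp : ∀ s : B, p₀ s = s := fun s => LinearMap.congr_fun hp₀ s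
  let u : (B →ₗ[ℂ] Rc) → (R × S) →ₗ[ℂ] (R × S) := fun h =>
    LinearMap.id + LinearMap.inl ℂ R S ∘ₗ Rc.subtype ∘ₗ h ∘ₗ p₀ ∘ₗ LinearMap.snd ℂ R S
  have hu : ∀ h r s, u h (r, s) = (r + h (p₀ s), s) := fun h r s =>
    Prod.ext rfl (add_zero s)
  let φ : D × D' × (B →ₗ[ℂ] Rc) → (R × S) →ₗ[ℂ] (R × S) := fun x =>
    (g x.1).prodMap (k x.2.1) ∘ₗ u x.2.2
  have hgki : ∀ d e, Function.Injective ((g d).prodMap (k e)) := fun d e x y h => by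
    rw [LinearMap.prodMap_apply, LinearMap.prodMap_apply, Prod.mk.injEq] at h
    exact Prod.ext (hgi d h.1) (hki e h.2)
  have hui : ∀ h, Function.Injective (u h) := fun h => by
    rintro ⟨r, s⟩ ⟨r', s'⟩ hh
    rw [hu, hu, Prod.mk.injEq] at hh
    obtain ⟨h1, rfl⟩ := hh
    rw [add_right_cancel h1]
  have hinner : ∀ x (Y : Submodule ℂ R) (Z : Submodule ℂ S),
      inner ((Y.prod Z).map (φ x)) = Y.map (g x.1) := fun x Y Z => by
    ext r
    rw [mem_inner]
    constructor
    · rintro ⟨⟨r', s⟩, ⟨h1, h2⟩, h3⟩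
      change (g x.1).prodMap (k x.2.1) (u x.2.2 (r', s)) = _ at h3
      rw [hu, LinearMap.prodMap_apply, Prod.mk.injEq] at h3
      obtain rfl : s = 0 := hki _ (h3.2.trans (map_zero _).symm)
      rw [map_zero, map_zero] at h3
      exact ⟨r', h1, by simpa using h3.1⟩
    · rintro ⟨r', h1, rfl⟩
      refine ⟨(r', 0), ⟨h1, Z.zero_mem⟩, ?_⟩
      change (g x.1).prodMap (k x.2.1) (u x.2.2 (r', 0)) = _
      rw [hu]; simp
  have houter : ∀ x (Y : Submodule ℂ R) (Z : Submodule ℂ S),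
      outer ((Y.prod Z).map (φ x)) = Z.map (k x.2.1) := fun x Y Z => by
    ext s
    rw [mem_outer]
    constructor
    · rintro ⟨r, ⟨r', s'⟩, ⟨h1, h2⟩, h3⟩
      change (g x.1).prodMap (k x.2.1) (u x.2.2 (r', s')) = _ at h3
      rw [hu, LinearMap.prodMap_apply, Prod.mk.injEq] at h3
      exact ⟨s', h2, h3.2⟩
    · rintro ⟨s', h1, rfl⟩
      refine ⟨g x.1 (0 + x.2.2 (p₀ s')), (0, s'), ⟨Y.zero_mem, h1⟩, ?_⟩
      change (g x.1).prodMap (k x.2.1) (u x.2.2 (0, s')) = _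
      rw [hu, LinearMap.prodMap_apply]
  have hback : ∀ d e (Y : Submodule ℂ (R × S)),
      (Y.comap ((g d).prodMap (k e))).map ((g d).prodMap (k e)) = Y := fun d e Y => by
    rw [Submodule.map_comap_eq, LinearMap.range_eq_top.2
      (LinearMap.injective_iff_surjective.1 (hgki d e)), top_inf_eq]
  have hbi : ∀ d e (Y : Submodule ℂ (R × S)) (Z : Submodule ℂ R), inner Y = Z.map (g d) →
      inner (Y.comap ((g d).prodMap (k e))) = Z := fun d e Y Z h => by
    ext r
    have h1 : r ∈ Z ↔ g d r ∈ Z.map (g d) :=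
      ⟨fun h => ⟨r, h, rfl⟩, fun ⟨r', h, e⟩ => hgi d e ▸ h⟩
    rw [h1, ← h, mem_inner, mem_inner, Submodule.mem_comap, LinearMap.prodMap_apply, map_zero]
  have hbo : ∀ d e (Y : Submodule ℂ (R × S)) (Z : Submodule ℂ S), outer Y = Z.map (k e) →
      outer (Y.comap ((g d).prodMap (k e))) = Z := fun d e Y Z h => by
    ext s
    have h1 : s ∈ Z ↔ k e s ∈ Z.map (k e) :=
      ⟨fun h => ⟨s, h, rfl⟩, fun ⟨r', h, e⟩ => hki _ e ▸ h⟩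
    rw [h1, ← h, mem_outer, mem_outer]
    constructor
    · rintro ⟨r, hr⟩; exact ⟨_, hr⟩
    · rintro ⟨r, hr⟩
      obtain ⟨r', rfl⟩ := LinearMap.injective_iff_surjective.1 (hgi d) r
      exact ⟨r', hr⟩
  have hgr : ∀ h (Y : Submodule ℂ R) (Z : Submodule ℂ S) s, s ∈ Z → s ∈ B →
      ((h (p₀ s) : R), s) ∈ (Y.prod Z).map (u h) := fun h Y Z s hs _ =>
    ⟨(0, s), ⟨Y.zero_mem, hs⟩, by rw [hu, zero_add]⟩
  have huin : ∀ h (Y : Submodule ℂ R) (Z : Submodule ℂ S), inner ((Y.prod Z).map (u h)) = Y :=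
    fun h Y Z => by
      ext r
      rw [mem_inner]
      constructor
      · rintro ⟨⟨r', s⟩, ⟨h1, h2⟩, h3⟩
        rw [hu, Prod.mk.injEq] at h3
        obtain ⟨h3, rfl⟩ := h3
        rw [map_zero, map_zero] at h3
        have : r' = r := by simpa using h3
        exact this ▸ h1
      · exact fun h1 => ⟨(r, 0), ⟨h1, Z.zero_mem⟩, by rw [hu]; simp⟩
  classical
  -- One graph must describe both members of the pair. It is read off from the member with trace
  -- `A₁` and projection `B`: the larger one if the traces agree, otherwise the smaller one, in
  -- which case the projections agree.
  let M : Submodule ℂ (R × S) → Submodule ℂ (R × S) → Submodule ℂ (R × S) := fun Y₁ Y =>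
    if A₁ = A then Y else Y₁
  have hM₁ : ∀ Y₁ Y : Submodule ℂ (R × S), inner Y₁ = A₁ → inner Y = A →
      outer Y₁ = B₁ → outer Y = B → inner (M Y₁ Y) = A₁ ∧ outer (M Y₁ Y) = B := by
    intro Y₁ Y h2 h3 h4 h5
    by_cases hc : A₁ = A
    · simp only [M, if_pos hc]; exact ⟨h3.trans hc.symm, h5⟩
    · simp only [M, if_neg hc]; exact ⟨h2, h4.trans (hAB.resolve_left hc)⟩
  have hM₂ : ∀ (Y₁ Y : Submodule ℂ (R × S)) (h : B →ₗ[ℂ] Rc), Y₁ ≤ Y → inner Y₁ = A₁ →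
      inner Y = A → outer Y₁ = B₁ → outer Y = B → (∀ s : B, ((h s : R), (s : S)) ∈ M Y₁ Y) →
      (A₁.prod B₁).map (u h) = Y₁ ∧ (A.prod B).map (u h) = Y := by
    intro Y₁ Y h h1 h2 h3 h4 h5 h6
    have h7 : ∀ s : B, ((h s : R), (s : S)) ∈ Y := fun s => by
      by_cases hc : A₁ = A
      · simpa only [M, if_pos hc] using h6 s
      · exact h1 (by simpa only [M, if_neg hc] using h6 s)
    have h8 : ∀ s : B, (s : S) ∈ B₁ → ((h s : R), (s : S)) ∈ Y₁ := fun s hs => by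
      by_cases hc : A₁ = A
      · rw [← h4, mem_outer] at hs
        obtain ⟨r, hr⟩ := hs
        have h9 : (h s - r : R) ∈ inner Y₁ := by
          rw [h2, hc, ← h3, mem_inner]
          simpa using Y.sub_mem (h7 s) (h1 hr)
        simpa using Y₁.add_mem (mem_inner.1 h9) hr
      · simpa only [M, if_neg hc] using h6 s
    constructor
    · refine Submodule.eq_of_le_of_finrank_eq ?_ ?_
      · rintro _ ⟨⟨r, s⟩, ⟨hr, hs⟩, rfl⟩
        rw [hu]
        have h9 := h8 ⟨s, hB hs⟩ hs
        have e : p₀ s = ⟨s, hB hs⟩ := hp ⟨s, hB hs⟩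
        rw [e]
        have h10 : r ∈ inner Y₁ := h2.symm ▸ hr
        simpa using Y₁.add_mem (mem_inner.1 h10) h9
      · rw [finrank_map_inj (hui h), ← finrank_outer Y₁, h2, h4, finrank_prod', add_comm]
    · refine Submodule.eq_of_le_of_finrank_eq ?_ ?_
      · rintro _ ⟨⟨r, s⟩, ⟨hr, hs⟩, rfl⟩
        rw [hu]
        have h9 := h7 ⟨s, hs⟩
        have e : p₀ s = ⟨s, hs⟩ := hp ⟨s, hs⟩
        rw [e]
        have h10 : r ∈ inner Y := h3.symm ▸ hr
        simpa using Y.add_mem (mem_inner.1 h10) h9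
      · rw [finrank_map_inj (hui h), ← finrank_outer Y, h3, h5, finrank_prod', add_comm]
  have hM₃ : ∀ h (s : B), ((h s : R), (s : S)) ∈
      M ((A₁.prod B₁).map (u h)) ((A.prod B).map (u h)) := by
    intro h s
    have h1 := hgr h A B s s.2 s.2
    rw [hp] at h1
    by_cases hc : A₁ = A
    · simp only [M, if_pos hc]; exact h1
    · simp only [M, if_neg hc]
      have h1 := hgr h A₁ B₁ s ((hAB.resolve_left hc).symm ▸ s.2) s.2
      rwa [hp] at h1
  have hM₄ : ∀ h, inner (M ((A₁.prod B₁).map (u h)) ((A.prod B).map (u h))) = A₁ := by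
    intro h
    by_cases hc : A₁ = A
    · simp only [M, if_pos hc]; rw [huin, hc]
    · simp only [M, if_neg hc]; rw [huin]
  have hRc0 : ∀ r : Rc, (r : R) ∈ A₁ → r = 0 := fun r hr => Subtype.ext (by
    have : (r : R) ∈ A₁ ⊓ Rc := ⟨hr, r.2⟩
    rwa [hRc.inf_eq_bot] at this)
  have hM₅ : ∀ Y : Submodule ℂ (R × S), inner Y = A₁ → outer Y = B →
      ∃ h : B →ₗ[ℂ] Rc, ∀ s : B, ((h s : R), (s : S)) ∈ Y := by
    intro Y h1 h2
    let ψ : Y →ₗ[ℂ] B := ((LinearMap.snd ℂ R S) ∘ₗ Y.subtype).codRestrict B fun y => by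
      rw [← h2]; exact ⟨y, y.2, rfl⟩
    obtain ⟨σ, hσ⟩ := ψ.exists_rightInverse_of_surjective (LinearMap.range_eq_top.2 (by
      rintro ⟨s, hs⟩
      rw [← h2, mem_outer] at hs
      obtain ⟨r, hr⟩ := hs
      exact ⟨⟨(r, s), hr⟩, rfl⟩))
    -- The `R`-component of any linear section over `B` is corrected by an element of `A₁`, which
    -- stays inside `Y` because `A₁` is its trace.
    refine ⟨Rc.projectionOnto A₁ hRc.symm ∘ₗ LinearMap.fst ℂ R S ∘ₗ Y.subtype ∘ₗ σ,
      fun s => ?_⟩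
    have h3 : ((σ s).1).2 = s := congrArg Subtype.val (LinearMap.congr_fun hσ s)
    have h4 : ((σ s).1).1 - Rc.projectionOnto A₁ hRc.symm ((σ s).1).1 ∈ inner Y := by
      rw [h1, ← Submodule.projectionOnto_apply_eq_zero_iff hRc.symm, map_sub,
        Submodule.projectionOnto_apply_left, sub_self]
    have h5 := Y.sub_mem (σ s).2 (mem_inner.1 h4)
    convert h5 using 1
    refine Prod.ext ?_ ?_
    · simp
    · simp [h3]
  have hsplit : ∀ x, (A₁.prod B₁).map (φ x) =
      ((A₁.prod B₁).map (u x.2.2)).map ((g x.1).prodMap (k x.2.1)) ∧ (A.prod B).map (φ x) =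
      ((A.prod B).map (u x.2.2)).map ((g x.1).prodMap (k x.2.1)) := fun x =>
    ⟨Submodule.map_comp _ _ _, Submodule.map_comp _ _ _⟩
  let p : D × D' × (B →ₗ[ℂ] Rc) → Submodule ℂ (R × S) × Submodule ℂ (R × S) := fun x =>
    ((A₁.prod B₁).map (φ x), (A.prod B).map (φ x))
  have hp1 : ∀ x, p x ∈ {x : Submodule ℂ (R × S) × Submodule ℂ (R × S) |
      x.1 ≤ x.2 ∧ (inner x.1, inner x.2) ∈ CR ∧ (outer x.1, outer x.2) ∈ CS} := fun x =>
    ⟨Submodule.map_mono (Submodule.prod_mono hA hB), by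
      simp only [p, hinner]; exact a2 _, by simp only [p, houter]; exact b2 _⟩
  have hp2 : ∀ x ∈ {x : Submodule ℂ (R × S) × Submodule ℂ (R × S) |
      x.1 ≤ x.2 ∧ (inner x.1, inner x.2) ∈ CR ∧ (outer x.1, outer x.2) ∈ CS}, ∃ d, p d = x := by
    rintro ⟨Y₁, Y⟩ ⟨h1, h2, h3⟩
    obtain ⟨d, hd⟩ := a3 _ h2
    obtain ⟨e, he⟩ := b3 _ h3
    rw [Prod.mk.injEq] at hd he
    have i1 := hbi d e Y₁ A₁ hd.1.symm
    have i2 := hbi d e Y A hd.2.symm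
    have i3 := hbo d e Y₁ B₁ he.1.symm
    have i4 := hbo d e Y B he.2.symm
    obtain ⟨h, hh⟩ := hM₅ _ (hM₁ _ _ i1 i2 i3 i4).1 (hM₁ _ _ i1 i2 i3 i4).2
    obtain ⟨j1, j2⟩ := hM₂ _ _ h (Submodule.comap_mono h1) i1 i2 i3 i4 hh
    refine ⟨(d, e, h), Prod.ext ?_ ?_⟩
    · exact ((hsplit (d, e, h)).1.trans (congrArg _ j1)).trans (hback d e Y₁)
    · exact ((hsplit (d, e, h)).2.trans (congrArg _ j2)).trans (hback d e Y)
  have hp3 : ∀ x x', p x = p x' → x = x' := by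
    rintro ⟨d, e, h⟩ ⟨d', e', h'⟩ hpp
    rw [Prod.mk.injEq] at hpp
    obtain rfl : d = d' := a4 d d' (by
      have := congrArg inner hpp.1; rwa [hinner, hinner] at this) (by
      have := congrArg inner hpp.2; rwa [hinner, hinner] at this)
    obtain rfl : e = e' := b4 e e' (by
      have := congrArg outer hpp.1; rwa [houter, houter] at this) (by
      have := congrArg outer hpp.2; rwa [houter, houter] at this)
    have h1 := Submodule.map_injective_of_injective (hgki d e)
      ((hsplit (d, e, h)).1.symm.trans (hpp.1.trans (hsplit (d, e, h')).1))
    have h2 := Submodule.map_injective_of_injective (hgki d e)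
      ((hsplit (d, e, h)).2.symm.trans (hpp.2.trans (hsplit (d, e, h')).2))
    simp only at h1 h2
    have : h = h' := by
      refine LinearMap.ext fun s => sub_eq_zero.1 (hRc0 _ ?_)
      rw [← hM₄ h, mem_inner]
      have h3 := hM₃ h' s
      rw [← h1, ← h2] at h3
      simpa using Submodule.sub_mem _ (hM₃ h s) h3
    rw [this]
  choose! c hc using hp2
  refine ⟨D × D' × (B →ₗ[ℂ] Rc), inferInstance, inferInstance, inferInstance, p, c, hp1, hc,
    fun d => hp3 _ _ (hc _ (hp1 d)), fun ι T f hf => ?_, fun ι T Y₁ Y hY₁ hY hC => ?_⟩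
  · have hφ : RegVec T fun t => φ (f t) := by
      have f1 := (a5 ι T _ (hf.linear (LinearMap.fst ℂ _ _))).1
      have f2 := (b5 ι T _ (hf.linear (LinearMap.fst ℂ _ _ ∘ₗ LinearMap.snd ℂ _ _))).1
      have f3 := hf.linear (LinearMap.snd ℂ _ _ ∘ₗ LinearMap.snd ℂ D (D' × (B →ₗ[ℂ] Rc)))
      refine RegVec.comp ?_ ?_
      · exact regVec_hom_iff.2 fun v => (regVec_hom_iff.1 f1 v.1).pair (regVec_hom_iff.1 f2 v.2)
      · refine (RegVec.const _).add ((RegVec.const _).comp ((RegVec.const _).comp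
          (RegVec.comp f3 (RegVec.const _))))
    have hφi : ∀ x, Function.Injective (φ x) := fun x => (hgki _ _).comp (hui _)
    exact ⟨RegFam.map hφ (RegFam.const _) fun t _ => finrank_map_inj (hφi _) _,
      RegFam.map hφ (RegFam.const _) fun t _ => finrank_map_inj (hφi _) _⟩
  · have hct := fun t ht => hc _ (hC t ht)
    have hct1 : ∀ t ∈ T, (A₁.prod B₁).map (φ (c (Y₁ t, Y t))) = Y₁ t := fun t ht =>
      congrArg Prod.fst (hct t ht)
    have hct2 : ∀ t ∈ T, (A.prod B).map (φ (c (Y₁ t, Y t))) = Y t := fun t ht =>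
      congrArg Prod.snd (hct t ht)
    have i1 : ∀ t ∈ T, inner (Y₁ t) = A₁.map (g (c (Y₁ t, Y t)).1) := fun t ht => by
      conv_lhs => rw [← hct1 t ht, hinner]
    have i2 : ∀ t ∈ T, inner (Y t) = A.map (g (c (Y₁ t, Y t)).1) := fun t ht => by
      conv_lhs => rw [← hct2 t ht, hinner]
    have o1 : ∀ t ∈ T, outer (Y₁ t) = B₁.map (k (c (Y₁ t, Y t)).2.1) := fun t ht => by
      conv_lhs => rw [← hct1 t ht, houter]
    have o2 : ∀ t ∈ T, outer (Y t) = B.map (k (c (Y₁ t, Y t)).2.1) := fun t ht => by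
      conv_lhs => rw [← hct2 t ht, houter]
    have hd : RegVec T fun t => (c (Y₁ t, Y t)).1 := a6 ι T _ _ _
      (hY₁.inner (r := finrank ℂ A₁) fun t ht => by rw [i1 t ht, finrank_map_inj (hgi _)])
      (hY.inner (r := finrank ℂ A) fun t ht => by rw [i2 t ht, finrank_map_inj (hgi _)])
      fun t ht => ⟨(i1 t ht).symm, (i2 t ht).symm⟩
    have he : RegVec T fun t => (c (Y₁ t, Y t)).2.1 := b6 ι T _ _ _
      (hY₁.outer (r := finrank ℂ B₁) fun t ht => by rw [o1 t ht, finrank_map_inj (hki _)])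
      (hY.outer (r := finrank ℂ B) fun t ht => by rw [o2 t ht, finrank_map_inj (hki _)])
      fun t ht => ⟨(o1 t ht).symm, (o2 t ht).symm⟩
    have hgk : RegVec T fun t => (g (c (Y₁ t, Y t)).1).prodMap (k (c (Y₁ t, Y t)).2.1) :=
      regVec_hom_iff.2 fun v => (regVec_hom_iff.1 (a5 ι T _ hd).1 v.1).pair
        (regVec_hom_iff.1 (b5 ι T _ he).1 v.2)
    have s1 : ∀ t ∈ T, (A₁.prod B₁).map (u (c (Y₁ t, Y t)).2.2) =
        (Y₁ t).comap ((g (c (Y₁ t, Y t)).1).prodMap (k (c (Y₁ t, Y t)).2.1)) := fun t ht => by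
      conv_rhs => arg 2; rw [← hct1 t ht, (hsplit _).1]
      rw [Submodule.comap_map_eq_of_injective (hgki _ _)]
    have s2 : ∀ t ∈ T, (A.prod B).map (u (c (Y₁ t, Y t)).2.2) =
        (Y t).comap ((g (c (Y₁ t, Y t)).1).prodMap (k (c (Y₁ t, Y t)).2.1)) := fun t ht => by
      conv_rhs => arg 2; rw [← hct2 t ht, (hsplit _).2]
      rw [Submodule.comap_map_eq_of_injective (hgki _ _)]
    have r1 : RegFam T fun t => (A₁.prod B₁).map (u (c (Y₁ t, Y t)).2.2) :=
      (RegFam.comap hgk hY₁ fun t ht => by rw [← s1 t ht, finrank_map_inj (hui _)]).congr s1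
    have r2 : RegFam T fun t => (A.prod B).map (u (c (Y₁ t, Y t)).2.2) :=
      (RegFam.comap hgk hY fun t ht => by rw [← s2 t ht, finrank_map_inj (hui _)]).congr s2
    have r3 : RegFam T fun t => M ((A₁.prod B₁).map (u (c (Y₁ t, Y t)).2.2))
        ((A.prod B).map (u (c (Y₁ t, Y t)).2.2)) := by
      by_cases hAA : A₁ = A
      · simp only [M, if_pos hAA]; exact r2
      · simp only [M, if_neg hAA]; exact r1
    -- The parameters of trace and projection are already regular. After undoing the automorphisms,
    -- the map `h` is the unique solution of the linear conditions `(h s, s) ∈ M`.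
    refine hd.pair (he.pair ?_)
    refine RegFam.solve_hom (F := B →ₗ[ℂ] Rc) (G := B) r3
      (L := fun _ => LinearMap.llcomp ℂ B Rc (R × S) (LinearMap.inl ℂ R S ∘ₗ Rc.subtype))
      (RegVec.const _) (f := fun _ => LinearMap.inr ℂ R S ∘ₗ B.subtype) (RegVec.const _) ?_ ?_
    · intro t _ v hv
      refine LinearMap.ext fun s => hRc0 _ ?_
      rw [← hM₄ (c (Y₁ t, Y t)).2.2, mem_inner]
      exact hv s
    · intro t _ s
      have := hM₃ (c (Y₁ t, Y t)).2.2 s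
      convert this using 1
      exact Prod.ext (add_zero _) (zero_add _)

end Product

/-! ### Cells for the pairs that describe the fibres -/

section ProductCells

variable {R S : Type} [AddCommGroup R] [Module ℂ R] [FiniteDimensional ℂ R]
  [AddCommGroup S] [Module ℂ S] [FiniteDimensional ℂ S]

/-- The test subspaces of a product. -/
def prodTests (ER : List (Submodule ℂ R)) (ES : List (Submodule ℂ S)) :
    List (Submodule ℂ (R × S)) :=
  ER.map (fun E => E.prod ⊥) ++ ES.map (fun E => (⊤ : Submodule ℂ R).prod E)

/-- The tests `E × 0` see the trace. The tests `R × E` see the projection up to the dimension of the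
trace, which is known because `⊤` is among the tests of `R`. -/
lemma sameDims_prodTests {ER : List (Submodule ℂ R)} {ES : List (Submodule ℂ S)} (ht : ⊤ ∈ ER)
    {W W₀ : Submodule ℂ (R × S)} : SameDims (prodTests ER ES) W W₀ ↔
      SameDims ER (inner W) (inner W₀) ∧ SameDims ES (outer W) (outer W₀) := by
  constructor
  · intro h
    have h1 : SameDims ER (inner W) (inner W₀) := fun E hE => by
      rw [finrank_inner_inf, finrank_inner_inf]
      exact h _ (List.mem_append_left _ (List.mem_map.2 ⟨E, hE, rfl⟩))
    refine ⟨h1, fun E hE => ?_⟩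
    have h2 := finrank_outer_inf W E
    have h3 := finrank_outer_inf W₀ E
    rw [h _ (List.mem_append_right _ (List.mem_map.2 ⟨E, hE, rfl⟩)), h1.finrank_eq ht] at h2
    omega
  · rintro ⟨h1, h2⟩ E hE
    rcases List.mem_append.1 hE with h | h
    · obtain ⟨E', hE', rfl⟩ := List.mem_map.1 h
      rw [← finrank_inner_inf, ← finrank_inner_inf, h1 E' hE']
    · obtain ⟨E', hE', rfl⟩ := List.mem_map.1 h
      rw [← finrank_outer_inf, ← finrank_outer_inf, h2 E' hE', h1.finrank_eq ht]

lemma inner_mono {W W' : Submodule ℂ (R × S)} (h : W ≤ W') : inner W ≤ inner W' :=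
  Submodule.comap_mono h

lemma outer_mono {W W' : Submodule ℂ (R × S)} (h : W ≤ W') : outer W ≤ outer W' :=
  Submodule.map_mono h

/-- Pairs of subspaces of `R × S` with isotropic projection to `S` and with traces on `R` related
by `P`. -/
def relPairs (P : Submodule ℂ R → Submodule ℂ R → Prop) (QS : LinearMap.BilinForm ℂ S) :
    Set (Submodule ℂ (R × S) × Submodule ℂ (R × S)) :=
  {x | x.1 ≤ x.2 ∧ outer x.2 ≤ QS.orthogonal (outer x.2) ∧ P (inner x.1) (inner x.2)}

/-- The two spaces differ by one dimension, so either the traces agree and the projections differ by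
a line, or the other way round. The position determines which, and one factor always consists of
equal pairs, as `isPairCell_of_isLiftCell` requires. -/
lemma isPairCell_relPairs {QR : LinearMap.BilinForm ℂ R} {QS : LinearMap.BilinForm ℂ S}
    (hsR : ∀ x y, QR x y = QR y x) (hnR : ∀ x, (∀ y, QR x y = 0) → x = 0)
    (hsS : ∀ x y, QS x y = QS y x) (hnS : ∀ x, (∀ y, QS x y = 0) → x = 0)
    {ER : List (Submodule ℂ R)} {ES : List (Submodule ℂ S)} (htR : ⊤ ∈ ER) (htS : ⊤ ∈ ES)
    {P : Submodule ℂ R → Submodule ℂ R → Prop}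
    (h1 : ∀ A₀, P A₀ A₀ → IsLiftCell QR {x | x.1 = x.2 ∧ P x.1 x.2 ∧ SameDims ER x.1 A₀ ∧
      SameDims ER x.2 A₀})
    (h2 : ∀ A₁ A₀, P A₁ A₀ → A₁ ≤ A₀ → finrank ℂ A₀ = finrank ℂ A₁ + 1 →
      IsLiftCell QR {x | x.1 ≤ x.2 ∧ P x.1 x.2 ∧ SameDims ER x.1 A₁ ∧ SameDims ER x.2 A₀})
    (h3 : ∀ W₀, W₀ ≤ QS.orthogonal W₀ → IsLiftCell QS {x | x.1 = x.2 ∧ x.2 ≤ QS.orthogonal x.2 ∧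
        SameDims ES x.1 W₀ ∧ SameDims ES x.2 W₀})
    (h4 : ∀ W₁ W₀, W₀ ≤ QS.orthogonal W₀ → W₁ ≤ W₀ → finrank ℂ W₀ = finrank ℂ W₁ + 1 →
        IsLiftCell QS {x | x.1 ≤ x.2 ∧ x.2 ≤ QS.orthogonal x.2 ∧ SameDims ES x.1 W₁ ∧
          SameDims ES x.2 W₀})
    {W₁ W₀ : Submodule ℂ (R × S)} (hW : (W₁, W₀) ∈ relPairs P QS)
    (hf : finrank ℂ W₀ = finrank ℂ W₁ + 1) :
    IsPairCell {x | x ∈ relPairs P QS ∧ SameDims (prodTests ER ES) x.1 W₁ ∧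
      SameDims (prodTests ER ES) x.2 W₀} := by
  obtain ⟨w1, w2, w3⟩ := hW
  simp only at w1 w2 w3
  have f1 := finrank_outer W₁
  have f0 := finrank_outer W₀
  have g1 := Submodule.finrank_mono (inner_mono w1)
  have g2 := Submodule.finrank_mono (outer_mono w1)
  by_cases hc : finrank ℂ (inner W₁) = finrank ℂ (inner W₀)
  · have hi : inner W₁ = inner W₀ := Submodule.eq_of_le_of_finrank_eq (inner_mono w1) hc
    rw [hi] at w3
    have key := isPairCell_of_isLiftCell hsR hnR hsS hnS (h1 _ w3)
      (h4 (outer W₁) (outer W₀) w2 (outer_mono w1) (by omega)) (fun x hx => hx.1.le)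
      (fun x hx => hx.1) (Or.inl fun x hx => hx.1)
    convert key using 1
    ext ⟨x₁, x₀⟩
    simp only [relPairs, Set.mem_ofPred_eq, sameDims_prodTests htR, hi]
    constructor
    · rintro ⟨⟨a1, a2, a3⟩, ⟨b1, b2⟩, c1, c2⟩
      have : inner x₁ = inner x₀ := Submodule.eq_of_le_of_finrank_eq (inner_mono a1)
        ((b1.finrank_eq htR).trans (c1.finrank_eq htR).symm)
      exact ⟨a1, ⟨this, a3, b1, c1⟩, outer_mono a1, a2, b2, c2⟩
    · rintro ⟨a1, ⟨b1, b2, b3, b4⟩, c1, c2, c3, c4⟩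
      exact ⟨⟨a1, c2, b2⟩, ⟨b3, c3⟩, b4, c4⟩
  · have ho : outer W₁ = outer W₀ := Submodule.eq_of_le_of_finrank_eq (outer_mono w1) (by omega)
    have key := isPairCell_of_isLiftCell hsR hnR hsS hnS
      (h2 _ _ w3 (inner_mono w1) (by rw [ho] at f1; omega)) (h3 (outer W₀) w2)
      (fun x hx => hx.1) (fun x hx => hx.1.le) (Or.inr fun x hx => hx.1)
    convert key using 1
    ext ⟨x₁, x₀⟩
    simp only [relPairs, Set.mem_ofPred_eq, sameDims_prodTests htR, ho]
    constructor
    · rintro ⟨⟨a1, a2, a3⟩, ⟨b1, b2⟩, c1, c2⟩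
      have : outer x₁ = outer x₀ := Submodule.eq_of_le_of_finrank_eq (outer_mono a1)
        ((b2.finrank_eq htS).trans (c2.finrank_eq htS).symm)
      exact ⟨a1, ⟨inner_mono a1, a3, b1, c1⟩, this, a2, b2, c2⟩
    · rintro ⟨a1, ⟨b1, b2, b3, b4⟩, c1, c2, c3, c4⟩
      exact ⟨⟨a1, c2, b2⟩, ⟨b3, c3⟩, b4, c4⟩

/-- The pairs of subspaces that describe the fibres of `τ`. -/
def relE (QR : LinearMap.BilinForm ℂ R) (QS : LinearMap.BilinForm ℂ S) :
    Set (Submodule ℂ (R × S) × Submodule ℂ (R × S)) :=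
  relPairs (fun A' A => QR.orthogonal A ≤ A') QS

/-- The pairs of subspaces that describe the fibres of `σ`. -/
def relO (QR : LinearMap.BilinForm ℂ R) (QS : LinearMap.BilinForm ℂ S) :
    Set (Submodule ℂ (R × S) × Submodule ℂ (R × S)) :=
  relPairs (fun A' _ => QR.orthogonal A' ≤ A') QS

/-- When the two traces coincide, the conditions of `relE` and `relO` both say that the trace is
coisotropic; the two sets differ only in the case of a jump in `R`. -/
theorem exists_relCells {QR : LinearMap.BilinForm ℂ R} {QS : LinearMap.BilinForm ℂ S}
    (hsR : ∀ x y, QR x y = QR y x) (hnR : ∀ x, (∀ y, QR x y = 0) → x = 0)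
    (hsS : ∀ x y, QS x y = QS y x) (hnS : ∀ x, (∀ y, QS x y = 0) → x = 0) :
    ∃ Es : List (Submodule ℂ (R × S)), ⊤ ∈ Es ∧ ∀ X, X = relE QR QS ∨ X = relO QR QS →
      ∀ x₀ ∈ X, finrank ℂ x₀.2 = finrank ℂ x₀.1 + 1 →
        IsPairCell {x | x ∈ X ∧ SameDims Es x.1 x₀.1 ∧ SameDims Es x.2 x₀.2} := by
  obtain ⟨ER, tR, rI, rE, rO, -, -⟩ := exists_liftCells hsR hnR
  obtain ⟨ES, tS, -, -, -, sI, sH⟩ := exists_liftCells hsS hnS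
  refine ⟨prodTests ER ES, List.mem_append_right _ (List.mem_map.2 ⟨⊤, tS, Submodule.prod_top⟩), ?_⟩
  rintro X (rfl | rfl) ⟨W₁, W₀⟩ hx hf
  · refine isPairCell_relPairs hsR hnR hsS hnS tR tS (fun A₀ h => ?_) (fun A₁ A₀ h h' => ?_) sI sH
      hx hf
    · convert rI A₀ h using 1
      ext ⟨x₁, x₀⟩
      refine and_congr_right fun h => ?_
      obtain rfl : x₁ = x₀ := h
      rfl
    · exact rE A₁ A₀ h h'
  · refine isPairCell_relPairs hsR hnR hsS hnS tR tS (fun A₀ h => ?_) (fun A₁ A₀ h h' => ?_) sI sH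
      hx hf
    · convert rI A₀ h using 1
      ext ⟨x₁, x₀⟩
      refine and_congr_right fun h => ?_
      obtain rfl : x₁ = x₀ := h
      rfl
    · exact rO A₁ A₀ h h'

end ProductCells

/-! ### The kernel of `x` modulo the image of `x²` as a pair of quadratic spaces -/

section Adapted

variable {U R S : Type} [AddCommGroup U] [Module ℂ U] [FiniteDimensional ℂ U]
  [AddCommGroup R] [Module ℂ R] [FiniteDimensional ℂ R]
  [AddCommGroup S] [Module ℂ S] [FiniteDimensional ℂ S]

/-- A description of the kernel of a self-adjoint endomorphism `x` modulo the image of `x²`: the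
first factor parametrises the classes of `range x ⊓ ker x`, with the form `(x v, w) ↦ Q v w`. -/
structure Adapted (Q : LinearMap.BilinForm ℂ U) (x : Module.End ℂ U)
    (QR : LinearMap.BilinForm ℂ R) (QS : LinearMap.BilinForm ℂ S) (θ : R × S →ₗ[ℂ] U) : Prop where
  eq_zero : ∀ p u, θ p = x (x u) → p = 0
  apply : ∀ p, x (θ p) = 0
  exists_of_apply : ∀ v, x v = 0 → ∃ u p, v = x (x u) + θ p
  exists_eq : ∀ r, ∃ v, x v = θ (r, 0)
  exists_of_apply_apply : ∀ v, x (x v) = 0 → ∃ u r, x v = x (x u) + θ (r, 0)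
  form_left : ∀ v r r', x v = θ (r, 0) → Q v (θ (r', 0)) = QR r r'
  form_right : ∀ p p', Q (θ p) (θ p') = QS p.2 p'.2

lemma orthogonal_ker {Q : LinearMap.BilinForm ℂ U} (hs : ∀ x y, Q x y = Q y x)
    (hn : ∀ x, (∀ y, Q x y = 0) → x = 0) {x : Module.End ℂ U}
    (hx : ∀ v w, Q (x v) w = Q v (x w)) :
    Q.orthogonal (LinearMap.range x) = LinearMap.ker x ∧
      Q.orthogonal (LinearMap.ker x) = LinearMap.range x := by
  have h : Q.orthogonal (LinearMap.range x) = LinearMap.ker x := by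
    ext v
    constructor
    · intro h
      refine hn _ fun w => ?_
      rw [hx, hs]
      exact h _ ⟨w, rfl⟩
    · rintro h _ ⟨w, rfl⟩
      change Q (x w) v = 0
      rw [hx, LinearMap.mem_ker.1 h, map_zero]
  exact ⟨h, by rw [← h, orthogonal_orthogonal' hs hn]⟩

lemma orthogonal_inf {Q : LinearMap.BilinForm ℂ U} (hs : ∀ x y, Q x y = Q y x)
    (hn : ∀ x, (∀ y, Q x y = 0) → x = 0) (Y Z : Submodule ℂ U) :
    Q.orthogonal (Y ⊓ Z) = Q.orthogonal Y ⊔ Q.orthogonal Z := by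
  rw [← orthogonal_orthogonal' hs hn (Q.orthogonal Y ⊔ Q.orthogonal Z), orthogonal_sup,
    orthogonal_orthogonal' hs hn, orthogonal_orthogonal' hs hn]

/-- `R` is a complement of `im x²` in `im x ∩ ker x`, and `S` a complement of `im x ∩ ker x` in `ker
x`. The form on `R` uses a linear section of `x` over its image. It is non-degenerate because `(im x
∩ ker x)^⊥ = ker x + im x`, which `x` maps into `im x²`; the form on `S` is non-degenerate because
`(ker x)^⊥ = im x`. -/
theorem exists_adapted {Q : LinearMap.BilinForm ℂ U} (hs : ∀ x y, Q x y = Q y x)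
    (hn : ∀ x, (∀ y, Q x y = 0) → x = 0) {x : Module.End ℂ U}
    (hx : ∀ v w, Q (x v) w = Q v (x w)) (h3 : ∀ v, x (x (x v)) = 0) :
    ∃ (R S : Submodule ℂ U) (QR : LinearMap.BilinForm ℂ R) (QS : LinearMap.BilinForm ℂ S)
      (θ : R × S →ₗ[ℂ] U), (∀ x y, QR x y = QR y x) ∧ (∀ x, (∀ y, QR x y = 0) → x = 0) ∧
        (∀ x y, QS x y = QS y x) ∧ (∀ x, (∀ y, QS x y = 0) → x = 0) ∧ Adapted Q x QR QS θ := by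
  obtain ⟨o1, o2⟩ := orthogonal_ker hs hn hx
  let I := LinearMap.range (x ∘ₗ x)
  let Rt := LinearMap.range x ⊓ LinearMap.ker x
  have hI : I ≤ Rt := by
    rintro _ ⟨v, rfl⟩
    exact ⟨⟨x v, rfl⟩, h3 v⟩
  have hort : Q.orthogonal Rt = LinearMap.ker x ⊔ LinearMap.range x := by
    rw [orthogonal_inf hs hn, o1, o2]
  have hperp : ∀ v w, x w = 0 → Q (x v) w = 0 := fun v w hw => by rw [hx, hw, map_zero]
  obtain ⟨R, hR, hR1, hR2⟩ := exists_relCompl hI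
  obtain ⟨S, hS, hS1, hS2⟩ := exists_relCompl (inf_le_right : Rt ≤ LinearMap.ker x)
  obtain ⟨σ, hσ⟩ := x.rangeRestrict.exists_rightInverse_of_surjective x.range_rangeRestrict
  have hσ' : ∀ v, x (σ v) = v := fun v => congrArg Subtype.val (LinearMap.congr_fun hσ v)
  let τ : R →ₗ[ℂ] U := σ ∘ₗ Submodule.inclusion (hR.trans inf_le_left)
  have hτ : ∀ r : R, x (τ r) = r := fun r => hσ' _
  have hRk : ∀ r : R, x r = 0 := fun r => (hR r.2).2
  have hSk : ∀ s : S, x s = 0 := fun s => hS s.2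
  have hθ : ∀ p : R × S, (LinearMap.coprod R.subtype S.subtype) p = (p.1 : U) + p.2 := fun p => rfl
  refine ⟨R, S, (Q ∘ₗ τ).compl₂ R.subtype, Q.restrict S, LinearMap.coprod R.subtype S.subtype,
    fun r r' => ?_, fun r hr => ?_, fun s s' => hs _ _, fun s hs' => ?_, ?_⟩
  · change Q (τ r) r' = Q (τ r') r
    rw [← hτ r, ← hτ r', ← hx, hτ, hs]
  · have h1 : τ r ∈ Q.orthogonal Rt := by
      intro w hw
      change Q w (τ r) = 0
      rw [← hR2] at hw
      obtain ⟨_, ⟨v, rfl⟩, r', hr', rfl⟩ := Submodule.mem_sup.1 hw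
      have h2 : Q (τ r) r' = 0 := hr ⟨r', hr'⟩
      rw [LinearMap.comp_apply, map_add, LinearMap.add_apply, hx, hx, hτ, hRk, map_zero, zero_add,
        hs, h2]
    rw [hort] at h1
    obtain ⟨k, hk, _, ⟨v, rfl⟩, h2⟩ := Submodule.mem_sup.1 h1
    have h5 : (r : U) ∈ I := by
      refine ⟨v, ?_⟩
      rw [← hτ r, ← h2, map_add, LinearMap.mem_ker.1 hk, zero_add]
      rfl
    have h4 : (r : U) ∈ I ⊓ R := ⟨h5, r.2⟩
    rw [hR1] at h4
    exact Subtype.ext h4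
  · have h1 : (s : U) ∈ Q.orthogonal (LinearMap.ker x) := by
      intro w hw
      change Q w s = 0
      rw [← hS2] at hw
      obtain ⟨_, ⟨⟨v, rfl⟩, -⟩, s', hs'', rfl⟩ := Submodule.mem_sup.1 hw
      have h2 : Q s s' = 0 := hs' ⟨s', hs''⟩
      rw [map_add, LinearMap.add_apply, hperp _ _ (hSk s), zero_add, hs, h2]
    rw [o2] at h1
    have h2 : (s : U) ∈ Rt ⊓ S := ⟨⟨h1, hSk s⟩, s.2⟩
    rw [hS1] at h2
    exact Subtype.ext h2
  · refine ⟨fun p u h => ?_, fun p => ?_, fun v hv => ?_, fun r => ⟨τ r, ?_⟩, fun v hv => ?_,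
      fun v r r' h => ?_, fun p p' => ?_⟩
    · rw [hθ] at h
      have h1 : (p.2 : U) ∈ Rt ⊓ S := by
        refine ⟨?_, p.2.2⟩
        rw [← eq_sub_iff_add_eq'] at h
        rw [h]
        exact Rt.sub_mem (hI ⟨u, rfl⟩) (hR p.1.2)
      rw [hS1] at h1
      have h1' : (p.2 : U) = 0 := h1
      rw [h1', add_zero] at h
      have h2 : (p.1 : U) ∈ I ⊓ R := ⟨⟨u, h.symm⟩, p.1.2⟩
      rw [hR1] at h2
      exact Prod.ext (Subtype.ext h2) (Subtype.ext h1')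
    · rw [hθ, map_add, hRk, hSk, add_zero]
    · have hv' : v ∈ I ⊔ R ⊔ S := by
        rw [hR2]
        change v ∈ LinearMap.range x ⊓ LinearMap.ker x ⊔ S
        rw [hS2]
        exact hv
      obtain ⟨y, hy, s, hs', rfl⟩ := Submodule.mem_sup.1 hv'
      obtain ⟨_, ⟨u, rfl⟩, r, hr, rfl⟩ := Submodule.mem_sup.1 hy
      exact ⟨u, (⟨r, hr⟩, ⟨s, hs'⟩), by rw [hθ, ← add_assoc]; rfl⟩
    · rw [hτ, hθ]; exact (add_zero _).symm
    · have hv' : x v ∈ Rt := ⟨⟨v, rfl⟩, hv⟩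
      rw [← hR2] at hv'
      obtain ⟨_, ⟨u, rfl⟩, r, hr, h⟩ := Submodule.mem_sup.1 hv'
      refine ⟨u, ⟨r, hr⟩, ?_⟩
      rw [← h, hθ]
      change x (x u) + r = x (x u) + (r + 0)
      rw [add_zero]
    · rw [hθ] at h ⊢
      change x v = r + 0 at h
      change Q v (r' + 0) = Q (τ r) r'
      rw [add_zero] at h ⊢
      rw [← hτ r', ← hx, ← hx, h, hτ]
    · rw [hθ, hθ]
      change _ = Q (p.2 : U) p'.2
      have e1 : ∀ (r : R) w, x w = 0 → Q r w = 0 := fun r w hw => by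
        rw [← hτ r]; exact hperp _ _ hw
      rw [map_add, map_add, LinearMap.add_apply, LinearMap.add_apply, e1 _ _ (hRk _),
        e1 _ _ (hSk _), hs (p.2 : U) p'.1, e1 _ _ (hSk _), zero_add, zero_add, zero_add]

namespace Adapted

variable {Q : LinearMap.BilinForm ℂ U} {x : Module.End ℂ U} {QR : LinearMap.BilinForm ℂ R}
  {QS : LinearMap.BilinForm ℂ S} {θ : R × S →ₗ[ℂ] U} (H : Adapted Q x QR QS θ)
  (hs : ∀ x y, Q x y = Q y x) (hn : ∀ x, (∀ y, Q x y = 0) → x = 0)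
  (hx : ∀ v w, Q (x v) w = Q v (x w)) (h3 : ∀ v, x (x (x v)) = 0)

-- If `x v` has class `r` in `R`, then pairing `v` with `B ∩ im x` computes the pairing of `r` with
-- `inner B`. So, modulo `im x²`, the space `x B^⊥` is the orthogonal of `inner B` in `R`.
include H hs hn hx h3 in
lemma apply_orthogonal_iff {B C : Submodule ℂ U} (hB : LinearMap.range (x ∘ₗ x) ≤ B)
    (hBk : B ≤ LinearMap.ker x) (hC : LinearMap.range (x ∘ₗ x) ≤ C) :
    (∀ v ∈ Q.orthogonal B, x v ∈ C) ↔
      QR.orthogonal (inner (B.comap θ)) ≤ inner (C.comap θ) := by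
  obtain ⟨o1, o2⟩ := orthogonal_ker hs hn hx
  have hsR : ∀ r r', QR r r' = QR r' r := fun r r' => by
    obtain ⟨v, hv⟩ := H.exists_eq r
    obtain ⟨v', hv'⟩ := H.exists_eq r'
    rw [← H.form_left v r r' hv, ← H.form_left v' r' r hv', ← hv, ← hv', ← hx, hs]
  constructor
  · intro h r hr
    obtain ⟨v, hv⟩ := H.exists_eq r
    have hv2 : x (x v) = 0 := by rw [hv, H.apply]
    have h1 : v ∈ Q.orthogonal (B ⊓ LinearMap.range x) := by
      rintro b ⟨hb, w, hw⟩
      change Q b v = 0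
      obtain ⟨u, r', hr'⟩ := H.exists_of_apply_apply w (by rw [hw]; exact hBk hb)
      have h2 : r' ∈ inner (B.comap θ) := by
        change θ (r', 0) ∈ B
        rw [hw, ← sub_eq_iff_eq_add'] at hr'
        rw [← hr']
        exact B.sub_mem hb (hB ⟨u, rfl⟩)
      have h4 : QR r' r = 0 := hr r' h2
      rw [← hw, hr', map_add, LinearMap.add_apply, hx, hx, hv2, map_zero, zero_add, hs,
        H.form_left v r r' hv, hsR, h4]
    -- Since `(B ∩ im x)^⊥ = B^⊥ + ker x`, the vector `v` can be moved into `B^⊥` without changing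
    -- `x v`.
    rw [orthogonal_inf hs hn, o1] at h1
    obtain ⟨v', hv', k, hk, rfl⟩ := Submodule.mem_sup.1 h1
    have h2 := h v' hv'
    rw [map_add, LinearMap.mem_ker.1 hk, add_zero] at hv
    change θ (r, 0) ∈ C
    rwa [← hv]
  · intro h v hv
    -- As `B` contains `im x²`, its orthogonal lies in `ker x²`.
    have hv2 : x (x v) = 0 := hn _ fun w => by
      rw [hx, hx, hs]
      exact hv _ (hB ⟨w, rfl⟩)
    obtain ⟨u, r, hr⟩ := H.exists_of_apply_apply v hv2
    have h1 : r ∈ QR.orthogonal (inner (B.comap θ)) := by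
      intro r' hr'
      change QR r' r = 0
      have h2 : x (v - x u) = θ (r, 0) := by rw [map_sub, hr]; abel
      have h4 : Q (θ (r', 0)) v = 0 := hv _ hr'
      rw [hsR, ← H.form_left _ r r' h2, map_sub, LinearMap.sub_apply, hs, h4, hx, H.apply,
        map_zero, sub_zero]
    rw [hr]
    exact C.add_mem (hC ⟨u, rfl⟩) (h h1)

-- The image of `x` is orthogonal to its kernel, so on `ker x` the form only sees the `S`-component.
include H hs hx h3 in
lemma isotropic_iff {B : Submodule ℂ U} (hB : LinearMap.range (x ∘ₗ x) ≤ B)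
    (hBk : B ≤ LinearMap.ker x) :
    B ≤ Q.orthogonal B ↔ outer (B.comap θ) ≤ QS.orthogonal (outer (B.comap θ)) := by
  constructor
  · intro h s hs' s' hs''
    obtain ⟨r, hr⟩ := mem_outer.1 hs'
    obtain ⟨r', hr'⟩ := mem_outer.1 hs''
    have h1 : Q (θ (r', s')) (θ (r, s)) = 0 := h hr _ hr'
    rwa [H.form_right] at h1
  · intro h b hb b' hb'
    change Q b' b = 0
    obtain ⟨u, p, rfl⟩ := H.exists_of_apply b (hBk hb)
    obtain ⟨u', p', rfl⟩ := H.exists_of_apply b' (hBk hb')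
    have hmem : ∀ u p, x (x u) + θ p ∈ B → p.2 ∈ outer (B.comap θ) := fun u p h =>
      mem_outer.2 ⟨p.1, by simpa using B.sub_mem h (hB ⟨u, rfl⟩)⟩
    have h1 : QS p'.2 p.2 = 0 := h (hmem u p hb) _ (hmem u' p' hb')
    have hperp : ∀ v w, x w = 0 → Q (x v) w = 0 := fun v w hw => by rw [hx, hw, map_zero]
    rw [map_add (Q _), hs _ (x (x u)), hperp _ _ (hBk hb'), zero_add, map_add, LinearMap.add_apply,
      hperp _ _ (H.apply p), zero_add, H.form_right, h1]

end Adapted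

end Adapted

/-! ### Subspaces between `I` and `I + im θ` -/

section Plus

variable {U E : Type} [AddCommGroup U] [Module ℂ U] [FiniteDimensional ℂ U]
  [AddCommGroup E] [Module ℂ E] [FiniteDimensional ℂ E] {I : Submodule ℂ U} {θ : E →ₗ[ℂ] U}

/-- The subspace of `U` containing `I` that corresponds to a subspace of `E ⊆ U / I`. -/
def plus (I : Submodule ℂ U) (θ : E →ₗ[ℂ] U) (W : Submodule ℂ E) : Submodule ℂ U := I ⊔ W.map θ

lemma plus_mono {W W' : Submodule ℂ E} (h : W ≤ W') : plus I θ W ≤ plus I θ W' :=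
  sup_le_sup_left (Submodule.map_mono h) I

lemma le_plus (W : Submodule ℂ E) : I ≤ plus I θ W := le_sup_left

lemma plus_le (W : Submodule ℂ E) : plus I θ W ≤ I ⊔ LinearMap.range θ :=
  sup_le_sup_left (LinearMap.map_le_range) I

/-- Together with `comap_plus` this identifies the subspaces of `E` with the interval between `I`
and `I + im θ`. -/
lemma plus_comap {B : Submodule ℂ U} (h1 : I ≤ B) (h2 : B ≤ I ⊔ LinearMap.range θ) :
    plus I θ (B.comap θ) = B := by
  refine le_antisymm (sup_le h1 (Submodule.map_comap_le _ _)) fun b hb => ?_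
  obtain ⟨i, hi, _, ⟨p, rfl⟩, rfl⟩ := Submodule.mem_sup.1 (h2 hb)
  exact Submodule.add_mem_sup hi ⟨p, by simpa using B.sub_mem hb (h1 hi), rfl⟩

variable (hθ : ∀ p, θ p ∈ I → p = 0)
include hθ

lemma comap_plus (W : Submodule ℂ E) : (plus I θ W).comap θ = W := by
  ext p
  constructor
  · intro h
    obtain ⟨i, hi, _, ⟨w, hw, rfl⟩, h⟩ := Submodule.mem_sup.1 h
    have h1 : p - w = 0 := hθ _ (by
      rw [map_sub, ← h, add_sub_cancel_right]; exact hi)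
    rwa [sub_eq_zero.1 h1]
  · exact fun h => Submodule.mem_sup_right ⟨p, h, rfl⟩

lemma finrank_plus (W : Submodule ℂ E) : finrank ℂ (plus I θ W) = finrank ℂ I + finrank ℂ W := by
  have h1 : Function.Injective θ := LinearMap.ker_eq_bot.1 (LinearMap.ker_eq_bot'.2 fun p hp =>
    hθ p (hp ▸ I.zero_mem))
  have h2 := Submodule.finrank_sup_add_finrank_inf_eq I (W.map θ)
  have h3 : I ⊓ W.map θ = ⊥ := by
    rw [eq_bot_iff]
    rintro _ ⟨h, p, -, rfl⟩
    have := hθ p h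
    rw [this, map_zero]; rfl
  rw [h3, finrank_bot, add_zero, finrank_map_inj h1] at h2
  exact h2

/-- Test subspaces of `E` become test subspaces of the ambient space, with all intersection
dimensions shifted by `dim I`. -/
lemma finrank_inf_plus {B : Submodule ℂ U} (h1 : I ≤ B) (h2 : B ≤ I ⊔ LinearMap.range θ)
    (W : Submodule ℂ E) : finrank ℂ (B ⊓ plus I θ W : Submodule ℂ U) =
      finrank ℂ I + finrank ℂ (B.comap θ ⊓ W : Submodule ℂ E) := by
  rw [← finrank_plus hθ, ← plus_comap (I := I) (θ := θ) (le_inf h1 (le_plus W))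
    (inf_le_left.trans h2), Submodule.comap_inf, comap_plus hθ]

lemma RegFam.plus {ι : Type} {T : Set (ι → ℂ)} {W : (ι → ℂ) → Submodule ℂ E} (hW : RegFam T W)
    {r : ℕ} (hr : ∀ t ∈ T, finrank ℂ (W t) = r) : RegFam T fun t => plus I θ (W t) := by
  have h1 : Function.Injective θ := LinearMap.ker_eq_bot.1 (LinearMap.ker_eq_bot'.2 fun p hp =>
    hθ p (hp ▸ I.zero_mem))
  refine RegFam.sup (RegFam.const I) (RegFam.map (RegVec.const θ) hW (r := r) fun t ht => ?_)
    (r := finrank ℂ I + r) fun t ht => ?_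
  · rw [finrank_map_inj h1, hr t ht]
  · exact (finrank_plus hθ _).trans (by rw [hr t ht])

lemma RegFam.comap_of_plus {ι : Type} {T : Set (ι → ℂ)} {B : (ι → ℂ) → Submodule ℂ U}
    (hB : RegFam T B) {r : ℕ} (hr : ∀ t ∈ T, finrank ℂ (B t) = r) (h1 : ∀ t ∈ T, I ≤ B t)
    (h2 : ∀ t ∈ T, B t ≤ I ⊔ LinearMap.range θ) : RegFam T fun t => (B t).comap θ :=
  RegFam.comap (RegVec.const θ) hB (r := r - finrank ℂ I) fun t ht => by
    have := finrank_plus hθ ((B t).comap θ)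
    rw [plus_comap (h1 t ht) (h2 t ht), hr t ht] at this
    omega

lemma IsPairCell.plus {C : Set (Submodule ℂ E × Submodule ℂ E)} (hC : IsPairCell C) {a b : ℕ}
    (ha : ∀ x ∈ C, finrank ℂ x.1 = a) (hb : ∀ x ∈ C, finrank ℂ x.2 = b) :
    IsPairCell ((fun x : Submodule ℂ E × Submodule ℂ E =>
      (plus I θ x.1, HessPaving.plus I θ x.2)) '' C) := by
  obtain ⟨D, _, _, _, p, c, h1, h2, h3, h4, h5⟩ := hC
  refine ⟨D, inferInstance, inferInstance, inferInstance,
    fun d => (HessPaving.plus I θ (p d).1, HessPaving.plus I θ (p d).2),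
    fun x => c (x.1.comap θ, x.2.comap θ), fun d => ⟨p d, h1 d, rfl⟩, ?_, fun d => ?_,
    fun ι T f hf => ?_, fun ι T S B hS hB h => ?_⟩
  · rintro _ ⟨x, hx, rfl⟩
    simp only [comap_plus hθ]
    rw [h2 x hx]
  · simp only [comap_plus hθ]; exact h3 d
  · obtain ⟨f1, f2⟩ := h4 ι T f hf
    exact ⟨f1.plus hθ fun t _ => ha _ (h1 _), f2.plus hθ fun t _ => hb _ (h1 _)⟩
  · refine h5 ι T (fun t => (S t).comap θ) (fun t => (B t).comap θ)
      (hS.comap_of_plus hθ (r := finrank ℂ I + a) ?_ ?_ ?_)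
      (hB.comap_of_plus hθ (r := finrank ℂ I + b) ?_ ?_ ?_) ?_ <;> intro t ht
    all_goals
      obtain ⟨x, hx, hxe⟩ := h t ht
      rw [Prod.mk.injEq] at hxe
      obtain ⟨e1, e2⟩ := hxe
    · rw [← e1, finrank_plus hθ, ha x hx]
    · rw [← e1]; exact le_plus _
    · rw [← e1]; exact plus_le _
    · rw [← e2, finrank_plus hθ, hb x hx]
    · rw [← e2]; exact le_plus _
    · rw [← e2]; exact plus_le _
    · rw [← e1, ← e2, comap_plus hθ, comap_plus hθ]; exact hx

end Plus

/-! ### The fibres in terms of the quadratic spaces, and their paving -/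

section Fibres

variable {m N : ℕ} {E : Type} [AddCommGroup E] [Module ℂ E] [FiniteDimensional ℂ E]
  {I : Submodule ℂ (V N)} {θ : E →ₗ[ℂ] V N}

/-- The flags `I ≤ small ≤ big ≤ I + range θ` that correspond to a set of pairs of subspaces. -/
def flagsOver (m : ℕ) (I : Submodule ℂ (V N)) (θ : E →ₗ[ℂ] V N)
    (X : Set (Submodule ℂ E × Submodule ℂ E)) : Set (Flag m N) :=
  {F | I ≤ F.small ∧ F.big ≤ I ⊔ LinearMap.range θ ∧ (F.small.comap θ, F.big.comap θ) ∈ X}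

/-- The strata for the tests `plus I θ E` are the images of the cells of pairs in `E`. The
hypothesis `1 ≤ m` makes the dimensions of each pair differ by exactly one. -/
theorem paved_flagsOver (hm : 1 ≤ m) (hθ : ∀ p, θ p ∈ I → p = 0)
    {X : Set (Submodule ℂ E × Submodule ℂ E)} (hX : ∀ x ∈ X, x.1 ≤ x.2)
    {Es : List (Submodule ℂ E)}
    (h : ∀ x₀ ∈ X, finrank ℂ x₀.2 = finrank ℂ x₀.1 + 1 →
      IsPairCell {x | x ∈ X ∧ SameDims Es x.1 x₀.1 ∧ SameDims Es x.2 x₀.2}) (ht : ⊤ ∈ Es) :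
    Paved (flagVariety m N) (flagsOver m I θ X) := by
  refine paved_of_levels (Es.map (plus I θ)) _ fun F₀ hF₀ => ?_
  obtain ⟨h1, h2, h3⟩ := hF₀
  have hfs : ∀ F : Flag m N, I ≤ F.small → F.big ≤ I ⊔ LinearMap.range θ →
      finrank ℂ I + finrank ℂ (F.small.comap θ) = m - 1 := fun F hF hF' => by
    rw [← finrank_plus hθ, plus_comap hF (F.le.trans hF'), F.finrank_small]
  have hfb : ∀ F : Flag m N, I ≤ F.small → F.big ≤ I ⊔ LinearMap.range θ →
      finrank ℂ I + finrank ℂ (F.big.comap θ) = m := fun F hF hF' => by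
    rw [← finrank_plus hθ, plus_comap (hF.trans F.le) hF', F.finrank_big]
  have f1 := hfs F₀ h1 h2
  have f2 := hfb F₀ h1 h2
  have key := (h _ h3 (by simp only; omega)).plus (I := I) hθ
    (a := finrank ℂ (F₀.small.comap θ)) (b := finrank ℂ (F₀.big.comap θ))
    (fun x hx => hx.2.1.finrank_eq ht) (fun x hx => hx.2.2.finrank_eq ht)
  convert key using 1
  ext ⟨S, B⟩
  constructor
  · rintro ⟨F, ⟨⟨g1, g2, g3⟩, hF⟩, hFe⟩
    rw [Flag.pair, Prod.mk.injEq] at hFe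
    obtain ⟨rfl, rfl⟩ := hFe
    refine ⟨(F.small.comap θ, F.big.comap θ), ⟨g3, fun E hE => ?_, fun E hE => ?_⟩,
      Prod.ext (plus_comap g1 (F.le.trans g2)) (plus_comap (g1.trans F.le) g2)⟩
    · have := (hF _ (List.mem_map.2 ⟨E, hE, rfl⟩)).1
      rw [finrank_inf_plus hθ g1 (F.le.trans g2), finrank_inf_plus hθ h1 (F₀.le.trans h2)] at this
      exact Nat.add_left_cancel this
    · have := (hF _ (List.mem_map.2 ⟨E, hE, rfl⟩)).2
      rw [finrank_inf_plus hθ (g1.trans F.le) g2, finrank_inf_plus hθ (h1.trans F₀.le) h2] at this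
      exact Nat.add_left_cancel this
  · rintro ⟨⟨x₁, x₀⟩, ⟨k1, k2, k3⟩, hx⟩
    rw [Prod.mk.injEq] at hx
    obtain ⟨rfl, rfl⟩ := hx
    refine ⟨⟨plus I θ x₁, plus I θ x₀, plus_mono (hX _ k1), ?_, ?_⟩, ⟨⟨le_plus _, plus_le _, ?_⟩,
      fun E' hE' => ?_⟩, rfl⟩
    · rw [finrank_plus hθ, k2.finrank_eq ht]; exact f1
    · rw [finrank_plus hθ, k3.finrank_eq ht]; exact f2
    · simp only [comap_plus hθ]; exact k1
    · obtain ⟨E, hE, rfl⟩ := List.mem_map.1 hE'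
      simp only
      rw [finrank_inf_plus hθ (le_plus _) (plus_le _), finrank_inf_plus hθ (le_plus _) (plus_le _),
        finrank_inf_plus hθ h1 (F₀.le.trans h2), finrank_inf_plus hθ (h1.trans F₀.le) h2,
        comap_plus hθ, comap_plus hθ, k2 E hE, k3 E hE]
      exact ⟨rfl, rfl⟩

variable {R S : Type} [AddCommGroup R] [Module ℂ R] [FiniteDimensional ℂ R]
  [AddCommGroup S] [Module ℂ S] [FiniteDimensional ℂ S]
  {Q : LinearMap.BilinForm ℂ (V N)} {x : Module.End ℂ (V N)} {QR : LinearMap.BilinForm ℂ R}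
  {QS : LinearMap.BilinForm ℂ S}

lemma range_le_orthogonal (hs : ∀ x y, Q x y = Q y x)
    (hx : ∀ v w, Q (x v) w = Q v (x w)) {B : Submodule ℂ (V N)} (hB : ∀ v ∈ B, x v = 0) (v : V N) :
    x v ∈ Q.orthogonal B := by
  intro w hw
  change Q w (x v) = 0
  rw [hs, hx, hB w hw, map_zero]

/-- The image of `x` is orthogonal to the killed space `F.big`, so a second application of `x` lands
in `F.small`. -/
lemma fiberTau_range_le (hs : ∀ x y, Q x y = Q y x) {F : Flag m N} (hF : F ∈ fiberTau Q m x) :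
    LinearMap.range (x ∘ₗ x) ≤ F.small := by
  obtain ⟨-, h1, h2, h3⟩ := hF
  rintro _ ⟨v, rfl⟩
  exact h3 _ (range_le_orthogonal hs h1.1 h2 v)

lemma fiberSigma_range_le (hs : ∀ x y, Q x y = Q y x) {F : Flag m N}
    (hF : F ∈ fiberSigma Q m x) : LinearMap.range (x ∘ₗ x) ≤ F.small := by
  obtain ⟨-, h1, h2, h3⟩ := hF
  rintro _ ⟨v, rfl⟩
  exact h3 _ (orthogonal_le_orthogonal F.le (range_le_orthogonal hs h1.1 h2 v))

lemma cube_eq_zero_of_range_le {F : Flag m N} (h : LinearMap.range (x ∘ₗ x) ≤ F.small)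
    (h2 : ∀ v ∈ F.big, x v = 0) (v : V N) : x (x (x v)) = 0 := h2 _ (F.le (h ⟨v, rfl⟩))

lemma fiberTau_cube (hs : ∀ x y, Q x y = Q y x) (h : (fiberTau Q m x).Nonempty) (v : V N) :
    x (x (x v)) = 0 := by
  obtain ⟨F, hF⟩ := h
  exact cube_eq_zero_of_range_le (fiberTau_range_le hs hF) hF.2.2.1 v

lemma fiberSigma_cube (hs : ∀ x y, Q x y = Q y x) (h : (fiberSigma Q m x).Nonempty) (v : V N) :
    x (x (x v)) = 0 := by
  obtain ⟨F, hF⟩ := h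
  exact cube_eq_zero_of_range_le (fiberSigma_range_le hs hF) hF.2.2.1 v

section

variable {θ : R × S →ₗ[ℂ] V N} (H : Adapted Q x QR QS θ)

include H in
lemma Adapted.ker_eq (h3 : ∀ v, x (x (x v)) = 0) :
    LinearMap.range (x ∘ₗ x) ⊔ LinearMap.range θ = LinearMap.ker x := by
  refine le_antisymm (sup_le ?_ ?_) fun v hv => ?_
  · rintro _ ⟨v, rfl⟩; exact h3 v
  · rintro _ ⟨p, rfl⟩; exact H.apply p
  · obtain ⟨u, p, rfl⟩ := H.exists_of_apply v hv
    exact Submodule.add_mem_sup ⟨u, rfl⟩ ⟨p, rfl⟩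

include H in
lemma Adapted.eq_zero' (p : R × S) (hp : θ p ∈ LinearMap.range (x ∘ₗ x)) : p = 0 := by
  obtain ⟨u, hu⟩ := hp
  exact H.eq_zero p u hu.symm

-- Both conditions on a flag are translated with `B = F.big`, and `C = F.small` as target; the fibre
-- of `σ` differs in that `F.small` also takes the place of `B` in the second condition.
include H in
theorem fiberTau_eq (hs : ∀ x y, Q x y = Q y x) (hn : ∀ x, (∀ y, Q x y = 0) → x = 0)
    (hx : x ∈ g1 Q) (h3 : ∀ v, x (x (x v)) = 0) :
    fiberTau Q m x = flagsOver m (LinearMap.range (x ∘ₗ x)) θ (relE QR QS) := by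
  ext F
  have hk := H.ker_eq h3
  constructor
  · intro hF
    have hI := fiberTau_range_le hs hF
    obtain ⟨g1, g2, g3, g4⟩ := hF
    exact ⟨hI, hk ▸ g3, Submodule.comap_mono F.le,
      (H.isotropic_iff hs hx.1 h3 (hI.trans F.le) g3).1 g1,
      (H.apply_orthogonal_iff hs hn hx.1 h3 (hI.trans F.le) g3 hI).1 g4⟩
  · rintro ⟨hI, g3, -, g1, g4⟩
    rw [hk] at g3
    exact ⟨(H.isotropic_iff hs hx.1 h3 (hI.trans F.le) g3).2 g1, hx, g3,
      (H.apply_orthogonal_iff hs hn hx.1 h3 (hI.trans F.le) g3 hI).2 g4⟩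

include H in
theorem fiberSigma_eq (hs : ∀ x y, Q x y = Q y x) (hn : ∀ x, (∀ y, Q x y = 0) → x = 0)
    (hx : x ∈ g1 Q) (h3 : ∀ v, x (x (x v)) = 0) :
    fiberSigma Q m x = flagsOver m (LinearMap.range (x ∘ₗ x)) θ (relO QR QS) := by
  ext F
  have hk := H.ker_eq h3
  constructor
  · intro hF
    have hI := fiberSigma_range_le hs hF
    obtain ⟨g1, g2, g3, g4⟩ := hF
    exact ⟨hI, hk ▸ g3, Submodule.comap_mono F.le,
      (H.isotropic_iff hs hx.1 h3 (hI.trans F.le) g3).1 g1,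
      (H.apply_orthogonal_iff hs hn hx.1 h3 hI (F.le.trans g3) hI).1 g4⟩
  · rintro ⟨hI, g3, -, g1, g4⟩
    rw [hk] at g3
    exact ⟨(H.isotropic_iff hs hx.1 h3 (hI.trans F.le) g3).2 g1, hx, g3,
      (H.apply_orthogonal_iff hs hn hx.1 h3 hI (F.le.trans g3) hI).2 g4⟩

end

/-- If `x³ ≠ 0`, both fibres are empty. Otherwise the adapted description applies. -/
theorem paved_fiber (hm : 1 ≤ m) (hs : ∀ x y, Q x y = Q y x)
    (hn : ∀ x, (∀ y, Q x y = 0) → x = 0) (hx : x ∈ g1 Q) :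
    Paved (flagVariety m N) (fiberTau Q m x) ∧ Paved (flagVariety m N) (fiberSigma Q m x) := by
  by_cases h3 : ∀ v, x (x (x v)) = 0
  · obtain ⟨R, S, QR, QS, θ, hsR, hnR, hsS, hnS, H⟩ := exists_adapted hs hn hx.1 h3
    obtain ⟨Es, ht, hEs⟩ := exists_relCells hsR hnR hsS hnS
    rw [fiberTau_eq H hs hn hx h3, fiberSigma_eq H hs hn hx h3]
    exact ⟨paved_flagsOver hm H.eq_zero' (fun x hx => hx.1) (hEs _ (Or.inl rfl)) ht,
      paved_flagsOver hm H.eq_zero' (fun x hx => hx.1) (hEs _ (Or.inr rfl)) ht⟩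
  · have h1 : fiberTau Q m x = ∅ := Set.not_nonempty_iff_eq_empty.1 fun h => h3 (fiberTau_cube hs h)
    have h2 : fiberSigma Q m x = ∅ :=
      Set.not_nonempty_iff_eq_empty.1 fun h => h3 (fiberSigma_cube hs h)
    rw [h1, h2]
    exact ⟨Paved.empty, Paved.empty⟩

end Fibres

/-! ### Conjugating isotropic subspaces by unipotent isometries -/

section Orthogonal

variable {U : Type} [AddCommGroup U] [Module ℂ U] [FiniteDimensional ℂ U]
  {Q : LinearMap.BilinForm ℂ U}

/-- This is the value at `1` of the characteristic polynomial of `-n`, which is a power of the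
variable. -/
lemma det_one_add_of_isNilpotent {n : Module.End ℂ U} (hn : IsNilpotent n) :
    LinearMap.det (1 + n) = 1 := by
  have h1 := LinearMap.eval_charpoly (-n) 1
  have h2 : (-n).charpoly = Polynomial.X ^ finrank ℂ U :=
    (LinearMap.charpoly_eq_X_pow_iff _).2 fun v => by
      obtain ⟨k, hk⟩ := hn.neg
      exact ⟨k, by rw [hk]; rfl⟩
  rw [h2] at h1
  simpa using h1.symm

/-- A special isometry of a quadratic space. -/
def IsSpecial (Q : LinearMap.BilinForm ℂ U) (g : U →ₗ[ℂ] U) : Prop :=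
  (∀ v w, Q (g v) (g w) = Q v w) ∧ LinearMap.det g = 1

lemma IsSpecial.comp {g h : U →ₗ[ℂ] U} (hg : IsSpecial Q g) (hh : IsSpecial Q h) :
    IsSpecial Q (g ∘ₗ h) :=
  ⟨fun v w => (hg.1 _ _).trans (hh.1 v w), by rw [LinearMap.det_comp, hg.2, hh.2, mul_one]⟩

variable (hs : ∀ x y, Q x y = Q y x) (hn : ∀ x, (∀ y, Q x y = 0) → x = 0) {W B W' : Submodule ℂ U}

include hs hn in
lemma isCompl_orthogonal (hf : finrank ℂ W = finrank ℂ B) (h : W ⊓ Q.orthogonal B = ⊥) :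
    IsCompl W (Q.orthogonal B) := by
  refine (Submodule.isCompl_iff_disjoint _ _ ?_).2 (disjoint_iff.2 h)
  rw [hf, finrank_orthogonal' hs hn]

include hs hn in
lemma inf_orthogonal_symm (hf : finrank ℂ W = finrank ℂ B) (h : W ⊓ Q.orthogonal B = ⊥) :
    B ⊓ Q.orthogonal W = ⊥ := by
  have h1 := (isCompl_orthogonal hs hn hf h).sup_eq_top
  have h2 : Q.orthogonal (W ⊔ Q.orthogonal B) = Q.orthogonal W ⊓ B := by
    rw [orthogonal_sup, orthogonal_orthogonal' hs hn]
  rw [inf_comm, ← h2, h1, eq_bot_iff]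
  intro v hv
  refine hn v fun w => ?_
  rw [hs]; exact hv w trivial

include hs hn in
/-- The projection to `W` along the orthogonal space of a subspace paired perfectly with `W`. -/
lemma exists_dual_projection (hf : finrank ℂ W = finrank ℂ B) (h : W ⊓ Q.orthogonal B = ⊥) :
    ∃ p : U →ₗ[ℂ] U, (∀ v, p v ∈ W) ∧ (∀ v, ∀ b ∈ B, Q b (p v) = Q b v) ∧ (∀ w ∈ W, p w = w) ∧
      ∀ v, (∀ b ∈ B, Q b v = 0) → p v = 0 := by
  have hc := isCompl_orthogonal hs hn hf h
  refine ⟨W.projection _ hc, Submodule.projection_apply_mem hc, fun v b hb => ?_,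
    fun w hw => Submodule.projection_apply_left hc ⟨w, hw⟩,
    fun v hv => (Submodule.projection_apply_eq_zero_iff hc).2 hv⟩
  have := Submodule.sub_projection_mem hc v b hb
  change Q b (v - _) = 0 at this
  rw [map_sub, sub_eq_zero] at this
  exact this.symm

-- A complement `C` of `W^⊥` pairs perfectly with `W`. With `φ` the projection to `W` that preserves
-- the pairing with `C`, the map `c ↦ c - φ(c) / 2` cancels the form on `C` and does not affect the
-- pairing with `W`.
include hs hn in
lemma exists_dual_isotropic (hW : W ≤ Q.orthogonal W) :
    ∃ B : Submodule ℂ U, B ≤ Q.orthogonal B ∧ finrank ℂ W = finrank ℂ B ∧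
      W ⊓ Q.orthogonal B = ⊥ := by
  obtain ⟨C, hC⟩ := (Q.orthogonal W).exists_isCompl
  have h1 := Submodule.finrank_add_eq_of_isCompl hC
  have h2 := finrank_orthogonal' hs hn W
  have hCf : finrank ℂ C = finrank ℂ W := by omega
  have hCW : W ⊓ Q.orthogonal C = ⊥ :=
    inf_orthogonal_symm hs hn hCf (by rw [inf_comm]; exact hC.inf_eq_bot)
  obtain ⟨φ, f1, f2, f3, f4⟩ := exists_dual_projection hs hn hCf.symm hCW
  let ψ : U →ₗ[ℂ] U := LinearMap.id - (2⁻¹ : ℂ) • φ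
  have hψ : ∀ v, ψ v = v - (2⁻¹ : ℂ) • φ v := fun v => rfl
  have hφφ : ∀ v w, Q (φ v) (φ w) = 0 := fun v w => hW (f1 w) _ (f1 v)
  have hinj : ∀ c ∈ C, ψ c = 0 → c = 0 := fun c hc h => by
    rw [hψ, sub_eq_zero] at h
    have : c ∈ Q.orthogonal W ⊓ C := ⟨hW (h ▸ W.smul_mem _ (f1 c)), hc⟩
    rwa [hC.inf_eq_bot] at this
  refine ⟨C.map ψ, ?_, ?_, ?_⟩
  · rintro _ ⟨c, hc, rfl⟩ _ ⟨c', hc', rfl⟩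
    change Q (ψ c') (ψ c) = 0
    have e1 := f2 c c' hc'
    have e2 := f2 c' c hc
    rw [hs] at e2
    simp only [hψ, map_sub, map_smul, LinearMap.sub_apply, LinearMap.smul_apply, smul_eq_mul,
      hφφ, e1, e2, hs c c']
    ring
  · have := finrank_map_add_inf_ker ψ C
    have h3 : C ⊓ LinearMap.ker ψ = ⊥ := eq_bot_iff.2 fun c hc => hinj c hc.1 hc.2
    rw [h3, finrank_bot, add_zero] at this
    rw [this, hCf]
  · rw [eq_bot_iff, ← hCW]
    rintro w ⟨hw, hw'⟩
    refine ⟨hw, fun c hc => ?_⟩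
    have h3 : Q (ψ c) w = 0 := hw' _ ⟨c, hc, rfl⟩
    have h4 : Q (φ c) w = 0 := hW hw _ (f1 c)
    change Q c w = 0
    rw [hψ, map_sub, map_smul, LinearMap.sub_apply, LinearMap.smul_apply, h4, smul_zero,
      sub_zero] at h3
    exact h3

include hs hn in
/-- Isotropic subspaces opposite to the same isotropic subspace are conjugate. -/
lemma exists_special_of_opposite (hW : W ≤ Q.orthogonal W) (hW' : W' ≤ Q.orthogonal W')
    (hB : B ≤ Q.orthogonal B) (hf : finrank ℂ W = finrank ℂ B) (hf' : finrank ℂ W' = finrank ℂ B)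
    (h : W ⊓ Q.orthogonal B = ⊥) (h' : W' ⊓ Q.orthogonal B = ⊥) :
    ∃ g : U →ₗ[ℂ] U, IsSpecial Q g ∧ W.map g = W' := by
  obtain ⟨p, p1, p2, p3, p4⟩ := exists_dual_projection hs hn hf h
  obtain ⟨p', p1', p2', p3', p4'⟩ := exists_dual_projection hs hn hf' h'
  obtain ⟨q, q1, q2, q3, q4⟩ := exists_dual_projection hs hn hf.symm (inf_orthogonal_symm hs hn hf h)
  obtain ⟨q', q1', q2', q3', q4'⟩ :=
    exists_dual_projection hs hn hf'.symm (inf_orthogonal_symm hs hn hf' h')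
  -- The map `1 + n` sends `W` to `W'` by `p'`, fixes `B`, and pushes the orthogonal of `W + B` into
  -- the orthogonal of `W' + B` by subtracting `q'`.
  let n : U →ₗ[ℂ] U := p' - p - q' ∘ₗ (LinearMap.id - p - q)
  have hu : ∀ v, n v = p' v - p v - q' (v - p v - q v) := fun v => rfl
  have hBB : ∀ b ∈ B, ∀ b' ∈ B, Q b b' = 0 := fun b hb b' hb' => hB hb' _ hb
  have nB : ∀ b ∈ B, n b = 0 := fun b hb => by
    rw [hu, p4 b fun b' hb' => hBB b' hb' b hb, p4' b fun b' hb' => hBB b' hb' b hb, q3 b hb]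
    simp
  have nB' : ∀ v, (∀ b ∈ B, Q b v = 0) → n v ∈ B := fun v hv => by
    rw [hu, p4 v hv, p4' v hv, sub_zero, zero_sub]
    exact B.neg_mem (q1' _)
  have nU : ∀ v, ∀ b ∈ B, Q b (n v) = 0 := fun v b hb => by
    rw [hu, map_sub, map_sub, p2 v b hb, p2' v b hb, hBB b hb _ (q1' _)]
    ring
  -- The map `n` sends everything into `B^⊥`, then `B^⊥` into `B`, and kills `B`.
  have nnil : IsNilpotent n := ⟨3, LinearMap.ext fun v => nB _ (nB' _ (nU v))⟩
  have hg : ∀ v, ((1 : Module.End ℂ U) + n) v = p' v + q v +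
      ((v - p v - q v) - q' (v - p v - q v)) := fun v => by
    change v + n v = _
    rw [hu]; abel
  have hiso : ∀ v w, Q (((1 : Module.End ℂ U) + n) v) (((1 : Module.End ℂ U) + n) w) = Q v w := by
    intro v w
    obtain ⟨a, ha⟩ : ∃ a, a = v - p v - q v := ⟨_, rfl⟩
    obtain ⟨b, hb⟩ : ∃ b, b = w - p w - q w := ⟨_, rfl⟩
    have huB : ∀ v, ∀ b ∈ B, Q b (v - p v - q v) = 0 := fun v b hb => by
      rw [map_sub, map_sub, p2 v b hb, hBB b hb _ (q1 v)]; ring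
    have huW : ∀ v, ∀ w ∈ W, Q w (v - p v - q v) = 0 := fun v w hw => by
      have : Q w (p v) = 0 := hW (p1 v) _ hw
      rw [map_sub, map_sub, q2 v w hw, this]; ring
    have huW' : ∀ u, ∀ w ∈ W', Q w (u - q' u) = 0 := fun u w hw => by
      rw [map_sub, q2' u w hw, sub_self]
    have c1 : Q (p' v) (p' w) = 0 := hW' (p1' w) _ (p1' v)
    have c2 : Q (p v) (p w) = 0 := hW (p1 w) _ (p1 v)
    have c3 : Q (q v) (q w) = 0 := hBB _ (q1 v) _ (q1 w)
    have d1 : Q (p' v) (q w) = Q (p v) (q w) := by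
      rw [hs (p' v), hs (p v), p2' v _ (q1 w), p2 v _ (q1 w)]
    have d2 : Q (q v) (p' w) = Q (q v) (p w) := by
      rw [p2' w _ (q1 v), p2 w _ (q1 v)]
    have e1 : Q (p' v) (b - q' b) = 0 := huW' b _ (p1' v)
    have e2 : Q (a - q' a) (p' w) = 0 := by rw [hs]; exact huW' a _ (p1' w)
    have k1 : ∀ b' ∈ B, Q b' a = 0 := fun b' hb' => ha ▸ huB v b' hb'
    have k2 : ∀ b' ∈ B, Q b' b = 0 := fun b' hb' => hb ▸ huB w b' hb'
    have e3 : Q (q v) (b - q' b) = 0 := by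
      rw [map_sub, k2 _ (q1 v), hBB _ (q1 v) _ (q1' b), sub_self]
    have e4 : Q (a - q' a) (q w) = 0 := by
      rw [hs, map_sub, k1 _ (q1 w), hBB _ (q1 w) _ (q1' a), sub_self]
    have e5 : Q (a - q' a) (b - q' b) = Q a b := by
      rw [map_sub (Q _), map_sub, LinearMap.sub_apply, LinearMap.sub_apply, hs a (q' b),
        k1 _ (q1' b), k2 _ (q1' a), hBB _ (q1' a) _ (q1' b)]
      ring
    have hv : v = p v + q v + a := by rw [ha]; abel
    have hw : w = p w + q w + b := by rw [hb]; abel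
    have l1 : Q (p v) b = 0 := hb ▸ huW w _ (p1 v)
    have l2 : Q a (p w) = 0 := by rw [hs]; exact ha ▸ huW v _ (p1 w)
    have l3 : Q a (q w) = 0 := by rw [hs]; exact k1 _ (q1 w)
    have l4 : Q (q v) b = 0 := k2 _ (q1 v)
    have L : Q (p' v + q v + (a - q' a)) (p' w + q w + (b - q' b)) =
        Q (p v) (q w) + Q (q v) (p w) + Q a b := by
      rw [map_add, map_add, map_add, map_add, LinearMap.add_apply, LinearMap.add_apply,
        LinearMap.add_apply, LinearMap.add_apply, LinearMap.add_apply, LinearMap.add_apply,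
        c1, c3, d1, d2, e1, e2, e3, e4, e5]
      ring
    have R : Q (p v + q v + a) (p w + q w + b) =
        Q (p v) (q w) + Q (q v) (p w) + Q a b := by
      rw [map_add, map_add, map_add, map_add, LinearMap.add_apply, LinearMap.add_apply,
        LinearMap.add_apply, LinearMap.add_apply, LinearMap.add_apply, LinearMap.add_apply,
        c2, c3, l1, l2, l3, l4]
      ring
    rw [hg, hg, ← ha, ← hb, L, ← R, ← hv, ← hw]
  refine ⟨1 + n, ⟨hiso, det_one_add_of_isNilpotent nnil⟩,
    Submodule.eq_of_le_of_finrank_eq ?_ ?_⟩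
  · rintro _ ⟨w, hw, rfl⟩
    have h1 : q w = 0 := q4 w fun w' hw' => hW hw _ hw'
    rw [hg, h1, p3 w hw, sub_self, sub_zero, map_zero, sub_zero, add_zero, add_zero]
    exact p1' w
  · rw [finrank_map_inj (isometry_injective hn hiso), hf, hf']

include hs hn in
/-- Hyperplanes in an isotropic subspace are conjugate under special isometries. -/
lemma exists_special_of_hyperplanes (hW : W ≤ Q.orthogonal W) {H H' : Submodule ℂ U} (hH : H ≤ W)
    (hH' : H' ≤ W) (hf : finrank ℂ W = finrank ℂ H + 1) (hf' : finrank ℂ W = finrank ℂ H' + 1) :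
    ∃ g : U →ₗ[ℂ] U, IsSpecial Q g ∧ W.map g = W ∧ H.map g = H' := by
  by_cases hHH : H = H'
  · exact ⟨LinearMap.id, ⟨fun _ _ => rfl, LinearMap.det_id⟩, Submodule.map_id _,
      by rw [Submodule.map_id, hHH]⟩
  obtain ⟨B, hB, hBf, hBW⟩ := exists_dual_isotropic hs hn hW
  have hex : ∀ {Y Z : Submodule ℂ U}, finrank ℂ Y = finrank ℂ Z → Y ≠ Z → ∃ a ∈ Y, a ∉ Z :=
    fun {Y Z} h h' => Set.not_subset.1 fun hle => h' (Submodule.eq_of_le_of_finrank_eq hle h)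
  obtain ⟨a, ha, ha'⟩ := hex (show finrank ℂ H = finrank ℂ H' by omega) hHH
  obtain ⟨b, hb, hb'⟩ := hex (show finrank ℂ H' = finrank ℂ H by omega) (Ne.symm hHH)
  have hfun : ∀ {Y : Submodule ℂ U} {a : U}, a ∉ Y → ∃ φ : U →ₗ[ℂ] ℂ, φ a = 1 ∧ ∀ v ∈ Y, φ v = 0 :=
    fun {Y a} h => by
      obtain ⟨φ, h1, h2⟩ := Submodule.exists_dual_map_eq_bot_of_notMem h inferInstance
      refine ⟨(φ a)⁻¹ • φ, by simp [h1], fun v hv => ?_⟩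
      have : φ v ∈ Y.map φ := ⟨v, hv, rfl⟩
      rw [h2] at this
      have h3 : φ v = 0 := this
      simp [h3]
  -- `φ` vanishes on `H` with value `1` at `b`, and `φ'` vanishes on `H'` with value `1` at `a`.
  -- Hence `w ↦ w + (φ + φ')(w) (b - a)` maps `H` into the kernel of `φ'` on `W`, which is `H'`.
  obtain ⟨φ, φ1, φ2⟩ := hfun hb'
  obtain ⟨φ', φ1', φ2'⟩ := hfun ha'
  obtain ⟨c₀, hc₀⟩ := exists_represent hn (φ + φ')
  obtain ⟨q, q1, q2, q3, q4⟩ := exists_dual_projection hs hn hBf.symm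
    (inf_orthogonal_symm hs hn hBf hBW)
  let c := q c₀
  have hc : ∀ w ∈ W, Q c w = φ w + φ' w := fun w hw => by
    rw [hs, q2 _ w hw, hs, hc₀]; rfl
  let z := b - a
  have hzW : z ∈ W := W.sub_mem (hH' hb) (hH ha)
  have hcz : Q c z = 0 := by
    rw [hc z hzW, map_sub, map_sub, φ1, φ1', φ2 a ha, φ2' b hb]; ring
  have hzc : Q z c = 0 := by rw [hs, hcz]
  have hcc : Q c c = 0 := hB (q1 c₀) _ (q1 c₀)
  have hzz : Q z z = 0 := hW hzW _ hzW
  -- The skew-adjoint operator attached to `c` and `z`, which span a totally isotropic subspace;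
  -- hence `n² = 0` and `1 + n` is an isometry. On `W` the second term vanishes.
  let n : U →ₗ[ℂ] U := (Q c).smulRight z - (Q z).smulRight c
  have hnv : ∀ v, n v = Q c v • z - Q z v • c := fun v => rfl
  have nnil : IsNilpotent n := ⟨2, LinearMap.ext fun v => by
    change n (n v) = 0
    simp [hnv, hcz, hzc, hcc, hzz]⟩
  have hg : ∀ v, ((1 : Module.End ℂ U) + n) v = v + (Q c v • z - Q z v • c) := fun v => rfl
  have hiso : ∀ v w, Q (((1 : Module.End ℂ U) + n) v) (((1 : Module.End ℂ U) + n) w) = Q v w := by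
    intro v w
    simp only [hg, map_add, map_sub, map_smul, LinearMap.add_apply, LinearMap.sub_apply,
      LinearMap.smul_apply, smul_eq_mul, hcz, hzc, hcc, hzz, hs v c, hs v z]
    ring
  have hgi := isometry_injective hn hiso
  have hgw : ∀ w ∈ W, ((1 : Module.End ℂ U) + n) w = w + Q c w • z := fun w hw => by
    have : Q z w = 0 := hW hw _ hzW
    rw [hg, this, zero_smul, sub_zero]
  refine ⟨1 + n, ⟨hiso, det_one_add_of_isNilpotent nnil⟩,
    map_eq_of_le hgi ?_, Submodule.eq_of_le_of_finrank_eq ?_ ?_⟩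
  · rintro _ ⟨w, hw, rfl⟩
    rw [hgw w hw]
    exact W.add_mem hw (W.smul_mem _ hzW)
  · have hspan : ∀ w ∈ W, φ' w = 0 → w ∈ H' := by
      have h1 : H' ⊔ Submodule.span ℂ {a} = W := by
        refine Submodule.eq_of_le_of_finrank_le (sup_le hH' (by simpa using hH ha)) ?_
        have : finrank ℂ H' < finrank ℂ (H' ⊔ Submodule.span ℂ {a} : Submodule ℂ U) :=
          Submodule.finrank_lt_finrank_of_lt (lt_of_le_of_ne le_sup_left fun h =>
            ha' (h ▸ Submodule.mem_sup_right (Submodule.mem_span_singleton_self a)))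
        omega
      intro w hw hw0
      rw [← h1] at hw
      obtain ⟨y, hy, _, hy', rfl⟩ := Submodule.mem_sup.1 hw
      obtain ⟨s, rfl⟩ := Submodule.mem_span_singleton.1 hy'
      rw [map_add, map_smul, φ1', φ2' y hy, zero_add, smul_eq_mul, mul_one] at hw0
      rw [hw0, zero_smul, add_zero]; exact hy
    rintro _ ⟨w, hw, rfl⟩
    rw [hgw w (hH hw)]
    refine hspan _ (W.add_mem (hH hw) (W.smul_mem _ hzW)) ?_
    rw [hc w (hH hw), φ2 w hw, map_add, map_smul, map_sub, φ1', φ2' b hb, smul_eq_mul]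
    ring
  · rw [finrank_map_inj hgi]; omega

end Orthogonal

/-! ### Orbits of isotropic flags are open and closed -/

section Orbits

variable {m N : ℕ} {Q : LinearMap.BilinForm ℂ (V N)} {F F₀ F₁ : Flag m N}

lemma mem_soOrbit_of_isSpecial (hn : ∀ x, (∀ y, Q x y = 0) → x = 0) {g : V N →ₗ[ℂ] V N}
    (hg : IsSpecial Q g) (h1 : F₀.small.map g = F.small) (h2 : F₀.big.map g = F.big) :
    F ∈ soOrbit Q F₀ := by
  let e := LinearEquiv.ofInjectiveEndo g (isometry_injective hn hg.1)
  have he : (e : V N →ₗ[ℂ] V N) = g := rfl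
  exact ⟨e, hg.1, hg.2, h1.symm, h2.symm⟩

lemma soOrbit_symm (h : F ∈ soOrbit Q F₀) : F₀ ∈ soOrbit Q F := by
  obtain ⟨g, h1, h2, h3, h4⟩ := h
  refine ⟨g.symm, fun v w => ?_, ?_, ?_, ?_⟩
  · rw [← h1, g.apply_symm_apply, g.apply_symm_apply]
  · have := LinearEquiv.det_mul_det_symm (A := ℂ) g
    rw [h2, one_mul] at this
    exact this
  · rw [h3, ← Submodule.map_comp]; simp
  · rw [h4, ← Submodule.map_comp]; simp

lemma soOrbit_trans (h : F ∈ soOrbit Q F₁) (h' : F₁ ∈ soOrbit Q F₀) : F ∈ soOrbit Q F₀ := by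
  obtain ⟨g, h1, h2, h3, h4⟩ := h
  obtain ⟨g', h1', h2', h3', h4'⟩ := h'
  refine ⟨g'.trans g, fun v w => ?_, ?_, ?_, ?_⟩
  · rw [LinearEquiv.trans_apply, LinearEquiv.trans_apply, h1, h1']
  · rw [LinearEquiv.coe_trans, LinearMap.det_comp, h2, h2', mul_one]
  · rw [h3, h3', ← Submodule.map_comp]; rfl
  · rw [h4, h4', ← Submodule.map_comp]; rfl

lemma soOrbit_subset (h : F₀ ∈ isotropicFlags Q m) : soOrbit Q F₀ ⊆ isotropicFlags Q m := by
  rintro F ⟨g, h1, -, -, h4⟩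
  change F.big ≤ Q.orthogonal F.big
  rw [h4]
  exact map_isotropic h1 h

/-- The neighbourhood consists of the flags whose larger space is opposite to a fixed isotropic `B`.
Opposite spaces are conjugate, and a second special isometry adjusts the hyperplane. -/
lemma exists_open_subset_soOrbit (hm : 1 ≤ m) (hs : ∀ x y, Q x y = Q y x)
    (hn : ∀ x, (∀ y, Q x y = 0) → x = 0) (hF : F ∈ isotropicFlags Q m) :
    ∃ O, IsOpen[(flagVariety m N).top] O ∧ F ∈ O ∧ O ∩ isotropicFlags Q m ⊆ soOrbit Q F := by
  obtain ⟨B, hB, hf, hFB⟩ := exists_dual_isotropic hs hn hF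
  refine ⟨_, isOpen_finrank_big (Q.orthogonal B) 1, ?_, ?_⟩
  · change finrank ℂ _ < 1
    rw [hFB, finrank_bot]; exact one_pos
  · rintro G ⟨hG, hG'⟩
    have hGB : G.big ⊓ Q.orthogonal B = ⊥ := Submodule.finrank_eq_zero.1 (Nat.lt_one_iff.1 hG)
    obtain ⟨g, hg, hgW⟩ := exists_special_of_opposite hs hn hF hG' hB hf
      (by rw [← hf, F.finrank_big, G.finrank_big]) hFB hGB
    have hgi := isometry_injective hn hg.1
    obtain ⟨k, hk, hk1, hk2⟩ := exists_special_of_hyperplanes hs hn (W := G.big)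
      (H := F.small.map g) (H' := G.small) hG' (hgW ▸ Submodule.map_mono F.le) G.le
      (by rw [finrank_map_inj hgi, F.finrank_small, G.finrank_big]; omega)
      (by rw [G.finrank_small, G.finrank_big]; omega)
    exact mem_soOrbit_of_isSpecial hn (hk.comp hg) (by rw [Submodule.map_comp, hk2])
      (by rw [Submodule.map_comp, hgW, hk1])

lemma relOpen_of_orbits (hm : 1 ≤ m) (hs : ∀ x y, Q x y = Q y x)
    (hn : ∀ x, (∀ y, Q x y = 0) → x = 0) {Z : Set (Flag m N)} (hZ : Z ⊆ isotropicFlags Q m)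
    (h : ∀ F ∈ Z, soOrbit Q F ⊆ Z) : RelOpen (flagVariety m N) (isotropicFlags Q m) Z := by
  have H : ∀ F : Z, ∃ O, IsOpen[(flagVariety m N).top] O ∧ F.1 ∈ O ∧
      O ∩ isotropicFlags Q m ⊆ soOrbit Q F.1 := fun F =>
    exists_open_subset_soOrbit hm hs hn (hZ F.2)
  choose O h1 h2 h3 using H
  refine ⟨⋃ F, O F, @isOpen_iUnion _ _ (flagVariety m N).top _ h1, ?_⟩
  ext G
  constructor
  · rintro ⟨hG, hG'⟩
    obtain ⟨F, hF⟩ := Set.mem_iUnion.1 hG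
    exact h F F.2 (h3 F ⟨hF, hG'⟩)
  · exact fun hG => ⟨Set.mem_iUnion.2 ⟨⟨G, hG⟩, h2 ⟨G, hG⟩⟩, hZ hG⟩

/-- The complement of an orbit in the isotropic flags is a union of orbits, so it is open as well.
-/
theorem Paved.inter_soOrbit (hm : 1 ≤ m) (hs : ∀ x y, Q x y = Q y x)
    (hn : ∀ x, (∀ y, Q x y = 0) → x = 0) {Z : Set (Flag m N)} (hZ : Z ⊆ isotropicFlags Q m)
    (h : Paved (flagVariety m N) Z) (hF₀ : F₀ ∈ isotropicFlags Q m) :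
    Paved (flagVariety m N) (Z ∩ soOrbit Q F₀) :=
  h.inter hZ
    (relOpen_of_orbits hm hs hn (soOrbit_subset hF₀) fun _ hF _ hG => soOrbit_trans hG hF)
    (relOpen_of_orbits hm hs hn Set.sdiff_subset fun _ hF _ hG => ⟨soOrbit_subset hF.1 hG,
      fun hG' => hF.2 (soOrbit_trans (soOrbit_symm hG) hG')⟩)

end Orbits

/-! ### Isometry of complex quadratic spaces of equal dimension -/

section Isometry

variable {R R' : Type} [AddCommGroup R] [Module ℂ R] [FiniteDimensional ℂ R]
  [AddCommGroup R'] [Module ℂ R'] [FiniteDimensional ℂ R']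

lemma exists_isometry_aux {QR : LinearMap.BilinForm ℂ R} {QR' : LinearMap.BilinForm ℂ R'}
    (hs : ∀ x y, QR x y = QR y x) (hs' : ∀ x y, QR' x y = QR' y x) {e : R ≃ₗ[ℂ] R'}
    (he : ∀ x, QR' (e x) (e x) = QR x x) (x y : R) : QR' (e x) (e y) = QR x y := by
  have h := he (x + y)
  simp only [map_add, LinearMap.add_apply, he, hs y x, hs' (e y) (e x)] at h
  linear_combination h / 2

/-- Over an algebraically closed field both forms are equivalent to the same diagonal form. -/
lemma exists_isometry {QR : LinearMap.BilinForm ℂ R} {QR' : LinearMap.BilinForm ℂ R'}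
    (hs : ∀ x y, QR x y = QR y x) (hn : ∀ x, (∀ y, QR x y = 0) → x = 0)
    (hs' : ∀ x y, QR' x y = QR' y x) (hn' : ∀ x, (∀ y, QR' x y = 0) → x = 0)
    (hf : finrank ℂ R = finrank ℂ R') :
    ∃ e : R ≃ₗ[ℂ] R', ∀ x y, QR' (e x) (e y) = QR x y := by
  have h1 : (QuadraticMap.associated (R := ℂ) QR.toQuadraticMap).SeparatingLeft := by
    rw [QuadraticMap.associated_left_inverse ℂ hs]; exact hn
  have h2 : (QuadraticMap.associated (R := ℂ) QR'.toQuadraticMap).SeparatingLeft := by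
    rw [QuadraticMap.associated_left_inverse ℂ hs']; exact hn'
  obtain ⟨f1⟩ := QuadraticForm.equivalent_weightedSumSquares_of_isAlgClosed _ h1
  obtain ⟨f2⟩ := QuadraticForm.equivalent_weightedSumSquares_of_isAlgClosed _ h2
  rw [← hf] at f2
  refine ⟨f1.toLinearEquiv.trans f2.symm.toLinearEquiv,
    exists_isometry_aux hs hs' fun x => ?_⟩
  exact (f2.symm.map_app (f1 x)).trans (f1.map_app x)

end Isometry

/-! ### Change of quadratic spaces, and dimension formulas -/

section Adapted

variable {U R S R' S' : Type} [AddCommGroup U] [Module ℂ U] [FiniteDimensional ℂ U]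
  [AddCommGroup R] [Module ℂ R] [FiniteDimensional ℂ R]
  [AddCommGroup S] [Module ℂ S] [FiniteDimensional ℂ S]
  [AddCommGroup R'] [Module ℂ R'] [FiniteDimensional ℂ R']
  [AddCommGroup S'] [Module ℂ S'] [FiniteDimensional ℂ S']
  {Q : LinearMap.BilinForm ℂ U} {x : Module.End ℂ U} {QR : LinearMap.BilinForm ℂ R}
  {QS : LinearMap.BilinForm ℂ S} {θ : R × S →ₗ[ℂ] U} (H : Adapted Q x QR QS θ)

include H in
lemma Adapted.comp {QR' : LinearMap.BilinForm ℂ R'} {QS' : LinearMap.BilinForm ℂ S'}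
    (e : R' ≃ₗ[ℂ] R) (f : S' ≃ₗ[ℂ] S) (he : ∀ x y, QR (e x) (e y) = QR' x y)
    (hf : ∀ x y, QS (f x) (f y) = QS' x y) :
    Adapted Q x QR' QS' (θ ∘ₗ (e.prodCongr f : R' × S' →ₗ[ℂ] R × S)) := by
  have hθ : ∀ p, (θ ∘ₗ (e.prodCongr f : R' × S' →ₗ[ℂ] R × S)) p = θ (e p.1, f p.2) := fun p => rfl
  refine ⟨fun p u h => ?_, fun p => H.apply _, fun v hv => ?_, fun r => ?_, fun v hv => ?_,
    fun v r r' h => ?_, fun p p' => ?_⟩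
  · have := H.eq_zero _ u h
    exact (e.prodCongr f).map_eq_zero_iff.1 this
  · obtain ⟨u, p, h⟩ := H.exists_of_apply v hv
    exact ⟨u, (e.symm p.1, f.symm p.2), by rw [hθ]; simpa using h⟩
  · obtain ⟨v, hv⟩ := H.exists_eq (e r)
    exact ⟨v, by rw [hθ]; simpa using hv⟩
  · obtain ⟨u, r, h⟩ := H.exists_of_apply_apply v hv
    exact ⟨u, e.symm r, by rw [hθ]; simpa using h⟩
  · rw [hθ] at h ⊢
    simp only [map_zero] at h ⊢
    rw [H.form_left v _ _ h, he]
  · rw [hθ, hθ, H.form_right, hf]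

-- Restricted to `im x`, the map `x` has image `im x²` and kernel `im x ∩ ker x`, and this kernel is
-- `im x²` plus a copy of `R`.
include H in
lemma Adapted.finrank_left (h3 : ∀ v, x (x (x v)) = 0) :
    finrank ℂ R + 2 * finrank ℂ (LinearMap.range (x ∘ₗ x)) = finrank ℂ (LinearMap.range x) := by
  have hθ : ∀ p, θ p ∈ LinearMap.range (x ∘ₗ x) → p = 0 := fun p ⟨u, hu⟩ => H.eq_zero p u hu.symm
  have h1 := finrank_plus hθ ((⊤ : Submodule ℂ R).prod (⊥ : Submodule ℂ S))
  rw [finrank_prod', finrank_bot, finrank_top, add_zero] at h1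
  have h2 : plus (LinearMap.range (x ∘ₗ x)) θ ((⊤ : Submodule ℂ R).prod (⊥ : Submodule ℂ S)) =
      LinearMap.range x ⊓ LinearMap.ker x := by
    refine le_antisymm (sup_le ?_ ?_) ?_
    · rintro _ ⟨v, rfl⟩; exact ⟨⟨x v, rfl⟩, h3 v⟩
    · rintro _ ⟨⟨r, s⟩, ⟨-, hs⟩, rfl⟩
      obtain rfl : s = 0 := hs
      obtain ⟨v, hv⟩ := H.exists_eq r
      exact ⟨⟨v, hv⟩, H.apply _⟩
    · rintro _ ⟨⟨v, rfl⟩, hv⟩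
      obtain ⟨u, r, h⟩ := H.exists_of_apply_apply v hv
      rw [h]
      exact Submodule.add_mem_sup ⟨u, rfl⟩ ⟨(r, 0), ⟨trivial, rfl⟩, rfl⟩
  have h4 := finrank_map_add_inf_ker x (LinearMap.range x)
  rw [← LinearMap.range_comp, ← h2] at h4
  omega

-- Rank-nullity for `x`, with `ker x` the direct sum of `im x²` and copies of `R` and `S`.
include H in
lemma Adapted.finrank_right (h3 : ∀ v, x (x (x v)) = 0) :
    finrank ℂ R + finrank ℂ S + finrank ℂ (LinearMap.range (x ∘ₗ x)) +
      finrank ℂ (LinearMap.range x) = finrank ℂ U := by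
  have hθ : ∀ p, θ p ∈ LinearMap.range (x ∘ₗ x) → p = 0 := fun p ⟨u, hu⟩ => H.eq_zero p u hu.symm
  have h1 := finrank_plus hθ (⊤ : Submodule ℂ (R × S))
  have h2 : plus (LinearMap.range (x ∘ₗ x)) θ ⊤ = LinearMap.ker x := by
    rw [plus, Submodule.map_top]
    refine le_antisymm (sup_le ?_ ?_) fun v hv => ?_
    · rintro _ ⟨v, rfl⟩; exact h3 v
    · rintro _ ⟨p, rfl⟩; exact H.apply p
    · obtain ⟨u, p, rfl⟩ := H.exists_of_apply v hv
      exact Submodule.add_mem_sup ⟨u, rfl⟩ ⟨p, rfl⟩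
  rw [finrank_top, finrank_prod, h2] at h1
  have h4 := LinearMap.finrank_range_add_finrank_ker x
  omega

end Adapted

/-! ### Ranks of powers from the Jordan type -/

section JordanType

variable {N : ℕ} {x : Module.End ℂ (V N)} {sizes : List ℕ}

/-- On each chain `x ^ p` is a shift by `p`, so its image is spanned by the first `a - p` vectors of
a chain of length `a`; truncated subtraction accounts for the short chains. -/
lemma HasJordanType.finrank_range_pow (h : HasJordanType x sizes) (p : ℕ) :
    finrank ℂ (LinearMap.range (x ^ p)) = (sizes.map fun a => a - p).sum := by
  obtain ⟨b, hb⟩ := h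
  have h1 : ∀ (p : ℕ) (s : Fin sizes.length) (r : ℕ) (hr : r < sizes.get s),
      (r < p → (x ^ p) (b ⟨s, r, hr⟩) = 0) ∧
      ∀ r' (h' : r = r' + p), (x ^ p) (b ⟨s, r, hr⟩) = b ⟨s, r', by omega⟩ := by
    intro p
    induction p with
    | zero =>
      intro s r hr
      exact ⟨fun h => absurd h (Nat.not_lt_zero _), fun r' h' => by
        obtain rfl : r = r' := h'
        rfl⟩
    | succ p ih =>
      intro s r hr
      rw [pow_succ']
      constructor
      · intro hrp
        change x ((x ^ p) _) = 0
        rcases Nat.lt_succ_iff_lt_or_eq.1 hrp with h | h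
        · rw [(ih s r hr).1 h, map_zero]
        · rw [(ih s r hr).2 0 (by omega), (hb s 0 (by omega)).1 rfl]
      · intro r' h'
        change x ((x ^ p) _) = _
        rw [(ih s r hr).2 (r' + 1) (by omega), (hb s (r' + 1) (by omega)).2 r' rfl]
  let c : ((s : Fin sizes.length) × Fin (sizes.get s - p)) → V N := fun i =>
    b ⟨i.1, i.2, by have := i.2.2; omega⟩
  have hc : LinearIndependent ℂ c := b.linearIndependent.comp
    (fun i : (s : Fin sizes.length) × Fin (sizes.get s - p) =>
      (⟨i.1, i.2, by have := i.2.2; omega⟩ : (s : Fin sizes.length) × Fin (sizes.get s)))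
    fun i j hij => by
      obtain ⟨s, r⟩ := i
      obtain ⟨s', r'⟩ := j
      simp only [Sigma.mk.injEq] at hij
      obtain ⟨rfl, h2⟩ := hij
      simp only [heq_eq_eq, Fin.mk.injEq] at h2
      rw [Fin.ext h2]
  have hr : LinearMap.range (x ^ p) = Submodule.span ℂ (Set.range c) := by
    refine le_antisymm ?_ (Submodule.span_le.2 ?_)
    · rw [← Submodule.map_top, ← b.span_eq, Submodule.map_span, Submodule.span_le]
      rintro _ ⟨_, ⟨⟨s, r, hr⟩, rfl⟩, rfl⟩
      by_cases hrp : r < p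
      · rw [(h1 p s r hr).1 hrp]; exact Submodule.zero_mem _
      · rw [(h1 p s r hr).2 (r - p) (by omega)]
        exact Submodule.subset_span ⟨⟨s, r - p, by omega⟩, rfl⟩
    · rintro _ ⟨⟨s, r, hr⟩, rfl⟩
      exact ⟨b ⟨s, r + p, by omega⟩, (h1 p s (r + p) (by omega)).2 r rfl⟩
  rw [hr, finrank_span_eq_card hc, Fintype.card_sigma]
  simp only [Fintype.card_fin]
  exact Fin.sum_univ_fun_getElem sizes fun a => a - p

lemma HasJordanType.part321 {i j k : ℕ} (h : HasJordanType x (part321 i j k)) :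
    finrank ℂ (LinearMap.range x) = 2 * i + j ∧ finrank ℂ (LinearMap.range (x ∘ₗ x)) = i ∧
      ∀ v, x (x (x v)) = 0 := by
  have h1 := h.finrank_range_pow 1
  have h2 := h.finrank_range_pow 2
  have h3 := h.finrank_range_pow 3
  rw [pow_one] at h1
  rw [pow_two] at h2
  simp [HessPaving.part321] at h1 h2 h3
  refine ⟨by omega, h2, fun v => ?_⟩
  have := LinearMap.congr_fun (LinearMap.range_eq_bot.1 h3) v
  simpa [pow_succ] using this

end JordanType

/-! ### Flags over the same pairs in different ambient spaces -/

section FlagsOver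

variable {m N m₀ N₀ : ℕ} {E : Type} [AddCommGroup E] [Module ℂ E] [FiniteDimensional ℂ E]
  {I : Submodule ℂ (V N)} {θ : E →ₗ[ℂ] V N} {I₀ : Submodule ℂ (V N₀)} {θ₀ : E →ₗ[ℂ] V N₀}
  {X : Set (Submodule ℂ E × Submodule ℂ E)}

/-- The map between sets of flags over the same set of pairs of subspaces. -/
def flagsOverMap (hθ : ∀ p, θ p ∈ I → p = 0) (hθ₀ : ∀ p, θ₀ p ∈ I₀ → p = 0)
    (h1 : finrank ℂ I + m₀ = finrank ℂ I₀ + m) (h2 : finrank ℂ I < m) 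
    (F : flagsOver m I θ X) : flagsOver m₀ I₀ θ₀ X :=
  ⟨{  small := plus I₀ θ₀ (F.1.small.comap θ)
      big := plus I₀ θ₀ (F.1.big.comap θ)
      le := plus_mono (Submodule.comap_mono F.1.le)
      finrank_small := by
        have := finrank_plus hθ (F.1.small.comap θ)
        rw [plus_comap F.2.1 (F.1.le.trans F.2.2.1), F.1.finrank_small] at this
        rw [finrank_plus hθ₀]; omega
      finrank_big := by
        have := finrank_plus hθ (F.1.big.comap θ)
        rw [plus_comap (F.2.1.trans F.1.le) F.2.2.1, F.1.finrank_big] at this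
        rw [finrank_plus hθ₀]; omega },
    le_plus _, plus_le _, by simp only [comap_plus hθ₀]; exact F.2.2.2⟩

lemma isMorphism_flagsOverMap (hθ : ∀ p, θ p ∈ I → p = 0) (hθ₀ : ∀ p, θ₀ p ∈ I₀ → p = 0)
    (h1 : finrank ℂ I + m₀ = finrank ℂ I₀ + m) (h2 : finrank ℂ I < m) :
    IsMorphism ((flagVariety m N).sub (flagsOver m I θ X))
      ((flagVariety m₀ N₀).sub (flagsOver m₀ I₀ θ₀ X)) (flagsOverMap hθ hθ₀ h1 h2) := by
  refine isMorphism_flag_flag _ (fun s _ => plus I₀ θ₀ (s.comap θ))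
    (fun _ b => plus I₀ θ₀ (b.comap θ)) (fun F => ⟨rfl, rfl⟩) fun T S B hS hB h => ?_
  have key : ∀ t ∈ T, (finrank ℂ (S t) = m - 1 ∧ finrank ℂ (B t) = m) ∧ I ≤ S t ∧ S t ≤ B t ∧
      B t ≤ I ⊔ LinearMap.range θ := fun t ht => by
    obtain ⟨F, hF, e1, e2⟩ := h t ht
    rw [← e1, ← e2]
    exact ⟨⟨F.finrank_small, F.finrank_big⟩, hF.1, F.le, hF.2.1⟩
  refine ⟨RegFam.plus hθ₀ (hS.comap_of_plus hθ (fun t ht => (key t ht).1.1)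
    (fun t ht => (key t ht).2.1) fun t ht => (key t ht).2.2.1.trans (key t ht).2.2.2)
    (r := m - 1 - finrank ℂ I) fun t ht => ?_,
    RegFam.plus hθ₀ (hB.comap_of_plus hθ (fun t ht => (key t ht).1.2)
    (fun t ht => (key t ht).2.1.trans (key t ht).2.2.1) fun t ht => (key t ht).2.2.2)
    (r := m - finrank ℂ I) fun t ht => ?_⟩
  · obtain ⟨⟨k1, k2⟩, k3, k4, k5⟩ := key t ht
    have := finrank_plus hθ ((S t).comap θ)
    rw [plus_comap k3 (k4.trans k5), k1] at this
    omega
  · obtain ⟨⟨k1, k2⟩, k3, k4, k5⟩ := key t ht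
    have := finrank_plus hθ ((B t).comap θ)
    rw [plus_comap (k3.trans k4) k5, k2] at this
    omega

lemma flagsOverMap_flagsOverMap (hθ : ∀ p, θ p ∈ I → p = 0) (hθ₀ : ∀ p, θ₀ p ∈ I₀ → p = 0)
    (h1 : finrank ℂ I + m₀ = finrank ℂ I₀ + m) (h2 : finrank ℂ I < m)
    (h1' : finrank ℂ I₀ + m = finrank ℂ I + m₀) (h2' : finrank ℂ I₀ < m₀)
    (F : flagsOver m I θ X) :
    flagsOverMap hθ₀ hθ h1' h2' (flagsOverMap (m₀ := m₀) hθ hθ₀ h1 h2 F) = F := by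
  refine Subtype.ext (Flag.ext' ?_ ?_)
  · change plus I θ ((plus I₀ θ₀ (F.1.small.comap θ)).comap θ₀) = _
    rw [comap_plus hθ₀, plus_comap F.2.1 (F.1.le.trans F.2.2.1)]
  · change plus I θ ((plus I₀ θ₀ (F.1.big.comap θ)).comap θ₀) = _
    rw [comap_plus hθ₀, plus_comap (F.2.1.trans F.1.le) F.2.2.1]

/-- Both sides are in bijection with the same pairs in `X`, through regular maps. The strict
inequality `h2` keeps the truncated differences `m - 1` and `m₀ - 1` compatible. -/
theorem isomorphic_flagsOver (hθ : ∀ p, θ p ∈ I → p = 0) (hθ₀ : ∀ p, θ₀ p ∈ I₀ → p = 0)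
    (h1 : finrank ℂ I + m₀ = finrank ℂ I₀ + m) (h2 : finrank ℂ I < m) :
    Isomorphic ((flagVariety m N).sub (flagsOver m I θ X))
      ((flagVariety m₀ N₀).sub (flagsOver m₀ I₀ θ₀ X)) := by
  have h2' : finrank ℂ I₀ < m₀ := by omega
  exact ⟨⟨flagsOverMap hθ hθ₀ h1 h2, flagsOverMap hθ₀ hθ h1.symm h2',
    flagsOverMap_flagsOverMap hθ hθ₀ h1 h2 h1.symm h2',
    flagsOverMap_flagsOverMap hθ₀ hθ h1.symm h2' h1 h2⟩,
    isMorphism_flagsOverMap hθ hθ₀ h1 h2, isMorphism_flagsOverMap hθ₀ hθ h1.symm h2'⟩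

end FlagsOver

/-! ### Reduction from order three to order two -/

section Reduction

variable {N : ℕ} {Q : LinearMap.BilinForm ℂ (V N)} {x : Module.End ℂ (V N)}

lemma exists_adapted_of_nilOrbit {i j k : ℕ} (hs : ∀ x y, Q x y = Q y x)
    (hn : ∀ x, (∀ y, Q x y = 0) → x = 0) (hx : x ∈ nilOrbit Q (part321 i j k)) :
    ∃ (R S : Submodule ℂ (V N)) (QR : LinearMap.BilinForm ℂ R) (QS : LinearMap.BilinForm ℂ S)
      (θ : R × S →ₗ[ℂ] V N), (∀ x y, QR x y = QR y x) ∧ (∀ x, (∀ y, QR x y = 0) → x = 0) ∧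
        (∀ x y, QS x y = QS y x) ∧ (∀ x, (∀ y, QS x y = 0) → x = 0) ∧ Adapted Q x QR QS θ ∧
        finrank ℂ R = j ∧ finrank ℂ S + 3 * i + 2 * j = N ∧
        finrank ℂ (LinearMap.range (x ∘ₗ x)) = i ∧ ∀ v, x (x (x v)) = 0 := by
  obtain ⟨⟨hx1, -⟩, hx2⟩ := hx
  obtain ⟨r1, r2, h3⟩ := hx2.part321
  obtain ⟨R, S, QR, QS, θ, hsR, hnR, hsS, hnS, H⟩ := exists_adapted hs hn hx1.1 h3
  have f1 := H.finrank_left h3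
  have f2 := H.finrank_right h3
  rw [r1, r2] at f1 f2
  rw [finrank_fin_fun] at f2
  exact ⟨R, S, QR, QS, θ, hsR, hnR, hsS, hnS, H, by omega, by omega, r2, h3⟩

/-- The trace is at most `R`, and the isotropic projection has at most half the dimension of `S`.
Applied to the larger space of a flag, this gives the bound on `m - i`. -/
lemma two_mul_finrank_le {R S : Type} [AddCommGroup R] [Module ℂ R] [FiniteDimensional ℂ R]
    [AddCommGroup S] [Module ℂ S] [FiniteDimensional ℂ S] {QS : LinearMap.BilinForm ℂ S}
    (hsS : ∀ x y, QS x y = QS y x) (hnS : ∀ x, (∀ y, QS x y = 0) → x = 0)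
    {W : Submodule ℂ (R × S)} (hW : outer W ≤ QS.orthogonal (outer W)) :
    2 * finrank ℂ W ≤ 2 * finrank ℂ R + finrank ℂ S := by
  have h1 := finrank_outer W
  have h2 := Submodule.finrank_le (inner W)
  have h3 := finrank_orthogonal' hsS hnS (outer W)
  have h4 := Submodule.finrank_mono hW
  omega

theorem isomorphic_fibers {m i j k : ℕ} {N₀ : ℕ} {Q₀ : LinearMap.BilinForm ℂ (V N₀)}
    (hs : ∀ x y, Q x y = Q y x) (hn : ∀ x, (∀ y, Q x y = 0) → x = 0)
    (hs₀ : ∀ x y, Q₀ x y = Q₀ y x) (hn₀ : ∀ x, (∀ y, Q₀ x y = 0) → x = 0) (hm : 1 ≤ m)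
    (hN : N₀ + 3 * i = N) (hx : x ∈ nilOrbit Q (part321 i j k)) {x₀ : Module.End ℂ (V N₀)}
    (hx₀ : x₀ ∈ nilOrbit Q₀ (part321 0 j k)) :
    (x ∈ imTau Q m → i < m ∧ 2 * (m - i) ≤ N₀ ∧ Isomorphic
      ((flagVariety m N).sub (fiberTau Q m x))
      ((flagVariety (m - i) N₀).sub (fiberTau Q₀ (m - i) x₀))) ∧
    (x ∈ imSigma Q m → i < m ∧ 2 * (m - i) ≤ N₀ ∧ Isomorphic
      ((flagVariety m N).sub (fiberSigma Q m x))
      ((flagVariety (m - i) N₀).sub (fiberSigma Q₀ (m - i) x₀))) := by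
  obtain ⟨R, S, QR, QS, θ, hsR, hnR, hsS, hnS, H, fR, fS, fI, h3⟩ :=
    exists_adapted_of_nilOrbit hs hn hx
  obtain ⟨R₀, S₀, QR₀, QS₀, θ', hsR₀, hnR₀, hsS₀, hnS₀, H', fR₀, fS₀, fI₀, h3₀⟩ :=
    exists_adapted_of_nilOrbit hs₀ hn₀ hx₀
  -- The spaces attached to `x` and `x₀` have the same dimensions, so `x₀` can be described by the
  -- very spaces `R` and `S` of `x`; both fibres then lie over the same set of pairs.
  obtain ⟨e, he⟩ := exists_isometry hsR hnR hsR₀ hnR₀ (fR.trans fR₀.symm)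
  obtain ⟨f, hf⟩ := exists_isometry hsS hnS hsS₀ hnS₀ (by omega)
  obtain ⟨θ₀, H₀⟩ : ∃ θ₀ : R × S →ₗ[ℂ] V N₀, Adapted Q₀ x₀ QR QS θ₀ :=
    ⟨_, H'.comp e f he hf⟩
  have key : ∀ X : Set (Submodule ℂ (R × S) × Submodule ℂ (R × S)),
      (∀ y ∈ X, outer y.2 ≤ QS.orthogonal (outer y.2)) →
      (flagsOver m (LinearMap.range (x ∘ₗ x)) θ X).Nonempty → i < m ∧ 2 * (m - i) ≤ N₀ ∧
      Isomorphic ((flagVariety m N).sub (flagsOver m (LinearMap.range (x ∘ₗ x)) θ X))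
        ((flagVariety (m - i) N₀).sub (flagsOver (m - i) (LinearMap.range (x₀ ∘ₗ x₀)) θ₀ X)) := by
    rintro X hX ⟨F, hF1, hF2, hF3⟩
    have hi : i ≤ m - 1 := by
      rw [← F.finrank_small, ← fI]; exact Submodule.finrank_mono hF1
    have hb := finrank_plus H.eq_zero' (F.big.comap θ)
    rw [plus_comap (hF1.trans F.le) hF2, F.finrank_big, fI] at hb
    have hd := two_mul_finrank_le hsS hnS (hX _ hF3)
    simp only at hd
    refine ⟨by omega, by omega, isomorphic_flagsOver H.eq_zero' H₀.eq_zero' ?_ ?_⟩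
    · rw [fI, fI₀]; omega
    · rw [fI]; omega
  rw [fiberTau_eq H hs hn hx.1.1 h3, fiberSigma_eq H hs hn hx.1.1 h3,
    fiberTau_eq H₀ hs₀ hn₀ hx₀.1.1 h3₀, fiberSigma_eq H₀ hs₀ hn₀ hx₀.1.1 h3₀]
  constructor
  · rintro ⟨⟨_, F⟩, hF, rfl⟩
    refine key _ (fun y hy => hy.2.1) ⟨F, ?_⟩
    rw [← fiberTau_eq H hs hn hx.1.1 h3]; exact hF
  · rintro ⟨⟨_, F⟩, hF, rfl⟩
    refine key _ (fun y hy => hy.2.1) ⟨F, ?_⟩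
    rw [← fiberSigma_eq H hs hn hx.1.1 h3]; exact hF

end Reduction

/-! ### The fibres that are orthogonal Grassmannians -/

section OrthogonalGrassmannian

variable {m N M p : ℕ} {I : Submodule ℂ (V N)} {Q' : LinearMap.BilinForm ℂ (V M)}
  {S : Type} [AddCommGroup S] [Module ℂ S] [FiniteDimensional ℂ S]
  {QS : LinearMap.BilinForm ℂ S} {θ : V M × S →ₗ[ℂ] V N}

lemma plus_prod_bot (B : Submodule ℂ (V M)) :
    plus I θ (B.prod ⊥) = plus I (θ ∘ₗ LinearMap.inl ℂ (V M) S) B := by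
  rw [plus, plus, Submodule.map_comp]
  congr 2
  ext ⟨r, s⟩
  constructor
  · rintro ⟨h1, h2⟩
    obtain rfl : s = 0 := h2
    exact ⟨r, h1, rfl⟩
  · rintro ⟨r', h, he⟩
    rw [LinearMap.inl_apply, Prod.mk.injEq] at he
    obtain ⟨rfl, rfl⟩ := he
    exact ⟨h, rfl⟩

/-- In the extremal dimension the pairs in `relE` are given by maximal isotropic subspaces. -/
lemma mem_relE_iff (hs : ∀ x y, Q' x y = Q' y x) (hn : ∀ x, (∀ y, Q' x y = 0) → x = 0)
    (hM : M = 2 * p + 1) {W₁ W₀ : Submodule ℂ (V M × S)} (h1 : finrank ℂ W₁ = p)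
    (h0 : finrank ℂ W₀ = p + 1) : (W₁, W₀) ∈ relE Q' QS ↔
      ∃ B : Submodule ℂ (V M), B ≤ Q'.orthogonal B ∧ W₁ = B.prod ⊥ ∧
        W₀ = (Q'.orthogonal B).prod ⊥ := by
  have hfo := finrank_orthogonal' hs hn
  constructor
  · rintro ⟨a1, a2, a3⟩
    simp only at a1 a2 a3
    have f1 := finrank_outer W₁
    have f0 := finrank_outer W₀
    have g := Submodule.finrank_mono a3
    have go := hfo (inner W₀)
    rw [finrank_fin_fun] at go
    -- The orthogonal of `inner W₀` has dimension `2p + 1 - dim (inner W₀)` and fits into a space of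
    -- dimension at most `p`, so `inner W₀` already has the full dimension `p + 1` of `W₀`.
    have ho : finrank ℂ (outer W₀) = 0 := by omega
    have ho' := Submodule.finrank_mono (outer_mono a1)
    have hW : ∀ {W : Submodule ℂ (V M × S)}, finrank ℂ (outer W) = 0 → W = (inner W).prod ⊥ := by
      intro W h
      have h2 := Submodule.finrank_eq_zero.1 h
      have h3 : ∀ v ∈ W, v.2 = 0 := fun v hv => by
        have : v.2 ∈ outer W := ⟨v, hv, rfl⟩
        rw [h2] at this; exact this
      ext ⟨r, s⟩
      constructor
      · intro hv
        obtain rfl : s = 0 := h3 _ hv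
        exact ⟨hv, rfl⟩
      · rintro ⟨hr, hs'⟩
        obtain rfl : s = 0 := hs'
        exact hr
    have e : Q'.orthogonal (inner W₀) = inner W₁ := Submodule.eq_of_le_of_finrank_le a3 (by omega)
    have e' : Q'.orthogonal (inner W₁) = inner W₀ := by rw [← e, orthogonal_orthogonal' hs hn]
    refine ⟨inner W₁, ?_, hW (by omega), ?_⟩
    · rw [e']; exact inner_mono a1
    · rw [e']; exact hW ho
  · rintro ⟨B, hB, rfl, rfl⟩
    have i1 : ∀ B : Submodule ℂ (V M), inner (B.prod (⊥ : Submodule ℂ S)) = B := fun B => by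
      ext r
      exact ⟨fun h => h.1, fun h => ⟨h, rfl⟩⟩
    refine ⟨Submodule.prod_mono hB le_rfl, ?_, ?_⟩
    · rintro s hs' s' hs''
      obtain ⟨r, hr⟩ := mem_outer.1 hs'
      obtain rfl : s = 0 := hr.2
      exact map_zero _
    · simp only [i1]
      rw [orthogonal_orthogonal' hs hn]

/-- The smaller space of the flag determines the isotropic subspace `B`, and the larger one is
recovered from `B^⊥`. Both passages preserve regular families. -/
theorem isomorphic_flagsOver_relE (hs : ∀ x y, Q' x y = Q' y x)
    (hn : ∀ x, (∀ y, Q' x y = 0) → x = 0) (hM : M = 2 * p + 1) (hθ : ∀ v, θ v ∈ I → v = 0)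
    (hm : finrank ℂ I + p + 1 = m) :
    Isomorphic ((flagVariety m N).sub (flagsOver m I θ (relE Q' QS)))
      ((grassmannian p M).sub (OGr p Q')) := by
  let φ : V M →ₗ[ℂ] V N := θ ∘ₗ LinearMap.inl ℂ (V M) S
  have hφ : ∀ v, φ v ∈ I → v = 0 := fun v hv => congrArg Prod.fst (hθ _ hv)
  have hfo := finrank_orthogonal' hs hn
  have hch : ∀ F ∈ flagsOver m I θ (relE Q' QS), ∃ B : Submodule ℂ (V M), B ≤ Q'.orthogonal B ∧
      F.small = plus I φ B ∧ F.big = plus I φ (Q'.orthogonal B) := by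
    rintro F ⟨h1, h2, h3⟩
    have e1 := plus_comap h1 (F.le.trans h2)
    have e2 := plus_comap (h1.trans F.le) h2
    have f1 := finrank_plus hθ (F.small.comap θ)
    have f2 := finrank_plus hθ (F.big.comap θ)
    rw [e1, F.finrank_small] at f1
    rw [e2, F.finrank_big] at f2
    obtain ⟨B, hB, b1, b2⟩ := (mem_relE_iff hs hn hM (by omega) (by omega)).1 h3
    exact ⟨B, hB, by rw [← e1, b1, plus_prod_bot], by rw [← e2, b2, plus_prod_bot]⟩
  have hfs : ∀ F ∈ flagsOver m I θ (relE Q' QS), I ≤ F.small ∧ F.small ≤ I ⊔ LinearMap.range φ ∧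
      (F.small.comap φ) ≤ Q'.orthogonal (F.small.comap φ) ∧
      F.big = plus I φ (Q'.orthogonal (F.small.comap φ)) := by
    intro F hF
    obtain ⟨B, hB, b1, b2⟩ := hch F hF
    rw [b1, b2, comap_plus hφ]
    exact ⟨le_plus _, plus_le _, hB, rfl⟩
  let f : flagsOver m I θ (relE Q' QS) → OGr p Q' := fun F =>
    ⟨⟨F.1.small.comap φ, by
      obtain ⟨h1, h2, -⟩ := hfs F.1 F.2
      have := finrank_plus hφ (F.1.small.comap φ)
      rw [plus_comap h1 h2, F.1.finrank_small] at this
      omega⟩, (hfs F.1 F.2).2.2.1⟩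
  let g : OGr p Q' → flagsOver m I θ (relE Q' QS) := fun B =>
    ⟨{  small := plus I φ B.1.1
        big := plus I φ (Q'.orthogonal B.1.1)
        le := plus_mono B.2
        finrank_small := by
          have := B.1.2
          rw [finrank_plus hφ]; omega
        finrank_big := by
          have := B.1.2
          have := hfo B.1.1
          rw [finrank_fin_fun] at this
          rw [finrank_plus hφ]; omega }, le_plus _,
      (plus_prod_bot (I := I) (θ := θ) _).symm.trans_le (plus_le _), by
      have b1 := B.1.2
      have b2 := hfo B.1.1
      rw [finrank_fin_fun] at b2
      change ((plus I φ B.1.1).comap θ, (plus I φ (Q'.orthogonal B.1.1)).comap θ) ∈ relE Q' QS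
      rw [← plus_prod_bot, ← plus_prod_bot, comap_plus hθ, comap_plus hθ]
      refine (mem_relE_iff hs hn hM ?_ ?_).2 ⟨B.1.1, B.2, rfl, rfl⟩
      · rw [finrank_prod', finrank_bot]; omega
      · rw [finrank_prod', finrank_bot]; omega⟩
  refine ⟨⟨f, g, fun F => ?_, fun B => ?_⟩, ?_, ?_⟩
  · obtain ⟨h1, h2, -, h3⟩ := hfs F.1 F.2
    exact Subtype.ext (Flag.ext' (plus_comap h1 h2) h3.symm)
  · exact Subtype.ext (Subtype.ext (comap_plus hφ _))
  · refine isMorphism_flag_gr _ (fun s _ => s.comap φ) (fun F => rfl) fun T s b hS hB h => ?_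
    refine hS.comap_of_plus hφ (r := m - 1) ?_ ?_ ?_ <;> intro t ht <;>
      obtain ⟨F, hF, e1, -⟩ := h t ht <;> rw [← e1]
    · exact F.finrank_small
    · exact (hfs F hF).1
    · exact (hfs F hF).2.1
  · refine isMorphism_gr_flag _ (fun b => plus I φ b) (fun b => plus I φ (Q'.orthogonal b))
      (fun B => ⟨rfl, rfl⟩) fun T b hb h => ?_
    have hp : ∀ t ∈ T, finrank ℂ (b t) = p := fun t ht => by
      obtain ⟨B, -, e⟩ := h t ht
      rw [← e]; exact B.2
    have hp' : ∀ t ∈ T, finrank ℂ (Q'.orthogonal (b t)) = M - p := fun t ht => by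
      have := hfo (b t)
      rw [finrank_fin_fun, hp t ht] at this
      omega
    exact ⟨hb.plus hφ hp, (hb.orthogonal hp').plus hφ hp'⟩

/-- The number of parts equal to two is `dim R = M`, so `R` may be replaced by the given space `V M`
through an isometry; here `p = m - 1 - i`. -/
theorem isomorphic_fiberTau_OGr {i k : ℕ} {Q : LinearMap.BilinForm ℂ (V N)}
    {x : Module.End ℂ (V N)} (hs : ∀ x y, Q x y = Q y x) (hn : ∀ x, (∀ y, Q x y = 0) → x = 0)
    (hs' : ∀ x y, Q' x y = Q' y x) (hn' : ∀ x, (∀ y, Q' x y = 0) → x = 0) (hM : M = 2 * p + 1)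
    (hm : i + p + 1 = m) (hx : x ∈ nilOrbit Q (part321 i M k)) :
    Isomorphic ((flagVariety m N).sub (fiberTau Q m x)) ((grassmannian p M).sub (OGr p Q')) := by
  obtain ⟨R, S, QR, QS, θ, hsR, hnR, hsS, hnS, H, fR, fS, fI, h3⟩ :=
    exists_adapted_of_nilOrbit hs hn hx
  obtain ⟨e, he⟩ := exists_isometry hs' hn' hsR hnR (by rw [fR, finrank_fin_fun])
  have H' := H.comp e (LinearEquiv.refl ℂ S) he (QS' := QS) fun _ _ => rfl
  rw [fiberTau_eq H' hs hn hx.1.1 h3]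
  exact isomorphic_flagsOver_relE hs' hn' hM H'.eq_zero' (by rw [fI]; exact hm)

end OrthogonalGrassmannian

end HessPaving

theorem mainTheorem11 :
    -- the maps `τ` and `σ` take values in the nilpotent cone, and their fibres are paved
    (∀ (N m : ℕ) (Q : LinearMap.BilinForm ℂ (V N)), Q.IsSymm → Q.Nondegenerate →
      1 ≤ m → 2 * m ≤ N →
        imTau Q m ⊆ N1 Q ∧ imSigma Q m ⊆ N1 Q ∧
        ∀ x ∈ N1 Q,
          HasAffinePaving ((flagVariety m N).sub (fiberTau Q m x)) ∧
          HasAffinePaving ((flagVariety m N).sub (fiberSigma Q m x)) ∧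
          ∀ F₀ ∈ isotropicFlags Q m,
            HasAffinePaving ((flagVariety m N).sub (fiberTau Q m x ∩ soOrbit Q F₀)) ∧
            HasAffinePaving ((flagVariety m N).sub (fiberSigma Q m x ∩ soOrbit Q F₀))) ∧
    -- reduction from order three to order two
    (∀ (N m i j : ℕ) (Q : LinearMap.BilinForm ℂ (V N))
      (Q₀ : LinearMap.BilinForm ℂ (V (N - 3 * i))),
      Q.IsSymm → Q.Nondegenerate → Q₀.IsSymm → Q₀.Nondegenerate →
      1 ≤ m → 2 * m ≤ N → 3 * i + 2 * j ≤ N →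
      ∀ x ∈ nilOrbit Q (part321 i j (N - 3 * i - 2 * j)),
      ∀ x₀ ∈ nilOrbit Q₀ (part321 0 j (N - 3 * i - 2 * j)),
        (x ∈ imTau Q m → i < m ∧ 2 * (m - i) ≤ N - 3 * i ∧
          Isomorphic ((flagVariety m N).sub (fiberTau Q m x))
            ((flagVariety (m - i) (N - 3 * i)).sub (fiberTau Q₀ (m - i) x₀))) ∧
        (x ∈ imSigma Q m → i < m ∧ 2 * (m - i) ≤ N - 3 * i ∧
          Isomorphic ((flagVariety m N).sub (fiberSigma Q m x))
            ((flagVariety (m - i) (N - 3 * i)).sub (fiberSigma Q₀ (m - i) x₀)))) ∧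
    -- the fibres that are orthogonal Grassmannians
    (∀ (n m i : ℕ) (Q : LinearMap.BilinForm ℂ (V (2 * n + 1)))
      (Q' : LinearMap.BilinForm ℂ (V (2 * m - 1 - 2 * i))),
      Q.IsSymm → Q.Nondegenerate → Q'.IsSymm → Q'.Nondegenerate →
      1 ≤ m → 2 * m ≤ 2 * n + 1 → i + 1 ≤ m → 4 * m ≤ 2 * n + 3 + i →
      ∀ x ∈ nilOrbit Q (part321 i (2 * m - 1 - 2 * i) (2 * n + 3 + i - 4 * m)),
        Isomorphic ((flagVariety m (2 * n + 1)).sub (fiberTau Q m x))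
          ((grassmannian (m - 1 - i) (2 * m - 1 - 2 * i)).sub (OGr (m - 1 - i) Q'))) := by
  have form : ∀ {N : ℕ} {Q : LinearMap.BilinForm ℂ (V N)}, Q.IsSymm → Q.Nondegenerate →
      (∀ x y, Q x y = Q y x) ∧ ∀ x, (∀ y, Q x y = 0) → x = 0 := fun hs hn =>
    ⟨fun x y => hs.eq x y, hn.1⟩
  refine ⟨fun N m Q hs hn hm _ => ?_, fun N m i j Q Q₀ hs hn hs₀ hn₀ hm _ hij x hx x₀ hx₀ => ?_,
    fun n m i Q Q' hs hn hs' hn' _ _ him _ x hx => ?_⟩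
  · obtain ⟨hs, hn⟩ := form hs hn
    refine ⟨?_, ?_, fun x hx => ?_⟩
    · rintro _ ⟨⟨x, F⟩, hF, rfl⟩
      exact ⟨hF.2.1, 3, LinearMap.ext fun v => by simpa [pow_succ] using fiberTau_cube hs ⟨F, hF⟩ v⟩
    · rintro _ ⟨⟨x, F⟩, hF, rfl⟩
      exact ⟨hF.2.1, 3, LinearMap.ext fun v => by
        simpa [pow_succ] using fiberSigma_cube hs ⟨F, hF⟩ v⟩
    · obtain ⟨h1, h2⟩ := paved_fiber hm hs hn hx.1
      have hA : ∀ {U U' : Set (HessPaving.Flag m N)} {f : HessPaving.Flag m N → ℂ},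
          (flagVariety m N).Reg U f → U' ⊆ U → (flagVariety m N).Reg U' f :=
        (flagPresentation m N).reg_mono
      exact ⟨h1.hasAffinePaving hA, h2.hasAffinePaving hA, fun F₀ hF₀ =>
        ⟨(h1.inter_soOrbit hm hs hn (fun _ h => h.1) hF₀).hasAffinePaving hA,
          (h2.inter_soOrbit hm hs hn (fun _ h => h.1) hF₀).hasAffinePaving hA⟩⟩
  · obtain ⟨hs, hn⟩ := form hs hn
    obtain ⟨hs₀, hn₀⟩ := form hs₀ hn₀
    exact isomorphic_fibers hs hn hs₀ hn₀ hm (by omega) hx hx₀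
  · obtain ⟨hs, hn⟩ := form hs hn
    obtain ⟨hs', hn'⟩ := form hs' hn'
    exact isomorphic_fiberTau_OGr hs hn hs' hn' (by omega) (by omega) hx
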